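/- **Setting.** Let $b\ge 5$ and let $L=U\oplus U\oplus L^+$, where $L^+$ is an even positive definite lattice of rank $b-2$ and $U$ is the hyperbolic plane; $q(x)=\tfrac12(x,x)$ and $x^2=(x,x)$. Fix an orthonormal basis $e_1,\dots,e_{b+2}$ of $L\otimes\mathbb R$ with $e_i^2=1$ for $i\le b$ and $e_{b+1}^2=e_{b+2}^2=-1$, such that $e_1,\dots,e_{b-2}$ is a basis of $L^+\otimes\mathbb R$ and the two hyperbolic planes are $\mathbb Zu\oplus\mathbb Zu'$ with $u=(e_b+e_{b+2})/\sqrt2$, $u'=(e_b-e_{b+2})/\sqrt2$, and $\mathbb Z\tilde u\oplus\mathbb Z\tilde u'$ with $\tilde u=(e_{b-1}+e_{b+1})/\sqrt2$, $\tilde u'=(e_{b-1}-e_{b+1})/\sqrt2$. Put $M=\mathbb Z\tilde u\oplus\mathbb Z\tilde u'\oplus L^+$, of signature $(b-1,1)$, and $D_M=M'/M\;(\cong L^{+\prime}/L^+)$. Write $e(t)=e^{2\pi i t}$, $\tau_j=x_j+iy_j$, and $x^{+}$, $x^{-}$ for the projections of $x$ to the spans of $e_1,\dots,e_b$ and of $e_{b+1},e_{b+2}$.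 **Jacobi forms.** Let $\eta\in L^{+\prime}\subseteq M'$ and $m=q(\eta)$. A Jacobi form of weight $k$ and index $\eta$ is a holomorphic $\phi:\mathbb H\times\mathbb C\to\mathbb C[D_M]$ with $\phi(\tau_1,\tau_2+p+r\tau_1)=e(-mr^2\tau_1-2mr\tau_2-prm-tm)\,\rho(p,r,t)\phi(\tau_1,\tau_2)$ for $p,r,t\in\mathbb Z$, $\phi(\tau_1+1,\tau_2)=\rho(T)\phi(\tau_1,\tau_2)$ and $\phi(-1/\tau_1,\tau_2/\tau_1)=\tau_1^k\,e(m\tau_2^2/\tau_1)\,\rho(S)\phi(\tau_1,\tau_2)$ (principal branch), where $\rho(p,r,t)\mathfrak e_\sigma=e\big(p(\sigma,\eta)+(t-pr)m\big)\mathfrak e_{\sigma-r\eta}$, $\rho(T)\mathfrak e_\sigma=e(q(\sigma))\mathfrak e_\sigma$ and $\rho(S)\mathfrak e_\sigma=e^{-\pi i(b-2)/4}|D_M|^{-1/2}\sum_{\sigma'}e(-(\sigma,\sigma'))\mathfrak e_{\sigma'}$. It is a Jacobi cusp form if it has a Fourier expansion $$\phi(\tau_1,\tau_2)=\sum_{\sigma\in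 D_M}\ \sum_{r\in\mathbb Z+q(\sigma)}\ \sum_{s\in\mathbb Z+(\sigma,\eta)}a(\sigma,r,s)\,e(r\tau_1+s\tau_2)\,\mathfrak e_\sigma$$ in which $a(\sigma,r,s)\ne0$ implies $4q(\eta)r>s^2$. **Polynomials.** For $\alpha=(\alpha_1,\alpha_2,\beta_1,\beta_2)\in\{1,\dots,b-2\}^4$ put $$P_\alpha(x_1,x_2)=4\,(x_{\alpha_1,1}x_{\beta_1,2}-x_{\alpha_1,2}x_{\beta_1,1})(x_{\alpha_2,1}x_{\beta_2,2}-x_{\alpha_2,2}x_{\beta_2,1}),$$ where $x_{i,j}$ is the $i$-th coordinate of $x_j$; call $\alpha$ *admissible* if $\alpha_1\ne\alpha_2$, $\beta_1\ne\beta_2$, $\alpha_1<\beta_1$ and $\alpha_2<\beta_2$. For $g\in SO(L\otimes\mathbb R)$ let $z=g^{-1}(\mathbb Re_{b+1}\oplus\mathbb Re_{b+2})$, let $u_z$ and $u_{z^\perp}$ be the projections of $u$ to $z$ and $z^\perp$, let $w$ and $w^\perp$ be the orthogonal complements of $u_z$ in $z$ and of $u_{z^\perp}$ in $z^\perp$,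 and put $g_M(v)=g(v_{w^\perp}+v_w)$. Define $P_{\alpha,g_M,h_1,h_2}$ by $$P_\alpha(g(v_1),g(v_2))=\sum_{h_1,h_2}(v_1,u_{z^\perp})^{h_1}(v_2,u_{z^\perp})^{h_2}\,P_{\alpha,g_M,h_1,h_2}\big(g_M(v_1),g_M(v_2)\big).$$ **Theta functions and inner product.** For $\eta'\in M'$ and a polynomial $P$ in the first $b$ coordinates, with Laplacian $\Delta$ in these coordinates, let $\Theta_{M,\eta'}(\tau_1,\tau_2,g_M,P)$ be the function with $\mathfrak e_\sigma$-component $$y_1^{1/2}\,e^{4\pi q(g_M(\eta')^-)y_2^2/y_1}\sum_{\lambda\in\sigma+M}\big(e^{-\Delta/8\pi y_1}P\big)\Big(g_M\big(\lambda+\tfrac{y_2}{y_1}\eta'\big)\Big)\,e\Big(q(g_M(\lambda)^+)\tau_1+q(g_M(\lambda)^-)\overline{\tau_1}+\tau_2\,(g_M(\lambda)^+,g_M(\eta')^+)+\overline{\tau_2}\,(g_M(\lambda)^-,g_M(\eta')^-)\Big).$$ For $\phi$ of weight $k$ and index $\eta$, and $q(\eta')=q(\eta)$, put $$\langle\phi,\Theta\rangle_{\rm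 Pet}=\int_{\Gamma^J\backslash\mathbb H\times\mathbb C}\Big(\sum_{\sigma\in D_M}\phi_\sigma\overline{\Theta_\sigma}\Big)\,y_1^{k}\,e^{-4\pi q(\eta)y_2^2/y_1}\,\frac{dx_1\,dy_1\,dx_2\,dy_2}{y_1^3},$$ where $\Gamma^J$ is the Jacobi group. **Theorem.** Let $0\ne\eta\in L^{+\prime}$, let $N$ be the largest natural number dividing $\eta$ in $L^{+\prime}$, and let $\phi$ be a Jacobi cusp form of weight $1+b/2$ and index $\eta$ with Fourier coefficients $a(\sigma,r,s)$. Suppose that $$\Big\langle\phi,\ \Theta_{M,\eta+l\tilde u}\big(\cdot,\cdot,g_M,P_{\alpha,g_M,0,1}(\cdot,g_M(\eta+l\tilde u))\big)\Big\rangle_{\rm Pet}=0$$ for all $l=1,\dots,N$, all admissible $\alpha$, and all $g\in SO(L\otimes\mathbb R)$ of the following type: $g$ fixes $e_{b+2}$ and interchanges $e_{\alpha_1}$ with $e_b$, where, if $(\eta,e_{\alpha_1})=0$, only $g(e_b)=e_{\alpha_1}$ and $g(e_{b+2})=e_{b+2}$ are required. Then $$a\big(\lambda,q(\lambda),(\lambda,\eta)\big)=0\qquad\text{for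 every }\lambda\in L^{+\prime}.$$ -/

import Mathlib

noncomputable section

namespace JacobiLift

/-! ### The quadratic space

Throughout `b = n + 2`.  The space `V n` is `L ⊗ ℝ` in the coordinates of the fixed orthonormal
basis `e_1, …, e_{b+2}`, that is `ℝ^{b,2}`.  The coordinates `0, …, n - 1` are those of
`L⁺ ⊗ ℝ`, and the indices `n`, `n + 1`, `n + 2`, `n + 3` belong to
`e_{b-1}`, `e_b`, `e_{b+1}`, `e_{b+2}`. -/

abbrev V (n : ℕ) : Type := Fin (n + 4) → ℝ

/-- The norm `(e_i, e_i)` of a basis vector. -/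
def sgn {n : ℕ} (i : Fin (n + 4)) : ℝ := if (i : ℕ) < n + 2 then 1 else -1

/-- The symmetric bilinear form of signature `(b, 2)`. -/
def bil {n : ℕ} (x y : V n) : ℝ := ∑ i, sgn i * x i * y i

/-- The quadratic form `q(x) = (x, x) / 2`. -/
def q {n : ℕ} (x : V n) : ℝ := bil x x / 2

/-- `x⁺`, the projection to `ℝ^{b,0}`. -/
def posPart {n : ℕ} (x : V n) : V n := fun i => if (i : ℕ) < n + 2 then x i else 0

/-- `x⁻`, the projection to `ℝ^{0,2}`. -/
def negPart {n : ℕ} (x : V n) : V n := fun i => if (i : ℕ) < n + 2 then 0 else x i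

/-- The basis vector `e_i` of `L⁺ ⊗ ℝ`, for `i` in the range `1, …, b - 2`. -/
def eP {n : ℕ} (i : Fin n) : V n := Pi.single (Fin.castAdd 4 i) 1

/-- The basis vectors `e_{b-1}`, `e_b`, `e_{b+1}`, `e_{b+2}`. -/
def eU {n : ℕ} (i : Fin 4) : V n := Pi.single (Fin.natAdd n i) 1

/-- The isotropic vector `u = (e_b + e_{b+2}) / √2`. -/
def u (n : ℕ) : V n := (1 / √2 : ℝ) • (eU 1 + eU 3)

/-- The isotropic vector `ũ = (e_{b-1} + e_{b+1}) / √2`. -/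
def uTilde (n : ℕ) : V n := (1 / √2 : ℝ) • (eU 0 + eU 2)

/-- The isotropic vector `ũ' = (e_{b-1} - e_{b+1}) / √2`. -/
def uTilde' (n : ℕ) : V n := (1 / √2 : ℝ) • (eU 0 - eU 2)

/-! ### Lattices -/

/-- The isometric embedding of `L⁺ ⊗ ℝ` into `L ⊗ ℝ`. -/
def embedPos (n : ℕ) : EuclideanSpace ℝ (Fin n) →+ V n where
  toFun x := fun i => if h : (i : ℕ) < n then x ⟨i, h⟩ else 0
  map_zero' := by
    funext i
    by_cases h : (i : ℕ) < n <;> simp [h]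
  map_add' x y := by
    funext i
    by_cases h : (i : ℕ) < n <;> simp [h]

/-- The lattice `L⁺` as a subgroup of `V n`. -/
def posLattice {n : ℕ} (Λ : Submodule ℤ (EuclideanSpace ℝ (Fin n))) : AddSubgroup (V n) :=
  Λ.toAddSubgroup.map (embedPos n)

/-- The Lorentzian lattice `M = ℤ ũ ⊕ ℤ ũ' ⊕ L⁺`, of signature `(b - 1, 1)`. -/
def lorLattice {n : ℕ} (Λ : Submodule ℤ (EuclideanSpace ℝ (Fin n))) : AddSubgroup (V n) :=
  posLattice Λ ⊔ AddSubgroup.closure {uTilde n, uTilde' n}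

theorem bil_add_left {n : ℕ} (x y z : V n) : bil (x + y) z = bil x z + bil y z := by
  simp [bil, mul_add, add_mul, Finset.sum_add_distrib]

theorem bil_add_right {n : ℕ} (x y z : V n) : bil x (y + z) = bil x y + bil x z := by
  simp [bil, mul_add, Finset.sum_add_distrib]

theorem bil_neg_left {n : ℕ} (x z : V n) : bil (-x) z = -bil x z := by
  simp [bil]

theorem bil_neg_right {n : ℕ} (x z : V n) : bil x (-z) = -bil x z := by
  simp [bil]

/-- The dual lattice of a lattice `Γ`, inside the real span of `Γ`. -/
def dualLattice {n : ℕ} (Γ : AddSubgroup (V n)) : AddSubgroup (V n) where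
  carrier := {x | x ∈ Submodule.span ℝ (Γ : Set (V n)) ∧ ∀ y ∈ Γ, ∃ m : ℤ, bil x y = m}
  zero_mem' := ⟨Submodule.zero_mem _, fun y _ => ⟨0, by simp [bil]⟩⟩
  add_mem' := by
    rintro x x' ⟨hx, hx2⟩ ⟨hx', hx2'⟩
    refine ⟨Submodule.add_mem _ hx hx', fun y hy => ?_⟩
    obtain ⟨m, hm⟩ := hx2 y hy
    obtain ⟨m', hm'⟩ := hx2' y hy
    exact ⟨m + m', by rw [bil_add_left, hm, hm']; push_cast; ring⟩
  neg_mem' := by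
    rintro x ⟨hx, hx2⟩
    refine ⟨Submodule.neg_mem _ hx, fun y hy => ?_⟩
    obtain ⟨m, hm⟩ := hx2 y hy
    exact ⟨-m, by rw [bil_neg_left, hm]; push_cast; ring⟩

/-- The discriminant group `Γ' / Γ` of an integral lattice. -/
abbrev Disc {n : ℕ} (Γ : AddSubgroup (V n)) : Type :=
  dualLattice Γ ⧸ Γ.addSubgroupOf (dualLattice Γ)

/-- The class of an element of `Γ'` in `Γ' / Γ`. -/
def cls {n : ℕ} {Γ : AddSubgroup (V n)} (x : dualLattice Γ) : Disc Γ := QuotientAddGroup.mk x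

/-- A representative in `Γ'` of a class in `Γ' / Γ`. -/
def rep {n : ℕ} {Γ : AddSubgroup (V n)} (σ : Disc Γ) : V n :=
  ((Quotient.out σ : dualLattice Γ) : V n)

theorem bil_pos_hyp {n : ℕ} (x y : V n) (hx : ∀ i : Fin (n + 4), n ≤ (i : ℕ) → x i = 0)
    (hy : ∀ i : Fin (n + 4), (i : ℕ) < n → y i = 0) : bil x y = 0 := by
  unfold bil
  refine Finset.sum_eq_zero fun i _ => ?_
  rcases lt_or_ge (i : ℕ) n with h | h
  · rw [hy i h, mul_zero]
  · rw [hx i h, mul_zero, zero_mul]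

theorem eU_apply_of_lt {n : ℕ} (j : Fin 4) (i : Fin (n + 4)) (h : (i : ℕ) < n) :
    (eU j : V n) i = 0 := by
  unfold eU
  rw [Pi.single_apply, if_neg]
  intro hij
  rw [hij] at h
  simp at h

/-- `L⁺' ⊆ M'`. -/
theorem dual_posLattice_le {n : ℕ} (Λ : Submodule ℤ (EuclideanSpace ℝ (Fin n))) :
    dualLattice (posLattice Λ) ≤ dualLattice (lorLattice Λ) := by
  rintro x ⟨hx, hx2⟩
  have hcoord : ∀ i : Fin (n + 4), n ≤ (i : ℕ) → x i = 0 := by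
    intro i hi
    refine Submodule.span_induction (p := fun y _ => y i = 0) ?_ rfl ?_ ?_ hx
    · rintro y ⟨z, -, rfl⟩
      simp [embedPos, not_lt.mpr hi]
    · intro y z _ _ hy hz
      simp [hy, hz]
    · intro c y _ hy
      simp [hy]
  have hhyp : ∀ y ∈ AddSubgroup.closure {uTilde n, uTilde' n},
      ∀ i : Fin (n + 4), (i : ℕ) < n → y i = 0 := by
    intro y hy i hi
    refine AddSubgroup.closure_induction (p := fun y _ => y i = 0) ?_ rfl ?_ ?_ hy
    · rintro y (rfl | rfl) <;>
        simp [uTilde, uTilde', eU_apply_of_lt _ i hi]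
    · intro y z _ _ hy hz
      simp [hy, hz]
    · intro y _ hy
      simp [hy]
  refine ⟨Submodule.span_mono ?_ hx, fun y hy => ?_⟩
  · exact fun y hy => AddSubgroup.mem_sup_left hy
  · obtain ⟨y₁, hy₁, y₂, hy₂, rfl⟩ := AddSubgroup.mem_sup.mp hy
    obtain ⟨m, hm⟩ := hx2 y₁ hy₁
    exact ⟨m, by rw [bil_add_right, hm, bil_pos_hyp x y₂ hcoord (hhyp y₂ hy₂), add_zero]⟩

/-- An element of `L⁺'`, viewed as an element of `M'`. -/
def toLorDual {n : ℕ} {Λ : Submodule ℤ (EuclideanSpace ℝ (Fin n))}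
    (x : dualLattice (posLattice Λ)) : dualLattice (lorLattice Λ) :=
  ⟨x, dual_posLattice_le Λ x.2⟩

/-! ### Projections attached to an isometry

The base point `z₀` of the Grassmannian of negative definite planes is spanned by `e_{b+1}` and
`e_{b+2}`; an isometry `g` determines the point `z = g⁻¹ z₀`. -/

/-- `g` preserves the bilinear form. -/
def IsIsometry {n : ℕ} (g : V n ≃ₗ[ℝ] V n) : Prop := ∀ x y, bil (g x) (g y) = bil x y

/-- `v_z`. -/
def projZ {n : ℕ} (g : V n ≃ₗ[ℝ] V n) (v : V n) : V n := g.symm (negPart (g v))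

/-- `v_{z^⊥}`. -/
def projZperp {n : ℕ} (g : V n ≃ₗ[ℝ] V n) (v : V n) : V n := g.symm (posPart (g v))

/-- `u_z`. -/
def uz {n : ℕ} (g : V n ≃ₗ[ℝ] V n) : V n := projZ g (u n)

/-- `u_{z^⊥}`. -/
def uzPerp {n : ℕ} (g : V n ≃ₗ[ℝ] V n) : V n := projZperp g (u n)

/-- `v_w`, where `w` is the orthogonal complement of `u_z` in `z`. -/
def projW {n : ℕ} (g : V n ≃ₗ[ℝ] V n) (v : V n) : V n :=
  projZ g v - (bil v (uz g) / bil (uz g) (uz g)) • uz g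

/-- `v_{w^⊥}`, where `w^⊥` is the orthogonal complement of `u_{z^⊥}` in `z^⊥`. -/
def projWperp {n : ℕ} (g : V n ≃ₗ[ℝ] V n) (v : V n) : V n :=
  projZperp g v - (bil v (uzPerp g) / bil (uzPerp g) (uzPerp g)) • uzPerp g

/-- The linear map `g_M(v) = g(v_{w^⊥} + v_w)`. -/
def gM {n : ℕ} (g : V n ≃ₗ[ℝ] V n) (v : V n) : V n := g (projWperp g v + projW g v)

/-! ### Polynomials

The variable `(i, j)` stands for the coordinate `x_{i,j}` of the vector `x_j` in a pair
`(x_1, x_2)`; the two members of the pair are indexed by `0, 1 : Fin 2`. -/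

open MvPolynomial in
/-- `P_α(x) = 4 (x_{α₁,1} x_{β₁,2} - x_{α₁,2} x_{β₁,1}) (x_{α₂,1} x_{β₂,2} - x_{α₂,2} x_{β₂,1})`
for `α = (α₁, α₂, β₁, β₂)`. -/
def polyAlpha {n : ℕ} (α₁ α₂ β₁ β₂ : Fin n) : MvPolynomial (Fin (n + 4) × Fin 2) ℂ :=
  let x (i : Fin n) (j : Fin 2) : MvPolynomial (Fin (n + 4) × Fin 2) ℂ := X (Fin.castAdd 4 i, j)
  4 * (x α₁ 0 * x β₁ 1 - x α₁ 1 * x β₁ 0) * (x α₂ 0 * x β₂ 1 - x α₂ 1 * x β₂ 0)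

open MvPolynomial in
/-- The algebra map `P ↦ P(π x_1 + T_1 c, π x_2 + T_2 c)`, where `y = g u_{z^⊥}`,
`c = y / (y, y)`, and `π` is the orthogonal projection to the complement of `y`. -/
def splitPoly {n : ℕ} (g : V n ≃ₗ[ℝ] V n) :
    MvPolynomial (Fin (n + 4) × Fin 2) ℂ →ₐ[ℂ]
      MvPolynomial (Fin 2) (MvPolynomial (Fin (n + 4) × Fin 2) ℂ) :=
  let y : V n := g (uzPerp g)
  let c : V n := (bil y y)⁻¹ • y
  aeval fun p : Fin (n + 4) × Fin 2 =>
    C (X p - ∑ k, C ((sgn k * y k * c p.1 : ℝ) : ℂ) * X (k, p.2)) +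
      X p.2 * C (C ((c p.1 : ℝ) : ℂ))

/-- The polynomial `P_{g_M, h₁, h₂}`, for `P` in the positive coordinates: it is determined on the
image of `g_M` by
`P(g v) = ∑ (v_1, u_{z^⊥})^{h₁} (v_2, u_{z^⊥})^{h₂} P_{g_M, h₁, h₂}(g_M v)`. -/
def reducedPoly {n : ℕ} (g : V n ≃ₗ[ℝ] V n) (P : MvPolynomial (Fin (n + 4) × Fin 2) ℂ)
    (h₁ h₂ : ℕ) : MvPolynomial (Fin (n + 4) × Fin 2) ℂ :=
  MvPolynomial.coeff (Finsupp.single 0 h₁ + Finsupp.single 1 h₂) (splitPoly g P)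

open MvPolynomial in
/-- `P(·, y)`: the second vector of the pair is specialized to `y`. -/
def fixSecond {n : ℕ} (y : V n) (P : MvPolynomial (Fin (n + 4) × Fin 2) ℂ) :
    MvPolynomial (Fin (n + 4)) ℂ :=
  aeval (fun p : Fin (n + 4) × Fin 2 => if p.2 = 0 then X p.1 else C ((y p.1 : ℝ) : ℂ)) P

/-- The Laplace operator in the positive coordinates. -/
def lap {n : ℕ} (P : MvPolynomial (Fin (n + 4)) ℂ) : MvPolynomial (Fin (n + 4)) ℂ :=
  ∑ i : Fin (n + 4), if (i : ℕ) < n + 2 then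
    MvPolynomial.pderiv i (MvPolynomial.pderiv i P) else 0

/-- `exp(-Δ / 8πy) P`; the exponential series terminates because `Δ^m P = 0` for `m > deg P`. -/
def heat {n : ℕ} (y : ℝ) (P : MvPolynomial (Fin (n + 4)) ℂ) : MvPolynomial (Fin (n + 4)) ℂ :=
  ∑ m ∈ Finset.range (P.totalDegree + 1),
    MvPolynomial.C ((((-1 / (8 * Real.pi * y)) ^ m / (m.factorial : ℝ) : ℝ)) : ℂ) * lap^[m] P

/-! ### Jacobi theta functions -/

/-- `e(t) = exp(2πit)`. -/
def e (t : ℂ) : ℂ := Complex.exp (2 * Real.pi * Complex.I * t)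

/-- The component of class `σ` of the Jacobi theta function of index `η` attached to a lattice `Γ`
with `b⁻ = bm`, an isometry `γ` from `Γ ⊗ ℝ` to a nondegenerate subspace of `V n`, and a polynomial
`P` in the positive coordinates. -/
def jacobiTheta {n : ℕ} (Γ : AddSubgroup (V n)) (bm : ℕ) (γ : V n → V n)
    (P : MvPolynomial (Fin (n + 4)) ℂ) (η : V n) (τ₁ τ₂ : ℂ) (σ : Disc Γ) : ℂ :=
  ((τ₁.im ^ ((bm : ℝ) / 2) * Real.exp (4 * Real.pi * q (negPart (γ η)) * τ₂.im ^ 2 / τ₁.im) : ℝ) : ℂ)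
    * ∑' x : Γ,
      MvPolynomial.eval (fun i => ((γ (rep σ + x + (τ₂.im / τ₁.im) • η) i : ℝ) : ℂ)) (heat τ₁.im P) *
      e (q (posPart (γ (rep σ + x))) * τ₁
        + q (negPart (γ (rep σ + x))) * (starRingEnd ℂ) τ₁
        + τ₂ * bil (posPart (γ (rep σ + x))) (posPart (γ η))
        + (starRingEnd ℂ) τ₂ * bil (negPart (γ (rep σ + x))) (negPart (γ η)))

/-! ### Jacobi forms -/

/-- The action of `T = ((1, 1; 0, 1), 1)` on `ℂ[Γ' / Γ]` in the Weil representation: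
`𝔢_σ ↦ e(q(σ)) 𝔢_σ`. -/
def weilT {n : ℕ} {Γ : AddSubgroup (V n)} (f : Disc Γ → ℂ) : Disc Γ → ℂ :=
  fun σ => e (q (rep σ)) * f σ

/-- The action of `S = ((0, -1; 1, 0), √τ)` on `ℂ[Γ' / Γ]` in the Weil representation, where
`sig = b⁺ - b⁻` is the signature of `Γ`:
`𝔢_σ ↦ √i^(b⁻ - b⁺) |Γ' / Γ|^(-1/2) ∑ e(-(σ, σ')) 𝔢_σ'`. -/
def weilS {n : ℕ} {Γ : AddSubgroup (V n)} (sig : ℤ) (f : Disc Γ → ℂ) : Disc Γ → ℂ :=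
  fun σ => Complex.exp (-(Real.pi * Complex.I / 4) * sig) / ((√(Nat.card (Disc Γ)) : ℝ) : ℂ) *
    ∑ᶠ σ' : Disc Γ, e (-(bil (rep σ') (rep σ) : ℝ)) * f σ'

/-- The action of the element `(p, r, t)` of the Heisenberg group on `ℂ[Γ' / Γ]`:
`𝔢_σ ↦ e(p (σ, η) + (t - p r) q(η)) 𝔢_{σ - r η}`. -/
def weilH {n : ℕ} {Γ : AddSubgroup (V n)} (η : dualLattice Γ) (p r t : ℤ) (f : Disc Γ → ℂ) :
    Disc Γ → ℂ :=
  fun σ => e ((p * bil (rep (σ + r • cls η)) η + (t - p * r) * q (η : V n) : ℝ)) *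
    f (σ + r • cls η)

/-- `φ` is a Jacobi form of weight `k` and index `η` with respect to the Weil representation of the
even lattice `Γ` of signature `sig`.  The transformation laws are those of the Heisenberg group
and of the generators `T`, `S` of `Mp₂(ℤ)`. -/
structure IsJacobiForm {n : ℕ} (Γ : AddSubgroup (V n)) (sig : ℤ) (k : ℝ) (η : dualLattice Γ)
    (φ : ℂ → ℂ → Disc Γ → ℂ) : Prop where
  holo : ∀ σ, DifferentiableOn ℂ (fun τ : ℂ × ℂ => φ τ.1 τ.2 σ) {τ | 0 < τ.1.im}
  heis : ∀ (p r t : ℤ) (τ₁ τ₂ : ℂ), 0 < τ₁.im →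
    φ τ₁ (τ₂ + p + r * τ₁) =
      e (-(q (η : V n) * r ^ 2 * τ₁) - 2 * q (η : V n) * r * τ₂ - p * r * q (η : V n)
        - t * q (η : V n)) • weilH η p r t (φ τ₁ τ₂)
  transT : ∀ τ₁ τ₂ : ℂ, 0 < τ₁.im → φ (τ₁ + 1) τ₂ = weilT (φ τ₁ τ₂)
  transS : ∀ τ₁ τ₂ : ℂ, 0 < τ₁.im →
    φ (-1 / τ₁) (τ₂ / τ₁) =
      (τ₁ ^ (k : ℂ) * e (q (η : V n) * τ₂ ^ 2 / τ₁)) • weilS sig (φ τ₁ τ₂)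

/-- `φ(τ₁, τ₂) = ∑ a(σ, r, s) 𝔢_σ(r τ₁ + s τ₂)`, the sum running over `σ ∈ Γ' / Γ`, `r ∈ ℤ + q(σ)`
and `s ∈ ℤ + (σ, η)`. -/
def HasFourierExpansion {n : ℕ} {Γ : AddSubgroup (V n)} (η : dualLattice Γ)
    (φ : ℂ → ℂ → Disc Γ → ℂ) (a : Disc Γ → ℝ → ℝ → ℂ) : Prop :=
  ∀ (ν : dualLattice Γ) (τ₁ τ₂ : ℂ), 0 < τ₁.im →
    HasSum (fun m : ℤ × ℤ =>
      a (cls ν) (m.1 + q (ν : V n)) (m.2 + bil (ν : V n) η) *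
        e (((m.1 + q (ν : V n) : ℝ) : ℂ) * τ₁ + ((m.2 + bil (ν : V n) η : ℝ) : ℂ) * τ₂))
      (φ τ₁ τ₂ (cls ν))

/-- `φ` is a Jacobi cusp form of weight `k` and index `η`, with Fourier coefficients `a`. -/
structure IsJacobiCuspForm {n : ℕ} (Γ : AddSubgroup (V n)) (sig : ℤ) (k : ℝ) (η : dualLattice Γ)
    (φ : ℂ → ℂ → Disc Γ → ℂ) (a : Disc Γ → ℝ → ℝ → ℂ) : Prop where
  jacobi : IsJacobiForm Γ sig k η φ
  fourier : HasFourierExpansion η φ a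
  cusp : ∀ (ν : dualLattice Γ) (i j : ℤ),
    a (cls ν) (i + q (ν : V n)) (j + bil (ν : V n) η) ≠ 0 →
      (j + bil (ν : V n) η) ^ 2 < 4 * q (η : V n) * (i + q (ν : V n))

/-! ### The Petersson inner product -/

/-- A fundamental domain for the action of the Jacobi group on `ℍ × ℂ`.  Over the usual fundamental
domain of the modular group lies half of the torus `ℂ / (ℤ + τ₁ ℤ)`, since minus the identity
acts by `τ₂ ↦ -τ₂`. -/
def jacobiDomain : Set (ℂ × ℂ) :=
  {τ | 0 < τ.1.im ∧ |τ.1.re| ≤ 1 / 2 ∧ 1 ≤ ‖τ.1‖ ∧ 0 ≤ τ.2.im ∧ τ.2.im ≤ τ.1.im / 2 ∧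
    τ.2.im * τ.1.re / τ.1.im ≤ τ.2.re ∧ τ.2.re ≤ 1 + τ.2.im * τ.1.re / τ.1.im}

/-- The Jacobi Petersson inner product in weight `k` and index of norm `q(η) = m`. -/
def petersson {n : ℕ} {Γ : AddSubgroup (V n)} (k m : ℝ) (φ ψ : ℂ → ℂ → Disc Γ → ℂ) : ℂ :=
  ∫ τ in jacobiDomain,
    (∑ᶠ σ : Disc Γ, φ τ.1 τ.2 σ * (starRingEnd ℂ) (ψ τ.1 τ.2 σ)) *
      ((τ.1.im ^ k * Real.exp (-(4 * Real.pi * m * τ.2.im ^ 2 / τ.1.im)) / τ.1.im ^ 3 : ℝ) : ℂ)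

end JacobiLift
end

/-! The admissible isometries include families that run off to infinity. The behaviour of the inner
product along such a family, with a parameter t → ∞, already exhibits the coefficients a(λ) = a(λ,
q(λ), (λ, η)).

Choice of isometries. Take distinct indices i₀, i₁, i₂ and (α₁, α₂, β₁, β₂) = (i₀, i₁, i₁, i₂). For
v in L⁺ ⊗ ℝ and a unit vector f in L⁺ ⊗ ℝ orthogonal to e_{i₀}, `exists_isometry` combines the
Eichler transformation of v, the dilation of the plane ⟨ũ, ũ'⟩ by t, a rotation of L⁺ ⊗ ℝ and an
exchange of coordinates. The reduced polynomial is then quadratic in the coordinates i₁ and i₂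
(`reducedPoly_eq`), and the integrand of the inner product is an explicit sum over x + jũ' + dũ with
x in L⁺' and integers j, d (`jacobiTheta_pairing`).

Asymptotics. The terms with j ≠ 0 are of order exp(-t²/16). For j = 0, Poisson summation over d
(`tsum_thKer`) gives frequencies k with a factor exp(-πk²t²/y), and k = 0 drops out because the heat
operator has produced Hermite functions of positive degree. So heights y ≤ 1 are negligible too.
Above height one the fundamental domain is a product in the coordinates τ₂ = x + cτ₁, and
integration over the real parts isolates a(x) (`integral_cuspDomain_perTerm`). The symmetries a(-x)
= a(x) and a(x + η) = a(x) unfold the range of c from [0, 1/2] to ℝ (`hasSum_symm`,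
`hasSum_unfold`). The Gaussian integral over c leaves integrals ∫₁^∞ y^p exp(-4πρy - πk²T²/y) dy,
where ρ = q(x) - (x, η)²/4q(η) and T² = t² + (l + (η, v))²/4q(η). Vanishing of the inner product
thus makes a series of such integrals O(exp(-T²/16)) (`exists_unfolded_bound`).

Separation. The integral with parameters ρ, k has exponential rate 4πk√ρ in T, so the terms with k =
1 and the least ρ carrying a nonzero coefficient must cancel among themselves
(`leading_bessel_coeffs_eq_zero`). Write x = p + cη with p orthogonal to η. The resulting
`leading_relations` involve the phases e((p, v) - lc). Varying v, independence of characters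
isolates each p (`sum_perpPart_eq_zero`). The elements with the same p differ by multiples of η/N,
so the numbers e(-c) are distinct modulo η and have a common N-th power; the relations for l = 1, …,
N form a Vandermonde system and kill every coefficient (`eq_zero_of_sum_pow`). This contradicts the
choice of ρ. -/

namespace JacobiLift

noncomputable section

open Complex MeasureTheory Filter Topology Asymptotics FourierTransform

/-! ### Gaussians and Hermite functions -/

/-- The Gaussian `exp(-πax²)`. -/
def gauss (a x : ℝ) : ℂ := cexp (-Real.pi * a * x ^ 2)

/-- The first Hermite function `x exp(-πax²)`. -/
def gauss₁ (a x : ℝ) : ℂ := x * gauss a x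

/-- The second Hermite function `(x² - 1/(2πa)) exp(-πax²)`. -/
def gauss₂ (a x : ℝ) : ℂ := (x ^ 2 - 1 / (2 * Real.pi * a)) * gauss a x

theorem gauss_eq_ofReal (a x : ℝ) : gauss a x = (Real.exp (-Real.pi * a * x ^ 2) : ℝ) := by
  simp [gauss]

theorem norm_gauss (a x : ℝ) : ‖gauss a x‖ = Real.exp (-Real.pi * a * x ^ 2) := by
  rw [gauss_eq_ofReal, norm_real, Real.norm_of_nonneg (Real.exp_pos _).le]

theorem continuous_gauss (a : ℝ) : Continuous (gauss a) := by unfold gauss; fun_prop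

theorem hasDerivAt_gauss (a x : ℝ) :
    HasDerivAt (gauss a) (-(2 * Real.pi * a) * gauss₁ a x) x := by
  have h : HasDerivAt (fun y : ℝ => (-Real.pi * a * (y : ℂ) ^ 2)) (-Real.pi * a * (2 * x)) x := by
    have := (hasDerivAt_id x).ofReal_comp
    simpa using! (this.pow 2).const_mul (-Real.pi * a : ℂ)
  refine h.cexp.congr_deriv ?_
  simp only [gauss₁, gauss]; ring

theorem hasDerivAt_gauss₁ {a : ℝ} (ha : 0 < a) (x : ℝ) :
    HasDerivAt (gauss₁ a) (-(2 * Real.pi * a) * gauss₂ a x) x := by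
  have h1 := ((hasDerivAt_id x).ofReal_comp).mul (hasDerivAt_gauss a x)
  refine h1.congr_deriv ?_
  simp only [gauss₁, gauss₂]
  have : (a : ℂ) ≠ 0 := by exact_mod_cast ha.ne'
  have hp : (Real.pi : ℂ) ≠ 0 := by exact_mod_cast Real.pi_ne_zero
  simp only [id, ofReal_one]
  field_simp
  ring

theorem isBigO_pow_mul_gauss {a : ℝ} (ha : 0 < a) (j : ℕ) :
    (fun x : ℝ => (x : ℂ) ^ j * gauss a x) =O[cocompact ℝ] fun x => |x| ^ (-2 : ℝ) := by
  have h := (isLittleO_exp_neg_mul_sq_cocompact (a := (Real.pi * a : ℝ))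
    (by simpa using mul_pos Real.pi_pos ha) (-2 - j)).isBigO
  have h2 : (fun x : ℝ => (x : ℂ) ^ j) =O[cocompact ℝ] fun x => |x| ^ (j : ℝ) := by
    refine IsBigO.of_bound 1 (Eventually.of_forall fun x => ?_)
    simp [Real.rpow_natCast]
  refine ((h2.mul h).congr_left fun x => ?_).trans ?_
  · simp [gauss]
  · refine IsBigO.of_bound 1 ?_
    have : ∀ᶠ x : ℝ in cocompact ℝ, x ≠ 0 := by
      have := (isCompact_singleton (x := (0 : ℝ))).compl_mem_cocompact
      filter_upwards [this] with x hx using hx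
    filter_upwards [this] with x hx
    rw [← Real.rpow_add (abs_pos.mpr hx)]
    simp

theorem isBigO_gauss₂ {a : ℝ} (ha : 0 < a) :
    gauss₂ a =O[cocompact ℝ] fun x => |x| ^ (-2 : ℝ) := by
  have := (isBigO_pow_mul_gauss ha 2).sub
    ((isBigO_pow_mul_gauss ha 0).const_mul_left (1 / (2 * Real.pi * a) : ℂ))
  refine this.congr_left fun x => ?_
  simp [gauss₂]; ring

theorem isBigO_gauss₁ {a : ℝ} (ha : 0 < a) :
    gauss₁ a =O[cocompact ℝ] fun x => |x| ^ (-2 : ℝ) := by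
  refine (isBigO_pow_mul_gauss ha 1).congr_left fun x => ?_
  simp [gauss₁]

theorem integrable_pow_mul_gauss {a : ℝ} (ha : 0 < a) (j : ℕ) :
    Integrable fun x : ℝ => (x : ℂ) ^ j * gauss a x := by
  have h := integrable_rpow_mul_exp_neg_mul_sq (b := Real.pi * a) (by positivity) (s := j)
    (by have : (0 : ℝ) ≤ j := j.cast_nonneg
        linarith)
  refine h.ofReal.congr (Eventually.of_forall fun x => ?_)
  simp [gauss, Real.rpow_natCast]

theorem integrable_gauss {a : ℝ} (ha : 0 < a) : Integrable (gauss a) := by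
  simpa using integrable_pow_mul_gauss ha 0

theorem integrable_gauss₁ {a : ℝ} (ha : 0 < a) : Integrable (gauss₁ a) := by
  simpa [gauss₁] using! integrable_pow_mul_gauss ha 1

theorem integrable_gauss₂ {a : ℝ} (ha : 0 < a) : Integrable (gauss₂ a) := by
  refine ((integrable_pow_mul_gauss ha 2).sub
    ((integrable_pow_mul_gauss ha 0).const_mul (1 / (2 * Real.pi * a) : ℂ))).congr
    (Eventually.of_forall fun x => ?_)
  simp [gauss₂]; ring

theorem fourier_gauss {a : ℝ} (ha : 0 < a) (t : ℝ) :
    𝓕 (gauss a) t = (1 / √a : ℝ) * gauss a⁻¹ t := by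
  have h := congrFun (fourier_gaussian_pi (b := a) (by simpa using ha)) t
  rw [show gauss a = fun x : ℝ => cexp (-Real.pi * a * x ^ 2) from rfl, h]
  have : (a : ℂ) ^ (1 / 2 : ℂ) = (√a : ℝ) := by
    rw [Real.sqrt_eq_rpow, ofReal_cpow ha.le]; norm_num
  rw [this, gauss]
  push_cast
  rw [div_eq_mul_inv (-(Real.pi : ℂ))]

/-- `gauss₁` is a multiple of the derivative of `gauss`, and `gauss₂` one of the derivative of
`gauss₁`, so each step multiplies the transform by a multiple of t. Both transforms vanish at t = 0,
which later removes the zero frequency. -/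
theorem fourier_gauss₁ {a : ℝ} (ha : 0 < a) (t : ℝ) :
    𝓕 (gauss₁ a) t = -(I * t / a) * ((1 / √a : ℝ) * gauss a⁻¹ t) := by
  have hd : deriv (gauss a) = (-(2 * Real.pi * a) : ℂ) • gauss₁ a := by
    funext x; simp [(hasDerivAt_gauss a x).deriv]
  have h := congrFun (Real.fourier_deriv (integrable_gauss ha)
    (fun x => (hasDerivAt_gauss a x).differentiableAt)
    (by rw [hd]; exact (integrable_gauss₁ ha).smul _)) t
  rw [hd, Real.fourier_eq] at h
  simp only [Pi.smul_apply, smul_comm _ (-(2 * Real.pi * a) : ℂ)] at h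
  rw [integral_smul, ← Real.fourier_eq, fourier_gauss ha] at h
  have : (a : ℂ) ≠ 0 := by exact_mod_cast ha.ne'
  have hp : (Real.pi : ℂ) ≠ 0 := by exact_mod_cast Real.pi_ne_zero
  simp only [smul_eq_mul] at h
  have h2 : (-(2 * Real.pi * a) : ℂ) ≠ 0 := by simp [this]
  apply mul_left_cancel₀ h2
  rw [h]; field_simp

theorem fourier_gauss₂ {a : ℝ} (ha : 0 < a) (t : ℝ) :
    𝓕 (gauss₂ a) t = -(t ^ 2 / a ^ 2) * ((1 / √a : ℝ) * gauss a⁻¹ t) := by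
  have hd : deriv (gauss₁ a) = (-(2 * Real.pi * a) : ℂ) • gauss₂ a := by
    funext x; simp [(hasDerivAt_gauss₁ ha x).deriv]
  have h := congrFun (Real.fourier_deriv (integrable_gauss₁ ha)
    (fun x => (hasDerivAt_gauss₁ ha x).differentiableAt)
    (by rw [hd]; exact (integrable_gauss₂ ha).smul _)) t
  rw [hd, Real.fourier_eq] at h
  simp only [Pi.smul_apply, smul_comm _ (-(2 * Real.pi * a) : ℂ)] at h
  rw [integral_smul, ← Real.fourier_eq, fourier_gauss₁ ha] at h
  have : (a : ℂ) ≠ 0 := by exact_mod_cast ha.ne'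
  have hp : (Real.pi : ℂ) ≠ 0 := by exact_mod_cast Real.pi_ne_zero
  simp only [smul_eq_mul] at h
  have h2 : (-(2 * Real.pi * a) : ℂ) ≠ 0 := by simp [this]
  apply mul_left_cancel₀ h2
  rw [h]; field_simp; ring_nf; simp

theorem summable_of_isBigO_rpow_neg_two {f : ℝ → ℂ} (hf : f =O[cocompact ℝ] fun x => |x| ^ (-2 : ℝ)) :
    Summable fun n : ℤ => f n :=
  summable_of_isBigO (Real.summable_abs_int_rpow one_lt_two) (hf.comp_tendsto Int.tendsto_coe_cofinite)

theorem summable_pow_mul_gauss {a : ℝ} (ha : 0 < a) (j : ℕ) :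
    Summable fun n : ℤ => (n : ℂ) ^ j * gauss a n := by
  simpa using! summable_of_isBigO_rpow_neg_two (isBigO_pow_mul_gauss ha j)

theorem fourier_coe_eq_e (n : ℤ) (x : ℝ) : fourier n (x : UnitAddCircle) = e (n * x) := by
  rw [fourier_coe_apply, e]; congr 1; push_cast; ring

/-- Poisson summation, the shift x becoming a phase. The decay of the function itself is used only
in the form |x|^(-2). -/
theorem tsum_gauss₁ {a : ℝ} (ha : 0 < a) (x : ℝ) :
    ∑' n : ℤ, gauss₁ a (x + n) =
      ∑' k : ℤ, -(I * k / a) * ((1 / √a : ℝ) * gauss a⁻¹ k) * e (k * x) := by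
  rw [Real.tsum_eq_tsum_fourier_of_rpow_decay_of_summable
    (f := gauss₁ a) (continuous_ofReal.mul (continuous_gauss a)) one_lt_two (isBigO_gauss₁ ha)]
  · exact tsum_congr fun k => by rw [fourier_gauss₁ ha, fourier_coe_eq_e]; simp
  · simp_rw [fourier_gauss₁ ha]
    refine ((summable_pow_mul_gauss (inv_pos.mpr ha) 1).mul_left (-(I / a) * (1 / √a : ℝ))).congr
      fun k => ?_
    simp; ring

theorem tsum_gauss₂ {a : ℝ} (ha : 0 < a) (x : ℝ) :
    ∑' n : ℤ, gauss₂ a (x + n) =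
      ∑' k : ℤ, -(k ^ 2 / a ^ 2) * ((1 / √a : ℝ) * gauss a⁻¹ k) * e (k * x) := by
  rw [Real.tsum_eq_tsum_fourier_of_rpow_decay_of_summable
    (f := gauss₂ a) (((continuous_ofReal.pow 2).sub continuous_const).mul (continuous_gauss a)) one_lt_two
    (isBigO_gauss₂ ha)]
  · exact tsum_congr fun k => by rw [fourier_gauss₂ ha, fourier_coe_eq_e]; simp
  · simp_rw [fourier_gauss₂ ha]
    refine ((summable_pow_mul_gauss (inv_pos.mpr ha) 2).mul_left (-(1 / (a : ℂ) ^ 2) * (1 / √a : ℝ))).congr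
      fun k => ?_
    simp; ring

end
end JacobiLift

namespace JacobiLift

noncomputable section

open Complex MeasureTheory Filter Topology Asymptotics Set

/-! ### Incomplete Bessel integrals and their asymptotics -/

/-- The incomplete Bessel integral `∫_1^∞ y^p exp(-Ay - B/y) dy`. -/
def bessel (p A B : ℝ) : ℝ := ∫ y in Ioi (1 : ℝ), y ^ p * Real.exp (-A * y - B / y)

theorem integrableOn_rpow_mul_exp_neg (p : ℝ) {A : ℝ} (hA : 0 < A) :
    IntegrableOn (fun y : ℝ => y ^ p * Real.exp (-A * y)) (Ioi 1) := by
  have h := (integrableOn_rpow_mul_exp_neg_mul_rpow (s := |p|) (p := 1) (b := A)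
    (by linarith [abs_nonneg p]) one_pos hA).mono_set (Ioi_subset_Ioi zero_le_one)
  refine Integrable.mono' h ?_ ?_
  · refine ContinuousOn.aestronglyMeasurable (fun y hy => ?_) measurableSet_Ioi
    have hy0 : (y : ℝ) ≠ 0 := (zero_lt_one.trans hy).ne'
    exact ((Real.continuousAt_rpow_const _ _ (Or.inl hy0)).mul (by fun_prop)).continuousWithinAt
  · refine (ae_restrict_iff' measurableSet_Ioi).mpr (Eventually.of_forall fun y (hy : 1 < y) => ?_)
    rw [Real.norm_of_nonneg (by positivity), Real.rpow_one]
    gcongr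
    · exact hy.le
    · exact le_abs_self p

theorem aestronglyMeasurable_bessel (p A B : ℝ) :
    AEStronglyMeasurable (fun y : ℝ => y ^ p * Real.exp (-A * y - B / y))
      (volume.restrict (Ioi 1)) := by
  refine ContinuousOn.aestronglyMeasurable (fun y hy => ?_) measurableSet_Ioi
  have hy0 : (y : ℝ) ≠ 0 := (zero_lt_one.trans hy).ne'
  refine ((Real.continuousAt_rpow_const _ _ (Or.inl hy0)).mul ?_).continuousWithinAt
  fun_prop (disch := assumption)

theorem integrableOn_bessel (p : ℝ) {A B : ℝ} (hA : 0 < A) (hB : 0 ≤ B) :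
    IntegrableOn (fun y : ℝ => y ^ p * Real.exp (-A * y - B / y)) (Ioi 1) := by
  refine Integrable.mono' (integrableOn_rpow_mul_exp_neg p hA) (aestronglyMeasurable_bessel p A B) ?_
  refine (ae_restrict_iff' measurableSet_Ioi).mpr (Eventually.of_forall fun y (hy : 1 < y) => ?_)
  have : 0 ≤ B / y := by positivity
  rw [Real.norm_of_nonneg (by positivity)]
  gcongr
  linarith

theorem bessel_nonneg (p A B : ℝ) : 0 ≤ bessel p A B :=
  setIntegral_nonneg measurableSet_Ioi fun y (hy : 1 < y) => by positivity

/-- A pointwise bound of the integrand gives a bound of the Bessel integral. -/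
theorem bessel_le_of_le {p A B A' p' C : ℝ} (hA : 0 < A) (hB : 0 ≤ B) (hA' : 0 < A')
    (h : ∀ y : ℝ, 1 < y → y ^ p * Real.exp (-A * y - B / y) ≤ C * (y ^ p' * Real.exp (-A' * y))) :
    bessel p A B ≤ C * ∫ y in Ioi (1 : ℝ), y ^ p' * Real.exp (-A' * y) := by
  rw [← integral_const_mul]
  exact setIntegral_mono_on (integrableOn_bessel p hA hB)
    ((integrableOn_rpow_mul_exp_neg p' hA').const_mul C) measurableSet_Ioi h

/-- Arithmetic-geometric mean inequality; it is the source of the exponential rates 2√(AB). -/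
theorem two_mul_sqrt_le {A B y : ℝ} (hA : 0 ≤ A) (hB : 0 ≤ B) (hy : 0 < y) :
    2 * √(A * B) ≤ A * y + B / y := by
  have h1 : √(A * B) = √(A * y) * √(B / y) := by
    rw [← Real.sqrt_mul (by positivity)]
    congr 1; field_simp
  have h2 := sq_nonneg (√(A * y) - √(B / y))
  rw [sub_sq, Real.sq_sqrt (by positivity), Real.sq_sqrt (by positivity)] at h2
  rw [h1]; linarith

/-- Laplace's method from below: only the unit interval to the right of the critical point y₀ =
T√(B/A) is kept. There y ≤ 2y₀, and the exponent exceeds its minimum 2T√(AB) by at most A. -/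
theorem le_bessel (p : ℝ) {A B : ℝ} (hA : 0 < A) (hB : 0 < B) :
    ∃ c > 0, ∃ T₀ > 0, ∀ T ≥ T₀,
      c * T ^ (-|p|) * Real.exp (-(2 * √(A * B)) * T) ≤ bessel p A (B * T ^ 2) := by
  set κ := √(B / A) with hκ
  have hκ0 : 0 < κ := Real.sqrt_pos.mpr (by positivity)
  -- T ≥ 1/κ puts the critical point κT inside the range of integration.
  refine ⟨(2 * κ) ^ (-|p|) * Real.exp (-A), by positivity, 1 / κ, by positivity, fun T hT => ?_⟩
  have hT0 : 0 < T := lt_of_lt_of_le (by positivity) hT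
  set y₀ := κ * T with hy₀
  have hy1 : 1 ≤ y₀ := by
    rw [ge_iff_le, div_le_iff₀ hκ0] at hT; rw [hy₀]; linarith
  have hAB : √(A * B) = A * κ := by
    rw [hκ, show A * B = A ^ 2 * (B / A) by field_simp, Real.sqrt_mul (by positivity),
      Real.sqrt_sq hA.le]
  have hBA : B = A * κ ^ 2 := by
    rw [hκ, Real.sq_sqrt (by positivity)]; field_simp
  have hint := integrableOn_bessel p hA (B := B * T ^ 2) (by positivity)
  have hsub : Ioc y₀ (y₀ + 1) ⊆ Ioi 1 := fun y hy => lt_of_le_of_lt hy1 hy.1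
  calc _ = ∫ _ in Ioc y₀ (y₀ + 1),
        (2 * κ) ^ (-|p|) * Real.exp (-A) * T ^ (-|p|) * Real.exp (-(2 * √(A * B)) * T) := by
        simp
    _ ≤ ∫ y in Ioc y₀ (y₀ + 1), y ^ p * Real.exp (-A * y - B * T ^ 2 / y) := by
        refine setIntegral_mono_on continuous_const.integrableOn_Ioc (hint.mono_set hsub) measurableSet_Ioc
          fun y hy => ?_
        have hy0 : 1 < y := hsub hy
        have h1 : (2 * κ) ^ (-|p|) * T ^ (-|p|) ≤ y ^ p := by
          rw [← Real.mul_rpow (by positivity) hT0.le]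
          calc (2 * κ * T) ^ (-|p|) ≤ y ^ (-|p|) := by
                apply Real.rpow_le_rpow_of_nonpos (by linarith)
                · have := hy.2
                  rw [mul_assoc, ← hy₀]; linarith
                · simp
            _ ≤ y ^ p := Real.rpow_le_rpow_of_exponent_le hy0.le (neg_abs_le p)
        have h2 : Real.exp (-A) * Real.exp (-(2 * √(A * B)) * T) ≤
            Real.exp (-A * y - B * T ^ 2 / y) := by
          rw [← Real.exp_add]
          apply Real.exp_le_exp.mpr
          have h3 : B * T ^ 2 / y ≤ A * y₀ := by
            rw [div_le_iff₀ (by linarith), hBA]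
            calc A * κ ^ 2 * T ^ 2 = A * y₀ * y₀ := by rw [hy₀]; ring
              _ ≤ A * y₀ * y := by gcongr; exact hy.1.le
          have h4 : A * y ≤ A * (y₀ + 1) := by gcongr; exact hy.2
          rw [hAB]
          have : 2 * (A * κ) * T = 2 * (A * y₀) := by rw [hy₀]; ring
          linarith
        calc _ = ((2 * κ) ^ (-|p|) * T ^ (-|p|)) *
              (Real.exp (-A) * Real.exp (-(2 * √(A * B)) * T)) := by ring
          _ ≤ _ := mul_le_mul h1 h2 (by positivity) (by positivity)
    _ ≤ bessel p A (B * T ^ 2) := by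
        refine setIntegral_mono_set hint ?_ (LE.le.eventuallyLE hsub)
        refine (ae_restrict_iff' measurableSet_Ioi).mpr
          (Eventually.of_forall fun y (hy : 1 < y) => ?_)
        have : (0 : ℝ) < y := by linarith
        positivity

/-- The range is cut at y = K: below, the additional factor y is at most K; above, half of the decay
exp(-Ay) yields exp(-AK/2). -/
theorem bessel_succ_le (p : ℝ) {A : ℝ} (hA : 0 < A) :
    ∃ C ≥ 0, ∀ B ≥ 0, ∀ K ≥ 0,
      bessel (p + 1) A B ≤ K * bessel p A B + C * Real.exp (-(A / 2) * K) := by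
  refine ⟨∫ y in Ioi (1 : ℝ), y ^ (p + 1) * Real.exp (-(A / 2) * y),
    setIntegral_nonneg measurableSet_Ioi fun y (hy : 1 < y) => by positivity,
    fun B hB K hK => ?_⟩
  rw [mul_comm _ (Real.exp _), bessel, bessel, ← integral_const_mul, ← integral_const_mul,
    ← integral_add ((integrableOn_bessel p hA hB).const_mul K)
      ((integrableOn_rpow_mul_exp_neg (p + 1) (half_pos hA)).const_mul _)]
  refine setIntegral_mono_on (integrableOn_bessel (p + 1) hA hB)
    (((integrableOn_bessel p hA hB).const_mul K).add
      ((integrableOn_rpow_mul_exp_neg (p + 1) (half_pos hA)).const_mul _)) measurableSet_Ioi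
    fun y (hy : 1 < y) => ?_
  have hy0 : 0 < y := by linarith
  rcases le_or_gt y K with h | h
  · have : y ^ (p + 1) * Real.exp (-A * y - B / y) ≤
        K * (y ^ p * Real.exp (-A * y - B / y)) := by
      rw [Real.rpow_add hy0, Real.rpow_one]
      calc _ = y * (y ^ p * Real.exp (-A * y - B / y)) := by ring
        _ ≤ _ := by gcongr
    refine this.trans (le_add_of_nonneg_right (by positivity))
  · have : y ^ (p + 1) * Real.exp (-A * y - B / y) ≤
        Real.exp (-(A / 2) * K) * (y ^ (p + 1) * Real.exp (-(A / 2) * y)) := by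
      calc _ ≤ y ^ (p + 1) * (Real.exp (-(A / 2) * K) * Real.exp (-(A / 2) * y)) := by
            rw [← Real.exp_add]
            gcongr
            have : 0 ≤ B / y := by positivity
            nlinarith
        _ = _ := by ring
    refine this.trans (le_add_of_nonneg_left (by positivity))

theorem tendsto_rpow_mul_exp_neg (p : ℝ) {c : ℝ} (hc : 0 < c) :
    Tendsto (fun T : ℝ => T ^ p * Real.exp (-c * T)) atTop (𝓝 0) :=
  tendsto_rpow_mul_exp_neg_mul_atTop_nhds_zero p c hc

/-- If a multiple of a Bessel integral is of smaller exponential order than the Bessel integral,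
the factor vanishes. -/
theorem eq_zero_of_mul_bessel_le {A B : ℝ} (hA : 0 < A) (hB : 0 < B) {p x : ℝ} (hx : 0 ≤ x)
    {f : ℝ → ℝ} (hf : ∀ r : ℝ, Tendsto (fun T => T ^ r * (Real.exp (2 * √(A * B) * T) * f T))
      atTop (𝓝 0)) (g : ℝ → ℝ) (hg : Tendsto g atTop (𝓝 0))
    (h : ∀ᶠ T in atTop, x * bessel p A (B * T ^ 2) ≤ g T * bessel p A (B * T ^ 2) + f T) :
    x = 0 := by
  obtain ⟨c, hc, T₀, hT₀, hlow⟩ := le_bessel p hA hB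
  refine le_antisymm ?_ hx
  have hlim : Tendsto (fun T => g T + c⁻¹ * |T ^ |p| * (Real.exp (2 * √(A * B) * T) * f T)|) atTop
      (𝓝 0) := by
    simpa using hg.add ((hf |p|).abs.const_mul c⁻¹)
  refine ge_of_tendsto hlim ?_
  filter_upwards [h, eventually_ge_atTop T₀] with T hT hT1
  have hTpos : 0 < T := lt_of_lt_of_le hT₀ hT1
  have hJ := hlow T hT1
  set J := bessel p A (B * T ^ 2)
  have hJ0 : 0 < J := lt_of_lt_of_le (by positivity) hJ
  -- The lower bound of `le_bessel` rewrites the error as a multiple of the Bessel integral, with a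
  -- factor tending to 0.
  have h1 : f T ≤ c⁻¹ * |T ^ |p| * (Real.exp (2 * √(A * B) * T) * f T)| * J := by
    calc f T ≤ |f T| := le_abs_self _
      _ = c⁻¹ * |T ^ |p| * (Real.exp (2 * √(A * B) * T) * f T)| *
          (c * T ^ (-|p|) * Real.exp (-(2 * √(A * B)) * T)) := by
        rw [abs_mul, abs_mul, abs_of_pos (Real.exp_pos _), abs_of_pos (Real.rpow_pos_of_pos hTpos _),
          Real.rpow_neg hTpos.le, neg_mul, Real.exp_neg]
        have := (Real.rpow_pos_of_pos hTpos |p|).ne'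
        field_simp
      _ ≤ _ := by gcongr
  have h2 : x * J ≤ (g T + c⁻¹ * |T ^ |p| * (Real.exp (2 * √(A * B) * T) * f T)|) * J := by
    rw [add_mul]; linarith
  exact le_of_mul_le_mul_right h2 hJ0

theorem tendsto_mul_exp_of_lt {α β : ℝ} (h : α < β) (C r s : ℝ) :
    Tendsto (fun T : ℝ => T ^ r * (Real.exp (α * T) * (C * T ^ s * Real.exp (-β * T))))
      atTop (𝓝 0) := by
  have := (tendsto_rpow_mul_exp_neg (r + s) (sub_pos.mpr h)).const_mul C
  rw [mul_zero] at this
  refine this.congr' ?_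
  filter_upwards [eventually_gt_atTop 0] with T hT
  rw [Real.rpow_add hT, show -(β - α) * T = α * T + -β * T by ring, Real.exp_add]
  ring

/-- The critical point is proportional to T, so raising the power of y by one costs a factor of
order T, while the first integral carries T². Hence C₂ must vanish first, and then C₁. -/
theorem two_bessel_coeffs_eq_zero {A B : ℝ} (hA : 0 < A) (hB : 0 < B) (s : ℝ) (C₁ C₂ : ℂ)
    {E β : ℝ} (hβ : 2 * √(A * B) < β)
    (h : ∀ᶠ T : ℝ in atTop,
      ‖C₂ * (T ^ 2 * bessel (s - 2) A (B * T ^ 2) : ℝ) + C₁ * (bessel (s - 1) A (B * T ^ 2) : ℝ)‖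
        ≤ E * T ^ (2 : ℝ) * Real.exp (-β * T)) : C₁ = 0 ∧ C₂ = 0 := by
  obtain ⟨D, hD, hsucc⟩ := bessel_succ_le (s - 2) hA
  rw [show s - 2 + 1 = s - 1 by ring] at hsucc
  -- Cutting at y = KT makes the error exp(-(A/2)KT) equal to exp(-βT).
  set K := 2 * β / A with hK
  have hβ0 : 0 < β := lt_of_le_of_lt (by positivity) hβ
  have hK0 : 0 < K := by positivity
  have hC2 : C₂ = 0 := by
    rw [← norm_eq_zero]
    refine eq_zero_of_mul_bessel_le hA hB (p := s - 2) (norm_nonneg _)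
      (f := fun T => ‖C₁‖ * D * T ^ (-2 : ℝ) * Real.exp (-β * T) + E * T ^ (0 : ℝ) * Real.exp (-β * T))
      (fun r => ?_) (fun T => ‖C₁‖ * K * T⁻¹) ?_ ?_
    · simp_rw [mul_add]
      simpa using (tendsto_mul_exp_of_lt hβ (‖C₁‖ * D) r (-2)).add (tendsto_mul_exp_of_lt hβ E r 0)
    · simpa using tendsto_inv_atTop_zero.const_mul (‖C₁‖ * K)
    · filter_upwards [h, eventually_gt_atTop 0] with T hT hT0
      have hs := hsucc (B * T ^ 2) (by positivity) (K * T) (by positivity)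
      rw [show -(A / 2) * (K * T) = -β * T by rw [hK]; field_simp] at hs
      set J₂ := bessel (s - 2) A (B * T ^ 2)
      set J₁ := bessel (s - 1) A (B * T ^ 2)
      have hJ1 : 0 ≤ J₁ := bessel_nonneg _ _ _
      have hJ2 : 0 ≤ J₂ := bessel_nonneg _ _ _
      have h3 : ‖C₂‖ * (T ^ 2 * J₂) ≤ ‖C₁‖ * J₁ + E * T ^ (2 : ℝ) * Real.exp (-β * T) := by
        have := norm_sub_norm_le (C₂ * (T ^ 2 * J₂ : ℝ)) (-(C₁ * (J₁ : ℝ)))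
        rw [sub_neg_eq_add, norm_neg, norm_mul, norm_mul, norm_real, norm_real,
          Real.norm_of_nonneg hJ1, Real.norm_of_nonneg (by positivity)] at this
        linarith
      have h4 : ‖C₁‖ * J₁ ≤ ‖C₁‖ * (K * T * J₂ + D * Real.exp (-β * T)) := by gcongr
      have h5 : ‖C₂‖ * J₂ * T ^ 2 ≤ (‖C₁‖ * K * T⁻¹ * J₂ + (‖C₁‖ * D * T ^ (-2 : ℝ) * Real.exp (-β * T)
          + E * T ^ (0 : ℝ) * Real.exp (-β * T))) * T ^ 2 := by
        have e1 : T ^ (-2 : ℝ) = (T ^ 2)⁻¹ := by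
          rw [Real.rpow_neg hT0.le]; norm_cast
        have e2 : T ^ (2 : ℝ) = T ^ 2 := by norm_cast
        rw [e1, Real.rpow_zero]
        rw [e2] at h3
        calc _ = ‖C₂‖ * (T ^ 2 * J₂) := by ring
          _ ≤ _ := h3.trans (add_le_add_left h4 _)
          _ = _ := by field_simp; ring
      exact le_of_mul_le_mul_right h5 (by positivity)
  refine ⟨?_, hC2⟩
  rw [← norm_eq_zero]
  refine eq_zero_of_mul_bessel_le hA hB (p := s - 1) (norm_nonneg _)
    (f := fun T => E * T ^ (2 : ℝ) * Real.exp (-β * T))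
    (fun r => tendsto_mul_exp_of_lt hβ E r 2) (fun _ => 0) tendsto_const_nhds ?_
  filter_upwards [h] with T hT
  rw [hC2, zero_mul, zero_add, norm_mul, norm_real, Real.norm_of_nonneg (bessel_nonneg _ _ _)] at hT
  simpa using hT

end
end JacobiLift

/-! ### Series of Bessel integrals and their smallest exponent -/

namespace JacobiLift

noncomputable section

open Complex MeasureTheory Filter Topology Asymptotics Set

theorem exp_neg_le_two_div_sq {x : ℝ} (hx : 0 < x) : Real.exp (-x) ≤ 2 / x ^ 2 := by
  rw [Real.exp_neg, inv_le_comm₀ (Real.exp_pos _) (by positivity), inv_div]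
  have := Real.quadratic_le_exp_of_nonneg hx.le
  linarith

/-- A bound for all non-leading terms with a rate β strictly better than the leading one. The
exponent 4πρy is split: the fraction θ produces the rate β, the fraction 1 - θ produces exp(-ωρ) and
keeps the integral convergent. For κ ≥ 2, half of π(κT)²/y suffices for the rate and the other half
gives κ^(-4). -/
theorem bessel_tail_bound {ρ₁ δ : ℝ} (hρ₁ : 0 < ρ₁) (hδ : 0 < δ) :
    ∃ β > 2 * √(4 * Real.pi * ρ₁ * Real.pi), ∃ ω > 0, ∀ p : ℝ, ∃ K ≥ 0, ∀ ρ ≥ ρ₁, ∀ κ : ℕ, 1 ≤ κ →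
      (2 ≤ κ ∨ ρ₁ + δ ≤ ρ) → ∀ T ≥ 1,
      bessel p (4 * Real.pi * ρ) (Real.pi * (κ * T) ^ 2) ≤
        K * (1 / (κ : ℝ) ^ 4 * Real.exp (-ω * ρ)) * Real.exp (-β * T) := by
  have hπ := Real.pi_pos
  -- The first entry serves κ = 1, where ρ ≥ ρ₁ + δ; the second serves κ ≥ 2.
  set ρ₂ := min (ρ₁ + δ / 2) (3 / 2 * ρ₁) with hρ₂
  have hρ12 : ρ₁ < ρ₂ := lt_min (by linarith) (by linarith)
  have hρ2 : 0 < ρ₂ := hρ₁.trans hρ12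
  -- θ < 1 satisfies θ(ρ₁ + δ) ≥ ρ₁ + δ/2 and 2θρ₁ ≥ 3ρ₁/2, as the two cases require.
  set θ := max ((ρ₁ + δ / 2) / (ρ₁ + δ)) (3 / 4) with hθ
  have hθ1 : θ < 1 := max_lt (by rw [div_lt_one (by positivity)]; linarith) (by norm_num)
  have hθ0 : 3 / 4 ≤ θ := le_max_right _ _
  have hθ2 : ρ₁ + δ / 2 ≤ θ * (ρ₁ + δ) := by
    rw [← div_le_iff₀ (by positivity)]; exact le_max_left _ _
  refine ⟨2 * √(4 * Real.pi * ρ₂ * Real.pi), ?_, 2 * Real.pi * (1 - θ),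
    mul_pos (by positivity) (by linarith), fun p => ?_⟩
  · gcongr
  set β := 2 * √(4 * Real.pi * ρ₂ * Real.pi) with hβ
  set A' := 2 * Real.pi * (1 - θ) * ρ₁ with hA'
  have hA'0 : 0 < A' := mul_pos (mul_pos (by positivity) (by linarith)) hρ₁
  refine ⟨∫ y in Ioi (1 : ℝ), y ^ (p + 2) * Real.exp (-A' * y),
    setIntegral_nonneg measurableSet_Ioi fun y (hy : 1 < y) => by positivity,
    fun ρ hρ κ hκ hor T hT => ?_⟩
  have hρ0 : 0 < ρ := lt_of_lt_of_le hρ₁ hρ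
  have hκ0 : (1 : ℝ) ≤ κ := by exact_mod_cast hκ
  have key : ∀ y : ℝ, 1 < y → Real.exp (-(4 * Real.pi * θ * ρ) * y - Real.pi * (κ * T) ^ 2 / y) ≤
      y ^ 2 * (1 / (κ : ℝ) ^ 4) * Real.exp (-β * T) := by
    intro y hy
    have hy0 : 0 < y := by linarith
    have hsq : ∀ x : ℝ, √(4 * Real.pi * x * (Real.pi * T ^ 2)) =
        √(4 * Real.pi * x * Real.pi) * T := by
      intro x
      rw [← mul_assoc, Real.sqrt_mul' _ (by positivity), Real.sqrt_sq (by linarith)]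
    rcases Nat.lt_or_ge κ 2 with h2 | h2
    · have hκ1 : κ = 1 := by omega
      have hρδ : ρ₁ + δ ≤ ρ := by rcases hor with h | h <;> [omega; exact h]
      have h3 : ρ₂ ≤ θ * ρ := by
        calc ρ₂ ≤ ρ₁ + δ / 2 := min_le_left _ _
          _ ≤ θ * (ρ₁ + δ) := hθ2
          _ ≤ θ * ρ := by gcongr
      have h4 := two_mul_sqrt_le (A := 4 * Real.pi * ρ₂) (B := Real.pi * T ^ 2) (by positivity)
        (by positivity) hy0
      rw [hsq] at h4
      subst hκ1
      have h5 : (1 : ℝ) ≤ y ^ 2 := one_le_pow₀ hy.le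
      calc _ ≤ Real.exp (-β * T) := by
            apply Real.exp_le_exp.mpr
            rw [hβ]
            have : 4 * Real.pi * ρ₂ * y ≤ 4 * Real.pi * θ * ρ * y := by
              rw [mul_assoc (4 * Real.pi) θ ρ]; gcongr
            push_cast
            rw [one_mul]
            linarith
        _ ≤ _ := by
            push_cast
            nlinarith [Real.exp_pos (-β * T)]
    · have h2' : (2 : ℝ) ≤ κ := by exact_mod_cast h2
      have h3 : ρ₂ ≤ 2 * (θ * ρ) := by
        calc ρ₂ ≤ 3 / 2 * ρ₁ := min_le_right _ _
          _ = 2 * (3 / 4 * ρ₁) := by ring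
          _ ≤ 2 * (θ * ρ) := by gcongr
      have h4 := two_mul_sqrt_le (A := 4 * Real.pi * (θ * ρ)) (B := 2 * Real.pi * T ^ 2)
        (by positivity) (by positivity) hy0
      have h5 : β * T ≤ 4 * Real.pi * (θ * ρ) * y + 2 * Real.pi * T ^ 2 / y := by
        refine le_trans ?_ h4
        rw [hβ, show 4 * Real.pi * (θ * ρ) * (2 * Real.pi * T ^ 2) =
          4 * Real.pi * (2 * (θ * ρ)) * (Real.pi * T ^ 2) by ring, hsq, mul_assoc]
        gcongr
      -- Half of the exponent: exp(-x) ≤ 2/x² gives κ^(-4) at the price of y².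
      set x := Real.pi * (κ * T) ^ 2 / (2 * y) with hx
      have hx0 : 0 < x := by positivity
      have h6 := exp_neg_le_two_div_sq hx0
      have h7 : 2 / x ^ 2 ≤ y ^ 2 * (1 / (κ : ℝ) ^ 4) := by
        have hT4 : 1 ≤ T ^ 4 := one_le_pow₀ hT
        rw [hx, div_pow, div_div_eq_mul_div, mul_one_div, div_le_div_iff₀ (by positivity) (by positivity)]
        have hpi : (8 : ℝ) ≤ Real.pi ^ 2 := by nlinarith [Real.pi_gt_three]
        have : 8 * (y ^ 2 * κ ^ 4) ≤ Real.pi ^ 2 * T ^ 4 * (y ^ 2 * κ ^ 4) := by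
          gcongr
          nlinarith
        nlinarith
      calc _ ≤ Real.exp (-x + -β * T) := by
            apply Real.exp_le_exp.mpr
            have h8 : Real.pi * (κ * T) ^ 2 / y = x + x := by rw [hx]; field_simp; ring
            have h9 : 2 * Real.pi * T ^ 2 / y ≤ x := by
              rw [hx, div_le_div_iff₀ hy0 (by positivity)]
              have : (4 : ℝ) ≤ κ ^ 2 := by nlinarith
              have : 4 * (Real.pi * T ^ 2 * y) ≤ κ ^ 2 * (Real.pi * T ^ 2 * y) := by gcongr
              nlinarith
            rw [h8]; linarith
        _ ≤ _ := by
            rw [Real.exp_add]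
            gcongr
            exact h6.trans h7
  refine (bessel_le_of_le (p' := p + 2)
    (C := 1 / (κ : ℝ) ^ 4 * Real.exp (-(2 * Real.pi * (1 - θ)) * ρ) * Real.exp (-β * T)) (by positivity) (by positivity) hA'0 fun y hy => ?_).trans_eq (by ring)
  have hy0 : 0 < y := by linarith
  calc _ = y ^ p * (Real.exp (-(4 * Real.pi * θ * ρ) * y - Real.pi * (κ * T) ^ 2 / y) *
        Real.exp (-(4 * Real.pi * (1 - θ) * ρ) * y)) := by
        rw [← Real.exp_add]; ring_nf
    _ ≤ y ^ p * (y ^ 2 * (1 / (κ : ℝ) ^ 4) * Real.exp (-β * T) *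
        (Real.exp (-(2 * Real.pi * (1 - θ)) * ρ) * Real.exp (-A' * y))) := by
        gcongr
        · exact key y hy
        · rw [← Real.exp_add]
          apply Real.exp_le_exp.mpr
          have hc : 0 < 2 * Real.pi * (1 - θ) := mul_pos (by positivity) (by linarith)
          have h1 : A' * y ≤ 2 * Real.pi * (1 - θ) * ρ * y := by rw [hA']; gcongr
          have h2 : 2 * Real.pi * (1 - θ) * ρ * 1 ≤ 2 * Real.pi * (1 - θ) * ρ * y := by gcongr
          linarith
    _ = _ := by
        rw [Real.rpow_add hy0, Real.rpow_two]; ring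

theorem tendsto_pow_mul_exp_sq {ε β C : ℝ} (hε : 0 < ε) :
    ∀ᶠ T : ℝ in atTop, C * Real.exp (-ε * T ^ 2) ≤ |C| * T ^ (2 : ℝ) * Real.exp (-β * T) := by
  filter_upwards [eventually_ge_atTop (|β| / ε), eventually_ge_atTop 1] with T hT hT1
  rw [div_le_iff₀ hε] at hT
  have h1 : (1 : ℝ) ≤ T ^ (2 : ℝ) := Real.one_le_rpow hT1 (by norm_num)
  have h2 : Real.exp (-ε * T ^ 2) ≤ Real.exp (-β * T) := by
    apply Real.exp_le_exp.mpr
    have : β * T ≤ T * ε * T := by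
      gcongr
      exact (le_abs_self β).trans hT
    linarith
  calc C * Real.exp (-ε * T ^ 2) ≤ |C| * 1 * Real.exp (-β * T) := by
        rw [mul_one]; gcongr; exact le_abs_self C
    _ ≤ _ := by gcongr

/-- The term with coefficients `A₁`, `A₂`, exponent `ρ` and frequency `κ` in a series of Bessel
integrals. -/
def besselTerm (s : ℝ) (A₁ A₂ : ℂ) (ρ : ℝ) (κ : ℕ) (T : ℝ) : ℂ :=
  A₂ * ((κ * T) ^ 2 * bessel (s - 2) (4 * Real.pi * ρ) (Real.pi * (κ * T) ^ 2) : ℝ) +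
    A₁ * (κ * bessel (s - 1) (4 * Real.pi * ρ) (Real.pi * (κ * T) ^ 2) : ℝ)

/-- Growth exp(ωρ/2) of the coefficients loses against exp(-ωρ), and κ^(-4) pays for the factor
(κT)² up to T²κ^(-2). The estimate κ ≤ (κT)² lets both summands share one bound. -/
theorem norm_besselTerm_le {s : ℝ} {A₁ A₂ : ℂ} {ρ ω B K₁ K₂ E T : ℝ} {κ : ℕ} (hκ : 1 ≤ κ)
    (hT : 1 ≤ T)
    (b₁ : bessel (s - 1) (4 * Real.pi * ρ) (Real.pi * (κ * T) ^ 2) ≤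
      K₁ * (1 / (κ : ℝ) ^ 4 * Real.exp (-ω * ρ)) * E)
    (b₂ : bessel (s - 2) (4 * Real.pi * ρ) (Real.pi * (κ * T) ^ 2) ≤
      K₂ * (1 / (κ : ℝ) ^ 4 * Real.exp (-ω * ρ)) * E)
    (a₁ : ‖A₁‖ ≤ B * Real.exp (ω / 2 * ρ)) (a₂ : ‖A₂‖ ≤ B * Real.exp (ω / 2 * ρ)) :
    ‖besselTerm s A₁ A₂ ρ κ T‖ ≤
      |B| * (K₁ + K₂) * (Real.exp (-(ω / 2) * ρ) * (1 / (κ : ℝ) ^ 2)) * (T ^ 2 * E) := by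
  have hκ1 : (1 : ℝ) ≤ κ := by exact_mod_cast hκ
  have hκ0 : (0 : ℝ) < κ := by linarith
  have hT2 : (1 : ℝ) ≤ T ^ 2 := one_le_pow₀ hT
  have n1 := bessel_nonneg (s - 1) (4 * Real.pi * ρ) (Real.pi * (κ * T) ^ 2)
  have n2 := bessel_nonneg (s - 2) (4 * Real.pi * ρ) (Real.pi * (κ * T) ^ 2)
  have hexp : Real.exp (ω / 2 * ρ) * Real.exp (-ω * ρ) = Real.exp (-(ω / 2) * ρ) := by
    rw [← Real.exp_add]; ring_nf
  have a1' : ‖A₁‖ ≤ |B| * Real.exp (ω / 2 * ρ) := a₁.trans (by gcongr; exact le_abs_self B)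
  have a2' : ‖A₂‖ ≤ |B| * Real.exp (ω / 2 * ρ) := a₂.trans (by gcongr; exact le_abs_self B)
  have hκT : (κ : ℝ) ≤ (κ * T) ^ 2 := by
    rw [mul_pow]; nlinarith
  unfold besselTerm
  generalize bessel (s - 1) (4 * Real.pi * ρ) (Real.pi * (κ * T) ^ 2) = J₁ at *
  generalize bessel (s - 2) (4 * Real.pi * ρ) (Real.pi * (κ * T) ^ 2) = J₂ at *
  have m2 : ‖A₂‖ * ((κ * T) ^ 2 * J₂) ≤ |B| * Real.exp (ω / 2 * ρ) * ((κ * T) ^ 2 *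
      (K₂ * (1 / (κ : ℝ) ^ 4 * Real.exp (-ω * ρ)) * E)) := by gcongr
  have m1 : ‖A₁‖ * (κ * J₁) ≤ |B| * Real.exp (ω / 2 * ρ) * ((κ * T) ^ 2 *
      (K₁ * (1 / (κ : ℝ) ^ 4 * Real.exp (-ω * ρ)) * E)) := by gcongr
  calc _ ≤ ‖A₂‖ * ((κ * T) ^ 2 * J₂) + ‖A₁‖ * (κ * J₁) := by
        refine (norm_add_le _ _).trans ?_
        rw [norm_mul, norm_mul, norm_real, norm_real, Real.norm_of_nonneg (by positivity),
          Real.norm_of_nonneg (by positivity)]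
    _ ≤ _ := add_le_add m2 m1
    _ = |B| * (K₁ + K₂) * (Real.exp (ω / 2 * ρ) * Real.exp (-ω * ρ) * (1 / (κ : ℝ) ^ 2)) *
          (T ^ 2 * E) := by field_simp; ring
    _ = _ := by rw [hexp]

/-- If a series of Bessel integrals is of order `exp(-εT²)`, the coefficients belonging to the
smallest exponent cancel. -/
theorem leading_bessel_coeffs_eq_zero {ι : Type*} (ρ : ι → ℝ) {ρ₁ δ : ℝ} (hρ₁ : 0 < ρ₁)
    (hδ : 0 < δ) (S : Finset ι) (hS : ∀ i ∈ S, ρ i = ρ₁) (A₁ A₂ : ι → ℕ → ℂ)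
    (hgap : ∀ i ∉ S, ρ₁ + δ ≤ ρ i ∨ ∀ k, A₁ i k = 0 ∧ A₂ i k = 0)
    (hsum : ∀ ε > 0, Summable fun i => Real.exp (-ε * ρ i))
    (hA : ∀ ε > 0, ∃ B, ∀ i k, ‖A₁ i k‖ ≤ B * Real.exp (ε * ρ i) ∧ ‖A₂ i k‖ ≤ B * Real.exp (ε * ρ i))
    (s : ℝ) {C ε : ℝ} (hε : 0 < ε)
    (h : ∀ᶠ T : ℝ in atTop, ‖∑' x : ι × ℕ,
      besselTerm s (A₁ x.1 x.2) (A₂ x.1 x.2) (ρ x.1) (x.2 + 1) T‖ ≤ C * Real.exp (-ε * T ^ 2)) :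
    ∑ i ∈ S, A₁ i 0 = 0 ∧ ∑ i ∈ S, A₂ i 0 = 0 := by
  classical
  obtain ⟨β, hβ, ω, hω, hb⟩ := bessel_tail_bound hρ₁ hδ
  obtain ⟨K₂, hK₂0, hK₂⟩ := hb (s - 2)
  obtain ⟨K₁, hK₁0, hK₁⟩ := hb (s - 1)
  obtain ⟨B, hB⟩ := hA (ω / 2) (by positivity)
  let g : ι × ℕ → ℝ := fun x => |B| * (K₁ + K₂) *
    (Real.exp (-(ω / 2) * ρ x.1) * (1 / ((x.2 + 1 : ℕ) : ℝ) ^ 2))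
  have hg0 : ∀ x, 0 ≤ g x := fun x => by positivity
  have hgsum : Summable g := by
    have h2 : Summable fun k : ℕ => 1 / ((k + 1 : ℕ) : ℝ) ^ 2 :=
      (summable_nat_add_iff 1).mpr (Real.summable_one_div_nat_pow.mpr one_lt_two)
    exact ((hsum (ω / 2) (by positivity)).mul_of_nonneg h2 (fun i => (Real.exp_pos _).le)
      (fun k => by positivity)).mul_left _
  let f : ℝ → ι × ℕ → ℂ := fun T x =>
    besselTerm s (A₁ x.1 x.2) (A₂ x.1 x.2) (ρ x.1) (x.2 + 1) T
  -- The second index k stands for the frequency k + 1, so k = 0 is the lowest frequency.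
  let S' : Finset (ι × ℕ) := S ×ˢ {0}
  have hbound : ∀ T ≥ 1, ∀ x ∉ S', ‖f T x‖ ≤ g x * (T ^ 2 * Real.exp (-β * T)) := by
    rintro T hT ⟨i, k⟩ hx
    have hcase : (ρ₁ ≤ ρ i ∧ (2 ≤ k + 1 ∨ ρ₁ + δ ≤ ρ i)) ∨ (A₁ i k = 0 ∧ A₂ i k = 0) := by
      by_cases hi : i ∈ S
      · left
        refine ⟨(hS i hi).ge, Or.inl ?_⟩
        have : k ≠ 0 := by rintro rfl; exact hx (by simp [S', hi])
        omega
      · rcases hgap i hi with h | h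
        · exact Or.inl ⟨by linarith, Or.inr h⟩
        · exact Or.inr (h k)
    rcases hcase with ⟨h1, h2⟩ | ⟨h1, h2⟩
    · exact norm_besselTerm_le (by omega) hT
        (hK₁ (ρ i) h1 (k + 1) (by omega) h2 T hT) (hK₂ (ρ i) h1 (k + 1) (by omega) h2 T hT)
        (hB i k).1 (hB i k).2
    · have : f T (i, k) = 0 := by simp [f, besselTerm, h1, h2]
      rw [this, norm_zero]
      exact mul_nonneg (hg0 _) (by positivity)
  -- All leading terms share the exponent ρ₁ and the frequency 1, so they collapse to two Bessel
  -- integrals, to which `two_bessel_coeffs_eq_zero` applies.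
  have hlead : ∀ T : ℝ, ∑ x ∈ S', f T x =
      (∑ i ∈ S, A₂ i 0) * (T ^ 2 * bessel (s - 2) (4 * Real.pi * ρ₁) (Real.pi * T ^ 2) : ℝ) +
      (∑ i ∈ S, A₁ i 0) * (bessel (s - 1) (4 * Real.pi * ρ₁) (Real.pi * T ^ 2) : ℝ) := by
    intro T
    rw [Finset.sum_product, Finset.sum_mul, Finset.sum_mul, ← Finset.sum_add_distrib]
    refine Finset.sum_congr rfl fun i hi => ?_
    simp [f, besselTerm, hS i hi]
  refine two_bessel_coeffs_eq_zero (A := 4 * Real.pi * ρ₁) (B := Real.pi) (by positivity)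
    Real.pi_pos s _ _ (E := |C| + ∑' x, g x) (β := β) hβ ?_
  filter_upwards [h, eventually_ge_atTop 1, tendsto_pow_mul_exp_sq (β := β) (C := C) hε]
    with T hT hT1 hTC
  rw [← hlead T]
  rw [Real.rpow_two] at hTC ⊢
  have hs : Summable fun x => g x * (T ^ 2 * Real.exp (-β * T)) := hgsum.mul_right _
  have hsumf : Summable (f T) := by
    refine Summable.of_norm_bounded_eventually (E := ℂ) hs ?_
    filter_upwards [S'.finite_toSet.compl_mem_cofinite] with x hx
    exact hbound T hT1 x hx
  have hdec := hsumf.sum_add_tsum_subtype_compl S'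
  have htail : ‖∑' x : {x // x ∉ S'}, f T x‖ ≤ (∑' x, g x) * (T ^ 2 * Real.exp (-β * T)) := by
    rw [← tsum_mul_right]
    refine (tsum_of_norm_bounded (hs.subtype {x | x ∉ S'}).hasSum
      fun x => hbound T hT1 x.1 x.2).trans ?_
    exact hs.tsum_subtype_le _ _ (fun x => mul_nonneg (hg0 x) (by positivity))
  rw [eq_sub_of_add_eq hdec]
  calc _ ≤ ‖∑' x, f T x‖ + ‖∑' x : {x // x ∉ S'}, f T x‖ := norm_sub_le _ _
    _ ≤ |C| * T ^ 2 * Real.exp (-β * T) +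
        (∑' x, g x) * (T ^ 2 * Real.exp (-β * T)) := add_le_add (hT.trans hTC) htail
    _ = _ := by ring

end
end JacobiLift

namespace JacobiLift

noncomputable section

open Complex MeasureTheory Filter Topology Asymptotics Set

/-! ### Bilinear algebra -/

section Bil
variable {n : ℕ}

theorem bil_comm (x y : V n) : bil x y = bil y x := by
  unfold bil; exact Finset.sum_congr rfl fun i _ => by ring

theorem bil_smul_left (c : ℝ) (x y : V n) : bil (c • x) y = c * bil x y := by
  unfold bil; rw [Finset.mul_sum]; exact Finset.sum_congr rfl fun i _ => by simp; ring

theorem bil_smul_right (c : ℝ) (x y : V n) : bil x (c • y) = c * bil x y := by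
  rw [bil_comm, bil_smul_left, bil_comm]

theorem bil_zero_left (x : V n) : bil 0 x = 0 := by simp [bil]

theorem bil_zero_right (x : V n) : bil x 0 = 0 := by simp [bil]

theorem bil_sub_left (x y z : V n) : bil (x - y) z = bil x z - bil y z := by
  rw [sub_eq_add_neg, bil_add_left, bil_neg_left, sub_eq_add_neg]

theorem bil_sub_right (x y z : V n) : bil x (y - z) = bil x y - bil x z := by
  rw [sub_eq_add_neg, bil_add_right, bil_neg_right, sub_eq_add_neg]

theorem bil_zsmul_left (c : ℤ) (x y : V n) : bil (c • x) y = c * bil x y := by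
  rw [← Int.cast_smul_eq_zsmul ℝ, bil_smul_left]

theorem bil_nsmul_left (c : ℕ) (x y : V n) : bil (c • x) y = c * bil x y := by
  rw [← Nat.cast_smul_eq_nsmul ℝ, bil_smul_left]

theorem bil_sum_left {ι : Type*} (s : Finset ι) (f : ι → V n) (y : V n) :
    bil (∑ i ∈ s, f i) y = ∑ i ∈ s, bil (f i) y :=
  map_sum (AddMonoidHom.mk' (fun x => bil x y) fun a b => bil_add_left a b y) f s

theorem bil_sum_right {ι : Type*} (s : Finset ι) (f : ι → V n) (y : V n) :
    bil y (∑ i ∈ s, f i) = ∑ i ∈ s, bil y (f i) := by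
  simp_rw [bil_comm y]; exact bil_sum_left s f y

theorem q_add (x y : V n) : q (x + y) = q x + bil x y + q y := by
  unfold q; rw [bil_add_left, bil_add_right, bil_add_right, bil_comm y x]; ring

theorem q_smul (c : ℝ) (x : V n) : q (c • x) = c ^ 2 * q x := by
  unfold q; rw [bil_smul_left, bil_smul_right]; ring

theorem q_neg (x : V n) : q (-x) = q x := by
  unfold q; rw [bil_neg_left, bil_neg_right]; ring

theorem bil_self (x : V n) : bil x x = 2 * q x := by unfold q; ring

theorem bil_single_left (i : Fin (n + 4)) (x : V n) : bil (Pi.single i 1) x = sgn i * x i := by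
  unfold bil
  rw [Finset.sum_eq_single i] <;> simp +contextual

theorem bil_eP_right (i : Fin n) (x : V n) : bil x (eP i) = x (Fin.castAdd 4 i) := by
  rw [bil_comm, eP, bil_single_left, sgn, if_pos (by simp; omega), one_mul]

theorem bil_eU_right (j : Fin 4) (x : V n) :
    bil x (eU j) = (if (j : ℕ) < 2 then 1 else -1) * x (Fin.natAdd n j) := by
  rw [bil_comm, eU, bil_single_left, sgn]; simp

theorem bil_uTilde_right (x : V n) :
    bil x (uTilde n) = (x (Fin.natAdd n 0) - x (Fin.natAdd n 2)) / √2 := by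
  rw [uTilde, bil_smul_right, bil_add_right, bil_eU_right, bil_eU_right]; simp; ring

theorem bil_uTilde'_right (x : V n) :
    bil x (uTilde' n) = (x (Fin.natAdd n 0) + x (Fin.natAdd n 2)) / √2 := by
  rw [uTilde', bil_smul_right, bil_sub_right, bil_eU_right, bil_eU_right]; simp; ring

theorem eU_apply (j k : Fin 4) : (eU j : V n) (Fin.natAdd n k) = if k = j then 1 else 0 := by
  unfold eU; rw [Pi.single_apply]; simp

theorem uTilde_apply (k : Fin 4) :
    uTilde n (Fin.natAdd n k) = if k = 0 ∨ k = 2 then 1 / √2 else 0 := by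
  simp only [uTilde, Pi.smul_apply, Pi.add_apply, eU_apply]
  fin_cases k <;> simp

theorem uTilde'_apply (k : Fin 4) :
    uTilde' n (Fin.natAdd n k) = if k = 0 then 1 / √2 else if k = 2 then -(1 / √2) else 0 := by
  simp only [uTilde', Pi.smul_apply, Pi.sub_apply, eU_apply]
  fin_cases k <;> simp

theorem bil_uTilde_uTilde : bil (uTilde n) (uTilde n) = 0 := by
  rw [bil_uTilde_right, uTilde_apply, uTilde_apply]; simp

theorem bil_uTilde'_uTilde' : bil (uTilde' n) (uTilde' n) = 0 := by
  rw [bil_uTilde'_right, uTilde'_apply, uTilde'_apply]; simp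

theorem bil_uTilde_uTilde' : bil (uTilde n) (uTilde' n) = 1 := by
  rw [bil_uTilde'_right, uTilde_apply, uTilde_apply]
  simp
  field_simp
  rw [Real.sq_sqrt (by norm_num)]; norm_num

theorem uTilde_apply_of_lt (i : Fin (n + 4)) (h : (i : ℕ) < n) : uTilde n i = 0 := by
  simp [uTilde, eU_apply_of_lt _ i h]

theorem uTilde'_apply_of_lt (i : Fin (n + 4)) (h : (i : ℕ) < n) : uTilde' n i = 0 := by
  simp [uTilde', eU_apply_of_lt _ i h]

/-- The real span of `L⁺`. -/
def IsPos (x : V n) : Prop := ∀ i : Fin (n + 4), n ≤ (i : ℕ) → x i = 0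

theorem IsPos.add {x y : V n} (hx : IsPos x) (hy : IsPos y) : IsPos (x + y) := fun i hi => by
  simp [hx i hi, hy i hi]

theorem IsPos.smul {x : V n} (c : ℝ) (hx : IsPos x) : IsPos (c • x) := fun i hi => by
  simp [hx i hi]

theorem IsPos.sub {x y : V n} (hx : IsPos x) (hy : IsPos y) : IsPos (x - y) := fun i hi => by
  simp [hx i hi, hy i hi]

theorem IsPos.bil_uTilde {x : V n} (hx : IsPos x) : bil x (uTilde n) = 0 :=
  bil_pos_hyp x _ hx uTilde_apply_of_lt

theorem IsPos.bil_uTilde' {x : V n} (hx : IsPos x) : bil x (uTilde' n) = 0 :=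
  bil_pos_hyp x _ hx uTilde'_apply_of_lt

theorem IsPos.bil_eq {x : V n} (hx : IsPos x) (y : V n) :
    bil x y = ∑ i : Fin n, x (Fin.castAdd 4 i) * y (Fin.castAdd 4 i) := by
  unfold bil
  rw [Fin.sum_univ_add, Finset.sum_eq_zero (s := (Finset.univ : Finset (Fin 4))), add_zero]
  · refine Finset.sum_congr rfl fun i _ => ?_
    rw [sgn, if_pos (by simp; omega), one_mul]
  · intro j _
    rw [hx _ (by simp)]; ring

theorem IsPos.q_nonneg {x : V n} (hx : IsPos x) : 0 ≤ q x := by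
  rw [q, hx.bil_eq]
  exact div_nonneg (Finset.sum_nonneg fun i _ => mul_self_nonneg _) zero_le_two

theorem IsPos.eq_zero_of_q {x : V n} (hx : IsPos x) (h : q x = 0) : x = 0 := by
  rw [q, hx.bil_eq, div_eq_zero_iff, or_iff_left two_ne_zero,
    Finset.sum_eq_zero_iff_of_nonneg fun i _ => mul_self_nonneg _] at h
  funext i
  rcases lt_or_ge (i : ℕ) n with hi | hi
  · have := mul_self_eq_zero.mp (h ⟨i, hi⟩ (Finset.mem_univ _))
    simpa using this
  · simpa using hx i hi

theorem IsPos.bil_sq_le {x y : V n} (hx : IsPos x) (hy : IsPos y) :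
    bil x y ^ 2 ≤ 4 * q x * q y := by
  rw [q, q, hx.bil_eq, hx.bil_eq, hy.bil_eq]
  have := Finset.sum_mul_sq_le_sq_mul_sq Finset.univ (fun i : Fin n => x (Fin.castAdd 4 i))
    (fun i => y (Fin.castAdd 4 i))
  simp only [pow_two] at this ⊢
  linarith

end Bil

/-! ### The lattices -/

section Lattice
variable {n : ℕ} {Λ : Submodule ℤ (EuclideanSpace ℝ (Fin n))}

theorem isPos_embedPos (x : EuclideanSpace ℝ (Fin n)) : IsPos (embedPos n x) := fun i hi => by
  simp [embedPos, not_lt.mpr hi]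

theorem isPos_of_mem_span {x : V n} (hx : x ∈ Submodule.span ℝ (posLattice Λ : Set (V n))) :
    IsPos x := by
  intro i hi
  refine Submodule.span_induction (p := fun y _ => y i = 0) ?_ rfl ?_ ?_ hx
  · rintro y ⟨z, -, rfl⟩
    exact isPos_embedPos z i hi
  · intro y z _ _ hy hz
    simp [hy, hz]
  · intro c y _ hy
    simp [hy]

theorem isPos_dual (x : dualLattice (posLattice Λ)) : IsPos (x : V n) := isPos_of_mem_span x.2.1

theorem isPos_of_mem_posLattice {x : V n} (hx : x ∈ posLattice Λ) : IsPos x :=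
  isPos_of_mem_span (Submodule.subset_span hx)

theorem embedPos_castAdd (x : EuclideanSpace ℝ (Fin n)) (i : Fin n) :
    embedPos n x (Fin.castAdd 4 i) = x i := by simp [embedPos]

theorem bil_embedPos (x y : EuclideanSpace ℝ (Fin n)) :
    bil (embedPos n x) (embedPos n y) = inner ℝ x y := by
  rw [(isPos_embedPos x).bil_eq]
  simp only [embedPos_castAdd, PiLp.inner_apply, RCLike.inner_apply, conj_trivial]
  exact Finset.sum_congr rfl fun i _ => mul_comm _ _

theorem IsPos.exists_embedPos {x : V n} (hx : IsPos x) : ∃ y, embedPos n y = x := by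
  refine ⟨WithLp.toLp 2 fun i => x (Fin.castAdd 4 i), funext fun i => ?_⟩
  rcases lt_or_ge (i : ℕ) n with h | h
  · simp [embedPos, h]
  · simp [embedPos, not_lt.mpr h, hx i h]

theorem embedPos_smul (c : ℝ) (x : EuclideanSpace ℝ (Fin n)) :
    embedPos n (c • x) = c • embedPos n x := by
  funext i
  by_cases h : (i : ℕ) < n <;> simp [embedPos, h]

/-- A basis of `L⁺` together with the dual basis of `L⁺'`. -/
theorem exists_dual_bases (Λ : Submodule ℤ (EuclideanSpace ℝ (Fin n))) [DiscreteTopology Λ]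
    [IsZLattice ℝ Λ] :
    ∃ B B' : Fin n → V n, (∀ i, B i ∈ posLattice Λ) ∧ (∀ i, B' i ∈ dualLattice (posLattice Λ)) ∧
      (∀ i j, bil (B i) (B' j) = if i = j then 1 else 0) ∧
      (∀ x, IsPos x → x = ∑ i, bil x (B' i) • B i) ∧ ∀ x, IsPos x → x = ∑ i, bil x (B i) • B' i := by
  classical
  have := ZLattice.module_finite ℝ Λ
  have := ZLattice.module_free ℝ Λ
  have hrank : Module.finrank ℤ Λ = n := by
    rw [ZLattice.rank ℝ Λ, finrank_euclideanSpace_fin]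
  let b := (Module.finBasisOfFinrankEq ℤ Λ hrank).ofZLatticeBasis ℝ Λ
  have hb : ∀ i, b i ∈ Λ := fun i => by simp [b]
  have hspan : Submodule.span ℤ (Set.range b) = Λ := Module.Basis.ofZLatticeBasis_span ℝ Λ _
  let F : LinearMap.BilinForm ℝ (EuclideanSpace ℝ (Fin n)) := innerₗ _
  have hFsymm : F.IsSymm := ⟨fun x y => (real_inner_comm y x :)⟩
  have hF : F.Nondegenerate := by
    exact ⟨fun x hx => inner_self_eq_zero.mp (hx x), fun x hx => inner_self_eq_zero.mp (hx x)⟩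
  let b' := F.dualBasis hF b
  have h1 : ∀ x, x = ∑ i, (inner ℝ x (b i) : ℝ) • b' i := fun x => by
    conv_lhs => rw [← b'.sum_repr x]
    refine Finset.sum_congr rfl fun i _ => ?_
    rw [LinearMap.BilinForm.dualBasis_repr_apply]; rfl
  have h2 : ∀ x, x = ∑ i, (inner ℝ x (b' i) : ℝ) • b i := fun x => by
    conv_lhs => rw [← b.sum_repr x]
    refine Finset.sum_congr rfl fun i _ => ?_
    congr 1
    have : ∀ j, (inner ℝ (b j) (b' i) : ℝ) = if j = i then 1 else 0 := fun j => by
      have := LinearMap.BilinForm.apply_dualBasis_right hF hFsymm b j i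
      exact this
    conv_rhs => rw [← b.sum_repr x, sum_inner]
    simp [inner_smul_left, this]
  refine ⟨fun i => embedPos n (b i), fun i => embedPos n (b' i), fun i => ⟨b i, hb i, rfl⟩,
    fun i => ⟨?_, ?_⟩, fun i j => ?_, ?_, ?_⟩
  · show embedPos n (b' i) ∈ _
    rw [h2 (b' i), map_sum]
    refine Submodule.sum_mem _ fun j _ => ?_
    rw [embedPos_smul]
    exact Submodule.smul_mem _ _ (Submodule.subset_span ⟨b j, hb j, rfl⟩)
  · rintro _ ⟨y, hy, rfl⟩
    have hy' : y ∈ Submodule.span ℤ (Set.range b) := by rw [hspan]; exact hy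
    obtain ⟨c, rfl⟩ := (Submodule.mem_span_range_iff_exists_fun ℤ).mp hy'
    refine ⟨c i, ?_⟩
    rw [bil_embedPos, inner_sum]
    have : ∀ j, (inner ℝ (b' i) (b j) : ℝ) = if j = i then 1 else 0 := fun j =>
      LinearMap.BilinForm.apply_dualBasis_left hF b i j
    simp_rw [← Int.cast_smul_eq_zsmul ℝ, inner_smul_right, this]
    simp
  · rw [bil_embedPos]
    exact LinearMap.BilinForm.apply_dualBasis_right hF hFsymm b i j
  · intro x hx
    obtain ⟨y, rfl⟩ := hx.exists_embedPos
    conv_lhs => rw [h2 y, map_sum]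
    exact Finset.sum_congr rfl fun i _ => by rw [bil_embedPos, embedPos_smul]
  · intro x hx
    obtain ⟨y, rfl⟩ := hx.exists_embedPos
    conv_lhs => rw [h1 y, map_sum]
    exact Finset.sum_congr rfl fun i _ => by rw [bil_embedPos, embedPos_smul]

/-- L⁺ is the dual of L⁺': pairing with the dual basis reads off the coordinates of x in a basis of
L⁺. -/
theorem mem_posLattice_of_forall_dual [DiscreteTopology Λ] [IsZLattice ℝ Λ] {x : V n} (hx : IsPos x)
    (h : ∀ y ∈ dualLattice (posLattice Λ), ∃ m : ℤ, bil x y = m) : x ∈ posLattice Λ := by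
  obtain ⟨B, B', hB, hB', -, h1, -⟩ := exists_dual_bases Λ
  rw [h1 x hx]
  refine AddSubgroup.sum_mem _ fun i _ => ?_
  obtain ⟨m, hm⟩ := h (B' i) (hB' i)
  rw [hm, Int.cast_smul_eq_zsmul]
  exact AddSubgroup.zsmul_mem _ (hB i) m

theorem exists_int_bil_posLattice (hΛ : ∀ x ∈ Λ, ∃ m : ℤ, inner ℝ x x = 2 * (m : ℝ)) {x : V n}
    (hx : x ∈ posLattice Λ) : ∃ m : ℤ, q x = m := by
  obtain ⟨y, hy, rfl⟩ := hx
  obtain ⟨m, hm⟩ := hΛ y hy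
  exact ⟨m, by rw [q]; erw [bil_embedPos]; rw [hm]; ring⟩

theorem posLattice_le_dual (hΛ : ∀ x ∈ Λ, ∃ m : ℤ, inner ℝ x x = 2 * (m : ℝ)) :
    posLattice Λ ≤ dualLattice (posLattice Λ) := by
  refine fun x hx => ⟨Submodule.subset_span hx, fun y hy => ?_⟩
  obtain ⟨m₁, h₁⟩ := exists_int_bil_posLattice hΛ hx
  obtain ⟨m₂, h₂⟩ := exists_int_bil_posLattice hΛ hy
  obtain ⟨m₃, h₃⟩ := exists_int_bil_posLattice hΛ (AddSubgroup.add_mem _ hx hy)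
  refine ⟨m₃ - m₁ - m₂, ?_⟩
  rw [q_add, h₁, h₂] at h₃
  push_cast; linarith

/-- The discriminant group of `L⁺` has finite exponent. -/
theorem exists_nsmul_mem_posLattice [DiscreteTopology Λ] [IsZLattice ℝ Λ]
    (hΛ : ∀ x ∈ Λ, ∃ m : ℤ, inner ℝ x x = 2 * (m : ℝ)) :
    ∃ E : ℕ, 0 < E ∧ ∀ x ∈ dualLattice (posLattice Λ), E • x ∈ posLattice Λ := by
  obtain ⟨B, B', hB, hB', hdelta, h1, h2⟩ := exists_dual_bases Λ
  have hint : ∀ i j, ∃ m : ℤ, bil (B i) (B j) = m := fun i j =>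
    (posLattice_le_dual hΛ (hB i)).2 _ (hB j)
  choose G hG using hint
  -- A kernel vector of the Gram matrix is the coordinate vector of an element orthogonal to every B
  -- j, and such an element is zero by the expansion in the dual basis.
  have hdet : (Matrix.of G).det ≠ 0 := by
    intro h0
    obtain ⟨v, hv, hGv⟩ := Matrix.exists_mulVec_eq_zero_iff.mpr h0
    have hpos : IsPos (∑ i, (v i : ℝ) • B i) := by
      intro k hk
      rw [Finset.sum_apply]
      exact Finset.sum_eq_zero fun i _ => (isPos_of_mem_posLattice (hB i)).smul _ k hk
    have hz : ∀ j, bil (B j) (∑ i, (v i : ℝ) • B i) = 0 := fun j => by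
      have := congrFun hGv j
      rw [bil_sum_right]
      simp only [bil_smul_right, hG]
      simp only [Matrix.mulVec, dotProduct, Matrix.of_apply, Pi.zero_apply] at this
      rw [← Int.cast_zero (R := ℝ), ← this]
      push_cast
      exact Finset.sum_congr rfl fun i _ => mul_comm _ _
    have hx0 : ∑ i, (v i : ℝ) • B i = 0 := by
      rw [h2 _ hpos]
      exact Finset.sum_eq_zero fun i _ => by rw [bil_comm, hz, zero_smul]
    apply hv
    funext j
    have := congrArg (fun x => bil x (B' j)) hx0
    simp only [bil_sum_left, bil_smul_left, hdelta, bil_zero_left] at this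
    simpa using this
  refine ⟨(Matrix.of G).det.natAbs, Int.natAbs_pos.mpr hdet, fun x hx => ?_⟩
  choose c hc using fun i => hx.2 (B i) (hB i)
  have hxpos := isPos_of_mem_span hx.1
  -- Cramer's rule: the coordinates of x in the basis B solve a system with Gram matrix G and
  -- integral right-hand side c.
  have hvec : ∀ j, ((Matrix.of G).det : ℝ) * bil x (B' j) =
      ((Matrix.vecMul c (Matrix.of G).adjugate j : ℤ) : ℝ) := fun j => by
    have e1 : Matrix.vecMul (fun i => bil x (B' i)) ((Matrix.of G).map (Int.cast : ℤ → ℝ)) =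
        fun i => (c i : ℝ) := by
      funext i
      rw [← hc i]
      conv_rhs => rw [h1 x hxpos, bil_sum_left]
      simp [Matrix.vecMul, dotProduct, bil_smul_left, hG]
    have e2 : Matrix.vecMul (fun i => (c i : ℝ)) ((Matrix.of G).adjugate.map (Int.cast : ℤ → ℝ)) =
        ((Matrix.of G).det : ℝ) • fun i => bil x (B' i) := by
      have h3 : ((Matrix.of G).map (Int.cast : ℤ → ℝ)) *
          ((Matrix.of G).adjugate.map (Int.cast : ℤ → ℝ)) =
          ((Matrix.of G).det : ℝ) • (1 : Matrix (Fin n) (Fin n) ℝ) := by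
        have h4 := congrArg (fun M => M.map (Int.castRingHom ℝ)) (Matrix.mul_adjugate (Matrix.of G))
        simp only [Matrix.map_mul] at h4
        refine h4.trans ?_
        ext i j
        rw [Matrix.map_apply, Matrix.smul_apply, Matrix.smul_apply, Matrix.one_apply,
          Matrix.one_apply]
        split_ifs <;> simp
      rw [← e1, Matrix.vecMul_vecMul, h3, Matrix.vecMul_smul, Matrix.vecMul_one]
    have := congrFun e2 j
    simp only [Pi.smul_apply, smul_eq_mul] at this
    rw [← this]
    simp [Matrix.vecMul, dotProduct]
  have hmem : (Matrix.of G).det • x ∈ posLattice Λ := by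
    rw [← Int.cast_smul_eq_zsmul ℝ]
    conv => enter [2]; rw [h1 x hxpos, Finset.smul_sum]
    refine AddSubgroup.sum_mem _ fun j _ => ?_
    rw [smul_smul, hvec, Int.cast_smul_eq_zsmul]
    exact AddSubgroup.zsmul_mem _ (hB j) _
  rcases Int.natAbs_eq (Matrix.of G).det with h | h
  · rw [← natCast_zsmul, ← h]; exact hmem
  · have := AddSubgroup.neg_mem _ hmem
    rw [h, neg_smul, neg_neg, natCast_zsmul] at this
    exact this

/-- Every element of `M'` is the sum of an element of `L⁺'` and of one of the hyperbolic plane. -/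
theorem exists_eq_add_of_mem_dual_lorLattice {ν : V n} (hν : ν ∈ dualLattice (lorLattice Λ)) :
    ∃ (x : dualLattice (posLattice Λ)) (j d : ℤ), ν = x + j • uTilde' n + d • uTilde n := by
  have hU : uTilde n ∈ lorLattice Λ :=
    AddSubgroup.mem_sup_right (AddSubgroup.subset_closure (by simp))
  have hU' : uTilde' n ∈ lorLattice Λ :=
    AddSubgroup.mem_sup_right (AddSubgroup.subset_closure (by simp))
  obtain ⟨j, hj⟩ := hν.2 _ hU
  obtain ⟨d, hd⟩ := hν.2 _ hU'
  -- Removing the hyperbolic components is linear in y, so it is enough to treat elements of M,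
  -- where exactly the L⁺-component remains.
  have hsplit : ∀ y ∈ Submodule.span ℝ (lorLattice Λ : Set (V n)),
      y - bil y (uTilde n) • uTilde' n - bil y (uTilde' n) • uTilde n ∈
        Submodule.span ℝ (posLattice Λ : Set (V n)) := by
    intro y hy
    induction hy using Submodule.span_induction with
    | zero => simp [bil_zero_left]
    | add y z _ _ h1 h2 =>
      have := Submodule.add_mem _ h1 h2
      rw [bil_add_left, bil_add_left, add_smul, add_smul]
      convert this using 1; abel
    | smul c y _ h =>
      have := Submodule.smul_mem _ c h
      rw [bil_smul_left, bil_smul_left, mul_smul, mul_smul, ← smul_sub, ← smul_sub]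
      exact this
    | mem y hy =>
      obtain ⟨y₁, hy₁, y₂, hy₂, rfl⟩ := AddSubgroup.mem_sup.mp hy
      have hp := isPos_of_mem_posLattice hy₁
      obtain ⟨a, b, rfl⟩ := AddSubgroup.mem_closure_pair.mp hy₂
      have e1 : bil (y₁ + (a • uTilde n + b • uTilde' n)) (uTilde n) = b := by
        rw [bil_add_left, bil_add_left, hp.bil_uTilde, bil_zsmul_left, bil_zsmul_left,
          bil_uTilde_uTilde, bil_comm (uTilde' n), bil_uTilde_uTilde']; ring
      have e2 : bil (y₁ + (a • uTilde n + b • uTilde' n)) (uTilde' n) = a := by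
        rw [bil_add_left, bil_add_left, hp.bil_uTilde', bil_zsmul_left, bil_zsmul_left,
          bil_uTilde'_uTilde', bil_uTilde_uTilde']; ring
      rw [e1, e2, Int.cast_smul_eq_zsmul, Int.cast_smul_eq_zsmul]
      have e3 : y₁ + (a • uTilde n + b • uTilde' n) - b • uTilde' n - a • uTilde n = y₁ := by abel
      rw [e3]
      exact Submodule.subset_span hy₁
  have h0 := hsplit ν hν.1
  rw [hj, hd] at h0
  refine ⟨⟨_, h0, fun y hy => ?_⟩, j, d, ?_⟩
  · obtain ⟨m, hm⟩ := hν.2 y (AddSubgroup.mem_sup_left hy)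
    have hp := isPos_of_mem_posLattice hy
    refine ⟨m, ?_⟩
    rw [bil_sub_left, bil_sub_left, bil_smul_left, bil_smul_left, bil_comm _ y, bil_comm _ y,
      bil_comm _ y, hp.bil_uTilde, hp.bil_uTilde', bil_comm y, hm]
    ring
  · simp only [Int.cast_smul_eq_zsmul]; abel

end Lattice
end
end JacobiLift

/-! ### Convergence of lattice sums and coordinates on M' -/

namespace JacobiLift

noncomputable section

open Complex MeasureTheory Filter Topology Asymptotics Set

section Gaussian

theorem summable_pi_prod {f : ℤ → ℝ} (hf : Summable f) (hf0 : ∀ k, 0 ≤ f k) (n : ℕ) :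
    Summable fun x : Fin n → ℤ => ∏ i, f (x i) := by
  induction n with
  | zero => exact (hasSum_fintype _).summable
  | succ n ih =>
    rw [← (Fin.consEquiv fun _ => ℤ).summable_iff]
    refine (hf.mul_of_nonneg ih hf0 fun x => Finset.prod_nonneg fun i _ => hf0 _).congr fun x => ?_
    simp [Fin.prod_univ_succ, Fin.consEquiv]

theorem summable_exp_neg_mul_int_sq {c : ℝ} (hc : 0 < c) :
    Summable fun k : ℤ => Real.exp (-c * (k : ℝ) ^ 2) := by
  have := (summable_pow_mul_gauss (a := c / Real.pi) (by positivity) 0).norm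
  refine this.congr fun k => ?_
  rw [pow_zero, one_mul, norm_gauss]
  congr 1; field_simp

end Gaussian

section Lattice
variable {n : ℕ} {Λ : Submodule ℤ (EuclideanSpace ℝ (Fin n))}

/-- The theta series of `L⁺'` converges. -/
theorem summable_exp_neg_q (Λ : Submodule ℤ (EuclideanSpace ℝ (Fin n))) [DiscreteTopology Λ]
    [IsZLattice ℝ Λ] {ε : ℝ} (hε : 0 < ε) :
    Summable fun x : dualLattice (posLattice Λ) => Real.exp (-ε * q (x : V n)) := by
  obtain ⟨B, B', hB, hB', -, -, h2⟩ := exists_dual_bases Λ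
  choose c hc using fun (x : dualLattice (posLattice Λ)) i => x.2.2 (B i) (hB i)
  have hinj : Function.Injective c := fun x y hxy => by
    apply Subtype.ext
    rw [h2 x (isPos_dual x), h2 y (isPos_dual y)]
    refine Finset.sum_congr rfl fun i _ => ?_
    rw [hc, hc, hxy]
  -- By Cauchy-Schwarz (x, B i)² ≤ 4q(x)q(B i), so the integral coordinates have square sum at most
  -- Rq(x). The summand 1 keeps R positive even when the sum is empty.
  set R : ℝ := 1 + ∑ i, 4 * q (B i) with hR
  have hBpos : ∀ i, IsPos (B i) := fun i => isPos_of_mem_posLattice (hB i)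
  have hR0 : 0 < R := by
    have : 0 ≤ ∑ i, 4 * q (B i) := Finset.sum_nonneg fun i _ => by linarith [(hBpos i).q_nonneg]
    linarith
  have hs := (summable_pi_prod (summable_exp_neg_mul_int_sq (c := ε / R) (by positivity))
    (fun k => (Real.exp_pos _).le) n).comp_injective hinj
  refine Summable.of_nonneg_of_le (fun x => (Real.exp_pos _).le) (fun x => ?_) hs
  simp only [Function.comp, ← Real.exp_sum]
  apply Real.exp_le_exp.mpr
  have hle : ∑ i, ((c x i : ℤ) : ℝ) ^ 2 ≤ R * q (x : V n) := by
    have hq := (isPos_dual x).q_nonneg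
    calc ∑ i, ((c x i : ℤ) : ℝ) ^ 2 ≤ ∑ i, 4 * q (B i) * q (x : V n) := by
          refine Finset.sum_le_sum fun i _ => ?_
          rw [← hc]
          have := (isPos_dual x).bil_sq_le (hBpos i)
          linarith
      _ ≤ _ := by rw [← Finset.sum_mul, hR]; nlinarith
  rw [← Finset.mul_sum]
  have : ε / R * ∑ i, ((c x i : ℤ) : ℝ) ^ 2 ≤ ε / R * (R * q (x : V n)) := by gcongr
  have h3 : ε / R * (R * q (x : V n)) = ε * q (x : V n) := by field_simp
  linarith

/-- A summable family has countable support, and the terms of the theta series never vanish. -/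
instance countable_dual [DiscreteTopology Λ] [IsZLattice ℝ Λ] :
    Countable (dualLattice (posLattice Λ)) := by
  have := summable_exp_neg_q Λ one_pos
  have h := this.countable_support
  rw [Function.support_eq_univ fun x => (Real.exp_pos _).ne'] at h
  exact countable_univ_iff.mp h

theorem uTilde_mem : uTilde n ∈ lorLattice Λ :=
  AddSubgroup.mem_sup_right (AddSubgroup.subset_closure (by simp))

theorem uTilde'_mem : uTilde' n ∈ lorLattice Λ :=
  AddSubgroup.mem_sup_right (AddSubgroup.subset_closure (by simp))

theorem posLattice_le : posLattice Λ ≤ lorLattice Λ := le_sup_left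

theorem mem_lorLattice_iff {y : V n} :
    y ∈ lorLattice Λ ↔ ∃ x ∈ posLattice Λ, ∃ j d : ℤ, y = x + j • uTilde' n + d • uTilde n := by
  constructor
  · intro hy
    obtain ⟨y₁, hy₁, y₂, hy₂, rfl⟩ := AddSubgroup.mem_sup.mp hy
    obtain ⟨a, b, rfl⟩ := AddSubgroup.mem_closure_pair.mp hy₂
    exact ⟨y₁, hy₁, b, a, by abel⟩
  · rintro ⟨x, hx, j, d, rfl⟩
    exact add_mem (add_mem (posLattice_le hx) (zsmul_mem uTilde'_mem j)) (zsmul_mem uTilde_mem d)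

/-- The bilinear form on the decomposition `L⁺ ⊕ ℤũ' ⊕ ℤũ`. -/
theorem bil_decomp {x y : V n} (hx : IsPos x) (hy : IsPos y) (j d j' d' : ℝ) :
    bil (x + j • uTilde' n + d • uTilde n) (y + j' • uTilde' n + d' • uTilde n) =
      bil x y + j * d' + d * j' := by
  simp only [bil_add_left, bil_add_right, bil_smul_left, bil_smul_right, hx.bil_uTilde,
    hx.bil_uTilde', bil_comm _ y, hy.bil_uTilde, hy.bil_uTilde', bil_uTilde_uTilde,
    bil_uTilde'_uTilde', bil_uTilde_uTilde', bil_comm (uTilde' n) (uTilde n)]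
  rw [bil_comm y x]; ring

theorem q_decomp {x : V n} (hx : IsPos x) (j d : ℝ) :
    q (x + j • uTilde' n + d • uTilde n) = q x + j * d := by
  rw [q, bil_decomp hx hx, bil_self]; ring

theorem q_decomp_int {x : V n} (hx : IsPos x) (j d : ℤ) :
    q (x + j • uTilde' n + d • uTilde n) = q x + j * d := by
  rw [← Int.cast_smul_eq_zsmul ℝ, ← Int.cast_smul_eq_zsmul ℝ, q_decomp hx]

theorem exists_int_q_lorLattice (hΛ : ∀ x ∈ Λ, ∃ m : ℤ, inner ℝ x x = 2 * (m : ℝ)) {y : V n}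
    (hy : y ∈ lorLattice Λ) : ∃ m : ℤ, q y = m := by
  obtain ⟨x, hx, j, d, rfl⟩ := mem_lorLattice_iff.mp hy
  obtain ⟨m, hm⟩ := exists_int_bil_posLattice hΛ hx
  exact ⟨m + j * d, by rw [q_decomp_int (isPos_of_mem_posLattice hx), hm]; push_cast; ring⟩

theorem lorLattice_le_dual (hΛ : ∀ x ∈ Λ, ∃ m : ℤ, inner ℝ x x = 2 * (m : ℝ)) :
    lorLattice Λ ≤ dualLattice (lorLattice Λ) := by
  refine fun x hx => ⟨Submodule.subset_span hx, fun y hy => ?_⟩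
  obtain ⟨m₁, h₁⟩ := exists_int_q_lorLattice hΛ hx
  obtain ⟨m₂, h₂⟩ := exists_int_q_lorLattice hΛ hy
  obtain ⟨m₃, h₃⟩ := exists_int_q_lorLattice hΛ (AddSubgroup.add_mem _ hx hy)
  refine ⟨m₃ - m₁ - m₂, ?_⟩
  rw [q_add, h₁, h₂] at h₃
  push_cast; linarith

theorem cls_eq_cls_iff {Γ : AddSubgroup (V n)} {x y : dualLattice Γ} :
    cls x = cls y ↔ (y : V n) - x ∈ Γ := by
  unfold cls
  rw [QuotientAddGroup.eq, AddSubgroup.mem_addSubgroupOf]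
  simp [neg_add_eq_sub]

theorem cls_out {Γ : AddSubgroup (V n)} (σ : Disc Γ) : cls (Quotient.out σ) = σ :=
  QuotientAddGroup.out_eq' σ

theorem rep_mem {Γ : AddSubgroup (V n)} (σ : Disc Γ) : rep σ ∈ dualLattice Γ :=
  (Quotient.out σ : dualLattice Γ).2

theorem rep_sub_mem {Γ : AddSubgroup (V n)} (x : dualLattice Γ) : rep (cls x) - x ∈ Γ := by
  have := cls_eq_cls_iff.mp (cls_out (cls x)).symm
  exact this

/-- The hyperbolic plane is unimodular, so it contributes nothing to the discriminant group and L⁺'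
represents every class. -/
theorem exists_cls_toLorDual_eq (σ : Disc (lorLattice Λ)) :
    ∃ x : dualLattice (posLattice Λ), cls (toLorDual x) = σ := by
  obtain ⟨x, j, d, h⟩ := exists_eq_add_of_mem_dual_lorLattice (rep_mem σ)
  refine ⟨x, ?_⟩
  rw [← cls_out σ, cls_eq_cls_iff]
  show rep σ - (x : V n) ∈ _
  rw [h, add_assoc, add_sub_cancel_left]
  exact add_mem (zsmul_mem uTilde'_mem j) (zsmul_mem uTilde_mem d)

theorem cls_toLorDual_eq_iff {x y : dualLattice (posLattice Λ)} :
    cls (toLorDual x) = cls (toLorDual y) ↔ (y : V n) - (x : V n) ∈ posLattice Λ := by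
  rw [cls_eq_cls_iff]
  refine ⟨fun h => ?_, fun h => posLattice_le h⟩
  obtain ⟨z, hz, j, d, h⟩ := mem_lorLattice_iff.mp h
  change (y : V n) - (x : V n) = _ at h
  have hyx : IsPos ((y : V n) - (x : V n)) := (isPos_dual y).sub (isPos_dual x)
  have hzp := isPos_of_mem_posLattice hz
  have hj : (j : ℝ) = 0 := by
    have := hyx.bil_uTilde
    rw [h, bil_add_left, bil_add_left, hzp.bil_uTilde, bil_zsmul_left, bil_zsmul_left,
      bil_uTilde_uTilde, bil_comm, bil_uTilde_uTilde'] at this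
    linarith
  have hd : (d : ℝ) = 0 := by
    have := hyx.bil_uTilde'
    rw [h, bil_add_left, bil_add_left, hzp.bil_uTilde', bil_zsmul_left, bil_zsmul_left,
      bil_uTilde'_uTilde', bil_uTilde_uTilde'] at this
    linarith
  rw [h, Int.cast_eq_zero.mp hj, Int.cast_eq_zero.mp hd]
  simpa using hz

/-- A class is determined by the coordinates of a representative in L⁺' modulo the exponent E. -/
theorem finite_disc [DiscreteTopology Λ] [IsZLattice ℝ Λ]
    (hΛ : ∀ x ∈ Λ, ∃ m : ℤ, inner ℝ x x = 2 * (m : ℝ)) : Finite (Disc (lorLattice Λ)) := by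
  obtain ⟨E, hE, hEmem⟩ := exists_nsmul_mem_posLattice hΛ
  obtain ⟨B, B', hB, hB', -, -, h2⟩ := exists_dual_bases Λ
  choose c hc using fun (x : dualLattice (posLattice Λ)) i => x.2.2 (B i) (hB i)
  choose s hs using exists_cls_toLorDual_eq (Λ := Λ)
  have : NeZero E := ⟨hE.ne'⟩
  refine Finite.of_injective (β := Fin n → ZMod E) (fun σ i => (c (s σ) i : ZMod E))
    fun σ σ' h => ?_
  rw [← hs σ, ← hs σ', cls_toLorDual_eq_iff]
  have hdvd : ∀ i, ∃ k : ℤ, c (s σ') i - c (s σ) i = E * k := fun i => by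
    have := congrFun h i
    simp only at this
    rw [ZMod.intCast_eq_intCast_iff_dvd_sub] at this
    exact this
  choose k hk using hdvd
  have hsub : IsPos ((s σ' : V n) - (s σ : V n)) := (isPos_dual _).sub (isPos_dual _)
  have : (s σ' : V n) - (s σ : V n) = ∑ i, k i • E • B' i := by
    rw [h2 _ hsub]
    refine Finset.sum_congr rfl fun i _ => ?_
    rw [bil_sub_left, hc, hc, ← Int.cast_sub, hk, Int.cast_smul_eq_zsmul, mul_comm, mul_smul,
      natCast_zsmul]
  rw [this]
  exact AddSubgroup.sum_mem _ fun i _ => zsmul_mem (hEmem _ (hB' i)) _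

/-- `(λ, j, d) ↦ λ + jũ' + dũ`. -/
def lorVec (p : dualLattice (posLattice Λ) × ℤ × ℤ) : V n :=
  (p.1 : V n) + p.2.1 • uTilde' n + p.2.2 • uTilde n

theorem lorVec_mem (hΛ : ∀ x ∈ Λ, ∃ m : ℤ, inner ℝ x x = 2 * (m : ℝ))
    (p : dualLattice (posLattice Λ) × ℤ × ℤ) : lorVec p ∈ dualLattice (lorLattice Λ) :=
  add_mem (add_mem (toLorDual p.1).2 (zsmul_mem (lorLattice_le_dual hΛ uTilde'_mem) _))
    (zsmul_mem (lorLattice_le_dual hΛ uTilde_mem) _)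

theorem cls_lorVec (hΛ : ∀ x ∈ Λ, ∃ m : ℤ, inner ℝ x x = 2 * (m : ℝ))
    (p : dualLattice (posLattice Λ) × ℤ × ℤ) :
    cls ⟨lorVec p, lorVec_mem hΛ p⟩ = cls (toLorDual p.1) := by
  rw [eq_comm, cls_eq_cls_iff]
  show lorVec p - (p.1 : V n) ∈ _
  rw [lorVec, add_assoc, add_sub_cancel_left]
  exact add_mem (zsmul_mem uTilde'_mem _) (zsmul_mem uTilde_mem _)

/-- `L⁺' × ℤ × ℤ ≃ M'`. -/
def lorEquiv (hΛ : ∀ x ∈ Λ, ∃ m : ℤ, inner ℝ x x = 2 * (m : ℝ)) :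
    dualLattice (posLattice Λ) × ℤ × ℤ ≃ dualLattice (lorLattice Λ) :=
  Equiv.ofBijective (fun p => ⟨lorVec p, lorVec_mem hΛ p⟩) <| by
    constructor
    · rintro ⟨x, j, d⟩ ⟨x', j', d'⟩ h
      have h := congrArg Subtype.val h
      change lorVec (x, j, d) = lorVec (x', j', d') at h
      simp only [lorVec] at h
      have hx := isPos_dual x
      have hx' := isPos_dual x'
      have hj : j = j' := by
        have := congrArg (fun y => bil y (uTilde n)) h
        simp only [bil_add_left, bil_zsmul_left, hx.bil_uTilde, hx'.bil_uTilde, bil_uTilde_uTilde,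
          bil_comm (uTilde' n), bil_uTilde_uTilde'] at this
        simpa using this
      have hd : d = d' := by
        have := congrArg (fun y => bil y (uTilde' n)) h
        simp only [bil_add_left, bil_zsmul_left, hx.bil_uTilde', hx'.bil_uTilde',
          bil_uTilde'_uTilde', bil_uTilde_uTilde'] at this
        simpa using this
      subst hj hd
      simp only [add_left_inj] at h
      rw [Subtype.ext h]
    · rintro ⟨ν, hν⟩
      obtain ⟨x, j, d, h⟩ := exists_eq_add_of_mem_dual_lorLattice hν
      exact ⟨(x, j, d), Subtype.ext h.symm⟩

/-- `M'/M × M ≃ M'`, by means of the chosen representatives. -/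
def discEquiv (hΛ : ∀ x ∈ Λ, ∃ m : ℤ, inner ℝ x x = 2 * (m : ℝ)) :
    Disc (lorLattice Λ) × lorLattice Λ ≃ dualLattice (lorLattice Λ) where
  toFun p := ⟨rep p.1 + p.2, add_mem (rep_mem _) (lorLattice_le_dual hΛ p.2.2)⟩
  invFun ν := (cls ν, ⟨ν - rep (cls ν), by
    have := neg_mem (rep_sub_mem ν); rwa [neg_sub] at this⟩)
  left_inv := by
    rintro ⟨σ, x⟩
    have h : cls (⟨rep σ + x, add_mem (rep_mem _) (lorLattice_le_dual hΛ x.2)⟩ :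
        dualLattice (lorLattice Λ)) = σ := by
      conv_rhs => rw [← cls_out σ]
      rw [eq_comm, cls_eq_cls_iff]
      show rep σ + (x : V n) - rep σ ∈ _
      rw [add_sub_cancel_left]; exact x.2
    simp only [h, Prod.mk.injEq, true_and]
    exact Subtype.ext (add_sub_cancel_left _ _)
  right_inv := by
    intro ν
    exact Subtype.ext (add_sub_cancel _ _)

theorem cls_discEquiv (hΛ : ∀ x ∈ Λ, ∃ m : ℤ, inner ℝ x x = 2 * (m : ℝ))
    (p : Disc (lorLattice Λ) × lorLattice Λ) : cls (discEquiv hΛ p) = p.1 :=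
  congrArg Prod.fst ((discEquiv hΛ).symm_apply_apply p)

/-- A pairing of a vector indexed by `M'/M` with a sum over the cosets is a sum over
`L⁺' × ℤ × ℤ`. -/
theorem finsum_mul_conj_tsum [DiscreteTopology Λ] [IsZLattice ℝ Λ]
    (hΛ : ∀ x ∈ Λ, ∃ m : ℤ, inner ℝ x x = 2 * (m : ℝ)) (Φ : Disc (lorLattice Λ) → ℂ)
    (F : V n → ℂ) (hF : Summable fun p : dualLattice (posLattice Λ) × ℤ × ℤ => F (lorVec p)) :
    ∑ᶠ σ, Φ σ * (starRingEnd ℂ) (∑' x : lorLattice Λ, F (rep σ + x)) =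
      ∑' p : dualLattice (posLattice Λ) × ℤ × ℤ,
        Φ (cls (toLorDual p.1)) * (starRingEnd ℂ) (F (lorVec p)) := by
  have := finite_disc hΛ
  have := Fintype.ofFinite (Disc (lorLattice Λ))
  -- One function on M' is summed along two enumerations, by cosets of M and by the coordinates of
  -- `lorVec`.
  let H : dualLattice (lorLattice Λ) → ℂ := fun ν => Φ (cls ν) * (starRingEnd ℂ) (F ν)
  have e1 : ∀ p, H (lorEquiv hΛ p) = Φ (cls (toLorDual p.1)) * (starRingEnd ℂ) (F (lorVec p)) :=
    fun p => by
      have : cls (lorEquiv hΛ p) = cls (toLorDual p.1) := cls_lorVec hΛ p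
      simp only [H, this]; rfl
  have e2 : ∀ p, H (discEquiv hΛ p) = Φ p.1 * (starRingEnd ℂ) (F (rep p.1 + p.2)) := fun p => by
    simp only [H, cls_discEquiv]; rfl
  have hFs : Summable fun ν : dualLattice (lorLattice Λ) => F ν := by
    rw [← (lorEquiv hΛ).summable_iff]; exact hF
  have hH : Summable H := by
    refine Summable.of_norm_bounded ((hFs.norm).mul_left (∑ σ, ‖Φ σ‖)) fun ν => ?_
    rw [norm_mul, RCLike.norm_conj]
    gcongr
    exact Finset.single_le_sum (f := fun σ => ‖Φ σ‖) (fun _ _ => norm_nonneg _) (Finset.mem_univ _)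
  simp_rw [← e1]
  have hH' : Summable fun p => H (discEquiv hΛ p) := (discEquiv hΛ).summable_iff.mpr hH
  rw [(lorEquiv hΛ).tsum_eq H, ← (discEquiv hΛ).tsum_eq H, hH'.tsum_prod, tsum_fintype, finsum_eq_sum_of_fintype]
  refine Finset.sum_congr rfl fun σ _ => ?_
  simp_rw [e2]
  rw [tsum_mul_left, conj_tsum]

end Lattice
end
end JacobiLift

/-! ### The exponential, decay at the cusp, and Fourier coefficients as integrals -/

namespace JacobiLift

noncomputable section

open Complex MeasureTheory Filter Topology Asymptotics Set

section Exponential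

theorem e_add (x y : ℂ) : e (x + y) = e x * e y := by
  unfold e; rw [← Complex.exp_add]; congr 1; ring

theorem e_zero : e 0 = 1 := by simp [e]

theorem e_neg (x : ℂ) : e (-x) = (e x)⁻¹ := by
  unfold e; rw [← Complex.exp_neg]; congr 1; ring

theorem e_int (k : ℤ) : e k = 1 := by
  unfold e
  rw [Complex.exp_eq_one_iff]
  exact ⟨k, by ring⟩

theorem e_real_int {x : ℝ} (h : ∃ k : ℤ, x = k) : e x = 1 := by
  obtain ⟨k, rfl⟩ := h
  exact_mod_cast e_int k

theorem norm_e (z : ℂ) : ‖e z‖ = Real.exp (-(2 * Real.pi * z.im)) := by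
  unfold e; rw [Complex.norm_exp]; congr 1; simp

theorem norm_e_real (x : ℝ) : ‖e x‖ = 1 := by simp [norm_e]

theorem conj_e (z : ℂ) : (starRingEnd ℂ) (e z) = e (-(starRingEnd ℂ) z) := by
  unfold e; rw [← Complex.exp_conj]; congr 1; simp [map_ofNat (starRingEnd ℂ) 2]

theorem continuous_e : Continuous e := by unfold e; fun_prop

theorem e_eq_one_iff {x : ℝ} : e x = 1 ↔ ∃ k : ℤ, x = k := by
  refine ⟨fun h => ?_, e_real_int⟩
  unfold e at h
  rw [Complex.exp_eq_one_iff] at h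
  obtain ⟨k, hk⟩ := h
  refine ⟨k, ?_⟩
  have hne : (2 * Real.pi * I : ℂ) ≠ 0 := Complex.two_pi_I_ne_zero
  have : (x : ℂ) = k := by
    apply mul_left_cancel₀ hne
    rw [hk]; ring
  exact_mod_cast this

/-- `e` of a sum with an imaginary multiple of `y`. -/
theorem e_add_mul_I (x y : ℝ) : e (x + y * I) = e x * (Real.exp (-(2 * Real.pi * y)) : ℝ) := by
  rw [e_add]; congr 1
  unfold e; push_cast; congr 1
  linear_combination (2 * Real.pi * y : ℂ) * I_sq

theorem integral_e_int_mul (k : ℤ) (a : ℝ) :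
    ∫ x in Ioc a (a + 1), e (k * x) = if k = 0 then 1 else 0 := by
  rw [← intervalIntegral.integral_of_le (by linarith)]
  split_ifs with h
  · simp [h, e_zero]
  · have hc : (2 * Real.pi * I * k : ℂ) ≠ 0 :=
      mul_ne_zero Complex.two_pi_I_ne_zero (by exact_mod_cast h)
    have h1 : (fun x : ℝ => e (k * x)) = fun x : ℝ => cexp (2 * Real.pi * I * k * x) := by
      funext x; unfold e; congr 1; ring
    rw [h1, integral_exp_mul_complex hc]
    have : cexp (2 * Real.pi * I * k * ((a + 1 : ℝ) : ℂ)) = cexp (2 * Real.pi * I * k * a) := by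
      push_cast
      rw [mul_add, Complex.exp_add, mul_one, show (2 * Real.pi * I * k : ℂ) = k * (2 * Real.pi * I)
        by ring, Complex.exp_int_mul_two_pi_mul_I, mul_one]
    rw [this, sub_self, zero_div]

end Exponential

section JacobiForm
variable {n : ℕ} {Λ : Submodule ℤ (EuclideanSpace ℝ (Fin n))}

theorem exists_nsmul_mem_lorLattice [DiscreteTopology Λ] [IsZLattice ℝ Λ]
    (hΛ : ∀ x ∈ Λ, ∃ m : ℤ, inner ℝ x x = 2 * (m : ℝ)) :
    ∃ E : ℕ, 0 < E ∧ ∀ x ∈ dualLattice (lorLattice Λ), E • x ∈ lorLattice Λ := by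
  obtain ⟨E, hE, h⟩ := exists_nsmul_mem_posLattice hΛ
  refine ⟨E, hE, fun x hx => ?_⟩
  obtain ⟨y, j, d, rfl⟩ := exists_eq_add_of_mem_dual_lorLattice hx
  rw [smul_add, smul_add]
  exact add_mem (add_mem (posLattice_le (h _ y.2)) (nsmul_mem (zsmul_mem uTilde'_mem _) _))
    (nsmul_mem (zsmul_mem uTilde_mem _) _)

theorem q_nsmul (E : ℕ) (x : V n) : q (E • x) = (E : ℝ) ^ 2 * q x := by
  rw [← Nat.cast_smul_eq_nsmul ℝ, q_smul]

/-- The discriminants `4q(η)r - s²` lie in a discrete subgroup. -/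
theorem exists_discriminant_gap [DiscreteTopology Λ] [IsZLattice ℝ Λ]
    (hΛ : ∀ x ∈ Λ, ∃ m : ℤ, inner ℝ x x = 2 * (m : ℝ)) (η : dualLattice (lorLattice Λ)) :
    ∃ E : ℝ, 0 < E ∧ ∀ (ν : dualLattice (lorLattice Λ)) (i j : ℤ), ∃ k : ℤ,
      4 * q (η : V n) * (i + q (ν : V n)) - (j + bil (ν : V n) η) ^ 2 = k / E := by
  obtain ⟨E, hE, h⟩ := exists_nsmul_mem_lorLattice hΛ
  have hE0 : (E : ℝ) ≠ 0 := by exact_mod_cast hE.ne'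
  refine ⟨(E : ℝ) ^ 4, by positivity, fun ν i j => ?_⟩
  obtain ⟨a, ha⟩ := exists_int_q_lorLattice hΛ (h _ η.2)
  obtain ⟨b, hb⟩ := exists_int_q_lorLattice hΛ (h _ ν.2)
  obtain ⟨c, hc⟩ := η.2.2 _ (h _ ν.2)
  rw [q_nsmul] at ha hb
  rw [bil_comm, bil_nsmul_left] at hc
  -- E²q(η), E²q(ν) and E(η, ν) are integers, so E⁴ clears all denominators.
  refine ⟨4 * a * (i * E ^ 2 + b) - E ^ 2 * (j * E + c) ^ 2, ?_⟩
  push_cast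
  rw [eq_div_iff (by positivity), ← ha, ← hb, ← hc]
  ring

theorem HasFourierExpansion.summable {η : dualLattice (lorLattice Λ)}
    {φ : ℂ → ℂ → Disc (lorLattice Λ) → ℂ} {a : Disc (lorLattice Λ) → ℝ → ℝ → ℂ}
    (h : HasFourierExpansion η φ a) (ν : dualLattice (lorLattice Λ)) {y : ℝ} (hy : 0 < y) (c : ℝ) :
    Summable fun p : ℤ × ℤ => ‖a (cls ν) (p.1 + q (ν : V n)) (p.2 + bil (ν : V n) η)‖ *
      Real.exp (-(2 * Real.pi * (y * ((p.1 + q (ν : V n)) + c * (p.2 + bil (ν : V n) η))))) := by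
  have := (h ν (y * I) (c * y * I) (by simpa using hy)).summable.norm
  refine this.congr fun p => ?_
  rw [norm_mul, norm_e]
  congr 3
  simp; ring

theorem norm_fourier_term (r s : ℝ) (τ₁ : ℂ) (c x : ℝ) :
    ‖e (r * τ₁ + s * (x + c * τ₁))‖ = Real.exp (-(2 * Real.pi * (τ₁.im * (r + c * s)))) := by
  rw [norm_e]; congr 1; simp; ring

/-- A Jacobi cusp form decays exponentially at the cusp. -/
theorem IsJacobiCuspForm.exists_norm_le [DiscreteTopology Λ] [IsZLattice ℝ Λ]
    (hΛ : ∀ x ∈ Λ, ∃ m : ℤ, inner ℝ x x = 2 * (m : ℝ)) {k : ℝ} {η : dualLattice (lorLattice Λ)}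
    (hη : 0 < q (η : V n)) {φ : ℂ → ℂ → Disc (lorLattice Λ) → ℂ}
    {a : Disc (lorLattice Λ) → ℝ → ℝ → ℂ} {sig : ℤ}
    (hφ : IsJacobiCuspForm (lorLattice Λ) sig k η φ a) :
    ∃ δ > 0, ∀ y₀ > 0, ∃ B ≥ 0, ∀ σ, ∀ τ₁ : ℂ, y₀ ≤ τ₁.im → ∀ c : ℝ, |c| ≤ 1 → ∀ x : ℝ,
      ‖φ τ₁ (x + c * τ₁) σ‖ ≤
        B * Real.exp (-δ * τ₁.im) * Real.exp (2 * Real.pi * q (η : V n) * c ^ 2 * τ₁.im) := by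
  obtain ⟨E, hE, hgap⟩ := exists_discriminant_gap hΛ η
  set m := q (η : V n) with hm
  -- A positive discriminant is at least 1/E; dividing by 4m gives the gap in the exponent.
  set δ := 1 / (4 * m * E) with hδ
  have hδ0 : 0 < δ := by positivity
  have hpi := Real.pi_pos
  refine ⟨2 * Real.pi * δ, by positivity, fun y₀ hy₀ => ?_⟩
  have := finite_disc hΛ
  have := Fintype.ofFinite (Disc (lorLattice Λ))
  -- The absolute series at height y₀ on the two extreme lines c = 1 and c = -1; together they
  -- dominate every line with |c| ≤ 1.
  let S : dualLattice (lorLattice Λ) → ℝ := fun ν =>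
    ∑' p : ℤ × ℤ, (‖a (cls ν) (p.1 + q (ν : V n)) (p.2 + bil (ν : V n) η)‖ *
      Real.exp (-(2 * Real.pi * (y₀ * ((p.1 + q (ν : V n)) + 1 * (p.2 + bil (ν : V n) η))))) +
      ‖a (cls ν) (p.1 + q (ν : V n)) (p.2 + bil (ν : V n) η)‖ *
      Real.exp (-(2 * Real.pi * (y₀ * ((p.1 + q (ν : V n)) + (-1) * (p.2 + bil (ν : V n) η))))))
  have hS0 : ∀ ν, 0 ≤ S ν := fun ν => tsum_nonneg fun p => by positivity
  have key : ∀ ν : dualLattice (lorLattice Λ), ∀ τ₁ : ℂ, y₀ ≤ τ₁.im → ∀ c : ℝ, |c| ≤ 1 → ∀ x : ℝ,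
      ‖φ τ₁ (x + c * τ₁) (cls ν)‖ ≤ (S ν * Real.exp (2 * Real.pi * δ * y₀)) *
        Real.exp (-(2 * Real.pi * δ) * τ₁.im) * Real.exp (2 * Real.pi * m * c ^ 2 * τ₁.im) := by
    intro ν τ₁ hτ c hc x
    have hsum := hφ.fourier ν τ₁ (x + c * τ₁) (hy₀.trans_le hτ)
    have hs1 := hφ.fourier.summable ν hy₀ 1
    have hs2 := hφ.fourier.summable ν hy₀ (-1)
    rw [← hsum.tsum_eq, mul_right_comm, mul_right_comm, mul_assoc (S ν), mul_assoc (S ν),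
      ← tsum_mul_right]
    refine tsum_of_norm_bounded ((hs1.add hs2).mul_right _).hasSum fun p => ?_
    rw [norm_mul, norm_fourier_term, ← mul_add, mul_assoc ‖a _ _ _‖]
    set r := (p.1 + q (ν : V n)) with hr
    set s := (p.2 + bil (ν : V n) η) with hs
    by_cases ha : a (cls ν) r s = 0
    · simp [ha]
    gcongr
    have hcusp : s ^ 2 < 4 * m * r := hφ.cusp ν p.1 p.2 ha
    obtain ⟨l, hl⟩ := hgap ν p.1 p.2
    rw [← hr, ← hs] at hl
    have hl1 : 1 ≤ l := by
      have : (0 : ℝ) < l / E := by rw [← hl]; linarith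
      have h3 : (0 : ℝ) < l := by rwa [div_pos_iff_of_pos_right hE] at this
      exact_mod_cast h3
    -- Completing the square: 4m(r + cs + mc²) is the discriminant 4mr - s² plus (2mc + s)².
    have hd : δ ≤ r + c * s + m * c ^ 2 := by
      have h2 : 1 / E ≤ 4 * m * r - s ^ 2 := by
        rw [hl]; gcongr; exact_mod_cast hl1
      have h3 : 4 * m * δ = 1 / E := by rw [hδ]; field_simp
      have h4 : 4 * m * (r + c * s + m * c ^ 2) = (4 * m * r - s ^ 2) + (2 * m * c + s) ^ 2 := by ring
      have h5 : 4 * m * δ ≤ 4 * m * (r + c * s + m * c ^ 2) := by nlinarith [sq_nonneg (2 * m * c + s)]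
      exact le_of_mul_le_mul_left h5 (by positivity)
    have hcs : Real.exp (-(2 * Real.pi * (y₀ * (r + c * s)))) ≤
        Real.exp (-(2 * Real.pi * (y₀ * (r + 1 * s)))) +
          Real.exp (-(2 * Real.pi * (y₀ * (r + -1 * s)))) := by
      obtain ⟨h1, h2⟩ := abs_le.mp hc
      rcases le_total 0 s with h0 | h0
      · refine le_trans (Real.exp_le_exp.mpr ?_) (le_add_of_nonneg_left (Real.exp_pos _).le)
        have : y₀ * (r + -1 * s) ≤ y₀ * (r + c * s) := by gcongr
        nlinarith
      · refine le_trans (Real.exp_le_exp.mpr ?_) (le_add_of_nonneg_right (Real.exp_pos _).le)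
        have : y₀ * (r + 1 * s) ≤ y₀ * (r + c * s) := by
          have : 1 * s ≤ c * s := mul_le_mul_of_nonpos_right h2 h0
          gcongr
        nlinarith
    calc Real.exp (-(2 * Real.pi * (τ₁.im * (r + c * s))))
        ≤ Real.exp (-(2 * Real.pi * (y₀ * (r + c * s)))) *
          (Real.exp (2 * Real.pi * δ * y₀) * Real.exp (2 * Real.pi * m * c ^ 2 * τ₁.im) *
            Real.exp (-(2 * Real.pi * δ) * τ₁.im)) := by
          rw [← Real.exp_add, ← Real.exp_add, ← Real.exp_add]
          apply Real.exp_le_exp.mpr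
          -- The gap is applied only to the height exceeding y₀; the part at y₀ is left to the
          -- convergent series S.
          have h6 : (τ₁.im - y₀) * δ ≤ (τ₁.im - y₀) * (r + c * s + m * c ^ 2) :=
            mul_le_mul_of_nonneg_left hd (by linarith)
          have h7 : 0 ≤ y₀ * (m * c ^ 2) := by positivity
          have h8 : τ₁.im * (r + c * s) ≥ y₀ * (r + c * s) - δ * y₀ - m * c ^ 2 * τ₁.im + δ * τ₁.im := by
            nlinarith
          nlinarith
      _ ≤ _ := by
          exact (mul_le_mul_of_nonneg_right hcs (by positivity)).trans_eq (by ring)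
  refine ⟨∑ σ : Disc (lorLattice Λ), S (Quotient.out σ) * Real.exp (2 * Real.pi * δ * y₀),
    Finset.sum_nonneg fun σ _ => mul_nonneg (hS0 _) (Real.exp_pos _).le,
    fun σ τ₁ hτ c hc x => ?_⟩
  have h1 := key (Quotient.out σ) τ₁ hτ c hc x
  rw [cls_out] at h1
  refine h1.trans ?_
  gcongr
  exact Finset.single_le_sum (f := fun σ => S (Quotient.out σ) * Real.exp (2 * Real.pi * δ * y₀))
    (fun σ _ => mul_nonneg (hS0 _) (Real.exp_pos _).le) (Finset.mem_univ σ)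

/-- The square over which the Fourier coefficients are computed. -/
def unitSquare : Set (ℝ × ℝ) := Ioc (-(1 / 2)) (1 / 2) ×ˢ Ioc 0 1

/-- The Fourier coefficients as integrals along the line `τ₂ = x + cτ₁`. -/
theorem HasFourierExpansion.integral_eq {η : dualLattice (lorLattice Λ)}
    {φ : ℂ → ℂ → Disc (lorLattice Λ) → ℂ} {a : Disc (lorLattice Λ) → ℝ → ℝ → ℂ}
    (h : HasFourierExpansion η φ a) (ν : dualLattice (lorLattice Λ)) {y : ℝ} (hy : 0 < y) (c : ℝ) :
    ∫ p in unitSquare, φ (p.1 + y * I) (p.2 + c * (p.1 + y * I)) (cls ν) *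
        e (-(q (ν : V n) * p.1 + bil (ν : V n) η * (p.2 + c * p.1) : ℝ)) =
      a (cls ν) (q (ν : V n)) (bil (ν : V n) η) *
        (Real.exp (-(2 * Real.pi * (y * (q (ν : V n) + c * bil (ν : V n) η)))) : ℝ) := by
  have hfin : IsFiniteMeasure (volume.restrict unitSquare) := by
    constructor
    rw [Measure.restrict_apply_univ, unitSquare, Measure.volume_eq_prod, Measure.prod_prod]
    simp
  set C : ℤ × ℤ → ℂ := fun k => a (cls ν) (k.1 + q (ν : V n)) (k.2 + bil (ν : V n) η) *
    (Real.exp (-(2 * Real.pi * (y * ((k.1 + q (ν : V n)) + c * (k.2 + bil (ν : V n) η))))) : ℝ)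
    with hC
  have hterm : ∀ (k : ℤ × ℤ) (p : ℝ × ℝ),
      a (cls ν) (k.1 + q (ν : V n)) (k.2 + bil (ν : V n) η) *
        e (((k.1 + q (ν : V n) : ℝ) : ℂ) * (p.1 + y * I) +
          ((k.2 + bil (ν : V n) η : ℝ) : ℂ) * (p.2 + c * (p.1 + y * I))) *
        e (-(q (ν : V n) * p.1 + bil (ν : V n) η * (p.2 + c * p.1) : ℝ)) =
      C k * (e ((k.1 + k.2 * c : ℝ) * p.1) * e (k.2 * p.2)) := by
    intro k p
    have e1 : ((k.1 + q (ν : V n) : ℝ) : ℂ) * (p.1 + y * I) +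
          ((k.2 + bil (ν : V n) η : ℝ) : ℂ) * (p.2 + c * (p.1 + y * I)) =
        (((k.1 + q (ν : V n)) * p.1 + (k.2 + bil (ν : V n) η) * (p.2 + c * p.1) : ℝ) : ℂ) +
          ((y * ((k.1 + q (ν : V n)) + c * (k.2 + bil (ν : V n) η)) : ℝ) : ℂ) * I := by
      push_cast; ring
    rw [e1, e_add_mul_I, hC]
    have e2 : e (((k.1 + q (ν : V n)) * p.1 + (k.2 + bil (ν : V n) η) * (p.2 + c * p.1) : ℝ) : ℂ) *
        e (-(q (ν : V n) * p.1 + bil (ν : V n) η * (p.2 + c * p.1) : ℝ)) =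
        e ((k.1 + k.2 * c : ℝ) * p.1) * e (k.2 * p.2) := by
      rw [← e_add, ← e_add]; congr 1; push_cast; ring
    linear_combination (a (cls ν) (k.1 + q (ν : V n)) (k.2 + bil (ν : V n) η) * (Real.exp
      (-(2 * Real.pi * (y * ((k.1 + q (ν : V n)) + c * (k.2 + bil (ν : V n) η))))) : ℝ)) * e2
  have hint := hasSum_integral_of_dominated_convergence (μ := volume.restrict unitSquare)
    (F := fun (k : ℤ × ℤ) (p : ℝ × ℝ) => C k * (e ((k.1 + k.2 * c : ℝ) * p.1) * e (k.2 * p.2)))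
    (f := fun p => φ (p.1 + y * I) (p.2 + c * (p.1 + y * I)) (cls ν) *
        e (-(q (ν : V n) * p.1 + bil (ν : V n) η * (p.2 + c * p.1) : ℝ)))
    (fun k _ => ‖C k‖) (fun k => ?_) (fun k => Eventually.of_forall fun p => ?_)
    (Eventually.of_forall fun p => ?_) (integrable_const _) (Eventually.of_forall fun p => ?_)
  · have hval : ∀ k : ℤ × ℤ, ∫ p in unitSquare, C k * (e ((k.1 + k.2 * c : ℝ) * p.1) * e (k.2 * p.2)) =
        if k = 0 then C 0 else 0 := by
      intro k
      rw [integral_const_mul, unitSquare, Measure.volume_eq_prod]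
      rw [setIntegral_prod_mul (fun x : ℝ => e ((k.1 + k.2 * c : ℝ) * x))
        (fun x : ℝ => e (k.2 * x))]
      have h2 := integral_e_int_mul k.2 0
      rw [zero_add] at h2
      rw [h2]
      -- As c need not be an integer, the first factor has period one only when k.2 = 0; for k.2 ≠ 0
      -- the second factor integrates to zero.
      by_cases hk2 : k.2 = 0
      · have h1 := integral_e_int_mul k.1 (-(1 / 2))
        rw [show -(1 / 2 : ℝ) + 1 = 1 / 2 by norm_num] at h1
        have : (fun x : ℝ => e ((k.1 + k.2 * c : ℝ) * x)) = fun x : ℝ => e (k.1 * x) := by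
          funext x; rw [hk2]; simp
        rw [this, h1, if_pos hk2]
        by_cases hk1 : k.1 = 0
        · rw [if_pos hk1, if_pos (Prod.ext hk1 hk2), mul_one, mul_one,
            show k = 0 from Prod.ext hk1 hk2]
        · rw [if_neg hk1, if_neg fun h => hk1 (by rw [h]; rfl)]; simp
      · rw [if_neg hk2, if_neg fun h => hk2 (by rw [h]; rfl)]; simp
    simp_rw [hval] at hint
    rw [hint.unique (hasSum_ite_eq 0 (C 0))]
    simp [hC]
  · exact (((continuous_e.comp (by fun_prop)).mul (continuous_e.comp (by fun_prop))).const_mul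
      (C k)).aestronglyMeasurable
  · rw [norm_mul, norm_mul (e _), norm_e, norm_e]
    simp
  · refine (h.summable ν hy c).congr fun k => ?_
    rw [hC]; simp only [norm_mul, norm_real, Real.norm_of_nonneg (Real.exp_pos _).le]
  · have := (h ν (p.1 + y * I) (p.2 + c * (p.1 + y * I)) (by simpa using hy)).mul_right
      (e (-(q (ν : V n) * p.1 + bil (ν : V n) η * (p.2 + c * p.1) : ℝ)))
    simp_rw [hterm] at this
    exact this

end JacobiForm
end
end JacobiLift

/-! ### Symmetries of the coefficients: sign change and translation by the index -/

namespace JacobiLift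

noncomputable section

open Complex MeasureTheory Filter Topology Asymptotics Set

section JacobiForm
variable {n : ℕ} {Λ : Submodule ℤ (EuclideanSpace ℝ (Fin n))}

theorem weilS_smul {Γ : AddSubgroup (V n)} (sig : ℤ) (c : ℂ) (f : Disc Γ → ℂ) :
    weilS sig (c • f) = c • weilS sig f := by
  funext σ
  simp only [weilS, Pi.smul_apply, smul_eq_mul]
  have h : ∀ σ' : Disc Γ, e (-(bil (rep σ') (rep σ) : ℝ)) * (c * f σ') =
      c * (e (-(bil (rep σ') (rep σ) : ℝ)) * f σ') := fun σ' => by ring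
  have h2 : ∑ᶠ σ' : Disc Γ, c * (e (-(bil (rep σ') (rep σ) : ℝ)) * f σ') =
      c * ∑ᶠ σ' : Disc Γ, e (-(bil (rep σ') (rep σ) : ℝ)) * f σ' := by
    simpa using (smul_finsum c (fun σ' : Disc Γ => e (-(bil (rep σ') (rep σ) : ℝ)) * f σ')).symm
  rw [finsum_congr h, h2, mul_left_comm]

/-- The character `σ ↦ e(-(σ, x))` of the discriminant group. -/
def discChar (x : dualLattice (lorLattice Λ)) : AddChar (Disc (lorLattice Λ)) ℂ where
  toFun σ := e (-(bil (rep σ) x : ℝ))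
  map_zero_eq_one' := by
    have h : rep (0 : Disc (lorLattice Λ)) ∈ lorLattice Λ := by
      have := rep_sub_mem (0 : dualLattice (lorLattice Λ))
      simpa [cls] using this
    obtain ⟨k, hk⟩ := x.2.2 _ h
    rw [bil_comm, hk, e_neg, ofReal_intCast, e_int, inv_one]
  map_add_eq_mul' σ τ := by
    have h : rep (σ + τ) - (rep σ + rep τ) ∈ lorLattice Λ := by
      have := rep_sub_mem (Quotient.out σ + Quotient.out τ : dualLattice (lorLattice Λ))
      have h2 : cls (Quotient.out σ + Quotient.out τ : dualLattice (lorLattice Λ)) = σ + τ := by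
        conv_rhs => rw [← cls_out σ, ← cls_out τ]
        rfl
      rwa [h2] at this
    obtain ⟨k, hk⟩ := x.2.2 _ h
    rw [bil_sub_right, bil_add_right, bil_comm, bil_comm _ (rep σ), bil_comm _ (rep τ),
      sub_eq_iff_eq_add] at hk
    rw [hk, ← e_add]
    push_cast
    rw [neg_add, e_add, e_neg, e_int, inv_one, one_mul, neg_add]

/-- Here 0 is the trivial character. The substantial direction tests the character on L⁺' and uses
that L⁺ is the dual of L⁺'. -/
theorem discChar_eq_zero_iff [DiscreteTopology Λ] [IsZLattice ℝ Λ] (x : dualLattice (lorLattice Λ)) :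
    discChar x = 0 ↔ (x : V n) ∈ lorLattice Λ := by
  constructor
  · intro h
    obtain ⟨y, j, d, hy⟩ := exists_eq_add_of_mem_dual_lorLattice x.2
    rw [hy]
    refine add_mem (add_mem (posLattice_le (mem_posLattice_of_forall_dual (isPos_dual y)
      fun z hz => ?_)) (zsmul_mem uTilde'_mem j)) (zsmul_mem uTilde_mem d)
    have h1 : discChar x (cls (toLorDual ⟨z, hz⟩)) = 1 := by rw [h]; rfl
    change e (-(bil (rep (cls (toLorDual ⟨z, hz⟩))) x : ℝ)) = 1 at h1
    rw [e_neg, inv_eq_one, e_eq_one_iff] at h1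
    obtain ⟨k, hk⟩ := h1
    obtain ⟨l, hl⟩ := x.2.2 _ (rep_sub_mem (toLorDual ⟨z, hz⟩))
    change bil (x : V n) (_ - z) = l at hl
    have hzp : IsPos z := isPos_dual ⟨z, hz⟩
    refine ⟨k - l, ?_⟩
    have h2 : bil (x : V n) z = bil (y : V n) z := by
      rw [hy, bil_add_left, bil_add_left, bil_zsmul_left, bil_zsmul_left, bil_comm (uTilde' n) z,
        bil_comm (uTilde n) z, hzp.bil_uTilde, hzp.bil_uTilde']
      ring
    rw [bil_sub_right, bil_comm _ (rep _), hk, h2] at hl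
    push_cast; linarith
  · intro h
    ext σ
    change e (-(bil (rep σ) x : ℝ)) = 1
    obtain ⟨k, hk⟩ := (rep_mem σ).2 _ h
    rw [hk, e_neg, ofReal_intCast, e_int, inv_one]

/-- Orthogonality of the characters of M'/M leaves only σ'' = -σ in the double sum; the factor
|M'/M| cancels the two square roots. -/
theorem weilS_weilS [DiscreteTopology Λ] [IsZLattice ℝ Λ]
    (hΛ : ∀ x ∈ Λ, ∃ m : ℤ, inner ℝ x x = 2 * (m : ℝ)) (sig : ℤ) (f : Disc (lorLattice Λ) → ℂ)
    (σ : Disc (lorLattice Λ)) :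
    weilS sig (weilS sig f) σ = cexp (-(Real.pi * I / 2) * sig) * f (-σ) := by
  classical
  have := finite_disc hΛ
  have := Fintype.ofFinite (Disc (lorLattice Λ))
  set D : ℂ := (Nat.card (Disc (lorLattice Λ)) : ℂ) with hD
  have hD0 : D ≠ 0 := by
    rw [hD]; exact_mod_cast Nat.card_pos.ne'
  have hroot : ((√(Nat.card (Disc (lorLattice Λ)) : ℝ) : ℝ) : ℂ) ^ 2 = D := by
    rw [← ofReal_pow, Real.sq_sqrt (Nat.cast_nonneg _)]; simp [hD]
  set R : ℂ := ((√(Nat.card (Disc (lorLattice Λ)) : ℝ) : ℝ) : ℂ) with hR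
  set C := cexp (-(Real.pi * I / 4) * sig) with hC
  have hCC : C ^ 2 = cexp (-(Real.pi * I / 2) * sig) := by
    rw [hC, ← Complex.exp_nat_mul]; congr 1; push_cast; ring
  simp only [weilS, finsum_eq_sum_of_fintype]
  let X : Disc (lorLattice Λ) → dualLattice (lorLattice Λ) := fun σ'' =>
    ⟨rep σ + rep σ'', add_mem (rep_mem _) (rep_mem _)⟩
  have hX : ∀ σ'', (X σ'' : V n) ∈ lorLattice Λ ↔ σ'' = -σ := by
    intro σ''
    have : ∀ x : dualLattice (lorLattice Λ), cls x = 0 ↔ (x : V n) ∈ lorLattice Λ := fun x => by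
      rw [show (0 : Disc (lorLattice Λ)) = cls 0 from rfl, eq_comm, cls_eq_cls_iff]; simp
    have h2 := this (Quotient.out σ + Quotient.out σ'')
    have h3 : cls (Quotient.out σ + Quotient.out σ'') = σ + σ'' := by
      conv_rhs => rw [← cls_out σ, ← cls_out σ'']
      rfl
    rw [h3] at h2
    rw [eq_neg_iff_add_eq_zero]
    exact h2.symm.trans (by rw [add_comm])
  have hchar : ∀ σ'', ∑ σ', discChar (X σ'') σ' = if σ'' = -σ then D else 0 := by
    intro σ''
    have h2 : discChar (X σ'') = 0 ↔ σ'' = -σ := (discChar_eq_zero_iff _).trans (hX σ'')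
    rw [AddChar.sum_eq_ite]
    by_cases h : σ'' = -σ
    · rw [if_pos (h2.mpr h), if_pos h, hD, Nat.card_eq_fintype_card]
    · rw [if_neg (mt h2.mp h), if_neg h]
  have hmul : ∀ σ' σ'', e (-(bil (rep σ') (rep σ) : ℝ)) * e (-(bil (rep σ'') (rep σ') : ℝ)) =
      discChar (X σ'') σ' := by
    intro σ' σ''
    rw [← e_add]
    change _ = e (-(bil (rep σ') (rep σ + rep σ'') : ℝ))
    rw [bil_add_right, bil_comm (rep σ'')]; congr 1; push_cast; ring
  calc _ = C / R * (C / R) * ∑ σ', ∑ σ'', e (-(bil (rep σ') (rep σ) : ℝ)) *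
          e (-(bil (rep σ'') (rep σ') : ℝ)) * f σ'' := by
        simp only [Finset.mul_sum]
        refine Finset.sum_congr rfl fun σ' _ => Finset.sum_congr rfl fun σ'' _ => by ring
    _ = C / R * (C / R) * ∑ σ'', (∑ σ', discChar (X σ'') σ') * f σ'' := by
        rw [Finset.sum_comm]
        simp_rw [hmul, Finset.sum_mul]
    _ = _ := by
        simp_rw [hchar]
        rw [Finset.sum_eq_single (-σ) (fun b _ hb => by rw [if_neg hb, zero_mul]) (by simp),
          if_pos rfl, ← hCC, div_mul_div_comm, ← pow_two, ← pow_two, hroot]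
        field_simp

/-- In the upper half-plane the arguments of τ and -1/τ add up to π, so the principal branch needs
no correction. -/
theorem log_neg_one_div {τ : ℂ} (hτ : 0 < τ.im) : Complex.log (-1 / τ) = Real.pi * I - Complex.log τ := by
  have hτ0 : τ ≠ 0 := by rintro rfl; simp at hτ
  have h1 : cexp (Real.pi * I - Complex.log τ) = -1 / τ := by
    rw [Complex.exp_sub, Complex.exp_pi_mul_I, Complex.exp_log hτ0]
  have harg0 : 0 ≤ τ.arg := Complex.arg_nonneg_iff.mpr hτ.le
  have hargpi : τ.arg < Real.pi := by
    refine lt_of_le_of_ne (Complex.arg_le_pi τ) fun h => ?_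
    rw [Complex.arg_eq_pi_iff] at h
    exact hτ.ne' h.2
  rw [← h1, Complex.log_exp] <;> simp [Complex.log_im] <;> linarith

/-- Applying S twice acts by τ₂ ↦ -τ₂ and σ ↦ -σ. The remaining scalar is exp(πi(k - n/2)), and k -
n/2 = 2 for the weight k = 1 + (n + 2)/2. -/
theorem IsJacobiForm.even [DiscreteTopology Λ] [IsZLattice ℝ Λ]
    (hΛ : ∀ x ∈ Λ, ∃ m : ℤ, inner ℝ x x = 2 * (m : ℝ)) {η : dualLattice (lorLattice Λ)}
    {φ : ℂ → ℂ → Disc (lorLattice Λ) → ℂ}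
    (hφ : IsJacobiForm (lorLattice Λ) n (1 + ((n : ℝ) + 2) / 2) η φ)
    {τ₁ : ℂ} (hτ : 0 < τ₁.im) (τ₂ : ℂ) (σ : Disc (lorLattice Λ)) :
    φ τ₁ (-τ₂) (-σ) = φ τ₁ τ₂ σ := by
  have hτ0 : τ₁ ≠ 0 := by rintro rfl; simp at hτ
  have him : 0 < (-1 / τ₁).im := by
    have : (-1 / τ₁).im = τ₁.im / Complex.normSq τ₁ := by
      rw [neg_div, one_div, neg_im, inv_im]; ring
    rw [this]
    exact div_pos hτ (Complex.normSq_pos.mpr hτ0)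
  have h1 := hφ.transS (-1 / τ₁) (τ₂ / τ₁) him
  have e1 : -1 / (-1 / τ₁) = τ₁ := by field_simp
  have e2 : τ₂ / τ₁ / (-1 / τ₁) = -τ₂ := by field_simp
  rw [e1, e2, hφ.transS τ₁ τ₂ hτ, weilS_smul, smul_smul] at h1
  have h2 := congrFun h1 (-σ)
  rw [Pi.smul_apply, weilS_weilS hΛ, neg_neg, smul_eq_mul] at h2
  rw [h2]
  set k : ℝ := 1 + ((n : ℝ) + 2) / 2 with hk
  have e3 : e (q (η : V n) * (τ₂ / τ₁) ^ 2 / (-1 / τ₁)) * e (q (η : V n) * τ₂ ^ 2 / τ₁) = 1 := by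
    rw [← e_add]; convert e_zero using 2; field_simp; ring
  have e4 : (-1 / τ₁) ^ (k : ℂ) * τ₁ ^ (k : ℂ) * cexp (-(Real.pi * I / 2) * (n : ℤ)) = 1 := by
    rw [Complex.cpow_def_of_ne_zero (div_ne_zero (by norm_num) hτ0),
      Complex.cpow_def_of_ne_zero hτ0, log_neg_one_div hτ, ← Complex.exp_add, ← Complex.exp_add,
      Complex.exp_eq_one_iff]
    refine ⟨1, ?_⟩
    rw [hk]; push_cast; ring
  linear_combination (φ τ₁ τ₂ σ * (-1 / τ₁) ^ (k : ℂ) * τ₁ ^ (k : ℂ) *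
    cexp (-(Real.pi * I / 2) * (n : ℤ))) * e3 + φ τ₁ τ₂ σ * e4

/-- The Fourier coefficients `a(λ, q(λ), (λ, η))`. -/
def diagCoeff (η : dualLattice (posLattice Λ)) (a : Disc (lorLattice Λ) → ℝ → ℝ → ℂ)
    (x : dualLattice (posLattice Λ)) : ℂ :=
  a (cls (toLorDual x)) (q (x : V n)) (bil (x : V n) η)

theorem diagCoeff_neg [DiscreteTopology Λ] [IsZLattice ℝ Λ]
    (hΛ : ∀ x ∈ Λ, ∃ m : ℤ, inner ℝ x x = 2 * (m : ℝ)) {η : dualLattice (posLattice Λ)}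
    {φ : ℂ → ℂ → Disc (lorLattice Λ) → ℂ} {a : Disc (lorLattice Λ) → ℝ → ℝ → ℂ}
    (hφ : IsJacobiCuspForm (lorLattice Λ) n (1 + ((n : ℝ) + 2) / 2) (toLorDual η) φ a)
    (x : dualLattice (posLattice Λ)) : diagCoeff η a (-x) = diagCoeff η a x := by
  have hexp : HasFourierExpansion (toLorDual η) φ fun σ r s => a (-σ) r (-s) := by
    intro ν τ₁ τ₂ hτ
    have h := hφ.fourier (-ν) τ₁ (-τ₂) hτ
    have hcls : cls (-ν) = -cls ν := rfl
    rw [hcls, hφ.jacobi.even hΛ hτ] at h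
    rw [← ((Equiv.refl ℤ).prodCongr (Equiv.neg ℤ)).hasSum_iff] at h
    refine h.congr_fun ?_ |> fun h => h
    intro p
    simp only [Function.comp, Equiv.prodCongr_apply, Prod.map, Equiv.refl_apply, Equiv.neg_apply,
      AddSubgroup.coe_neg, q_neg, bil_neg_left]
    push_cast
    ring_nf
  have h1 := hφ.fourier.integral_eq (toLorDual x) one_pos 0
  have h2 := hexp.integral_eq (toLorDual x) one_pos 0
  rw [h1] at h2
  have h3 := mul_right_cancel₀ (ofReal_ne_zero.mpr (Real.exp_pos _).ne') h2
  unfold diagCoeff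
  have e1 : q ((-x : dualLattice (posLattice Λ)) : V n) = q (x : V n) := q_neg _
  have e2 : bil ((-x : dualLattice (posLattice Λ)) : V n) η = -bil (x : V n) η := bil_neg_left _ _
  rw [e1, e2]
  exact h3.symm

/-- The Heisenberg translation τ₂ ↦ τ₂ + τ₁ identifies the component x + η on the line c = 0 with
the component x on the line c = 1. The integral formula is evaluated on both lines. -/
theorem diagCoeff_add [DiscreteTopology Λ] [IsZLattice ℝ Λ] {η : dualLattice (posLattice Λ)}
    {φ : ℂ → ℂ → Disc (lorLattice Λ) → ℂ} {a : Disc (lorLattice Λ) → ℝ → ℝ → ℂ} {sig : ℤ} {k : ℝ}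
    (hφ : IsJacobiCuspForm (lorLattice Λ) sig k (toLorDual η) φ a)
    (x : dualLattice (posLattice Λ)) : diagCoeff η a (x + η) = diagCoeff η a x := by
  set m := q (η : V n) with hm
  have hq : q ((x + η : dualLattice (posLattice Λ)) : V n) = q (x : V n) + bil (x : V n) η + m :=
    q_add _ _
  have hb : bil ((x + η : dualLattice (posLattice Λ)) : V n) η = bil (x : V n) η + 2 * m := by
    rw [AddSubgroup.coe_add, bil_add_left, bil_self]
  have h1 := hφ.fourier.integral_eq (toLorDual (x + η)) one_pos 0
  have h2 := hφ.fourier.integral_eq (toLorDual x) one_pos 1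
  have hpt : ∀ p : ℝ × ℝ, φ (p.1 + (1 : ℝ) * I) (p.2 + (0 : ℝ) * (p.1 + (1 : ℝ) * I))
      (cls (toLorDual (x + η))) * e (-(q ((x + η : dualLattice (posLattice Λ)) : V n) * p.1 +
        bil ((x + η : dualLattice (posLattice Λ)) : V n) η * (p.2 + 0 * p.1) : ℝ)) =
      (Real.exp (-(2 * Real.pi * m)) : ℝ) *
        (φ (p.1 + (1 : ℝ) * I) (p.2 + (1 : ℝ) * (p.1 + (1 : ℝ) * I)) (cls (toLorDual x)) *
        e (-(q (x : V n) * p.1 + bil (x : V n) η * (p.2 + 1 * p.1) : ℝ))) := by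
    intro p
    have hheis := congrFun (hφ.jacobi.heis 0 1 0 (p.1 + (1 : ℝ) * I) p.2 (by simp))
      (cls (toLorDual x))
    have hcls : cls (toLorDual x) + (1 : ℤ) • cls (toLorDual η) = cls (toLorDual (x + η)) := by
      rw [one_smul]; rfl
    have hmq : q ((toLorDual η : dualLattice (lorLattice Λ)) : V n) = m := rfl
    simp only [Pi.smul_apply, weilH, hcls, smul_eq_mul, hmq] at hheis
    simp only [Int.cast_zero, Int.cast_one, add_zero, one_mul, zero_mul, mul_one, sub_zero,
      one_pow, ofReal_zero, e_zero] at hheis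
    rw [hq, hb]
    have e1 : (p.2 : ℂ) + (1 : ℝ) * (p.1 + (1 : ℝ) * I) = p.2 + (p.1 + (1 : ℝ) * I) := by simp
    have e2 : (p.2 : ℂ) + (0 : ℝ) * (p.1 + (1 : ℝ) * I) = p.2 := by simp
    rw [e1, e2]
    simp only [ofReal_one, one_mul] at hheis ⊢
    rw [hheis]
    have e3 : -(m * (p.1 + I)) - 2 * m * p.2 = ((-(m * p.1 + 2 * m * p.2) : ℝ) : ℂ) + ((-m : ℝ) : ℂ) * I := by
      push_cast; ring
    rw [e3, e_add_mul_I]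
    have e4 : (Real.exp (-(2 * Real.pi * m)) : ℂ) * (Real.exp (-(2 * Real.pi * -m)) : ℂ) = 1 := by
      rw [← ofReal_mul, ← Real.exp_add]; simp
    have e5 : e ((-(m * p.1 + 2 * m * p.2) : ℝ) : ℂ) *
        e (-(q (x : V n) * p.1 + bil (x : V n) η * (p.2 + p.1) : ℝ)) =
        e (-((q (x : V n) + bil (x : V n) η + m) * p.1 +
          (bil (x : V n) η + 2 * m) * (p.2 + 0 * p.1) : ℝ)) := by
      rw [← e_add]; congr 1; push_cast; ring
    rw [← e5]
    linear_combination (-(φ (p.1 + I) p.2 (cls (toLorDual (x + η)))) *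
      e ((-(m * p.1 + 2 * m * p.2) : ℝ) : ℂ) *
        e (-(q (x : V n) * p.1 + bil (x : V n) η * (p.2 + p.1) : ℝ))) * e4
  have h3 := (integral_congr_ae (Eventually.of_forall hpt)).symm.trans h1
  rw [integral_const_mul] at h3
  have h4 := h3.symm.trans (congrArg _ h2)
  change diagCoeff η a (x + η) * _ = _ * (diagCoeff η a x * _) at h4
  have hcoe : ((toLorDual (x + η) : dualLattice (lorLattice Λ)) : V n) =
    ((x + η : dualLattice (posLattice Λ)) : V n) := rfl
  have hcoe2 : ((toLorDual x : dualLattice (lorLattice Λ)) : V n) = x := rfl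
  have hcoe3 : ((toLorDual η : dualLattice (lorLattice Λ)) : V n) = η := rfl
  have hE : -(2 * Real.pi * (1 * (q ((x + η : dualLattice (posLattice Λ)) : V n) + 0 *
      bil ((x + η : dualLattice (posLattice Λ)) : V n) η))) =
      -(2 * Real.pi * m) + -(2 * Real.pi * (1 * (q (x : V n) + 1 * bil (x : V n) η))) := by
    rw [hq]; ring
  rw [hcoe, hcoe2, hcoe3, hE, Real.exp_add, ofReal_mul] at h4
  have hne : (Real.exp (-(2 * Real.pi * m)) : ℂ) *
      (Real.exp (-(2 * Real.pi * (1 * (q (x : V n) + 1 * bil (x : V n) η)))) : ℂ) ≠ 0 :=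
    mul_ne_zero (ofReal_ne_zero.mpr (Real.exp_pos _).ne') (ofReal_ne_zero.mpr (Real.exp_pos _).ne')
  refine mul_right_cancel₀ hne ?_
  linear_combination h4

end JacobiForm
end
end JacobiLift

namespace JacobiLift

noncomputable section

open Complex MeasureTheory Filter Topology Asymptotics Set

/-! ### Isometries from orthonormal families -/

section Frames
variable {n : ℕ}

theorem sgn_mul_self (i : Fin (n + 4)) : sgn i * sgn i = 1 := by
  unfold sgn; split_ifs <;> norm_num

theorem bil_eq_dotProduct (x y : V n) : bil x y = x ⬝ᵥ (Matrix.diagonal sgn).mulVec y := by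
  unfold bil dotProduct
  refine Finset.sum_congr rfl fun i _ => ?_
  rw [Matrix.mulVec_diagonal]; ring

/-- The linear map with rows the vectors of an orthonormal family. -/
def frameMap (w : Fin (n + 4) → V n) : V n →ₗ[ℝ] V n where
  toFun x := fun i => sgn i * bil x (w i)
  map_add' x y := by funext i; simp [bil_add_left, mul_add]
  map_smul' c x := by funext i; simp [bil_smul_left]; ring

theorem frameMap_self {w : Fin (n + 4) → V n}
    (hw : ∀ i j, bil (w i) (w j) = if i = j then sgn i else 0) (j : Fin (n + 4)) :
    frameMap w (w j) = Pi.single j 1 := by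
  funext i
  change sgn i * bil (w j) (w i) = _
  rw [hw, Pi.single_apply]
  by_cases h : i = j
  · subst h; simp [sgn_mul_self]
  · simp [h, Ne.symm h]

theorem frameMap_surjective {w : Fin (n + 4) → V n}
    (hw : ∀ i j, bil (w i) (w j) = if i = j then sgn i else 0) :
    Function.Surjective (frameMap w) := by
  intro y
  refine ⟨∑ i, y i • w i, ?_⟩
  rw [map_sum]
  simp_rw [map_smul, frameMap_self hw]
  funext j
  simp [Finset.sum_apply, Pi.single_apply]

/-- The isometry with rows the vectors of an orthonormal family. -/
def frameEquiv (w : Fin (n + 4) → V n)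
    (hw : ∀ i j, bil (w i) (w j) = if i = j then sgn i else 0) : V n ≃ₗ[ℝ] V n :=
  LinearEquiv.ofBijective (frameMap w)
    ⟨LinearMap.injective_iff_surjective.mpr (frameMap_surjective hw), frameMap_surjective hw⟩

theorem frameEquiv_apply {w : Fin (n + 4) → V n}
    (hw : ∀ i j, bil (w i) (w j) = if i = j then sgn i else 0) (x : V n) (i : Fin (n + 4)) :
    frameEquiv w hw x i = sgn i * bil x (w i) := rfl

theorem isIsometry_frameEquiv {w : Fin (n + 4) → V n}
    (hw : ∀ i j, bil (w i) (w j) = if i = j then sgn i else 0) :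
    IsIsometry (frameEquiv w hw) := by
  intro x y
  have hx : x = ∑ i, frameEquiv w hw x i • w i := by
    refine (frameEquiv w hw).injective ?_
    rw [map_sum]
    have : ∀ i, frameEquiv w hw (w i) = Pi.single i 1 := frameMap_self hw
    simp_rw [map_smul, this]
    funext j
    simp [Finset.sum_apply, Pi.single_apply]
  conv_rhs => rw [hx]
  rw [bil_sum_left]
  unfold bil
  refine Finset.sum_congr rfl fun i _ => ?_
  change _ = bil (_ • w i) y
  rw [bil_smul_left, bil_comm, frameEquiv_apply hw y]
  linear_combination (frameEquiv w hw x i * bil y (w i)) * sgn_mul_self i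

/-- Determinants are compared in GᵀDG = D, with D the diagonal Gram matrix. -/
theorem IsIsometry.det_sq {g : V n ≃ₗ[ℝ] V n} (hg : IsIsometry g) :
    LinearMap.det (g : V n →ₗ[ℝ] V n) = 1 ∨ LinearMap.det (g : V n →ₗ[ℝ] V n) = -1 := by
  set G := LinearMap.toMatrix' (g : V n →ₗ[ℝ] V n) with hG
  have hmul : ∀ x, G.mulVec x = g x := fun x => LinearMap.toMatrix'_mulVec _ x
  have h : G.transpose * Matrix.diagonal sgn * G = Matrix.diagonal sgn := by
    ext i j
    have h1 := hg (Pi.single i 1) (Pi.single j 1)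
    rw [bil_eq_dotProduct, bil_eq_dotProduct, ← hmul, ← hmul, Matrix.dotProduct_mulVec,
      Matrix.vecMul_mulVec, ← Matrix.dotProduct_mulVec, Matrix.mulVec_mulVec] at h1
    have h2 : (Matrix.diagonal sgn : Matrix (Fin (n + 4)) (Fin (n + 4)) ℝ) i j =
        (Pi.single i 1 : V n) j * sgn j := by
      rw [Matrix.diagonal_apply, Pi.single_apply]
      by_cases h : i = j
      · subst h; simp
      · simp [h, Ne.symm h]
    rw [h2]
    simpa [Matrix.mulVec_single_one, Matrix.mul_assoc] using h1
  have h2 := congrArg Matrix.det h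
  rw [Matrix.det_mul, Matrix.det_mul, Matrix.det_transpose] at h2
  have h3 : (Matrix.diagonal (sgn : Fin (n + 4) → ℝ)).det ≠ 0 := by
    rw [Matrix.det_diagonal]
    exact Finset.prod_ne_zero_iff.mpr fun i _ h => by have := sgn_mul_self i; simp [h] at this
  have h4 : G.det * G.det = 1 := by
    have : (G.det * G.det - 1) * (Matrix.diagonal (sgn : Fin (n + 4) → ℝ)).det = 0 := by
      linear_combination h2
    rcases mul_eq_zero.mp this with h | h
    · linarith
    · exact absurd h h3
  rw [← LinearMap.det_toMatrix', ← hG]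
  exact mul_self_eq_one_iff.mp h4

/-- The reflection in a coordinate hyperplane. -/
def reflCoord (k : Fin (n + 4)) : V n ≃ₗ[ℝ] V n :=
  LinearEquiv.piCongrRight fun i => if i = k then LinearEquiv.neg ℝ else LinearEquiv.refl ℝ ℝ

theorem reflCoord_apply (k i : Fin (n + 4)) (x : V n) :
    reflCoord k x i = if i = k then -x i else x i := by
  unfold reflCoord
  rw [LinearEquiv.piCongrRight_apply]
  split_ifs <;> simp

theorem isIsometry_reflCoord (k : Fin (n + 4)) : IsIsometry (reflCoord k : V n ≃ₗ[ℝ] V n) := by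
  intro x y
  unfold bil
  refine Finset.sum_congr rfl fun i _ => ?_
  rw [reflCoord_apply, reflCoord_apply]
  split_ifs <;> ring

theorem det_reflCoord (k : Fin (n + 4)) :
    LinearMap.det ((reflCoord k : V n ≃ₗ[ℝ] V n) : V n →ₗ[ℝ] V n) = -1 := by
  have : ((reflCoord k : V n ≃ₗ[ℝ] V n) : V n →ₗ[ℝ] V n) =
      Matrix.toLin' (Matrix.diagonal fun i => if i = k then -1 else 1) := by
    refine LinearMap.ext fun x => funext fun i => ?_
    rw [Matrix.toLin'_apply, Matrix.mulVec_diagonal]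
    change reflCoord k x i = _
    rw [reflCoord_apply]
    split_ifs <;> ring
  rw [this, LinearMap.det_toLin', Matrix.det_diagonal, Finset.prod_ite_eq' ]
  simp

/-- An isometry can be given determinant one by changing the sign of one coordinate. -/
theorem IsIsometry.exists_det_eq_one {g : V n ≃ₗ[ℝ] V n} (hg : IsIsometry g) (k : Fin (n + 4)) :
    ∃ g' : V n ≃ₗ[ℝ] V n, IsIsometry g' ∧ LinearMap.det (g' : V n →ₗ[ℝ] V n) = 1 ∧
      (∀ x i, i ≠ k → g' x i = g x i) ∧ ∀ x, g x k = 0 → g' x = g x := by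
  rcases hg.det_sq with h | h
  · exact ⟨g, hg, h, fun _ _ _ => rfl, fun _ _ => rfl⟩
  · refine ⟨g.trans (reflCoord k), fun x y => ?_, ?_, fun x i hi => ?_, fun x hx => ?_⟩
    · rw [LinearEquiv.trans_apply, LinearEquiv.trans_apply, isIsometry_reflCoord, hg]
    · rw [LinearEquiv.coe_trans, LinearMap.det_comp, det_reflCoord, h]; norm_num
    · rw [LinearEquiv.trans_apply, reflCoord_apply, if_neg hi]
    · funext i
      rw [LinearEquiv.trans_apply, reflCoord_apply]
      split_ifs with hi
      · subst hi; rw [hx, neg_zero]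
      · rfl

/-- The isotropic vector `ũ' + v - q(v) ũ`. -/
def uTwist (v : V n) : V n := uTilde' n + v - q v • uTilde n

theorem bil_uTwist_uTwist {v : V n} (hv : IsPos v) : bil (uTwist v) (uTwist v) = 0 := by
  simp only [uTwist, bil_add_left, bil_add_right, bil_sub_left, bil_sub_right, bil_smul_left,
    bil_smul_right, bil_comm _ v, hv.bil_uTilde, hv.bil_uTilde', bil_uTilde_uTilde,
    bil_uTilde'_uTilde', bil_uTilde_uTilde', bil_comm (uTilde' n) (uTilde n), bil_self v]
  ring

theorem bil_uTilde_uTwist {v : V n} (hv : IsPos v) : bil (uTilde n) (uTwist v) = 1 := by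
  simp only [uTwist, bil_add_right, bil_sub_right, bil_smul_right, bil_comm _ v, hv.bil_uTilde,
    bil_uTilde_uTilde, bil_uTilde_uTilde']
  ring

theorem IsPos.bil_uTwist {x : V n} (hx : IsPos x) (v : V n) : bil x (uTwist v) = bil x v := by
  simp only [uTwist, bil_add_right, bil_sub_right, bil_smul_right, hx.bil_uTilde, hx.bil_uTilde']
  ring

theorem IsPos.bil_eU {x : V n} (hx : IsPos x) (k : Fin 4) : bil x (eU k) = 0 := by
  rw [bil_eU_right, hx _ (by simp), mul_zero]

theorem bil_uTilde_eU (k : Fin 4) (hk : k = 1 ∨ k = 3) : bil (uTilde n) (eU k) = 0 := by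
  rw [bil_eU_right, uTilde_apply]; rcases hk with rfl | rfl <;> simp

theorem bil_uTilde'_eU (k : Fin 4) (hk : k = 1 ∨ k = 3) : bil (uTilde' n) (eU k) = 0 := by
  rw [bil_eU_right, uTilde'_apply]; rcases hk with rfl | rfl <;> simp

theorem bil_uTwist_eU {v : V n} (hv : IsPos v) (k : Fin 4) (hk : k = 1 ∨ k = 3) :
    bil (uTwist v) (eU k) = 0 := by
  rw [uTwist, bil_sub_left, bil_add_left, bil_smul_left, bil_uTilde_eU k hk, bil_uTilde'_eU k hk,
    hv.bil_eU]; ring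

/-- The image of the standard basis under the inverse of an Eichler transformation and a dilation,
followed by an orthogonal transformation `o` of `L⁺ ⊗ ℝ`. -/
def baseFrame (o : Fin n → V n) (v : V n) (t : ℝ) : Fin (n + 4) → V n :=
  Fin.addCases (fun i => o i - bil (o i) v • uTilde n)
    ![(1 / √2 : ℝ) • (t • uTilde n + t⁻¹ • uTwist v), eU 1,
      (1 / √2 : ℝ) • (t • uTilde n - t⁻¹ • uTwist v), eU 3]

/-- ũ and `uTwist v` form a hyperbolic pair, also after scaling by t and t⁻¹, so their normalized
sum and difference have norms 1 and -1. The correction -(o i, v)ũ makes o i orthogonal to `uTwist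
v`. -/
theorem bil_baseFrame {o : Fin n → V n} (ho : ∀ i, IsPos (o i))
    (horth : ∀ i j, bil (o i) (o j) = if i = j then 1 else 0) {v : V n} (hv : IsPos v) {t : ℝ}
    (ht : t ≠ 0) (i j : Fin (n + 4)) :
    bil (baseFrame o v t i) (baseFrame o v t j) = if i = j then sgn i else 0 := by
  have h2 : (√2)⁻¹ * (√2)⁻¹ = (1 / 2 : ℝ) := by
    rw [← mul_inv, Real.mul_self_sqrt (by norm_num)]; norm_num
  have htt : t * t⁻¹ = 1 := mul_inv_cancel₀ ht
  have hpp : ∀ i j, bil (o i - bil (o i) v • uTilde n) (o j - bil (o j) v • uTilde n) =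
      if i = j then 1 else 0 := by
    intro i j
    rw [← horth i j]
    simp only [bil_sub_left, bil_sub_right, bil_smul_left, bil_smul_right, (ho _).bil_uTilde,
      bil_comm (uTilde n) (o _), bil_uTilde_uTilde]
    ring
  have hpu : ∀ i, bil (o i - bil (o i) v • uTilde n) (uTilde n) = 0 := by
    intro i
    rw [bil_sub_left, bil_smul_left, (ho i).bil_uTilde, bil_uTilde_uTilde]; ring
  have hpt : ∀ i, bil (o i - bil (o i) v • uTilde n) (uTwist v) = 0 := by
    intro i
    rw [bil_sub_left, bil_smul_left, (ho i).bil_uTwist, bil_uTilde_uTwist hv]; ring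
  have hpe : ∀ i k, (k = 1 ∨ k = 3) → bil (o i - bil (o i) v • uTilde n) (eU k) = 0 := by
    intro i k hk
    rw [bil_sub_left, bil_smul_left, (ho i).bil_eU, bil_uTilde_eU k hk]; ring
  have hph : ∀ (i : Fin n) (k : Fin 4), bil (baseFrame o v t (Fin.castAdd 4 i))
      (baseFrame o v t (Fin.natAdd n k)) = 0 := by
    intro i k
    simp only [baseFrame, Fin.addCases_left, Fin.addCases_right]
    fin_cases k
    · simp [bil_smul_right, bil_add_right, hpu, hpt]
    · exact hpe i 1 (Or.inl rfl)
    · simp [bil_smul_right, bil_sub_right, hpu, hpt]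
    · exact hpe i 3 (Or.inr rfl)
  induction i using Fin.addCases with
  | left i =>
    induction j using Fin.addCases with
    | left j =>
      simp only [baseFrame, Fin.addCases_left]
      rw [hpp]
      simp only [Fin.castAdd_inj, sgn, Fin.val_castAdd, show (i : ℕ) < n + 2 by omega, if_true]
    | right k =>
      rw [hph, if_neg]
      intro h
      have := congrArg Fin.val h
      simp at this
      omega
  | right k =>
    induction j using Fin.addCases with
    | left j =>
      rw [bil_comm, hph, if_neg]
      intro h
      have := congrArg Fin.val h
      simp at this
      omega
    | right l =>
      have e1 : bil (eU 1 : V n) (eU 1) = 1 := by rw [bil_eU_right, eU_apply]; simp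
      have e3 : bil (eU 3 : V n) (eU 3) = -1 := by rw [bil_eU_right, eU_apply]; simp
      have e13 : bil (eU 1 : V n) (eU 3) = 0 := by rw [bil_eU_right, eU_apply]; simp
      simp only [baseFrame, Fin.addCases_right, Fin.natAdd_inj, sgn, Fin.val_natAdd,
        Nat.add_lt_add_iff_left]
      fin_cases k <;> fin_cases l <;>
        simp [bil_smul_left, bil_smul_right, bil_add_left, bil_add_right, bil_sub_left,
          bil_sub_right, bil_uTilde_uTilde, bil_uTwist_uTwist hv, bil_comm (uTwist v) (uTilde n),
          bil_uTilde_uTwist hv, e1, e3, e13, bil_comm (eU 3) (eU 1), bil_comm (eU _) (uTilde n),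
          bil_comm (eU _) (uTwist v), bil_uTilde_eU, bil_uTwist_eU hv] <;>
        first
          | linear_combination 2 * (√2)⁻¹ * (√2)⁻¹ * htt + 2 * h2
          | linear_combination -2 * (√2)⁻¹ * (√2)⁻¹ * htt - 2 * h2
          | ring

/-- The exchange of two positive coordinates of `L⁺ ⊗ ℝ` with the positive coordinates of the
hyperbolic planes. -/
def exchangePerm (i₀ i₁ : Fin n) : Equiv.Perm (Fin (n + 4)) :=
  (Equiv.swap (Fin.castAdd 4 i₀) (Fin.natAdd n 1)).trans
    (Equiv.swap (Fin.castAdd 4 i₁) (Fin.natAdd n 0))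

theorem castAdd_ne_natAdd (i : Fin n) (k : Fin 4) : Fin.castAdd 4 i ≠ Fin.natAdd n k := by
  intro h
  have := congrArg Fin.val h
  simp at this
  omega

theorem sgn_swap (i : Fin n) (k : Fin 4) (hk : (k : ℕ) < 2) (j : Fin (n + 4)) :
    sgn (Equiv.swap (Fin.castAdd 4 i) (Fin.natAdd n k) j) = sgn j := by
  have h1 : sgn (Fin.castAdd 4 i) = 1 := if_pos (by simp; omega)
  have h2 : sgn (Fin.natAdd n k) = 1 := if_pos (by simp; omega)
  rw [Equiv.swap_apply_def]
  split_ifs with ha hb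
  · rw [ha, h1, h2]
  · rw [hb, h1, h2]
  · rfl

theorem sgn_exchangePerm (i₀ i₁ : Fin n) (j : Fin (n + 4)) : sgn (exchangePerm i₀ i₁ j) = sgn j := by
  rw [exchangePerm, Equiv.trans_apply, sgn_swap _ _ (by norm_num), sgn_swap _ _ (by norm_num)]

theorem exists_orthonormal_extension {i₀ i₂ : Fin n} (h02 : i₀ ≠ i₂) {f : V n} (hf : IsPos f)
    (hf1 : bil f f = 1) (hf0 : bil f (eP i₀) = 0) :
    ∃ o : Fin n → V n, (∀ i, IsPos (o i)) ∧ (∀ i j, bil (o i) (o j) = if i = j then 1 else 0) ∧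
      o i₀ = eP i₀ ∧ o i₂ = f := by
  classical
  obtain ⟨F, rfl⟩ := hf.exists_embedPos
  have heP : embedPos n (EuclideanSpace.single i₀ 1) = eP i₀ := by
    funext k
    induction k using Fin.addCases with
    | left k => simp [embedPos, eP, Pi.single_apply]
    | right k => simp [embedPos, eP, (castAdd_ne_natAdd _ _).symm]
  rw [← heP, bil_embedPos] at hf0
  rw [bil_embedPos] at hf1
  let w : Fin n → EuclideanSpace ℝ (Fin n) := fun i => if i = i₀ then EuclideanSpace.single i₀ 1 else F
  have hw : Orthonormal ℝ (({i₀, i₂} : Set (Fin n)).domRestrict w) := by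
    rw [orthonormal_iff_ite]
    rintro ⟨i, hi⟩ ⟨j, hj⟩
    simp only [Set.domRestrict_apply, Subtype.mk.injEq]
    rcases hi with rfl | rfl <;> rcases hj with rfl | rfl
    · simp [w]
    · simp only [w, if_true, if_neg h02, if_neg h02.symm]
      rw [real_inner_comm]; exact hf0
    · simp only [w, if_true, if_neg h02.symm]; exact hf0
    · simp only [w, if_true, if_neg h02.symm]; exact hf1
  obtain ⟨b, hb⟩ := hw.exists_orthonormalBasis_extension_of_card_eq (by simp)
  refine ⟨fun i => embedPos n (b i), fun i => isPos_embedPos _, fun i j => ?_, ?_, ?_⟩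
  · rw [bil_embedPos]; exact orthonormal_iff_ite.mp b.orthonormal i j
  · change embedPos n (b i₀) = _
    rw [hb i₀ (by simp), ← heP]; simp [w]
  · change embedPos n (b i₂) = _
    rw [hb i₂ (by simp)]; simp [w, h02.symm]

/-- The family driving the argument: v shears, t dilates, f is rotated into the coordinate i₂, and
e_{i₀}, e_{i₁} trade places with e_b, e_{b-1}. Only the coordinates seen by the theta kernel are
recorded. The Eichler transformation moves e_{i₀} unless (v, e_{i₀}) = 0, hence the condition for
g(e_{i₀}) = e_b. -/
theorem exists_isometry {i₀ i₁ i₂ : Fin n} (h01 : i₀ ≠ i₁) (h02 : i₀ ≠ i₂) (h12 : i₁ ≠ i₂) {f v : V n}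
    (hf : IsPos f) (hf1 : bil f f = 1) (hf0 : bil f (eP i₀) = 0) (hv : IsPos v) {t : ℝ}
    (ht : t ≠ 0) :
    ∃ g : V n ≃ₗ[ℝ] V n, IsIsometry g ∧ LinearMap.det (g : V n →ₗ[ℝ] V n) = 1 ∧
      g (eU 1) = eP i₀ ∧ g (eU 3) = eU 3 ∧ (bil v (eP i₀) = 0 → g (eP i₀) = eU 1) ∧
      ∀ x, IsPos x → ∀ j d : ℝ,
        g (x + j • uTilde' n + d • uTilde n) (Fin.castAdd 4 i₁) =
          (j * t + (d + bil x v - q v * j) / t) / √2 ∧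
        g (x + j • uTilde' n + d • uTilde n) (Fin.castAdd 4 i₂) = bil (x - j • v) f ∧
        g (x + j • uTilde' n + d • uTilde n) (Fin.natAdd n 2) =
          -((j * t - (d + bil x v - q v * j) / t) / √2) ∧
        g (x + j • uTilde' n + d • uTilde n) (Fin.natAdd n 3) = 0 := by
  obtain ⟨o, ho, horth, ho0, ho2⟩ := exists_orthonormal_extension h02 hf hf1 hf0
  set π := exchangePerm i₀ i₁ with hπ
  have hw : ∀ i j, bil (baseFrame o v t (π i)) (baseFrame o v t (π j)) =
      if i = j then sgn i else 0 := by
    intro i j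
    rw [bil_baseFrame ho horth hv ht, sgn_exchangePerm]
    simp
  have hc0 : (Fin.castAdd 4 i₀ : Fin (n + 4)) ≠ Fin.castAdd 4 i₁ := by simpa using h01
  have π0 : π (Fin.castAdd 4 i₀) = Fin.natAdd n 1 := by
    rw [hπ, exchangePerm, Equiv.trans_apply, Equiv.swap_apply_left, Equiv.swap_apply_of_ne_of_ne
      (castAdd_ne_natAdd _ _).symm (by simp)]
  have π1 : π (Fin.castAdd 4 i₁) = Fin.natAdd n 0 := by
    rw [hπ, exchangePerm, Equiv.trans_apply, Equiv.swap_apply_of_ne_of_ne hc0.symm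
      (castAdd_ne_natAdd _ _), Equiv.swap_apply_left]
  have π2 : π (Fin.castAdd 4 i₂) = Fin.castAdd 4 i₂ := by
    rw [hπ, exchangePerm, Equiv.trans_apply, Equiv.swap_apply_of_ne_of_ne (by simpa using h02.symm)
      (castAdd_ne_natAdd _ _), Equiv.swap_apply_of_ne_of_ne (by simpa using h12.symm)
      (castAdd_ne_natAdd _ _)]
  have πb : π (Fin.natAdd n 1) = Fin.castAdd 4 i₀ := by
    rw [hπ, exchangePerm, Equiv.trans_apply, Equiv.swap_apply_right,
      Equiv.swap_apply_of_ne_of_ne hc0 (castAdd_ne_natAdd _ _)]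
  have πh : ∀ k : Fin 4, k ≠ 0 → k ≠ 1 → π (Fin.natAdd n k) = Fin.natAdd n k := by
    intro k h0 h1
    rw [hπ, exchangePerm, Equiv.trans_apply, Equiv.swap_apply_of_ne_of_ne
      (castAdd_ne_natAdd _ _).symm (by simpa using h1), Equiv.swap_apply_of_ne_of_ne
      (castAdd_ne_natAdd _ _).symm (by simpa using h0)]
  set g := frameEquiv (fun i => baseFrame o v t (π i)) hw with hg
  have hself : ∀ j, g (baseFrame o v t (π j)) = Pi.single j 1 := fun j => frameMap_self hw j
  have h1 : g (eU 1) = eP i₀ := by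
    have := hself (Fin.castAdd 4 i₀)
    rwa [π0, baseFrame, Fin.addCases_right] at this
  have h3 : g (eU 3) = eU 3 := by
    have := hself (Fin.natAdd n 3)
    rwa [πh 3 (by decide) (by decide), baseFrame, Fin.addCases_right] at this
  have h4 : bil v (eP i₀) = 0 → g (eP i₀) = eU 1 := by
    intro h
    have := hself (Fin.natAdd n 1)
    rwa [πb, baseFrame, Fin.addCases_left, ho0, bil_comm, h, zero_smul, sub_zero] at this
  -- The determinant is corrected in the coordinate e_{b-1}, which none of the recorded data
  -- involves.
  obtain ⟨g', hg', hdet, hne, heq⟩ := (isIsometry_frameEquiv hw).exists_det_eq_one (Fin.natAdd n 0)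
  rw [← hg] at hne heq
  refine ⟨g', hg', hdet, ?_, ?_, fun h => ?_, fun x hx j d => ?_⟩
  · rw [heq _ (by rw [h1, eP]; simp [(castAdd_ne_natAdd _ _).symm]), h1]
  · rw [heq _ (by rw [h3, eU_apply]; simp), h3]
  · rw [heq _ (by rw [h4 h, eU_apply]; simp), h4 h]
  · have hu : bil (x + j • uTilde' n + d • uTilde n) (uTilde n) = j := by
      simp only [bil_add_left, bil_smul_left, hx.bil_uTilde, bil_uTilde_uTilde,
        bil_comm (uTilde' n) (uTilde n), bil_uTilde_uTilde']; ring
    have hp : ∀ y, IsPos y → bil (x + j • uTilde' n + d • uTilde n) y = bil x y := by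
      intro y hy
      rw [bil_add_left, bil_add_left, bil_smul_left, bil_smul_left, bil_comm (uTilde' n) y,
        bil_comm (uTilde n) y, hy.bil_uTilde, hy.bil_uTilde']; ring
    have htw : bil (x + j • uTilde' n + d • uTilde n) (uTwist v) = d + bil x v - q v * j := by
      have hu' : bil (uTilde' n) (uTwist v) = -q v := by
        simp only [uTwist, bil_add_right, bil_sub_right, bil_smul_right, bil_uTilde'_uTilde',
          bil_comm (uTilde' n) v, hv.bil_uTilde', bil_comm (uTilde' n) (uTilde n),
          bil_uTilde_uTilde']
        ring
      rw [bil_add_left, bil_add_left, bil_smul_left, bil_smul_left, hx.bil_uTwist, hu',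
        bil_uTilde_uTwist hv]; ring
    have he3 : bil (x + j • uTilde' n + d • uTilde n) (eU 3) = 0 := by
      rw [bil_add_left, bil_add_left, bil_smul_left, bil_smul_left, hx.bil_eU,
        bil_uTilde'_eU 3 (Or.inr rfl), bil_uTilde_eU 3 (Or.inr rfl)]; ring
    have hsp : ∀ i : Fin n, sgn (Fin.castAdd 4 i) = 1 := fun i => if_pos (by simp; omega)
    have hs2 : sgn (Fin.natAdd n 2) = -1 := if_neg (by simp)
    refine ⟨?_, ?_, ?_, ?_⟩
    · rw [hne _ _ (castAdd_ne_natAdd _ _), hg, frameEquiv_apply, π1, baseFrame, Fin.addCases_right,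
        hsp]
      simp only [Matrix.cons_val_zero, bil_smul_right, bil_add_right, hu, htw]
      ring
    · rw [hne _ _ (castAdd_ne_natAdd _ _), hg, frameEquiv_apply, π2, baseFrame, Fin.addCases_left,
        hsp, ho2, bil_sub_right, bil_smul_right, hp f hf, hu, bil_sub_left, bil_smul_left,
        bil_comm f v]
      ring
    · rw [hne _ _ (by simp), hg, frameEquiv_apply, πh 2 (by decide) (by decide), baseFrame,
        Fin.addCases_right, hs2]
      change -1 * bil _ ((1 / √2 : ℝ) • (t • uTilde n - t⁻¹ • uTwist v)) = _
      simp only [bil_smul_right, bil_sub_right, hu, htw]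
      ring
    · rw [hne _ _ (by simp), hg, frameEquiv_apply, πh 3 (by decide) (by decide), baseFrame,
        Fin.addCases_right]
      change _ * bil _ (eU 3) = _
      rw [he3, mul_zero]

end Frames
end
end JacobiLift

namespace JacobiLift

noncomputable section

open Complex MeasureTheory Filter Topology Asymptotics Set

/-! ### The reduced polynomial and its heat evolution -/

section Poly
variable {n : ℕ}

theorem posPart_single (i : Fin (n + 4)) (h : (i : ℕ) < n + 2) :
    posPart (Pi.single i 1 : V n) = Pi.single i 1 := by
  funext k
  unfold posPart
  by_cases hk : k = i
  · subst hk; simp [h]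
  · simp [hk]

theorem negPart_single (i : Fin (n + 4)) (h : (i : ℕ) < n + 2) :
    negPart (Pi.single i 1 : V n) = 0 := by
  funext k
  unfold negPart
  by_cases hk : k = i
  · subst hk; simp [h]
  · simp [hk]

theorem posPart_single' (i : Fin (n + 4)) (h : ¬(i : ℕ) < n + 2) :
    posPart (Pi.single i 1 : V n) = 0 := by
  funext k
  unfold posPart
  by_cases hk : k = i
  · subst hk; simp [h]
  · simp [hk]

theorem negPart_single' (i : Fin (n + 4)) (h : ¬(i : ℕ) < n + 2) :
    negPart (Pi.single i 1 : V n) = Pi.single i 1 := by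
  funext k
  unfold negPart
  by_cases hk : k = i
  · subst hk; simp [h]
  · simp [hk]

theorem posPart_add_negPart (x : V n) : posPart x + negPart x = x := by
  funext i
  simp only [posPart, negPart, Pi.add_apply]
  split_ifs <;> ring

theorem posPart_add_smul (c : ℝ) (x y : V n) : posPart (c • (x + y)) = c • (posPart x + posPart y) := by
  funext i
  simp only [posPart, Pi.smul_apply, Pi.add_apply, smul_eq_mul]
  split_ifs <;> ring

theorem negPart_add_smul (c : ℝ) (x y : V n) : negPart (c • (x + y)) = c • (negPart x + negPart y) := by
  funext i
  simp only [negPart, Pi.smul_apply, Pi.add_apply, smul_eq_mul]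
  split_ifs <;> ring

variable {g : V n ≃ₗ[ℝ] V n} {i₀ : Fin n}

theorem map_u (h1 : g (eU 1) = eP i₀) (h3 : g (eU 3) = eU 3) :
    g (u n) = (1 / √2 : ℝ) • (eP i₀ + eU 3) := by
  rw [u, map_smul, map_add, h1, h3]

theorem uzPerp_eq (h1 : g (eU 1) = eP i₀) (h3 : g (eU 3) = eU 3) :
    uzPerp g = (1 / √2 : ℝ) • eU 1 := by
  rw [uzPerp, projZperp, map_u h1 h3, posPart_add_smul, eP, eU, posPart_single _ (by simp; omega),
    posPart_single' _ (by simp), add_zero, LinearEquiv.symm_apply_eq, map_smul]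
  exact congrArg _ h1.symm

theorem uz_eq (h1 : g (eU 1) = eP i₀) (h3 : g (eU 3) = eU 3) :
    uz g = (1 / √2 : ℝ) • eU 3 := by
  rw [uz, projZ, map_u h1 h3, negPart_add_smul, eP, eU, negPart_single _ (by simp; omega),
    negPart_single' _ (by simp), zero_add, LinearEquiv.symm_apply_eq, map_smul]
  exact congrArg _ h3.symm

/-- Since u_{z^⊥} and u_z are multiples of e_b and e_{b+2}, nothing is projected away on vectors
orthogonal to both; this covers all of M ⊗ ℝ. -/
theorem gM_apply (h1 : g (eU 1) = eP i₀) (h3 : g (eU 3) = eU 3) {x : V n}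
    (hx1 : bil x (eU 1) = 0) (hx3 : bil x (eU 3) = 0) : gM g x = g x := by
  have e1 : bil x (uzPerp g) = 0 := by rw [uzPerp_eq h1 h3, bil_smul_right, hx1, mul_zero]
  have e3 : bil x (uz g) = 0 := by rw [uz_eq h1 h3, bil_smul_right, hx3, mul_zero]
  rw [gM, projWperp, projW, e1, e3, zero_div, zero_div, zero_smul, zero_smul, sub_zero, sub_zero,
    projZperp, projZ, ← map_add, posPart_add_negPart, LinearEquiv.apply_symm_apply]

open MvPolynomial in
-- With y = e_{i₀}/√2 the projection kills exactly the coordinate i₀, and y/(y, y) = √2 e_{i₀}.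
theorem splitPoly_X (h1 : g (eU 1) = eP i₀) (h3 : g (eU 3) = eU 3) (p : Fin n × Fin 2) :
    splitPoly g (X (Fin.castAdd 4 p.1, p.2)) =
      if p.1 = i₀ then X p.2 * C (C ((√2 : ℝ) : ℂ)) else C (X (Fin.castAdd 4 p.1, p.2)) := by
  have hy : g (uzPerp g) = (1 / √2 : ℝ) • eP i₀ := by rw [uzPerp_eq h1 h3, map_smul, h1]
  have hyy : (bil (g (uzPerp g)) (g (uzPerp g)))⁻¹ = 2 := by
    rw [hy, bil_smul_left, bil_smul_right, bil_eP_right, eP, Pi.single_eq_same, mul_one, ← pow_two,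
      div_pow, Real.sq_sqrt (by norm_num)]; norm_num
  have hs : 2 * (1 / √2 : ℝ) = √2 := by
    rw [mul_one_div, div_eq_iff (by positivity), Real.mul_self_sqrt (by norm_num)]
  have hc : ∀ i : Fin n, (((bil (g (uzPerp g)) (g (uzPerp g)))⁻¹ • g (uzPerp g)) : V n)
      (Fin.castAdd 4 i) = if i = i₀ then √2 else 0 := by
    intro i
    rw [hyy, hy, smul_smul, hs, eP, Pi.smul_apply, Pi.single_apply]
    simp
  obtain ⟨i, j⟩ := p
  simp only [splitPoly, aeval_X, hc]
  split_ifs with h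
  · subst h
    rw [Finset.sum_eq_single (Fin.castAdd 4 i)]
    · rw [hy, Pi.smul_apply, eP, Pi.single_eq_same, sgn, if_pos (by simp; omega)]
      have : (1 * ((1 / √2 : ℝ) • (1 : ℝ)) * √2) = 1 := by
        rw [smul_eq_mul, mul_one, one_mul, one_div, inv_mul_cancel₀ (by positivity)]
      rw [this]; simp
    · intro k _ hk
      rw [hy, Pi.smul_apply, eP, Pi.single_apply, if_neg hk]; simp
    · simp
  · simp

open MvPolynomial in
-- The coordinate i₀ occurs only in the first factor of P_α, and linearly, so the coefficient sought
-- comes from the single product of the i₀-coordinate of the second vector with the i₁-coordinate of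
-- the first.
theorem reducedPoly_eq (h1 : g (eU 1) = eP i₀) (h3 : g (eU 3) = eU 3) {i₁ i₂ : Fin n}
    (h01 : i₁ ≠ i₀) (h02 : i₂ ≠ i₀) :
    reducedPoly g (polyAlpha i₀ i₁ i₁ i₂) 0 1 = C ((-(4 * √2) : ℝ) : ℂ) *
      (X (Fin.castAdd 4 i₁, 0) * (X (Fin.castAdd 4 i₁, 0) * X (Fin.castAdd 4 i₂, 1) -
        X (Fin.castAdd 4 i₁, 1) * X (Fin.castAdd 4 i₂, 0))) := by
  set A : MvPolynomial (Fin (n + 4) × Fin 2) ℂ := X (Fin.castAdd 4 i₁, 0) with hA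
  set A' : MvPolynomial (Fin (n + 4) × Fin 2) ℂ := X (Fin.castAdd 4 i₁, 1) with hA'
  set D : MvPolynomial (Fin (n + 4) × Fin 2) ℂ := X (Fin.castAdd 4 i₁, 0) *
    X (Fin.castAdd 4 i₂, 1) - X (Fin.castAdd 4 i₁, 1) * X (Fin.castAdd 4 i₂, 0) with hD
  have hsplit : splitPoly g (polyAlpha i₀ i₁ i₁ i₂) =
      C (4 * C ((√2 : ℝ) : ℂ) * A' * D) * X 0 - C (4 * C ((√2 : ℝ) : ℂ) * A * D) * X 1 := by
    have e4 : splitPoly g 4 = 4 := map_ofNat _ 4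
    simp only [polyAlpha, map_mul, map_sub, e4, splitPoly_X h1 h3 (_, _), if_neg h01, if_neg h02,
      if_true, hA, hA', hD, map_ofNat]
    ring
  have hne : (Finsupp.single (1 : Fin 2) 1 : Fin 2 →₀ ℕ) ≠ Finsupp.single 0 1 := by
    intro h
    have := DFunLike.congr_fun h 0
    simp at this
  rw [reducedPoly, hsplit, Finsupp.single_zero, zero_add, coeff_sub, coeff_C_mul, coeff_C_mul,
    coeff_X, coeff_X, if_pos rfl, if_neg hne.symm]
  rw [show ((-(4 * √2) : ℝ) : ℂ) = -(4 * ((√2 : ℝ) : ℂ)) by push_cast; ring, map_neg, map_mul,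
    map_ofNat]
  ring

open MvPolynomial in
theorem fixSecond_reduced (y : V n) (c : ℂ) (i₁ i₂ : Fin n) :
    fixSecond y (C c * (X (Fin.castAdd 4 i₁, 0) * (X (Fin.castAdd 4 i₁, 0) * X (Fin.castAdd 4 i₂, 1) -
        X (Fin.castAdd 4 i₁, 1) * X (Fin.castAdd 4 i₂, 0)))) =
      C (c * (y (Fin.castAdd 4 i₂) : ℝ)) * X (Fin.castAdd 4 i₁) ^ 2 -
        C (c * (y (Fin.castAdd 4 i₁) : ℝ)) * (X (Fin.castAdd 4 i₁) * X (Fin.castAdd 4 i₂)) := by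
  simp only [fixSecond, map_mul, map_sub, aeval_X, aeval_C, algebraMap_eq]
  simp
  ring

theorem lap_zero : lap (0 : MvPolynomial (Fin (n + 4)) ℂ) = 0 := by
  simp [lap]

open MvPolynomial in
-- The exponential series stops after its linear term. When P is constant the defining sum stops one
-- term earlier, but then c = 0.
theorem heat_eq (y : ℝ) {P : MvPolynomial (Fin (n + 4)) ℂ} {c : ℂ} (hP : lap P = C c) :
    heat y P = P + C (((-1 / (8 * Real.pi * y) : ℝ) : ℂ) * c) := by
  have hC : ∀ c : ℂ, lap (C c : MvPolynomial (Fin (n + 4)) ℂ) = 0 := fun c => by simp [lap]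
  have hiter : ∀ m, lap^[m + 2] P = 0 := by
    intro m
    induction m with
    | zero => rw [Function.iterate_succ_apply', Function.iterate_one, hP, hC]
    | succ m ih => rw [Function.iterate_succ_apply', ih, lap_zero]
  unfold heat
  rcases Nat.eq_zero_or_pos P.totalDegree with h | h
  · have h2 : C c = (0 : MvPolynomial (Fin (n + 4)) ℂ) := by
      rw [← hP, totalDegree_eq_zero_iff_eq_C.mp h, hC]
    rw [h, C_mul, h2]
    simp
  · obtain ⟨d, hd⟩ : ∃ d, P.totalDegree + 1 = d + 2 := ⟨P.totalDegree - 1, by omega⟩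
    rw [hd, Finset.sum_range_succ', Finset.sum_range_succ', Finset.sum_eq_zero]
    · simp [hP]; ring
    · intro m _
      rw [hiter, mul_zero]

open MvPolynomial in
theorem lap_quadratic {i₁ i₂ : Fin n} (h12 : i₁ ≠ i₂) (A B : ℂ) :
    lap (C A * X (Fin.castAdd 4 i₁) ^ 2 - C B * (X (Fin.castAdd 4 i₁) * X (Fin.castAdd 4 i₂)) :
      MvPolynomial (Fin (n + 4)) ℂ) = C (2 * A) := by
  have h12' : Fin.castAdd 4 i₁ ≠ Fin.castAdd 4 i₂ := by simpa using h12
  unfold lap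
  rw [Finset.sum_eq_single (Fin.castAdd 4 i₁)]
  · rw [if_pos (by simp; omega)]
    simp only [map_sub, Derivation.leibniz_pow, Derivation.leibniz, pderiv_X_self,
      pderiv_X_of_ne h12'.symm, smul_eq_mul]
    have h2 : pderiv (Fin.castAdd 4 i₁) (2 : MvPolynomial (Fin (n + 4)) ℂ) = 0 := by
      exact_mod_cast (pderiv (R := ℂ) (Fin.castAdd 4 i₁)).map_natCast 2
    simp [pderiv_X_of_ne h12'.symm, h2, map_ofNat C]
    ring
  · intro k _ hk
    split_ifs with h
    · simp only [map_sub, Derivation.leibniz_pow, Derivation.leibniz,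
        pderiv_X_of_ne hk.symm, smul_eq_mul]
      by_cases h2 : k = Fin.castAdd 4 i₂
      · subst h2
        simp [pderiv_X_of_ne hk.symm]
      · simp [pderiv_X_of_ne (Ne.symm h2)]
    · rfl
  · simp

open MvPolynomial in
theorem eval_heat_reduced (h1 : g (eU 1) = eP i₀) (h3 : g (eU 3) = eU 3) {i₁ i₂ : Fin n}
    (h01 : i₁ ≠ i₀) (h02 : i₂ ≠ i₀) (h12 : i₁ ≠ i₂) (y : ℝ) (Y x : V n) :
    eval (fun i => ((x i : ℝ) : ℂ))
      (heat y (fixSecond Y (reducedPoly g (polyAlpha i₀ i₁ i₁ i₂) 0 1))) =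
      ((-(4 * √2) * ((x (Fin.castAdd 4 i₁) ^ 2 - 1 / (4 * Real.pi * y)) * Y (Fin.castAdd 4 i₂) -
        x (Fin.castAdd 4 i₁) * x (Fin.castAdd 4 i₂) * Y (Fin.castAdd 4 i₁)) : ℝ) : ℂ) := by
  rw [reducedPoly_eq h1 h3 h01 h02, fixSecond_reduced, heat_eq y (lap_quadratic h12 _ _)]
  simp only [map_add, map_sub, map_mul, map_pow, eval_C, eval_X]
  push_cast
  ring

end Poly
end
end JacobiLift

namespace JacobiLift

noncomputable section

open Complex MeasureTheory Filter Topology Asymptotics Set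

/-! ### The theta kernel along the family of isometries -/

section Kernel
variable {n : ℕ}

/-- The coordinate `(λ + cη', ũ' + v - q(v) ũ)` of `λ = x + j ũ' + d ũ`, where `η' = η + l ũ`. -/
def thX (η v : V n) (l c : ℝ) (x : V n) (j d : ℝ) : ℝ :=
  d + bil x v + (l + bil η v) * c - q v * j

/-- The majorant `q(μ⁺) - q(μ⁻)` of `μ = λ + cη'`. -/
def thQ (η v : V n) (l t c : ℝ) (x : V n) (j d : ℝ) : ℝ :=
  q (x + c • η - j • v) + ((j * t) ^ 2 + (thX η v l c x j d / t) ^ 2) / 2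

/-- The values of the heat polynomial. -/
def thH (η v f : V n) (l t y c : ℝ) (x : V n) (j d : ℝ) : ℝ :=
  -(4 * √2) * ((((j * t + thX η v l c x j d / t) / √2) ^ 2 - 1 / (4 * Real.pi * y)) * bil η f -
    (j * t + thX η v l c x j d / t) / √2 * bil (x + c • η - j • v) f *
      ((l + bil η v) / t / √2))

/-- The kernel `P(μ) exp(-2πyQ(μ))`. -/
def thKer (η v f : V n) (l t y c : ℝ) (x : V n) (j d : ℝ) : ℝ :=
  thH η v f l t y c x j d * Real.exp (-(2 * Real.pi * y * thQ η v l t c x j d))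

theorem IsPos.q_add_ge {x y : V n} (hx : IsPos x) (hy : IsPos y) : q x / 2 - q y ≤ q (x + y) := by
  have h := (hx.add (hy.smul 2)).q_nonneg
  rw [q_add, bil_smul_right, q_smul] at h
  rw [q_add]; linarith

theorem IsPos.q_sub_le {x y : V n} (hx : IsPos x) (hy : IsPos y) : q (x - y) ≤ 2 * q x + 2 * q y := by
  have h := (hx.add hy).q_nonneg
  rw [q_add] at h
  rw [sub_eq_add_neg, q_add, q_neg, bil_neg_right]; linarith

/-- The condition t² ≥ 16q(v) lets the diagonal terms absorb the mixed terms created by the shear v;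
the loss depends only on η, v and l, uniformly in |c| ≤ 1. -/
theorem thQ_ge {η v : V n} (hη : IsPos η) (hv : IsPos v) {l t c : ℝ} (ht1 : 1 ≤ t)
    (ht : 16 * q v ≤ t ^ 2) (hc : |c| ≤ 1) {x : V n} (hx : IsPos x) (j d : ℝ) :
    q x / 4 + d ^ 2 / (8 * t ^ 2) + j ^ 2 * t ^ 2 / 4 - (2 * q η + (l + bil η v) ^ 2 / 2) ≤
      thQ η v l t c x j d := by
  have ht0 : 0 < t := by linarith
  have hc2 : c ^ 2 ≤ 1 := by rw [← sq_abs]; nlinarith [abs_nonneg c]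
  have hqv := hv.q_nonneg
  have hqη := hη.q_nonneg
  have hqx := hx.q_nonneg
  have h1 : q x / 2 - (2 * q η + 2 * (j ^ 2 * q v)) ≤ q (x + c • η - j • v) := by
    have e1 := hx.q_add_ge ((hη.smul c).sub (hv.smul j))
    have e2 := (hη.smul c).q_sub_le (hv.smul j)
    rw [q_smul, q_smul] at e2
    rw [add_sub_assoc]
    nlinarith
  set X := thX η v l c x j d with hX
  have h2 : d ^ 2 / 4 - 4 * q x * q v - (l + bil η v) ^ 2 - (q v) ^ 2 * j ^ 2 ≤ X ^ 2 := by
    have e1 := hx.bil_sq_le hv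
    have e2 : (l + bil η v) ^ 2 * c ^ 2 ≤ (l + bil η v) ^ 2 := by nlinarith [sq_nonneg (l + bil η v)]
    have e3 : d = X - bil x v - (l + bil η v) * c + q v * j := by rw [hX, thX]; ring
    have e4 : d ^ 2 ≤ 4 * (X ^ 2 + bil x v ^ 2 + ((l + bil η v) * c) ^ 2 + (q v * j) ^ 2) := by
      rw [e3]
      nlinarith [sq_nonneg (X + bil x v), sq_nonneg (X + (l + bil η v) * c), sq_nonneg (X - q v * j),
        sq_nonneg (bil x v - (l + bil η v) * c), sq_nonneg (bil x v + q v * j),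
        sq_nonneg ((l + bil η v) * c + q v * j)]
    nlinarith
  have ht2 : 0 < t ^ 2 := by positivity
  have h3 : d ^ 2 / (8 * t ^ 2) - q x / 8 - (l + bil η v) ^ 2 / 2 - q v * j ^ 2 / 32 ≤
      (X / t) ^ 2 / 2 := by
    rw [div_pow, div_div, le_div_iff₀ (by positivity)]
    have e1 : d ^ 2 / (8 * t ^ 2) * (t ^ 2 * 2) = d ^ 2 / 4 := by field_simp; ring
    have e2 : q x * (16 * q v) ≤ q x * t ^ 2 := mul_le_mul_of_nonneg_left ht hqx
    have e3 : (l + bil η v) ^ 2 * 1 ≤ (l + bil η v) ^ 2 * t ^ 2 :=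
      mul_le_mul_of_nonneg_left (by nlinarith) (sq_nonneg _)
    have e4 : (q v * j ^ 2) * (16 * q v) ≤ (q v * j ^ 2) * t ^ 2 :=
      mul_le_mul_of_nonneg_left ht (by positivity)
    have e5 : 0 ≤ (q v * j ^ 2) * t ^ 2 := by positivity
    nlinarith
  have h4 : j ^ 2 * (16 * q v) ≤ j ^ 2 * t ^ 2 := mul_le_mul_of_nonneg_left ht (sq_nonneg _)
  have h5 : 0 ≤ j ^ 2 * q v := by positivity
  rw [thQ]
  rw [show (j * t) ^ 2 = j ^ 2 * t ^ 2 by ring]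
  nlinarith

/-- The coordinates entering the quadratic polynomial have squares at most 2Q, where Q is the
majorant. -/
theorem abs_thH_le {η v f : V n} (hη : IsPos η) (hv : IsPos v) (hf : IsPos f) (hf1 : bil f f = 1)
    {l t y c : ℝ} (ht1 : 1 ≤ t) (hy : 1 / 2 ≤ y) {x : V n} (hx : IsPos x) (j d : ℝ) :
    |thH η v f l t y c x j d| ≤
      12 * (|bil η f| + |l + bil η v|) * (1 + thQ η v l t c x j d) := by
  have ht0 : 0 < t := by linarith
  have hs : (1 : ℝ) < √2 := by rw [Real.lt_sqrt] <;> norm_num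
  have hs2 : √2 ^ 2 = (2 : ℝ) := Real.sq_sqrt (by norm_num)
  have hs3 : √2 ≤ (3 / 2 : ℝ) := by rw [Real.sqrt_le_iff]; norm_num
  set Q := thQ η v l t c x j d with hQ
  set ξ := (j * t + thX η v l c x j d / t) / √2 with hξ
  set z := x + c • η - j • v with hz
  have hzp : IsPos z := (hx.add (hη.smul c)).sub (hv.smul j)
  have hqz := hzp.q_nonneg
  have hξ2 : ξ ^ 2 ≤ 2 * Q := by
    rw [hξ, div_pow, hs2, hQ, thQ]
    nlinarith [sq_nonneg (j * t - thX η v l c x j d / t)]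
  have hQ0 : 0 ≤ Q := by nlinarith [sq_nonneg ξ]
  have hz2 : bil z f ^ 2 ≤ 2 * Q := by
    have e1 := hzp.bil_sq_le hf
    have e2 : q f = 1 / 2 := by rw [q, hf1]
    rw [e2] at e1
    have e3 : q z ≤ Q := by rw [hQ, thQ]; nlinarith [sq_nonneg (j * t), sq_nonneg (thX η v l c x j d / t)]
    linarith
  have hξz : |ξ * bil z f| ≤ 2 * Q := by
    rw [abs_le]; constructor <;> nlinarith [sq_nonneg (ξ + bil z f), sq_nonneg (ξ - bil z f)]
  have hy1 : 0 ≤ 1 / (4 * Real.pi * y) ∧ 1 / (4 * Real.pi * y) ≤ 1 := by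
    have := Real.pi_gt_three
    refine ⟨by positivity, ?_⟩
    rw [div_le_one (by positivity)]; nlinarith
  have hA : |ξ ^ 2 - 1 / (4 * Real.pi * y)| ≤ 2 * Q + 1 := by
    rw [abs_le]; constructor <;> nlinarith [sq_nonneg ξ]
  have hL : |(l + bil η v) / t / √2| ≤ |l + bil η v| := by
    rw [abs_div, abs_div, abs_of_pos ht0, abs_of_pos (by linarith : (0 : ℝ) < √2), div_div]
    exact div_le_self (abs_nonneg _) (by nlinarith)
  rw [thH, abs_mul, abs_neg, abs_of_pos (by positivity : (0 : ℝ) < 4 * √2)]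
  have hB : |(ξ ^ 2 - 1 / (4 * Real.pi * y)) * bil η f - ξ * bil z f * ((l + bil η v) / t / √2)| ≤
      (2 * Q + 1) * |bil η f| + 2 * Q * |l + bil η v| := by
    refine (abs_sub _ _).trans (add_le_add ?_ ?_)
    · rw [abs_mul]; exact mul_le_mul_of_nonneg_right hA (abs_nonneg _)
    · rw [abs_mul]; exact mul_le_mul hξz hL (abs_nonneg _) (by positivity)
  calc 4 * √2 * _ ≤ 6 * ((2 * Q + 1) * |bil η f| + 2 * Q * |l + bil η v|) :=
        mul_le_mul (by linarith) hB (abs_nonneg _) (by norm_num)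
    _ ≤ _ := by
        nlinarith [abs_nonneg (bil η f), abs_nonneg (l + bil η v),
          mul_nonneg hQ0 (abs_nonneg (bil η f)), mul_nonneg hQ0 (abs_nonneg (l + bil η v))]

/-- For y ≥ 1/2 the exponent is at least 2Q; one copy of exp(-Q) absorbs the polynomial factor 1 + Q
and the other is bounded by `thQ_ge`. -/
theorem abs_thKer_le {η v f : V n} (hη : IsPos η) (hv : IsPos v) (hf : IsPos f) (hf1 : bil f f = 1)
    {l t y c : ℝ} (ht1 : 1 ≤ t) (ht : 16 * q v ≤ t ^ 2) (hy : 1 / 2 ≤ y) (hc : |c| ≤ 1) {x : V n}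
    (hx : IsPos x) (j d : ℝ) :
    |thKer η v f l t y c x j d| ≤ 12 * (|bil η f| + |l + bil η v|) *
      Real.exp (2 * q η + (l + bil η v) ^ 2 / 2) *
      Real.exp (-(q x / 4 + d ^ 2 / (8 * t ^ 2) + j ^ 2 * t ^ 2 / 4)) := by
  have h1 := abs_thH_le hη hv hf hf1 (l := l) (c := c) ht1 hy hx j d
  have h2 := thQ_ge hη hv (l := l) ht1 ht hc hx j d
  set Q := thQ η v l t c x j d with hQ
  have hQ0 : 0 ≤ Q := by
    rw [hQ, thQ]
    have := ((hx.add (hη.smul c)).sub (hv.smul j)).q_nonneg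
    positivity
  rw [thKer, abs_mul, Real.abs_exp, mul_assoc _ (Real.exp _), ← Real.exp_add]
  have h3 : (1 + Q) * Real.exp (-(2 * Real.pi * y * Q)) ≤ Real.exp (-Q) := by
    calc (1 + Q) * Real.exp (-(2 * Real.pi * y * Q)) ≤ Real.exp Q * Real.exp (-(2 * Q)) := by
          refine mul_le_mul (by linarith [Real.add_one_le_exp Q]) (Real.exp_le_exp.mpr ?_)
            (Real.exp_pos _).le (Real.exp_pos _).le
          have : 2 ≤ 2 * Real.pi * y := by nlinarith [Real.pi_gt_three]
          nlinarith
      _ = _ := by rw [← Real.exp_add]; congr 1; ring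
  calc _ ≤ 12 * (|bil η f| + |l + bil η v|) * (1 + Q) * Real.exp (-(2 * Real.pi * y * Q)) :=
        mul_le_mul_of_nonneg_right h1 (Real.exp_pos _).le
    _ = 12 * (|bil η f| + |l + bil η v|) * ((1 + Q) * Real.exp (-(2 * Real.pi * y * Q))) := by ring
    _ ≤ _ := by
        refine mul_le_mul_of_nonneg_left (h3.trans (Real.exp_le_exp.mpr ?_)) (by positivity)
        linarith

theorem summable_thKer_bound (Λ : Submodule ℤ (EuclideanSpace ℝ (Fin n))) [DiscreteTopology Λ]
    [IsZLattice ℝ Λ] {t : ℝ} (ht : 0 < t) :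
    Summable fun p : dualLattice (posLattice Λ) × ℤ × ℤ => Real.exp (-(q (p.1 : V n) / 4 +
      (p.2.2 : ℝ) ^ 2 / (8 * t ^ 2) + (p.2.1 : ℝ) ^ 2 * t ^ 2 / 4)) := by
  have h1 := summable_exp_neg_q Λ (ε := 1 / 4) (by norm_num)
  have h2 := summable_exp_neg_mul_int_sq (c := 1 / (8 * t ^ 2)) (by positivity)
  have h3 := summable_exp_neg_mul_int_sq (c := t ^ 2 / 4) (by positivity)
  refine (h1.mul_of_nonneg (h3.mul_of_nonneg h2 (fun _ => (Real.exp_pos _).le)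
    fun _ => (Real.exp_pos _).le) (fun _ => (Real.exp_pos _).le)
    fun _ => mul_nonneg (Real.exp_pos _).le (Real.exp_pos _).le).congr fun p => ?_
  rw [← Real.exp_add, ← Real.exp_add]
  congr 1; ring

end Kernel
end
end JacobiLift

namespace JacobiLift

noncomputable section

open Complex MeasureTheory Filter Topology Asymptotics Set

/-! ### Evaluation of the theta function -/

section Evaluation
variable {n : ℕ}

theorem bil_negPart (x y : V n) : bil (negPart x) (negPart y) =
    -(x (Fin.natAdd n 2) * y (Fin.natAdd n 2) + x (Fin.natAdd n 3) * y (Fin.natAdd n 3)) := by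
  unfold bil
  rw [Fin.sum_univ_add, Finset.sum_eq_zero, Fin.sum_univ_four, zero_add]
  · simp [negPart, sgn]; ring
  · intro i _
    simp [negPart, show (i : ℕ) < n + 2 by omega]

theorem bil_posPart (x y : V n) : bil (posPart x) (posPart y) =
    bil x y - bil (negPart x) (negPart y) := by
  unfold bil
  rw [← Finset.sum_sub_distrib]
  refine Finset.sum_congr rfl fun i _ => ?_
  simp only [posPart, negPart]
  split_ifs <;> ring

/-- The exponent of the theta function, with its absolute value separated. -/
theorem theta_exponent (a b : V n) (x₁ y r c : ℝ) :
    (q (posPart a) : ℂ) * (x₁ + y * I) + (q (negPart a) : ℂ) * (x₁ - y * I) +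
      (r + (c * y : ℝ) * I) * (bil (posPart a) (posPart b) : ℝ) +
      (r - (c * y : ℝ) * I) * (bil (negPart a) (negPart b) : ℝ) =
    ((q a * x₁ + bil a b * r : ℝ) : ℂ) +
      ((y * (q (a + c • b) - 2 * q (negPart (a + c • b))) -
        y * c ^ 2 * (q b - 2 * q (negPart b)) : ℝ) : ℂ) * I := by
  have h1 : q (posPart a) = q a - q (negPart a) := by
    rw [q, q, q, bil_posPart]; ring
  have h2 : q (negPart (a + c • b)) = q (negPart a) + c * bil (negPart a) (negPart b) +
      c ^ 2 * q (negPart b) := by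
    simp only [q, bil_negPart, Pi.add_apply, Pi.smul_apply, smul_eq_mul]; ring
  rw [h1, h2, bil_posPart, q_add, q_smul, bil_smul_right]
  push_cast
  ring

/-- Completing the square in c = y₂/y₁ turns the modulus of each theta term into a Gaussian in λ +
cη', up to a factor depending on η' alone. The prefactor of the theta function removes the
dependence of that factor on g and leaves exp(2πq(η)c²y₁), because q(η + lũ) = q(η). -/
theorem jacobiTheta_pairing {Λ : Submodule ℤ (EuclideanSpace ℝ (Fin n))} [DiscreteTopology Λ]
    [IsZLattice ℝ Λ] (hΛ : ∀ x ∈ Λ, ∃ m : ℤ, inner ℝ x x = 2 * (m : ℝ))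
    {i₀ i₁ i₂ : Fin n} (h01 : i₁ ≠ i₀) (h02 : i₂ ≠ i₀) (h12 : i₁ ≠ i₂)
    (η : dualLattice (posLattice Λ)) {f v : V n} (hf : IsPos f) (hf1 : bil f f = 1) (hv : IsPos v)
    (l : ℕ) {t : ℝ} (ht1 : 1 ≤ t) (ht : 16 * q v ≤ t ^ 2)
    {g : V n ≃ₗ[ℝ] V n} (hg : IsIsometry g) (hg1 : g (eU 1) = eP i₀) (hg3 : g (eU 3) = eU 3)
    (hcoord : ∀ x, IsPos x → ∀ j d : ℝ,
        g (x + j • uTilde' n + d • uTilde n) (Fin.castAdd 4 i₁) =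
          (j * t + (d + bil x v - q v * j) / t) / √2 ∧
        g (x + j • uTilde' n + d • uTilde n) (Fin.castAdd 4 i₂) = bil (x - j • v) f ∧
        g (x + j • uTilde' n + d • uTilde n) (Fin.natAdd n 2) =
          -((j * t - (d + bil x v - q v * j) / t) / √2) ∧
        g (x + j • uTilde' n + d • uTilde n) (Fin.natAdd n 3) = 0)
    (Φ : Disc (lorLattice Λ) → ℂ) {τ₁ τ₂ : ℂ} {c : ℝ} (hy : 1 / 2 ≤ τ₁.im)
    (hτ₂ : τ₂.im = c * τ₁.im) (hc : |c| ≤ 1) :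
    ∑ᶠ σ, Φ σ * (starRingEnd ℂ) (jacobiTheta (lorLattice Λ) 1 (gM g)
        (fixSecond (gM g ((η : V n) + l • uTilde n)) (reducedPoly g (polyAlpha i₀ i₁ i₁ i₂) 0 1))
        ((η : V n) + l • uTilde n) τ₁ τ₂ σ) =
      ∑' p : dualLattice (posLattice Λ) × ℤ × ℤ, Φ (cls (toLorDual p.1)) *
        e ((-((q (p.1 : V n) + p.2.1 * p.2.2) * τ₁.re +
          (bil (p.1 : V n) η + p.2.1 * l) * τ₂.re) : ℝ) : ℂ) *
        ((τ₁.im ^ (1 / 2 : ℝ) * Real.exp (2 * Real.pi * q (η : V n) * c ^ 2 * τ₁.im) *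
          thKer η v f l t τ₁.im c p.1 p.2.1 p.2.2 : ℝ) : ℂ) := by
  have hηp : IsPos (η : V n) := isPos_dual η
  have hy0 : 0 < τ₁.im := by linarith
  have ht0 : t ≠ 0 := by linarith
  have hratio : τ₂.im / τ₁.im = c := by rw [hτ₂]; field_simp
  set η' : V n := (η : V n) + l • uTilde n with hη'
  have hη'2 : η' = (η : V n) + (0 : ℝ) • uTilde' n + (l : ℝ) • uTilde n := by
    rw [hη', zero_smul, add_zero, Nat.cast_smul_eq_nsmul]
  have hgM : ∀ x, IsPos x → ∀ j d : ℝ, gM g (x + j • uTilde' n + d • uTilde n) =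
      g (x + j • uTilde' n + d • uTilde n) := by
    intro x hx j d
    apply gM_apply hg1 hg3 <;>
      rw [bil_add_left, bil_add_left, bil_smul_left, bil_smul_left, hx.bil_eU,
        bil_uTilde'_eU _ (by simp), bil_uTilde_eU _ (by simp)] <;> ring
  have hgη : gM g η' = g η' := by rw [hη'2, hgM _ hηp]
  obtain ⟨hY1, hY2, hY3, hY4⟩ := hcoord η hηp 0 l
  rw [← hη'2] at hY1 hY2 hY3 hY4
  simp only [zero_mul, mul_zero, sub_zero, zero_add, zero_smul] at hY1 hY2 hY3
  have hqη' : q η' = q (η : V n) := by rw [hη'2, q_decomp hηp]; ring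
  set P := fixSecond (gM g η') (reducedPoly g (polyAlpha i₀ i₁ i₁ i₂) 0 1) with hP
  let F : V n → ℂ := fun x => MvPolynomial.eval (fun i => ((gM g (x + (τ₂.im / τ₁.im) • η') i : ℝ) : ℂ))
    (heat τ₁.im P) * e (q (posPart (gM g x)) * τ₁ + q (negPart (gM g x)) * (starRingEnd ℂ) τ₁ +
      τ₂ * bil (posPart (gM g x)) (posPart (gM g η')) +
      (starRingEnd ℂ) τ₂ * bil (negPart (gM g x)) (negPart (gM g η')))
  have hF : ∀ p : dualLattice (posLattice Λ) × ℤ × ℤ, F (lorVec p) =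
      e (((q (p.1 : V n) + p.2.1 * p.2.2) * τ₁.re +
          (bil (p.1 : V n) η + p.2.1 * l) * τ₂.re : ℝ) : ℂ) *
        ((Real.exp (2 * Real.pi * (τ₁.im * c ^ 2 * (q (η : V n) - 2 * q (negPart (g η'))))) *
          thKer η v f l t τ₁.im c p.1 p.2.1 p.2.2 : ℝ) : ℂ) := by
    rintro ⟨x, j, d⟩
    have hxp : IsPos (x : V n) := isPos_dual x
    have hx1 : lorVec (x, j, d) = (x : V n) + (j : ℝ) • uTilde' n + (d : ℝ) • uTilde n := by
      rw [lorVec, Int.cast_smul_eq_zsmul, Int.cast_smul_eq_zsmul]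
    have hx2 : lorVec (x, j, d) + c • η' = ((x : V n) + c • (η : V n)) + (j : ℝ) • uTilde' n +
        (d + c * l : ℝ) • uTilde n := by
      rw [hx1, hη'2]; module
    have hxc := hxp.add (hηp.smul c)
    have hbil1 : bil ((x : V n) + c • (η : V n)) v = bil (x : V n) v + c * bil (η : V n) v := by
      rw [bil_add_left, bil_smul_left]
    have hX : (d : ℝ) + c * l + bil ((x : V n) + c • (η : V n)) v - q v * j =
        thX η v l c x j d := by rw [hbil1, thX]; ring
    obtain ⟨k1, k2, k3, k4⟩ := hcoord _ hxc j (d + c * l)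
    rw [hX] at k1 k3
    rw [← hx2] at k1 k2 k3 k4
    have hqneg : q (negPart (g (lorVec (x, j, d) + c • η'))) =
        -((j * t - thX η v l c x j d / t) / √2) ^ 2 / 2 := by
      rw [q, bil_negPart, k3, k4]; ring
    have hs2 : √2 ^ 2 = (2 : ℝ) := Real.sq_sqrt (by norm_num)
    -- Here q is invariant under g, and the negative part has only the coordinate e_{b+1}, since the
    -- coordinate e_{b+2} vanishes.
    have hQ : q (g (lorVec (x, j, d) + c • η')) - 2 * q (negPart (g (lorVec (x, j, d) + c • η'))) =
        thQ η v l t c x j d := by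
      have e1 : q (g (lorVec (x, j, d) + c • η')) = q ((x : V n) + c • (η : V n)) + j * (d + c * l) := by
        rw [q, hg, ← q, hx2, q_decomp hxc]
      have e2 : q ((x : V n) + c • (η : V n) - (j : ℝ) • v) =
          q ((x : V n) + c • (η : V n)) - j * (bil (x : V n) v + c * bil (η : V n) v) + j ^ 2 * q v := by
        rw [sub_eq_add_neg, q_add, q_neg, q_smul, bil_neg_right, bil_smul_right, hbil1]; ring
      rw [hqneg, e1, thQ, e2, div_pow, hs2]
      have e3 : (j : ℝ) * t * (thX η v l c x j d / t) = j * thX η v l c x j d := by field_simp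
      have e4 : thX η v l c x j d = d + bil (x : V n) v + (l + bil (η : V n) v) * c - q v * j := rfl
      linear_combination -e3 - (j : ℝ) * e4
    have hgx : gM g (lorVec (x, j, d)) = g (lorVec (x, j, d)) := by rw [hx1, hgM _ hxp]
    have hgxc : gM g (lorVec (x, j, d) + c • η') = g (lorVec (x, j, d) + c • η') := by
      rw [hx2, hgM _ hxc]
    have hexp : (q (posPart (gM g (lorVec (x, j, d)))) : ℂ) * τ₁ +
        q (negPart (gM g (lorVec (x, j, d)))) * (starRingEnd ℂ) τ₁ +
        τ₂ * bil (posPart (gM g (lorVec (x, j, d)))) (posPart (gM g η')) +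
        (starRingEnd ℂ) τ₂ * bil (negPart (gM g (lorVec (x, j, d)))) (negPart (gM g η')) =
        (((q (x : V n) + j * d) * τ₁.re + (bil (x : V n) η + j * l) * τ₂.re : ℝ) : ℂ) +
        ((τ₁.im * thQ η v l t c x j d -
          τ₁.im * c ^ 2 * (q (η : V n) - 2 * q (negPart (g η'))) : ℝ) : ℂ) * I := by
      have e1 : τ₁ = τ₁.re + τ₁.im * I := (re_add_im τ₁).symm
      have e2 : τ₂ = τ₂.re + (c * τ₁.im : ℝ) * I := by rw [← hτ₂]; exact (re_add_im τ₂).symm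
      have e3 : (starRingEnd ℂ) τ₁ = τ₁.re - τ₁.im * I := by
        apply Complex.ext <;> simp
      have e4 : (starRingEnd ℂ) τ₂ = τ₂.re - (c * τ₁.im : ℝ) * I := by
        apply Complex.ext <;> simp [hτ₂]
      have e5 := theta_exponent (g (lorVec (x, j, d))) (g η') τ₁.re τ₁.im τ₂.re c
      rw [← map_smul, ← map_add, hQ] at e5
      have e6 : q (g (lorVec (x, j, d))) = q (x : V n) + j * d := by
        rw [q, hg, ← q, hx1, q_decomp hxp]
      have e7 : bil (g (lorVec (x, j, d))) (g η') = bil (x : V n) η + j * l := by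
        rw [hg, hx1, hη'2, bil_decomp hxp hηp]; ring
      have e8 : q (g η') = q (η : V n) := by rw [q, hg, ← q, hqη']
      rw [e6, e7, e8] at e5
      rw [hgx, hgη, e3, e4, ← e5]
      conv_lhs => rw [e1, e2]
      simp
    have heval : MvPolynomial.eval (fun i => ((gM g (lorVec (x, j, d) + (τ₂.im / τ₁.im) • η') i : ℝ) : ℂ))
        (heat τ₁.im P) = (thH η v f l t τ₁.im c x j d : ℝ) := by
      rw [hratio, hP, eval_heat_reduced hg1 hg3 h01 h02 h12, hgxc, hgη, k1, k2, hY1, hY2]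
      rfl
    simp only [F]
    rw [heval, hexp, e_add_mul_I, thKer]
    rw [show -(2 * Real.pi * (τ₁.im * thQ η v l t c x j d -
        τ₁.im * c ^ 2 * (q (η : V n) - 2 * q (negPart (g η'))))) =
        2 * Real.pi * (τ₁.im * c ^ 2 * (q (η : V n) - 2 * q (negPart (g η')))) +
        -(2 * Real.pi * τ₁.im * thQ η v l t c x j d) by ring, Real.exp_add]
    push_cast
    ring
  have hsum : Summable fun p : dualLattice (posLattice Λ) × ℤ × ℤ => F (lorVec p) := by
    refine Summable.of_norm_bounded (g := fun p : dualLattice (posLattice Λ) × ℤ × ℤ =>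
      Real.exp (2 * Real.pi * (τ₁.im * c ^ 2 * (q (η : V n) - 2 * q (negPart (g η'))))) *
      (12 * (|bil (η : V n) f| + |l + bil (η : V n) v|) *
      Real.exp (2 * q (η : V n) + (l + bil (η : V n) v) ^ 2 / 2) *
      Real.exp (-(q (p.1 : V n) / 4 + (p.2.2 : ℝ) ^ 2 / (8 * t ^ 2) +
        (p.2.1 : ℝ) ^ 2 * t ^ 2 / 4))))
      (((summable_thKer_bound Λ (by linarith)).mul_left _).mul_left _) fun p => ?_
    rw [hF, norm_mul, norm_e_real, one_mul, norm_real, Real.norm_eq_abs, abs_mul, Real.abs_exp]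
    exact mul_le_mul_of_nonneg_left (abs_thKer_le hηp hv hf hf1 ht1 ht hy hc (isPos_dual p.1) _ _)
      (Real.exp_pos _).le
  set A : ℝ := τ₁.im ^ (((1 : ℕ) : ℝ) / 2) *
    Real.exp (4 * Real.pi * q (negPart (gM g η')) * τ₂.im ^ 2 / τ₁.im) with hA
  have hAeq : A * Real.exp (2 * Real.pi * (τ₁.im * c ^ 2 * (q (η : V n) - 2 * q (negPart (g η'))))) =
      τ₁.im ^ (1 / 2 : ℝ) * Real.exp (2 * Real.pi * q (η : V n) * c ^ 2 * τ₁.im) := by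
    rw [hA, mul_assoc, ← Real.exp_add, Nat.cast_one, hgη]
    congr 2
    rw [hτ₂]; field_simp; ring
  have hcong : ∀ σ, Φ σ * (starRingEnd ℂ) (jacobiTheta (lorLattice Λ) 1 (gM g) P η' τ₁ τ₂ σ) =
      (fun σ => Φ σ * A) σ * (starRingEnd ℂ) (∑' x : lorLattice Λ, F (rep σ + x)) := by
    intro σ
    have : jacobiTheta (lorLattice Λ) 1 (gM g) P η' τ₁ τ₂ σ =
        (A : ℂ) * ∑' x : lorLattice Λ, F (rep σ + x) := rfl
    rw [this, map_mul, conj_ofReal]; ring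
  rw [finsum_congr hcong, finsum_mul_conj_tsum hΛ _ F hsum]
  refine tsum_congr fun p => ?_
  rw [hF, map_mul, conj_ofReal, conj_e, conj_ofReal, ← hAeq]
  push_cast
  ring

end Evaluation
end
end JacobiLift

namespace JacobiLift

noncomputable section

open Complex MeasureTheory Filter Topology Asymptotics Set

/-! ### Poisson summation of the kernel -/

section Poisson
variable {n : ℕ}

theorem summable_gauss_shift {a : ℝ} (ha : 0 < a) (x : ℝ) :
    (Summable fun k : ℤ => gauss₁ a (x + k)) ∧ Summable fun k : ℤ => gauss₂ a (x + k) := by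
  have hpi := Real.pi_pos
  have key : ∀ u : ℝ, u ^ 2 * Real.exp (-Real.pi * a * u ^ 2) ≤
      2 / (Real.pi * a) * Real.exp (-(Real.pi * a / 2) * u ^ 2) := by
    intro u
    have h := Real.add_one_le_exp (Real.pi * a / 2 * u ^ 2)
    have h1 : u ^ 2 ≤ 2 / (Real.pi * a) * Real.exp (Real.pi * a / 2 * u ^ 2) := by
      rw [div_mul_eq_mul_div, le_div_iff₀ (by positivity)]; nlinarith
    calc u ^ 2 * Real.exp (-Real.pi * a * u ^ 2)
        ≤ 2 / (Real.pi * a) * Real.exp (Real.pi * a / 2 * u ^ 2) * Real.exp (-Real.pi * a * u ^ 2) :=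
          mul_le_mul_of_nonneg_right h1 (Real.exp_pos _).le
      _ = _ := by rw [mul_assoc, ← Real.exp_add]; congr 2; ring
  have key0 : ∀ u : ℝ, Real.exp (-Real.pi * a * u ^ 2) ≤ Real.exp (-(Real.pi * a / 2) * u ^ 2) := by
    intro u
    refine Real.exp_le_exp.mpr ?_
    have : 0 ≤ Real.pi * a * u ^ 2 := by positivity
    linarith
  have hshift : ∀ k : ℤ, Real.exp (-(Real.pi * a / 2) * (x + k) ^ 2) ≤
      Real.exp (Real.pi * a / 2 * x ^ 2) * Real.exp (-(Real.pi * a / 4) * (k : ℝ) ^ 2) := by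
    intro k
    rw [← Real.exp_add]
    -- The inequality behind this is (x + k)² ≥ k²/2 - x², that is (2x + k)² ≥ 0.
    refine Real.exp_le_exp.mpr ?_
    have : 0 ≤ Real.pi * a * (2 * x + k) ^ 2 := by positivity
    nlinarith
  have hs := (summable_exp_neg_mul_int_sq (c := Real.pi * a / 4) (by positivity)).mul_left
    (Real.exp (Real.pi * a / 2 * x ^ 2))
  constructor
  · refine Summable.of_norm_bounded (hs.mul_left (1 + 2 / (Real.pi * a))) fun k => ?_
    rw [gauss₁, norm_mul, norm_gauss, norm_real, Real.norm_eq_abs]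
    have h1 : |x + (k : ℝ)| ≤ 1 + (x + k) ^ 2 := by
      rw [abs_le]; constructor <;> nlinarith [sq_nonneg (x + k + 1), sq_nonneg (x + k - 1)]
    calc _ ≤ (1 + (x + k) ^ 2) * Real.exp (-Real.pi * a * (x + k) ^ 2) :=
          mul_le_mul_of_nonneg_right h1 (Real.exp_pos _).le
      _ ≤ (1 + 2 / (Real.pi * a)) * Real.exp (-(Real.pi * a / 2) * (x + k) ^ 2) := by
          rw [add_mul, add_mul, one_mul, one_mul]; exact add_le_add (key0 _) (key _)
      _ ≤ _ := mul_le_mul_of_nonneg_left (hshift k) (by positivity)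
  · refine Summable.of_norm_bounded (hs.mul_left (2 / (Real.pi * a) + 1 / (2 * Real.pi * a)))
      fun k => ?_
    rw [gauss₂, norm_mul, norm_gauss, show (((x + k : ℝ) : ℂ) ^ 2 - 1 / (2 * Real.pi * a) : ℂ) =
      (((x + k) ^ 2 - 1 / (2 * Real.pi * a) : ℝ) : ℂ) by push_cast; ring, norm_real,
      Real.norm_eq_abs]
    have h1 : |(x + (k : ℝ)) ^ 2 - 1 / (2 * Real.pi * a)| ≤ (x + k) ^ 2 + 1 / (2 * Real.pi * a) := by
      have : 0 ≤ 1 / (2 * Real.pi * a) := by positivity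
      rw [abs_le]; constructor <;> nlinarith [sq_nonneg (x + k)]
    calc _ ≤ ((x + k) ^ 2 + 1 / (2 * Real.pi * a)) * Real.exp (-Real.pi * a * (x + k) ^ 2) :=
          mul_le_mul_of_nonneg_right h1 (Real.exp_pos _).le
      _ ≤ (2 / (Real.pi * a) + 1 / (2 * Real.pi * a)) *
            Real.exp (-(Real.pi * a / 2) * (x + k) ^ 2) := by
          rw [add_mul, add_mul]
          exact add_le_add (key _) (mul_le_mul_of_nonneg_left (key0 _) (by positivity))
      _ ≤ _ := mul_le_mul_of_nonneg_left (hshift k) (by positivity)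

/-- The terms of the kernel with `j = 0` after Poisson summation over `d`. -/
def pTerm (η v f : V n) (l t y c : ℝ) (x : V n) (k : ℤ) : ℂ :=
  ((2 * √2 * t / √y * Real.exp (-(2 * Real.pi * y * q (x + c • η))) *
      Real.exp (-(Real.pi * (k * t) ^ 2 / y)) : ℝ) : ℂ) *
    (((k * t) ^ 2 / y ^ 2 * bil η f : ℝ) -
      I * (k * (l + bil η v) * bil (x + c • η) f / y : ℝ)) *
    e ((k * (bil x v + (l + bil η v) * c) : ℝ) : ℂ)

/-- For j = 0 the kernel, as a function of d, combines the first two Hermite functions with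
parameter a = y/t². The correction -1/(4πy) made by the heat operator is exactly the constant which
completes `gauss₂`. -/
theorem tsum_thKer (η v f : V n) {l t y c : ℝ} (ht : 0 < t) (hy : 0 < y) (x : V n) :
    ∑' d : ℤ, (thKer η v f l t y c x 0 d : ℂ) = ∑' k : ℤ, pTerm η v f l t y c x k := by
  set a := y / t ^ 2 with ha
  have ha0 : 0 < a := by positivity
  set X := bil x v + (l + bil η v) * c with hX
  set E := Real.exp (-(2 * Real.pi * y * q (x + c • η))) with hE
  set Y := bil η f
  set L := l + bil η v
  set b := bil (x + c • η) f
  have hs2 : √2 ^ 2 = (2 : ℝ) := Real.sq_sqrt (by norm_num)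
  have h1 : ∀ d : ℤ, (thKer η v f l t y c x 0 d : ℂ) = ((-(2 * √2 / t ^ 2) * E * Y : ℝ) : ℂ) *
      gauss₂ a (X + d) + ((2 * √2 / t ^ 2 * E * (L * b) : ℝ) : ℂ) * gauss₁ a (X + d) := by
    intro d
    have hQ : thX η v l c x 0 d = X + d := by rw [thX, hX]; ring
    have hexp : Real.exp (-(2 * Real.pi * y * thQ η v l t c x 0 d)) =
        E * Real.exp (-Real.pi * a * (X + d) ^ 2) := by
      rw [hE, ← Real.exp_add, thQ, hQ, ha, zero_smul, sub_zero]
      congr 1; field_simp; ring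
    have e1 : thH η v f l t y c x 0 d = -(2 * √2 / t ^ 2) * (((X + d) ^ 2 - 1 / (2 * Real.pi * a)) * Y -
        (X + d) * (L * b)) := by
      rw [thH, hQ, zero_smul, sub_zero, zero_mul, zero_add, ha, div_pow, hs2]
      change -(4 * √2) * ((((X + d) / t) ^ 2 / 2 - 1 / (4 * Real.pi * y)) * Y -
        (X + d) / t / √2 * b * (L / t / √2)) = _
      have e2 : (X + d) / t / √2 * b * (L / t / √2) = (X + d) * (L * b) / (2 * t ^ 2) := by
        have e3 : (X + d) / t / √2 * b * (L / t / √2) = (X + d) * (L * b) / (√2 ^ 2 * t ^ 2) := by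
          field_simp
        rw [e3, hs2]
      rw [e2]; field_simp; ring
    rw [thKer, e1, hexp, gauss₂, gauss₁, gauss_eq_ofReal]
    push_cast
    ring
  have h2 : ∀ k : ℤ, pTerm η v f l t y c x k = ((-(2 * √2 / t ^ 2) * E * Y : ℝ) : ℂ) *
      (-(k ^ 2 / a ^ 2) * ((1 / √a : ℝ) * gauss a⁻¹ k) * e (k * X)) +
      ((2 * √2 / t ^ 2 * E * (L * b) : ℝ) : ℂ) *
      (-(I * k / a) * ((1 / √a : ℝ) * gauss a⁻¹ k) * e (k * X)) := by
    intro k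
    have hsa : √a = √y / t := by rw [ha, Real.sqrt_div hy.le, Real.sqrt_sq ht.le]
    have hsy : √y ≠ 0 := (Real.sqrt_pos.mpr hy).ne'
    have hg : gauss a⁻¹ k = (Real.exp (-(Real.pi * (k * t) ^ 2 / y)) : ℝ) := by
      rw [gauss_eq_ofReal, ha]; congr 2; field_simp
    have hX2 : ((k * X : ℝ) : ℂ) = k * X := by push_cast; ring
    rw [pTerm, hg, hsa, ha]
    change ((2 * √2 * t / √y * E * _ : ℝ) : ℂ) *
      (((k * t) ^ 2 / y ^ 2 * Y : ℝ) - I * (k * L * b / y : ℝ)) * e ((k * X : ℝ) : ℂ) = _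
    rw [hX2]
    have ht' : (t : ℂ) ≠ 0 := ofReal_ne_zero.mpr ht.ne'
    have hy' : (y : ℂ) ≠ 0 := ofReal_ne_zero.mpr hy.ne'
    have hsy' : ((√y : ℝ) : ℂ) ≠ 0 := ofReal_ne_zero.mpr hsy
    push_cast
    field_simp
    ring
  have hsum : ∀ j : ℕ, Summable fun k : ℤ => (k : ℂ) ^ j * gauss a⁻¹ k * e (k * X) := by
    intro j
    refine Summable.of_norm_bounded (summable_pow_mul_gauss (inv_pos.mpr ha0) j).norm fun k => ?_
    rw [norm_mul, show ((k : ℂ) * X) = ((k * X : ℝ) : ℂ) by push_cast; ring, norm_e_real, mul_one]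
  obtain ⟨hg1, hg2⟩ := summable_gauss_shift ha0 X
  have hs1 : Summable fun k : ℤ => -(I * k / a) * ((1 / √a : ℝ) * gauss a⁻¹ k) * e (k * X) := by
    refine ((hsum 1).mul_left (-(I / a) * (1 / √a : ℝ))).congr fun k => ?_
    ring
  have hs2 : Summable fun k : ℤ => -((k : ℂ) ^ 2 / a ^ 2) * ((1 / √a : ℝ) * gauss a⁻¹ k) *
      e (k * X) := by
    refine ((hsum 2).mul_left (-(1 / (a : ℂ) ^ 2) * (1 / √a : ℝ))).congr fun k => ?_
    ring
  simp_rw [h1, h2]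
  rw [(hg2.mul_left _).tsum_add (hg1.mul_left _), (hs2.mul_left _).tsum_add (hs1.mul_left _),
    tsum_mul_left, tsum_mul_left, tsum_mul_left, tsum_mul_left, tsum_gauss₁ ha0, tsum_gauss₂ ha0]

/-- The Hermite functions involved have integral zero. Without this the frequency k = 0 would not
decay as t → ∞. -/
theorem pTerm_zero (η v f : V n) (l t y c : ℝ) (x : V n) : pTerm η v f l t y c x 0 = 0 := by
  simp [pTerm]

theorem pTerm_estimate {P M G E t κ S R H : ℝ} (hκ : 0 ≤ κ) (hS : 0 ≤ S) (hG : 0 ≤ G)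
    (hE : 0 ≤ E) (hP : 0 ≤ P) (hH : 0 ≤ H) (h1 : P ≤ 6 * t) (h2 : M ≤ 4 * (t ^ 2 * κ) * S * R) (h3 : R * E ≤ H) :
    P * E * G * M ≤ 24 * t ^ 3 * κ * S * G * H :=
  calc P * E * G * M ≤ P * E * G * (4 * (t ^ 2 * κ) * S * R) :=
        mul_le_mul_of_nonneg_left h2 (by positivity)
    _ = P * (4 * (t ^ 2 * κ) * S * G * (R * E)) := by ring
    _ ≤ P * (4 * (t ^ 2 * κ) * S * G * H) :=
        mul_le_mul_of_nonneg_left (mul_le_mul_of_nonneg_left h3 (by positivity)) hP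
    _ ≤ _ := by
        have hH' : 0 ≤ 4 * (t ^ 2 * κ) * S * G * H := by positivity
        exact (mul_le_mul_of_nonneg_right h1 hH').trans_eq (by ring)

theorem norm_pTerm_le {η v f : V n} (hη : IsPos η) (hf : IsPos f) (hf1 : bil f f = 1)
    {l t y c : ℝ} (ht1 : 1 ≤ t) (hy : 1 / 2 ≤ y) (hc : |c| ≤ 1) {x : V n} (hx : IsPos x) (k : ℤ) :
    ‖pTerm η v f l t y c x k‖ ≤ 24 * (|bil η f| + |l + bil η v|) * Real.exp (q η) *
      (t ^ 3 * (k : ℝ) ^ 2 * Real.exp (-(q x / 2)) * Real.exp (-(Real.pi * (k * t) ^ 2 / y))) := by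
  have ht0 : 0 < t := by linarith
  have hy0 : 0 < y := by linarith
  have hs3 : √2 ≤ (3 / 2 : ℝ) := by rw [Real.sqrt_le_iff]; norm_num
  set Q := q (x + c • η) with hQ
  have hxc := hx.add (hη.smul c)
  have hQ0 : 0 ≤ Q := hxc.q_nonneg
  have hsy : 1 / √y ≤ 3 / 2 := by
    rw [div_le_iff₀ (Real.sqrt_pos.mpr hy0)]
    have : (2 / 3 : ℝ) ≤ √y := Real.le_sqrt_of_sq_le (by norm_num; linarith)
    linarith
  set b := bil (x + c • η) f with hb
  have hb1 : |b| ≤ 1 + Q := by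
    have e1 := hxc.bil_sq_le hf
    rw [show q f = 1 / 2 by rw [q, hf1]] at e1
    have e2 : b ^ 2 ≤ 2 * Q := by rw [hb, hQ]; linarith
    rw [abs_le]; constructor <;> nlinarith [sq_nonneg (b + 1), sq_nonneg (b - 1)]
  -- Integrality of k gives the term linear in k the same factor k² as the quadratic one.
  have hk : |(k : ℝ)| ≤ (k : ℝ) ^ 2 := by
    have : |k| ≤ k ^ 2 := by
      rw [← sq_abs]; nlinarith [abs_nonneg k, Int.one_le_abs (z := k), sq_nonneg (|k| - 1), Int.le_self_sq |k|]
    exact_mod_cast this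
  set Y := |bil η f| with hY
  set L := |l + bil η v| with hL
  have hY0 : 0 ≤ Y := abs_nonneg _
  have hL0 : 0 ≤ L := abs_nonneg _
  have hk0 : 0 ≤ (k : ℝ) ^ 2 := sq_nonneg _
  have hmid : ‖((((k * t) ^ 2 / y ^ 2 * bil η f : ℝ) : ℂ) -
      I * (k * (l + bil η v) * b / y : ℝ))‖ ≤ 4 * (t ^ 2 * (k : ℝ) ^ 2) * (Y + L) * (1 + Q) := by
    refine (norm_sub_le _ _).trans ?_
    rw [norm_mul, norm_I, one_mul, norm_real, norm_real, Real.norm_eq_abs, Real.norm_eq_abs,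
      abs_mul, abs_div, abs_div, abs_mul, abs_mul, abs_of_pos hy0, abs_of_nonneg (sq_nonneg (k * t)),
      abs_of_nonneg (sq_nonneg y)]
    have hyinv : 1 / y ≤ 2 := by rw [div_le_iff₀ hy0]; linarith
    have e1 : (k * t) ^ 2 / y ^ 2 ≤ 4 * (t ^ 2 * (k : ℝ) ^ 2) := by
      rw [div_le_iff₀ (by positivity)]
      have : 1 ≤ 4 * y ^ 2 := by nlinarith
      nlinarith [mul_nonneg hk0 (sq_nonneg t)]
    have e2 : |(k : ℝ)| * L * |b| / y ≤ (k : ℝ) ^ 2 * L * (1 + Q) * 2 := by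
      rw [div_eq_mul_one_div]
      gcongr
    have e3 : (k : ℝ) ^ 2 * L * (1 + Q) * 2 ≤ 4 * (t ^ 2 * (k : ℝ) ^ 2) * L * (1 + Q) := by
      have : (k : ℝ) ^ 2 * 2 ≤ 4 * (t ^ 2 * (k : ℝ) ^ 2) := by
        have ht2 : 1 ≤ t ^ 2 := by nlinarith
        have := mul_le_mul_of_nonneg_right ht2 hk0
        linarith
      have h6 := mul_le_mul_of_nonneg_right this (mul_nonneg hL0 (by linarith : 0 ≤ 1 + Q))
      linarith
    have e4 : (k * t) ^ 2 / y ^ 2 * Y ≤ 4 * (t ^ 2 * (k : ℝ) ^ 2) * Y * (1 + Q) := by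
      have := mul_le_mul_of_nonneg_right e1 hY0
      have h5 : 0 ≤ 4 * (t ^ 2 * (k : ℝ) ^ 2) * Y * Q := by positivity
      linarith
    linarith
  have hexp : (1 + Q) * Real.exp (-(2 * Real.pi * y * Q)) ≤ Real.exp (q η) * Real.exp (-(q x / 2)) := by
    have h2 : q x / 2 - q η ≤ Q := by
      have e1 := hx.q_add_ge (hη.smul c)
      rw [q_smul] at e1
      have hc2 : c ^ 2 ≤ 1 := by rw [← sq_abs]; nlinarith [abs_nonneg c]
      nlinarith [hη.q_nonneg]
    calc (1 + Q) * Real.exp (-(2 * Real.pi * y * Q)) ≤ Real.exp Q * Real.exp (-(2 * Q)) := by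
          refine mul_le_mul (by linarith [Real.add_one_le_exp Q]) (Real.exp_le_exp.mpr ?_)
            (Real.exp_pos _).le (Real.exp_pos _).le
          have : 2 ≤ 2 * Real.pi * y := by nlinarith [Real.pi_gt_three]
          nlinarith
      _ ≤ _ := by
          rw [← Real.exp_add, ← Real.exp_add]
          exact Real.exp_le_exp.mpr (by linarith)
  have hpre : 2 * √2 * t / √y ≤ 6 * t := by
    rw [div_eq_mul_one_div]
    have h9 : 2 * √2 * t ≤ 3 * t := by nlinarith
    have h10 : 2 * √2 * t * (1 / √y) ≤ 3 * t * (3 / 2) :=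
      mul_le_mul h9 hsy (by positivity) (by positivity)
    nlinarith
  rw [pTerm, norm_mul, norm_mul, norm_e_real, mul_one, norm_real, Real.norm_eq_abs,
    abs_of_nonneg (by positivity)]
  generalize ‖((((k * t) ^ 2 / y ^ 2 * bil η f : ℝ) : ℂ) -
      I * (k * (l + bil η v) * b / y : ℝ))‖ = M at hmid ⊢
  exact (pTerm_estimate (sq_nonneg _) (add_nonneg hY0 hL0) (Real.exp_pos _).le
    (Real.exp_pos _).le (by positivity) (by positivity) hpre hmid hexp).trans_eq (by ring)

end Poisson
end
end JacobiLift

namespace JacobiLift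

noncomputable section

open Complex MeasureTheory Filter Topology Asymptotics Set

/-! ### The fundamental domain in sheared coordinates -/

section Domain

/-- The parametrization `((y, w), (x₁, x)) ↦ (x₁ + iy, x + (w/y)(x₁ + iy))`. -/
def shearMap (p : (ℝ × ℝ) × (ℝ × ℝ)) : ℂ × ℂ :=
  (⟨p.2.1, p.1.1⟩, ⟨p.2.2 + p.1.2 / p.1.1 * p.2.1, p.1.2⟩)

theorem measurePreserving_shear_fiber (s : ℝ) :
    MeasurePreserving fun p : ℝ × ℝ => (p.1, p.2 + s * p.1) :=
  (MeasurePreserving.id (volume : Measure ℝ)).skew_product (g := fun x z => z + s * x)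
    (by fun_prop)
    (Eventually.of_forall fun x => (measurePreserving_add_right volume (s * x)).map_eq)

theorem measurePreserving_prodProdProdComm :
    MeasurePreserving fun p : (ℝ × ℝ) × (ℝ × ℝ) => ((p.1.1, p.2.1), (p.1.2, p.2.2)) := by
  have a1 := volume_preserving_prodAssoc (α₁ := ℝ) (β₁ := ℝ) (γ₁ := ℝ × ℝ)
  have a2 := (MeasurePreserving.id (volume : Measure ℝ)).prod
    (volume_preserving_prodAssoc (α₁ := ℝ) (β₁ := ℝ) (γ₁ := ℝ)).symm
  have a3 := (MeasurePreserving.id (volume : Measure ℝ)).prod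
    ((Measure.measurePreserving_swap (μ := (volume : Measure ℝ)) (ν := (volume : Measure ℝ))).prod
      (MeasurePreserving.id (volume : Measure ℝ)))
  have a4 := (MeasurePreserving.id (volume : Measure ℝ)).prod
    (volume_preserving_prodAssoc (α₁ := ℝ) (β₁ := ℝ) (γ₁ := ℝ))
  have a5 := (volume_preserving_prodAssoc (α₁ := ℝ) (β₁ := ℝ) (γ₁ := ℝ × ℝ)).symm
  exact a5.comp (a4.comp (a3.comp (a2.comp a1)))

/-- For fixed y and w the map shears the (x₁, x)-plane, and for fixed x₁ that is a translation in x;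
the rest rearranges coordinates. -/
theorem measurePreserving_shearMap : MeasurePreserving shearMap := by
  have b1 : MeasurePreserving fun p : (ℝ × ℝ) × (ℝ × ℝ) =>
      (p.1, (p.2.1, p.2.2 + p.1.2 / p.1.1 * p.2.1)) :=
    (MeasurePreserving.id (volume : Measure (ℝ × ℝ))).skew_product
      (g := fun (a p : ℝ × ℝ) => (p.1, p.2 + a.2 / a.1 * p.1)) (by fun_prop)
      (Eventually.of_forall fun a => (measurePreserving_shear_fiber (a.2 / a.1)).map_eq)
  have b3 := (Measure.measurePreserving_swap (μ := (volume : Measure ℝ))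
      (ν := (volume : Measure ℝ))).prod
    (Measure.measurePreserving_swap (μ := (volume : Measure ℝ)) (ν := (volume : Measure ℝ)))
  have b4 := volume_preserving_equiv_real_prod.symm.prod volume_preserving_equiv_real_prod.symm
  exact b4.comp (b3.comp (measurePreserving_prodProdProdComm.comp b1))

theorem shearMap_injective : Function.Injective shearMap := by
  rintro ⟨⟨y, w⟩, x₁, x⟩ ⟨⟨y', w'⟩, x₁', x'⟩ h
  simp only [shearMap, Prod.mk.injEq, Complex.mk.injEq] at h
  obtain ⟨⟨rfl, rfl⟩, h, rfl⟩ := h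
  simpa using h

/-- Lusin-Souslin: an injective measurable map between standard Borel spaces has measurable images.
-/
theorem measurableEmbedding_shearMap : MeasurableEmbedding shearMap :=
  measurePreserving_shearMap.measurable.measurableEmbedding shearMap_injective

theorem shearMap_snd {p : (ℝ × ℝ) × (ℝ × ℝ)} (hp : p.1.1 ≠ 0) :
    (shearMap p).2 = p.2.2 + ((p.1.2 / p.1.1 : ℝ) : ℂ) * (p.2.1 + p.1.1 * I) := by
  apply Complex.ext
  · simp [shearMap]
  · simp [shearMap]; field_simp

/-- The part of the fundamental domain above height one. -/
def cuspDomain : Set (ℂ × ℂ) := jacobiDomain ∩ {τ | 1 < τ.1.im}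

theorem measurableSet_jacobiDomain : MeasurableSet jacobiDomain := by
  have h1 : Measurable fun τ : ℂ × ℂ => τ.1.im := by fun_prop
  have h2 : Measurable fun τ : ℂ × ℂ => |τ.1.re| := by fun_prop
  have h3 : Measurable fun τ : ℂ × ℂ => ‖τ.1‖ := by fun_prop
  have h4 : Measurable fun τ : ℂ × ℂ => τ.2.im := by fun_prop
  have h5 : Measurable fun τ : ℂ × ℂ => τ.2.re := by fun_prop
  have h6 : Measurable fun τ : ℂ × ℂ => τ.2.im * τ.1.re / τ.1.im := by fun_prop
  exact (measurableSet_lt measurable_const h1).inter <|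
    (measurableSet_le h2 measurable_const).inter <|
    (measurableSet_le measurable_const h3).inter <|
    (measurableSet_le measurable_const h4).inter <|
    (measurableSet_le h4 (h1.div_const 2)).inter <|
    (measurableSet_le h6 h5).inter (measurableSet_le h5 (h6.const_add 1))

theorem measurableSet_cuspDomain : MeasurableSet cuspDomain :=
  measurableSet_jacobiDomain.inter
    (measurableSet_lt measurable_const (Complex.measurable_im.comp measurable_fst))

theorem half_le_im {τ : ℂ × ℂ} (h : τ ∈ jacobiDomain) : 1 / 2 ≤ τ.1.im := by
  obtain ⟨h0, h1, h2, -⟩ := h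
  have h3 : 1 ≤ τ.1.re ^ 2 + τ.1.im ^ 2 := by
    have := Complex.sq_norm τ.1
    rw [Complex.normSq_apply] at this
    nlinarith
  have h4 : τ.1.re ^ 2 ≤ (1 / 2) ^ 2 := by rw [← sq_abs]; gcongr
  nlinarith

theorem ratio_mem {τ : ℂ × ℂ} (h : τ ∈ jacobiDomain) :
    τ.2.im / τ.1.im ∈ Icc (0 : ℝ) (1 / 2) := by
  obtain ⟨h0, -, -, h3, h4, -⟩ := h
  exact ⟨div_nonneg h3 h0.le, by rw [div_le_iff₀ h0]; linarith⟩

/-- The range of the imaginary parts above height one. -/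
def cuspBase : Set (ℝ × ℝ) := {p | 1 < p.1 ∧ 0 ≤ p.2 ∧ p.2 ≤ p.1 / 2}

theorem measurableSet_cuspBase : MeasurableSet cuspBase :=
  MeasurableSet.inter (measurableSet_lt measurable_const measurable_fst)
    (MeasurableSet.inter (measurableSet_le measurable_const measurable_snd)
      (measurableSet_le measurable_snd (measurable_fst.div_const 2)))

/-- Above height one the condition ‖τ₁‖ ≥ 1 holds automatically, so the fibre over every pair of
imaginary parts is the same rectangle. -/
theorem shearMap_preimage_cuspDomain :
    shearMap ⁻¹' cuspDomain = cuspBase ×ˢ (Icc (-(1 / 2)) (1 / 2) ×ˢ Icc 0 1) := by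
  ext ⟨⟨y, w⟩, x₁, x⟩
  simp only [mem_preimage, cuspDomain, jacobiDomain, mem_inter_iff, mem_ofPred_eq, shearMap, mem_prod,
    cuspBase, mem_Icc]
  constructor
  · rintro ⟨⟨h0, h1, h2, h3, h4, h5, h6⟩, h7⟩
    rw [abs_le] at h1
    rw [div_mul_eq_mul_div] at h5 h6
    exact ⟨⟨h7, h3, h4⟩, h1, by linarith, by linarith⟩
  · rintro ⟨⟨h7, h3, h4⟩, h1, h5, h6⟩
    rw [div_mul_eq_mul_div]
    refine ⟨⟨by linarith, abs_le.mpr h1, ?_, h3, h4, by linarith, by linarith⟩, h7⟩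
    refine h7.le.trans ((le_abs_self y).trans (Complex.abs_im_le_norm ⟨x₁, y⟩))

/-- On the domain w ≤ y/2, hence δy ≥ (δ/2)y + δw and the exponential is dominated by a product of
integrable exponentials. -/
theorem integrableOn_exp_neg_jacobiDomain {δ : ℝ} (hδ : 0 < δ) :
    IntegrableOn (fun τ : ℂ × ℂ => Real.exp (-δ * τ.1.im)) jacobiDomain := by
  rw [← measurePreserving_shearMap.integrableOn_comp_preimage measurableEmbedding_shearMap]
  have hsub : shearMap ⁻¹' jacobiDomain ⊆
      ((Ioi 0 ×ˢ Ioi (-1)) ×ˢ (Icc (-(1 / 2)) (1 / 2) ×ˢ Icc 0 1)) ∩ {p | p.1.2 ≤ p.1.1 / 2} := by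
    rintro ⟨⟨y, w⟩, x₁, x⟩ ⟨h0, h1, h2, h3, h4, h5, h6⟩
    simp only [shearMap] at h0 h1 h3 h4 h5 h6
    rw [div_mul_eq_mul_div] at h5 h6
    simp only [mem_inter_iff, mem_prod, mem_Ioi, mem_Icc, mem_ofPred_eq]
    exact ⟨⟨⟨h0, by linarith⟩, abs_le.mp h1, by linarith, by linarith⟩, h4⟩
  have hint : IntegrableOn (fun p : (ℝ × ℝ) × (ℝ × ℝ) =>
      Real.exp (-(δ / 2) * p.1.1) * Real.exp (-δ * p.1.2) * (1 * 1))
      ((Ioi 0 ×ˢ Ioi (-1)) ×ˢ (Icc (-(1 / 2)) (1 / 2) ×ˢ Icc 0 1)) := by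
    rw [IntegrableOn, Measure.volume_eq_prod, Measure.volume_eq_prod, ← Measure.prod_restrict,
      ← Measure.prod_restrict, ← Measure.prod_restrict]
    have i1 : IntegrableOn (fun y : ℝ => Real.exp (-(δ / 2) * y)) (Ioi 0) :=
      exp_neg_integrableOn_Ioi 0 (by positivity)
    have i2 : IntegrableOn (fun y : ℝ => Real.exp (-δ * y)) (Ioi (-1)) :=
      exp_neg_integrableOn_Ioi (-1) hδ
    have i3 : IntegrableOn (fun _ : ℝ => (1 : ℝ)) (Icc (-(1 / 2)) (1 / 2)) := by simp
    have i4 : IntegrableOn (fun _ : ℝ => (1 : ℝ)) (Icc 0 1) := by simp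
    exact (i1.mul_prod i2).mul_prod (i3.mul_prod i4)
  have hmeas : MeasurableSet (shearMap ⁻¹' jacobiDomain) :=
    measurePreserving_shearMap.measurable measurableSet_jacobiDomain
  refine Integrable.mono' (hint.mono_set (hsub.trans inter_subset_left)) ?_ ?_
  · refine Measurable.aestronglyMeasurable ?_
    have := measurePreserving_shearMap.measurable
    fun_prop
  · refine (ae_restrict_iff' hmeas).mpr (Eventually.of_forall fun p hp => ?_)
    have h := (hsub hp).2
    simp only [mem_ofPred_eq] at h
    rw [Function.comp_apply, Real.norm_of_nonneg (Real.exp_pos _).le, mul_one, mul_one,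
      ← Real.exp_add]
    refine Real.exp_le_exp.mpr ?_
    change -δ * p.1.1 ≤ _
    nlinarith

end Domain
end
end JacobiLift

namespace JacobiLift

noncomputable section

open Complex MeasureTheory Filter Topology Asymptotics Set

/-! ### The terms of the Petersson product -/

section Terms
variable {n : ℕ} {Λ : Submodule ℤ (EuclideanSpace ℝ (Fin n))}

/-- The weight of the inner product, combined with the automorphy factors of the theta kernel. -/
def perWeight (n : ℕ) (m y c : ℝ) : ℝ :=
  y ^ (((n : ℝ) - 1) / 2) * Real.exp (-(2 * Real.pi * m * c ^ 2 * y))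

/-- The part of a term which does not depend on the isometry. -/
def perBase (η : dualLattice (posLattice Λ)) (φ : ℂ → ℂ → Disc (lorLattice Λ) → ℂ) (l : ℕ)
    (p : dualLattice (posLattice Λ) × ℤ × ℤ) (τ : ℂ × ℂ) : ℂ :=
  φ τ.1 τ.2 (cls (toLorDual p.1)) *
    e ((-((q (p.1 : V n) + p.2.1 * p.2.2) * τ.1.re +
      (bil (p.1 : V n) η + p.2.1 * l) * τ.2.re) : ℝ) : ℂ) *
    (perWeight n (q (η : V n)) τ.1.im (τ.2.im / τ.1.im) : ℝ)

/-- The kernel after Poisson summation of the terms with `j = 0`. -/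
def perKer (η v f : V n) (l t y c : ℝ) (p : dualLattice (posLattice Λ) × ℤ × ℤ) : ℂ :=
  if p.2.1 = 0 then pTerm η v f l t y c p.1 p.2.2
  else (thKer η v f l t y c p.1 p.2.1 p.2.2 : ℝ)

/-- The terms of the inner product after Poisson summation. -/
def perTerm (η : dualLattice (posLattice Λ)) (φ : ℂ → ℂ → Disc (lorLattice Λ) → ℂ) (v f : V n)
    (l : ℕ) (t : ℝ) (p : dualLattice (posLattice Λ) × ℤ × ℤ) (τ : ℂ × ℂ) : ℂ :=
  perBase η φ l p τ * perKer η v f l t τ.1.im (τ.2.im / τ.1.im) p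

theorem rpow_mul_exp_neg_le {s δ : ℝ} (hδ : 0 < δ) :
    ∃ C : ℝ, 0 ≤ C ∧ ∀ y : ℝ, 1 / 2 ≤ y → y ^ s * Real.exp (-δ * y) ≤ C * Real.exp (-(δ / 2) * y) := by
  have h0 : Tendsto (fun y : ℝ => y ^ s * Real.exp (-(δ / 2) * y)) atTop (𝓝 0) :=
    tendsto_rpow_mul_exp_neg_mul_atTop_nhds_zero s (δ / 2) (by positivity)
  obtain ⟨M, hM⟩ := eventually_atTop.mp (h0.eventually (ge_mem_nhds (zero_lt_one)))
  have hcont : ContinuousOn (fun y : ℝ => y ^ s * Real.exp (-(δ / 2) * y)) (Icc (1 / 2) (max M (1 / 2))) := by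
    refine ContinuousOn.mul (ContinuousOn.rpow_const continuousOn_id fun y hy => Or.inl ?_)
      (by fun_prop)
    exact (lt_of_lt_of_le (by norm_num) hy.1).ne'
  obtain ⟨C, hC⟩ := (isCompact_Icc.image_of_continuousOn hcont).bddAbove
  refine ⟨max C 1, le_trans zero_le_one (le_max_right _ _), fun y hy => ?_⟩
  have key : y ^ s * Real.exp (-(δ / 2) * y) ≤ max C 1 := by
    rcases le_total y (max M (1 / 2)) with h | h
    · exact (hC ⟨y, ⟨hy, h⟩, rfl⟩).trans (le_max_left _ _)
    · exact (hM y ((le_max_left _ _).trans h)).trans (le_max_right _ _)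
  calc y ^ s * Real.exp (-δ * y) = y ^ s * Real.exp (-(δ / 2) * y) * Real.exp (-(δ / 2) * y) := by
        rw [mul_assoc, ← Real.exp_add]; congr 2; ring
    _ ≤ _ := mul_le_mul_of_nonneg_right key (Real.exp_pos _).le

/-- The growth exp(2πq(η)c²y) permitted to a cusp form is cancelled exactly by the weight. Half of
the exponential decay pays for the power of y. -/
theorem norm_perBase_le [DiscreteTopology Λ] [IsZLattice ℝ Λ]
    (hΛ : ∀ x ∈ Λ, ∃ m : ℤ, inner ℝ x x = 2 * (m : ℝ)) {η : dualLattice (posLattice Λ)}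
    (hη : 0 < q (η : V n)) {φ : ℂ → ℂ → Disc (lorLattice Λ) → ℂ}
    {a : Disc (lorLattice Λ) → ℝ → ℝ → ℂ} {sig : ℤ} {k : ℝ}
    (hφ : IsJacobiCuspForm (lorLattice Λ) sig k (toLorDual η) φ a) :
    ∃ δ > 0, ∃ B ≥ 0, ∀ l p, ∀ τ ∈ jacobiDomain,
      ‖perBase η φ l p τ‖ ≤ B * Real.exp (-δ * τ.1.im) := by
  obtain ⟨δ, hδ, h⟩ := hφ.exists_norm_le hΛ hη
  obtain ⟨B, hB, hB2⟩ := h (1 / 2) (by norm_num)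
  obtain ⟨C, hC, hC2⟩ := rpow_mul_exp_neg_le (s := ((n : ℝ) - 1) / 2) hδ
  refine ⟨δ / 2, by positivity, B * C, by positivity, fun l p τ hτ => ?_⟩
  have hy := half_le_im hτ
  have hc := ratio_mem hτ
  have hy0 : τ.1.im ≠ 0 := by linarith
  set c := τ.2.im / τ.1.im with hcdef
  have h1 := hB2 (cls (toLorDual p.1)) τ.1 hy c (by rw [abs_le]; constructor <;> linarith [hc.1, hc.2])
    (τ.2.re - c * τ.1.re)
  have h2 : ((τ.2.re - c * τ.1.re : ℝ) : ℂ) + c * τ.1 = τ.2 := by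
    apply Complex.ext
    · simp
    · simp [hcdef]; field_simp
  rw [h2] at h1
  rw [perBase, norm_mul, norm_mul, norm_e_real, mul_one, norm_real, perWeight, norm_mul,
    Real.norm_of_nonneg (Real.exp_pos _).le,
    Real.norm_of_nonneg (Real.rpow_nonneg (by linarith : 0 ≤ τ.1.im) _)]
  have hq : q ((toLorDual η : dualLattice (lorLattice Λ)) : V n) = q (η : V n) := rfl
  rw [hq] at h1
  calc _ ≤ B * Real.exp (-δ * τ.1.im) * Real.exp (2 * Real.pi * q (η : V n) * c ^ 2 * τ.1.im) *
        (τ.1.im ^ (((n : ℝ) - 1) / 2) * Real.exp (-(2 * Real.pi * q (η : V n) * c ^ 2 * τ.1.im))) :=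
        mul_le_mul_of_nonneg_right h1 (mul_nonneg (Real.rpow_nonneg (by linarith) _) (Real.exp_pos _).le)
    _ = B * (τ.1.im ^ (((n : ℝ) - 1) / 2) * Real.exp (-δ * τ.1.im)) *
        (Real.exp (2 * Real.pi * q (η : V n) * c ^ 2 * τ.1.im) *
          Real.exp (-(2 * Real.pi * q (η : V n) * c ^ 2 * τ.1.im))) := by ring
    _ = B * (τ.1.im ^ (((n : ℝ) - 1) / 2) * Real.exp (-δ * τ.1.im)) := by
        rw [← Real.exp_add, add_neg_cancel, Real.exp_zero, mul_one]
    _ ≤ B * (C * Real.exp (-(δ / 2) * τ.1.im)) := mul_le_mul_of_nonneg_left (hC2 _ hy) hB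
    _ = _ := by ring

@[fun_prop]
theorem continuous_q : Continuous (q : V n → ℝ) := by unfold q bil; fun_prop

@[fun_prop]
theorem continuous_bil_left (f : V n) : Continuous fun x : V n => bil x f := by unfold bil; fun_prop

@[fun_prop]
theorem measurable_q : Measurable (q : V n → ℝ) := continuous_q.measurable

@[fun_prop]
theorem measurable_bil_left (f : V n) : Measurable fun x : V n => bil x f :=
  (continuous_bil_left f).measurable

@[fun_prop]
theorem measurable_e : Measurable e := continuous_e.measurable

theorem measurable_perKer (η v f : V n) (l t : ℝ) (p : dualLattice (posLattice Λ) × ℤ × ℤ) :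
    Measurable fun z : ℝ × ℝ => perKer η v f l t z.1 z.2 p := by
  have hline : ∀ j : ℝ, Measurable fun z : ℝ × ℝ => (p.1 : V n) + z.2 • η - j • v := fun j => by
    fun_prop
  have hline0 : Measurable fun z : ℝ × ℝ => (p.1 : V n) + z.2 • η := by fun_prop
  have h1 := fun j => measurable_q.comp (hline j)
  have h2 := fun j => (measurable_bil_left f).comp (hline j)
  have h3 := measurable_q.comp hline0
  have h4 := (measurable_bil_left f).comp hline0
  simp only [Function.comp_def] at h1 h2 h3 h4
  unfold perKer
  split_ifs with h
  · unfold pTerm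
    fun_prop
  · unfold thKer thH thQ thX
    have h1' := h1 p.2.1
    have h2' := h2 p.2.1
    fun_prop

theorem aestronglyMeasurable_perTerm [DiscreteTopology Λ] [IsZLattice ℝ Λ]
    {η : dualLattice (posLattice Λ)} {φ : ℂ → ℂ → Disc (lorLattice Λ) → ℂ} {sig : ℤ} {k : ℝ}
    (hφ : IsJacobiForm (lorLattice Λ) sig k (toLorDual η) φ) (v f : V n) (l : ℕ) (t : ℝ)
    (p : dualLattice (posLattice Λ) × ℤ × ℤ) :
    AEStronglyMeasurable (perTerm η φ v f l t p) (volume.restrict jacobiDomain) := by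
  have h1 : AEStronglyMeasurable (fun τ : ℂ × ℂ => φ τ.1 τ.2 (cls (toLorDual p.1)))
      (volume.restrict jacobiDomain) :=
    ((hφ.holo _).continuousOn.mono fun τ hτ => hτ.1).aestronglyMeasurable measurableSet_jacobiDomain
  have h2 : Measurable fun τ : ℂ × ℂ => e ((-((q (p.1 : V n) + p.2.1 * p.2.2) * τ.1.re +
      (bil (p.1 : V n) η + p.2.1 * l) * τ.2.re) : ℝ) : ℂ) := by fun_prop
  have h3 : Measurable fun τ : ℂ × ℂ =>
      ((perWeight n (q (η : V n)) τ.1.im (τ.2.im / τ.1.im) : ℝ) : ℂ) := by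
    unfold perWeight; fun_prop
  have h4 : Measurable fun τ : ℂ × ℂ => perKer (η : V n) v f l t τ.1.im (τ.2.im / τ.1.im) p :=
    (measurable_perKer (η : V n) v f l t p).comp
      (g := fun z : ℝ × ℝ => perKer (η : V n) v f l t z.1 z.2 p)
      (f := fun τ : ℂ × ℂ => (τ.1.im, τ.2.im / τ.1.im)) (by fun_prop)
  exact ((h1.mul h2.aestronglyMeasurable).mul h3.aestronglyMeasurable).mul h4.aestronglyMeasurable

end Terms
end
end JacobiLift

namespace JacobiLift

noncomputable section

open Complex MeasureTheory Filter Topology Asymptotics Set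

/-! ### Termwise integration -/

section Termwise
variable {n : ℕ} {Λ : Submodule ℤ (EuclideanSpace ℝ (Fin n))}

/-- A constant bounding the kernels uniformly. -/
def kerConst (η v f : V n) (l : ℝ) : ℝ :=
  24 * (|bil η f| + |l + bil η v|) * Real.exp (2 * q η + (l + bil η v) ^ 2 / 2)

theorem kerConst_nonneg (η v f : V n) (l : ℝ) : 0 ≤ kerConst η v f l := by
  unfold kerConst; positivity

/-- The bound of the kernel at height `y`. -/
def kerMaj (t y : ℝ) (p : dualLattice (posLattice Λ) × ℤ × ℤ) : ℝ :=
  if p.2.1 = 0 then t ^ 3 * (p.2.2 : ℝ) ^ 2 * Real.exp (-(q (p.1 : V n) / 2)) *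
    Real.exp (-(Real.pi * (p.2.2 * t) ^ 2 / y))
  else Real.exp (-(q (p.1 : V n) / 4 + (p.2.2 : ℝ) ^ 2 / (8 * t ^ 2) + (p.2.1 : ℝ) ^ 2 * t ^ 2 / 4))

theorem norm_perKer_le {η v f : V n} (hη : IsPos η) (hv : IsPos v) (hf : IsPos f)
    (hf1 : bil f f = 1) {l t y c : ℝ} (ht1 : 1 ≤ t) (ht : 16 * q v ≤ t ^ 2) (hy : 1 / 2 ≤ y)
    (hc : |c| ≤ 1) (p : dualLattice (posLattice Λ) × ℤ × ℤ) :
    ‖perKer η v f l t y c p‖ ≤ kerConst η v f l * kerMaj t y p := by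
  have hx := isPos_dual p.1
  have hS : 0 ≤ |bil η f| + |l + bil η v| := by positivity
  unfold perKer kerMaj kerConst
  split_ifs with h
  · refine (norm_pTerm_le hη hf hf1 ht1 hy hc hx _).trans ?_
    refine mul_le_mul_of_nonneg_right (mul_le_mul_of_nonneg_left (Real.exp_le_exp.mpr ?_)
      (by positivity)) (by positivity)
    have := hη.q_nonneg
    nlinarith [sq_nonneg (l + bil η v)]
  · rw [norm_real, Real.norm_eq_abs]
    refine (abs_thKer_le hη hv hf hf1 ht1 ht hy hc hx _ _).trans ?_
    refine mul_le_mul_of_nonneg_right (mul_le_mul_of_nonneg_right ?_ (Real.exp_pos _).le)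
      (Real.exp_pos _).le
    linarith

/-- A summable majorant, uniform in the height. -/
def sumMaj (κ t : ℝ) (p : dualLattice (posLattice Λ) × ℤ × ℤ) : ℝ :=
  t ^ 3 * (Real.exp (-(1 / 2) * q (p.1 : V n)) * ((if p.2.1 = 0 then 1 else 0) *
    ((p.2.2 : ℝ) ^ 2 * Real.exp (-κ * |(p.2.2 : ℝ)|)))) +
  Real.exp (-(q (p.1 : V n) / 4 + (p.2.2 : ℝ) ^ 2 / (8 * t ^ 2) + (p.2.1 : ℝ) ^ 2 * t ^ 2 / 4))

theorem summable_pow_mul_exp_neg_abs (j : ℕ) {κ : ℝ} (hκ : 0 < κ) :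
    Summable fun k : ℤ => |(k : ℝ)| ^ j * Real.exp (-κ * |(k : ℝ)|) := by
  have h := Real.summable_pow_mul_exp_neg_nat_mul j hκ
  refine Summable.of_nat_of_neg ?_ ?_ <;>
  · refine h.congr fun k => ?_
    simp

theorem summable_sumMaj (Λ : Submodule ℤ (EuclideanSpace ℝ (Fin n))) [DiscreteTopology Λ]
    [IsZLattice ℝ Λ] {κ t : ℝ} (hκ : 0 < κ) (ht : 0 < t) :
    Summable (sumMaj κ t : dualLattice (posLattice Λ) × ℤ × ℤ → ℝ) := by
  refine Summable.add (Summable.mul_left _ ?_) (summable_thKer_bound Λ ht)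
  have h1 := summable_exp_neg_q Λ (ε := 1 / 2) (by norm_num)
  have h2 : Summable fun j : ℤ => if j = 0 then (1 : ℝ) else 0 :=
    (hasSum_ite_eq (0 : ℤ) (1 : ℝ)).summable
  have h3 : Summable fun k : ℤ => (k : ℝ) ^ 2 * Real.exp (-κ * |(k : ℝ)|) := by
    simpa using summable_pow_mul_exp_neg_abs 2 hκ
  have n2 : ∀ j : ℤ, 0 ≤ if j = 0 then (1 : ℝ) else 0 := fun j => by split_ifs <;> norm_num
  have n3 : ∀ k : ℤ, 0 ≤ (k : ℝ) ^ 2 * Real.exp (-κ * |(k : ℝ)|) := fun k => by positivity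
  exact h1.mul_of_nonneg (h2.mul_of_nonneg h3 n2 n3) (fun _ => (Real.exp_pos _).le)
    fun p => mul_nonneg (n2 _) (n3 _)

/-- The factor exp(-π(kt)²/y) is not summable over k uniformly in y. Half of the cusp decay restores
uniformity, since π(kt)²/y + (δ/2)y ≥ 2√(δπ/2)|k|t. -/
theorem kerMaj_mul_exp_le {δ t y : ℝ} (hδ : 0 < δ) (ht1 : 1 ≤ t) (hy : 0 < y)
    (p : dualLattice (posLattice Λ) × ℤ × ℤ) :
    kerMaj t y p * Real.exp (-δ * y) ≤ sumMaj (2 * √(δ / 2 * Real.pi)) t p *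
      Real.exp (-(δ / 2) * y) := by
  have hδy : Real.exp (-δ * y) ≤ Real.exp (-(δ / 2) * y) := by
    refine Real.exp_le_exp.mpr ?_
    nlinarith
  unfold kerMaj sumMaj
  split_ifs with h
  · have h1 := two_mul_sqrt_le (A := δ / 2) (B := Real.pi * (p.2.2 * t) ^ 2) (by positivity)
      (by positivity) hy
    have h2 : √(δ / 2 * Real.pi) * |(p.2.2 : ℝ)| ≤ √(δ / 2 * (Real.pi * (p.2.2 * t) ^ 2)) := by
      rw [← mul_assoc, Real.sqrt_mul (x := δ / 2 * Real.pi) (by positivity), Real.sqrt_sq_eq_abs, abs_mul,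
        abs_of_pos (by linarith : 0 < t)]
      exact mul_le_mul_of_nonneg_left (le_mul_of_one_le_right (abs_nonneg _) ht1)
        (Real.sqrt_nonneg _)
    have h3 : Real.exp (-(Real.pi * (p.2.2 * t) ^ 2 / y)) * Real.exp (-δ * y) ≤
        Real.exp (-(2 * √(δ / 2 * Real.pi)) * |(p.2.2 : ℝ)|) * Real.exp (-(δ / 2) * y) := by
      rw [← Real.exp_add, ← Real.exp_add]
      exact Real.exp_le_exp.mpr (by linarith)
    have h4 : (0 : ℝ) ≤ t ^ 3 * (p.2.2 : ℝ) ^ 2 * Real.exp (-(q (p.1 : V n) / 2)) := by positivity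
    have h5 := mul_le_mul_of_nonneg_left h3 h4
    have h6 : 0 ≤ Real.exp (-(q (p.1 : V n) / 4 + (p.2.2 : ℝ) ^ 2 / (8 * t ^ 2) +
      (p.2.1 : ℝ) ^ 2 * t ^ 2 / 4)) * Real.exp (-(δ / 2) * y) := by positivity
    rw [show -(1 / 2) * q (p.1 : V n) = -(q (p.1 : V n) / 2) by ring, add_mul]
    linarith
  · rw [zero_mul, mul_zero, mul_zero, zero_add]
    exact mul_le_mul_of_nonneg_left hδy (Real.exp_pos _).le

/-- A summable majorant for the contribution of low heights and of the terms with `j ≠ 0`. -/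
def errMaj (p : dualLattice (posLattice Λ) × ℤ × ℤ) : ℝ :=
  Real.exp (-(1 / 4) * q (p.1 : V n)) * (Real.exp (-(1 / 16) * (p.2.1 : ℝ) ^ 2) *
    Real.exp (-(1 / 4) * |(p.2.2 : ℝ)|))

theorem summable_errMaj (Λ : Submodule ℤ (EuclideanSpace ℝ (Fin n))) [DiscreteTopology Λ]
    [IsZLattice ℝ Λ] : Summable (errMaj : dualLattice (posLattice Λ) × ℤ × ℤ → ℝ) := by
  have h1 := summable_exp_neg_q Λ (ε := 1 / 4) (by norm_num)
  have h2 := summable_exp_neg_mul_int_sq (c := 1 / 16) (by norm_num)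
  have h3 : Summable fun k : ℤ => Real.exp (-(1 / 4) * |(k : ℝ)|) := by
    simpa using summable_pow_mul_exp_neg_abs 0 (κ := 1 / 4) (by norm_num)
  exact h1.mul_of_nonneg (h2.mul_of_nonneg h3 (fun _ => (Real.exp_pos _).le)
    fun _ => (Real.exp_pos _).le) (fun _ => (Real.exp_pos _).le) fun p => by positivity

/-- The inequality |d|/4 ≤ d²/(8t²) + t²/8 gives summability in d; since j² ≥ 1, the exponent j²t²/4
can spare t²/8 and still leave t²/16 + j²/16. -/
theorem kerMaj_le_errMaj_of_ne {t y : ℝ} (ht1 : 1 ≤ t)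
    (p : dualLattice (posLattice Λ) × ℤ × ℤ) (hp : p.2.1 ≠ 0) :
    kerMaj t y p ≤ 2 * Real.exp (-(1 / 16) * t ^ 2) * errMaj p := by
  rw [kerMaj, if_neg hp, errMaj, ← Real.exp_add, ← Real.exp_add, mul_assoc, ← Real.exp_add]
  refine (Real.exp_le_exp.mpr ?_).trans (le_mul_of_one_le_left (Real.exp_pos _).le one_le_two)
  have hj : (1 : ℝ) ≤ (p.2.1 : ℝ) ^ 2 := by
    have : (1 : ℤ) ≤ p.2.1 ^ 2 := by
      have := sq_pos_of_ne_zero hp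
      omega
    exact_mod_cast this
  have ht2 : 1 ≤ t ^ 2 := by nlinarith
  have hd : |(p.2.2 : ℝ)| / 4 ≤ (p.2.2 : ℝ) ^ 2 / (8 * t ^ 2) + t ^ 2 / 8 := by
    rw [div_add' _ _ _ (by positivity), le_div_iff₀ (by positivity)]
    nlinarith [sq_nonneg (|(p.2.2 : ℝ)| - t ^ 2), sq_abs (p.2.2 : ℝ)]
  nlinarith [mul_nonneg (sub_nonneg.mpr hj) (sub_nonneg.mpr ht2)]

/-- With w = (kt)² and y ≤ 1, the decay exp(-πw/y) ≤ exp(-3w) overcomes the polynomial factor, as w²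
≤ 2exp(w). For k ≠ 0 the remainder controls both t² and |k|; for k = 0 the majorant is zero. -/
theorem kerMaj_le_errMaj_of_le {t y : ℝ} (ht1 : 1 ≤ t) (hy0 : 0 < y) (hy : y ≤ 1)
    (p : dualLattice (posLattice Λ) × ℤ × ℤ) (hp : p.2.1 = 0) :
    kerMaj t y p ≤ 2 * Real.exp (-(1 / 16) * t ^ 2) * errMaj p := by
  rw [kerMaj, if_pos hp, errMaj, hp]
  have hqx := (isPos_dual p.1).q_nonneg
  have ht2 : 1 ≤ t ^ 2 := by nlinarith
  rcases eq_or_ne p.2.2 0 with h | h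
  · rw [h]; simp; positivity
  set k : ℝ := (p.2.2 : ℝ) with hk
  have hk1 : 1 ≤ |k| := by rw [hk]; exact_mod_cast Int.one_le_abs h
  have hk2 : |k| ≤ k ^ 2 := by rw [← sq_abs]; nlinarith
  set w := (k * t) ^ 2 with hw
  have hw0 : 0 ≤ w := sq_nonneg _
  have hwk : k ^ 2 ≤ w := by rw [hw, mul_pow]; nlinarith [sq_nonneg k]
  have hwt : t ^ 2 ≤ w := by rw [hw, mul_pow]; nlinarith [sq_nonneg t]
  have e1 : t ^ 3 * k ^ 2 ≤ w ^ 2 := by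
    have : t ^ 3 ≤ t ^ 4 := pow_le_pow_right₀ ht1 (by norm_num)
    have h4 : k ^ 2 ≤ k ^ 4 := by nlinarith [sq_nonneg k]
    calc t ^ 3 * k ^ 2 ≤ t ^ 4 * k ^ 4 := mul_le_mul this h4 (sq_nonneg _) (by positivity)
      _ = w ^ 2 := by rw [hw]; ring
  have e2 : w ^ 2 ≤ 2 * Real.exp w := by
    have := Real.quadratic_le_exp_of_nonneg hw0
    linarith
  have e3 : Real.exp (-(Real.pi * w / y)) ≤ Real.exp (-(3 * w)) := by
    refine Real.exp_le_exp.mpr (neg_le_neg ?_)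
    rw [le_div_iff₀ hy0]
    nlinarith [Real.pi_gt_three, mul_nonneg hw0 (sub_nonneg.mpr hy)]
  calc t ^ 3 * k ^ 2 * Real.exp (-(q (p.1 : V n) / 2)) * Real.exp (-(Real.pi * w / y))
      ≤ 2 * Real.exp w * Real.exp (-(q (p.1 : V n) / 2)) * Real.exp (-(3 * w)) := by
        exact mul_le_mul (mul_le_mul_of_nonneg_right (e1.trans e2) (Real.exp_pos _).le) e3
          (Real.exp_pos _).le (by positivity)
    _ = 2 * Real.exp (w + -(q (p.1 : V n) / 2) + -(3 * w)) := by
        rw [Real.exp_add, Real.exp_add]; ring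
    _ ≤ 2 * Real.exp (-(1 / 16) * t ^ 2 + (-(1 / 4) * q (p.1 : V n) +
          (-(1 / 16) * ((0 : ℤ) : ℝ) ^ 2 + -(1 / 4) * |k|))) := by
        refine mul_le_mul_of_nonneg_left (Real.exp_le_exp.mpr ?_) zero_le_two
        simp only [Int.cast_zero]
        nlinarith
    _ = _ := by rw [Real.exp_add, Real.exp_add, Real.exp_add]; ring

/-- The integrand of the inner product as a sum over `L⁺' × ℤ × ℤ`, after Poisson summation. -/
theorem hasSum_perTerm [DiscreteTopology Λ] [IsZLattice ℝ Λ] {η : dualLattice (posLattice Λ)}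
    {φ : ℂ → ℂ → Disc (lorLattice Λ) → ℂ} {v f : V n} (hv : IsPos v) (hf : IsPos f)
    (hf1 : bil f f = 1) (l : ℕ) {t : ℝ} (ht1 : 1 ≤ t) (ht : 16 * q v ≤ t ^ 2) {τ : ℂ × ℂ}
    (hτ : τ ∈ jacobiDomain) {δ B : ℝ} (hδ : 0 < δ)
    (hB : ∀ p, ‖perBase η φ l p τ‖ ≤ B * Real.exp (-δ * τ.1.im)) :
    HasSum (fun p => perTerm η φ v f l t p τ)
      (∑' p : dualLattice (posLattice Λ) × ℤ × ℤ, perBase η φ l p τ *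
        (thKer (η : V n) v f l t τ.1.im (τ.2.im / τ.1.im) p.1 p.2.1 p.2.2 : ℝ)) := by
  have hy := half_le_im hτ
  have hy0 : 0 < τ.1.im := by linarith
  have ht0 : 0 < t := by linarith
  have hc := ratio_mem hτ
  set c := τ.2.im / τ.1.im with hcdef
  have hc1 : |c| ≤ 1 := by rw [abs_le]; constructor <;> linarith [hc.1, hc.2]
  have hη := isPos_dual η
  have hB0 : 0 ≤ B := by
    have := (norm_nonneg _).trans (hB (0, 0, 0))
    exact nonneg_of_mul_nonneg_left this (Real.exp_pos _)
  have hs1 : Summable fun p => perTerm η φ v f l t p τ := by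
    refine Summable.of_norm_bounded (((summable_sumMaj Λ (κ := 2 * √(δ / 2 * Real.pi))
      (by positivity) ht0).mul_left (B * kerConst (η : V n) v f l)).mul_right
        (Real.exp (-(δ / 2) * τ.1.im))) fun p => ?_
    rw [perTerm, norm_mul]
    have h1 := norm_perKer_le hη hv hf hf1 (l := l) ht1 ht hy hc1 p
    have h2 := kerMaj_mul_exp_le hδ ht1 hy0 p
    calc _ ≤ B * Real.exp (-δ * τ.1.im) * (kerConst (η : V n) v f l * kerMaj t τ.1.im p) :=
          mul_le_mul (hB p) h1 (norm_nonneg _) (by positivity)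
      _ = B * kerConst (η : V n) v f l * (kerMaj t τ.1.im p * Real.exp (-δ * τ.1.im)) := by ring
      _ ≤ B * kerConst (η : V n) v f l * (sumMaj (2 * √(δ / 2 * Real.pi)) t p *
            Real.exp (-(δ / 2) * τ.1.im)) :=
          mul_le_mul_of_nonneg_left h2 (mul_nonneg hB0 (kerConst_nonneg _ _ _ _))
      _ = _ := by ring
  have hs2 : Summable fun p : dualLattice (posLattice Λ) × ℤ × ℤ => perBase η φ l p τ *
      (thKer (η : V n) v f l t τ.1.im c p.1 p.2.1 p.2.2 : ℝ) := by
    refine Summable.of_norm_bounded ((summable_thKer_bound Λ ht0).mul_left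
      (B * Real.exp (-δ * τ.1.im) * (12 * (|bil (η : V n) f| + |l + bil (η : V n) v|) *
      Real.exp (2 * q (η : V n) + (l + bil (η : V n) v) ^ 2 / 2)))) fun p => ?_
    rw [norm_mul, norm_real, Real.norm_eq_abs, mul_assoc (B * _)]
    exact mul_le_mul (hB p) (abs_thKer_le hη hv hf hf1 ht1 ht hy hc1 (isPos_dual p.1) _ _)
      (abs_nonneg _) (by positivity)
  convert hs1.hasSum using 1
  rw [hs1.tsum_prod, hs2.tsum_prod]
  refine tsum_congr fun x => ?_
  rw [(hs1.prod_factor x).tsum_prod, (hs2.prod_factor x).tsum_prod]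
  refine tsum_congr fun j => ?_
  rcases eq_or_ne j 0 with rfl | hj
  -- For j = 0 the phase does not involve d, so Poisson summation applies to the kernel alone.
  · have hbase : ∀ d : ℤ, perBase η φ l (x, 0, d) τ = perBase η φ l (x, 0, 0) τ := fun d => by
      simp [perBase]
    simp only [perTerm, perKer, if_true, hbase]
    rw [tsum_mul_left, tsum_mul_left, Int.cast_zero, tsum_thKer _ _ _ ht0 hy0]
  · simp only [perTerm, perKer, if_neg hj, hcdef]

end Termwise
end
end JacobiLift

/-! ### Consequences of the vanishing of the inner product -/

namespace JacobiLift

noncomputable section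

open Complex MeasureTheory Filter Topology Asymptotics Set

section CuspSum
variable {n : ℕ} {Λ : Submodule ℤ (EuclideanSpace ℝ (Fin n))}

/-- If the inner product vanishes, the contribution of large heights to the terms with `j = 0` is
negligible as `t → ∞`. -/
theorem exists_cusp_sum_bound [DiscreteTopology Λ] [IsZLattice ℝ Λ]
    (hΛ : ∀ x ∈ Λ, ∃ m : ℤ, inner ℝ x x = 2 * (m : ℝ)) {η : dualLattice (posLattice Λ)}
    (hη0 : 0 < q (η : V n)) {φ : ℂ → ℂ → Disc (lorLattice Λ) → ℂ}
    {a : Disc (lorLattice Λ) → ℝ → ℝ → ℂ} {sig : ℤ} {k : ℝ}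
    (hφ : IsJacobiCuspForm (lorLattice Λ) sig k (toLorDual η) φ a)
    {v f : V n} (hv : IsPos v) (hf : IsPos f) (hf1 : bil f f = 1) (l : ℕ) :
    ∃ C : ℝ, ∀ t : ℝ, 1 ≤ t → 16 * q v ≤ t ^ 2 →
      (∫ τ in jacobiDomain, ∑' p : dualLattice (posLattice Λ) × ℤ × ℤ, perBase η φ l p τ *
        (thKer (η : V n) v f l t τ.1.im (τ.2.im / τ.1.im) p.1 p.2.1 p.2.2 : ℝ)) = 0 →
      (∀ p, IntegrableOn (perTerm η φ v f l t p) jacobiDomain) ∧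
      (Summable fun x : dualLattice (posLattice Λ) × ℤ =>
        ∫ τ in cuspDomain, perTerm η φ v f l t (x.1, 0, x.2) τ) ∧
      ‖∑' x : dualLattice (posLattice Λ) × ℤ,
        ∫ τ in cuspDomain, perTerm η φ v f l t (x.1, 0, x.2) τ‖ ≤ C * Real.exp (-(1 / 16) * t ^ 2) := by
  classical
  obtain ⟨δ, hδ, B, hB0, hB⟩ := norm_perBase_le hΛ hη0 hφ
  have hη := isPos_dual η
  set K := kerConst (η : V n) v f l with hK
  have hK0 : 0 ≤ K := kerConst_nonneg _ _ _ _
  set J := ∫ τ in jacobiDomain, Real.exp (-δ * τ.1.im) with hJ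
  have hJint := integrableOn_exp_neg_jacobiDomain hδ
  have hJint2 := integrableOn_exp_neg_jacobiDomain (half_pos hδ)
  refine ⟨B * K * 2 * J * ∑' p : dualLattice (posLattice Λ) × ℤ × ℤ, errMaj p,
    fun t ht1 ht hzero => ?_⟩
  have ht0 : 0 < t := by linarith
  have hker : ∀ p, ∀ τ ∈ jacobiDomain, ‖perTerm η φ v f l t p τ‖ ≤
      B * K * (kerMaj t τ.1.im p * Real.exp (-δ * τ.1.im)) := by
    intro p τ hτ
    have hc := ratio_mem hτ
    have h1 := norm_perKer_le hη hv hf hf1 (l := l) ht1 ht (half_le_im hτ)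
      (c := τ.2.im / τ.1.im) (by rw [abs_le]; constructor <;> linarith [hc.1, hc.2]) p
    rw [perTerm, norm_mul]
    calc _ ≤ B * Real.exp (-δ * τ.1.im) * (K * kerMaj t τ.1.im p) :=
          mul_le_mul (hB l p τ hτ) h1 (norm_nonneg _) (by positivity)
      _ = _ := by ring
  set κ := 2 * √(δ / 2 * Real.pi)
  have hκ : 0 < κ := by positivity
  have hdom : ∀ p, ∀ τ ∈ jacobiDomain, ‖perTerm η φ v f l t p τ‖ ≤
      B * K * sumMaj κ t p * Real.exp (-(δ / 2) * τ.1.im) := by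
    intro p τ hτ
    refine (hker p τ hτ).trans ?_
    rw [mul_assoc (B * K)]
    have hy0 : 0 < τ.1.im := by linarith [half_le_im hτ]
    exact mul_le_mul_of_nonneg_left (kerMaj_mul_exp_le hδ ht1 hy0 p) (mul_nonneg hB0 hK0)
  have hmeas := fun p => aestronglyMeasurable_perTerm hφ.jacobi v f l t p
  have hint : ∀ p, IntegrableOn (perTerm η φ v f l t p) jacobiDomain := fun p =>
    Integrable.mono' (hJint2.const_mul (B * K * sumMaj κ t p)) (hmeas p)
      ((ae_restrict_iff' measurableSet_jacobiDomain).mpr (Eventually.of_forall (hdom p)))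
  have hsumMaj : Summable fun p : dualLattice (posLattice Λ) × ℤ × ℤ => B * K * sumMaj κ t p :=
    (summable_sumMaj Λ hκ ht0).mul_left _
  -- Dominated convergence turns the vanishing integral into a vanishing sum of integrals.
  have hsum : HasSum (fun p => ∫ τ in jacobiDomain, perTerm η φ v f l t p τ) 0 := by
    rw [← hzero]
    refine hasSum_integral_of_dominated_convergence
      (fun p τ => B * K * sumMaj κ t p * Real.exp (-(δ / 2) * τ.1.im)) hmeas (fun p => ?_) ?_ ?_ ?_
    · exact (ae_restrict_iff' measurableSet_jacobiDomain).mpr (Eventually.of_forall (hdom p))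
    · exact Eventually.of_forall fun τ => hsumMaj.mul_right _
    · simp_rw [tsum_mul_right]
      exact hJint2.const_mul _
    · exact (ae_restrict_iff' measurableSet_jacobiDomain).mpr (Eventually.of_forall fun τ hτ =>
        hasSum_perTerm hv hf hf1 l ht1 ht hτ hδ fun p => hB l p τ hτ)
  -- The main part consists of the terms with j = 0 above height one. The rest is at most a constant
  -- times exp(-t²/16) `errMaj`, so the main part equals minus a small error.
  set J0 : dualLattice (posLattice Λ) × ℤ × ℤ → ℂ := fun p =>
    if p.2.1 = 0 then ∫ τ in cuspDomain, perTerm η φ v f l t p τ else 0 with hJ0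
  have hbound : ∀ p, ∀ S ⊆ jacobiDomain, MeasurableSet S →
      (∀ τ ∈ S, kerMaj t τ.1.im p ≤ 2 * Real.exp (-(1 / 16) * t ^ 2) * errMaj p) →
      ‖∫ τ in S, perTerm η φ v f l t p τ‖ ≤
        B * K * 2 * J * Real.exp (-(1 / 16) * t ^ 2) * errMaj p := by
    intro p S hS hSm hle
    have herr0 : 0 ≤ errMaj p := by unfold errMaj; positivity
    set c := B * K * (2 * Real.exp (-(1 / 16) * t ^ 2) * errMaj p) with hc
    have hc0 : 0 ≤ c := by positivity
    calc _ ≤ ∫ τ in S, c * Real.exp (-δ * τ.1.im) := by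
          refine norm_integral_le_of_norm_le ((hJint.mono_set hS).const_mul c)
            ((ae_restrict_iff' hSm).mpr (Eventually.of_forall fun τ hτ => ?_))
          refine (hker p τ (hS hτ)).trans ?_
          rw [hc, mul_assoc (B * K)]
          exact mul_le_mul_of_nonneg_left
            (mul_le_mul_of_nonneg_right (hle τ hτ) (Real.exp_pos _).le) (by positivity)
      _ ≤ ∫ τ in jacobiDomain, c * Real.exp (-δ * τ.1.im) :=
          setIntegral_mono_set (hJint.const_mul c)
            (Eventually.of_forall fun τ => mul_nonneg hc0 (Real.exp_pos _).le)
            (LE.le.eventuallyLE hS)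
      _ = _ := by rw [integral_const_mul, ← hJ, hc]; ring
  have herr : ∀ p, ‖(∫ τ in jacobiDomain, perTerm η φ v f l t p τ) - J0 p‖ ≤
      B * K * 2 * J * Real.exp (-(1 / 16) * t ^ 2) * errMaj p := by
    intro p
    rcases eq_or_ne p.2.1 0 with hp | hp
    · have e1 : (∫ τ in jacobiDomain, perTerm η φ v f l t p τ) - J0 p =
          ∫ τ in jacobiDomain \ cuspDomain, perTerm η φ v f l t p τ := by
        rw [setIntegral_sdiff measurableSet_cuspDomain (hint p) inter_subset_left]
        simp only [hJ0, if_pos hp]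
      rw [e1]
      refine hbound p _ sdiff_subset (measurableSet_jacobiDomain.diff measurableSet_cuspDomain)
        fun τ hτ => kerMaj_le_errMaj_of_le ht1 (by linarith [half_le_im hτ.1]) ?_ p hp
      by_contra h
      exact hτ.2 ⟨hτ.1, not_le.mp h⟩
    · simp only [hJ0, if_neg hp, sub_zero]
      exact hbound p _ Subset.rfl measurableSet_jacobiDomain
        fun τ hτ => kerMaj_le_errMaj_of_ne ht1 p hp
  have hserr := (summable_errMaj Λ).mul_left (B * K * 2 * J * Real.exp (-(1 / 16) * t ^ 2))
  have hs1 : Summable fun p => (∫ τ in jacobiDomain, perTerm η φ v f l t p τ) - J0 p :=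
    Summable.of_norm_bounded hserr herr
  have hs2 : Summable J0 := by
    have := hsum.summable.sub hs1
    simpa using this
  have hts : ∑' p, J0 p = -∑' p, ((∫ τ in jacobiDomain, perTerm η φ v f l t p τ) - J0 p) := by
    rw [hsum.summable.tsum_sub hs2, hsum.tsum_eq]; ring
  have hinj : Function.Injective fun x : dualLattice (posLattice Λ) × ℤ =>
      ((x.1, 0, x.2) : dualLattice (posLattice Λ) × ℤ × ℤ) := by
    rintro ⟨x, k⟩ ⟨x', k'⟩ h
    simpa using h
  have hsupp : Function.support J0 ⊆ range fun x : dualLattice (posLattice Λ) × ℤ =>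
      ((x.1, 0, x.2) : dualLattice (posLattice Λ) × ℤ × ℤ) := by
    rintro ⟨x, j, k⟩ hp
    rcases eq_or_ne j 0 with rfl | hj
    · exact ⟨(x, k), rfl⟩
    · exact absurd (if_neg hj) hp
  have hcomp : (J0 ∘ fun x : dualLattice (posLattice Λ) × ℤ =>
      ((x.1, 0, x.2) : dualLattice (posLattice Λ) × ℤ × ℤ)) = fun x =>
      ∫ τ in cuspDomain, perTerm η φ v f l t (x.1, 0, x.2) τ := by
    funext x; simp [hJ0]
  refine ⟨hint, ?_, ?_⟩
  · rw [← hcomp]; exact hs2.comp_injective hinj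
  · have e1 : ∑' x : dualLattice (posLattice Λ) × ℤ,
        ∫ τ in cuspDomain, perTerm η φ v f l t (x.1, 0, x.2) τ = ∑' p, J0 p := by
      rw [← hinj.tsum_eq hsupp]
      exact tsum_congr fun x => (congrFun hcomp x).symm
    rw [e1, hts, norm_neg]
    calc _ ≤ ∑' p, B * K * 2 * J * Real.exp (-(1 / 16) * t ^ 2) * errMaj p :=
          tsum_of_norm_bounded hserr.hasSum herr
      _ = _ := by rw [tsum_mul_left]; ring

end CuspSum
end
end JacobiLift

namespace JacobiLift

noncomputable section

open Complex MeasureTheory Filter Topology Asymptotics Set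

/-! ### Integration over the real parts -/

section RealParts
variable {n : ℕ}

/-- Fubini and the substitution w = cy in the inner integral. -/
theorem setIntegral_cuspBase {G : ℝ → ℝ → ℂ}
    (h1 : IntegrableOn (fun p : ℝ × ℝ => G p.1 (p.2 / p.1)) cuspBase)
    (h2 : IntegrableOn (fun p : ℝ × ℝ => p.1 * G p.1 p.2) (Ioi 1 ×ˢ Icc 0 (1 / 2))) :
    ∫ p in cuspBase, G p.1 (p.2 / p.1) = ∫ p in Ioi (1 : ℝ) ×ˢ Icc (0 : ℝ) (1 / 2), p.1 * G p.1 p.2 := by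
  rw [Measure.volume_eq_prod, setIntegral_prod _ h2, ← integral_indicator measurableSet_cuspBase,
    integral_prod _ ((integrable_indicator_iff measurableSet_cuspBase).mpr h1),
    ← integral_indicator measurableSet_Ioi]
  congr 1
  funext y
  by_cases hy : 1 < y
  · rw [indicator_of_mem (mem_Ioi.mpr hy)]
    have hy0 : 0 < y := by linarith
    have e1 : (fun w => cuspBase.indicator (fun p : ℝ × ℝ => G p.1 (p.2 / p.1)) (y, w)) =
        (Icc 0 (y / 2)).indicator fun w => G y (w / y) := by
      funext w
      by_cases hw : w ∈ Icc 0 (y / 2)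
      · rw [indicator_of_mem hw, indicator_of_mem (show (y, w) ∈ cuspBase from ⟨hy, hw⟩)]
      · rw [indicator_of_notMem hw, indicator_of_notMem fun h => hw h.2]
    rw [e1, integral_indicator measurableSet_Icc, integral_Icc_eq_integral_Ioc,
      integral_Icc_eq_integral_Ioc, ← intervalIntegral.integral_of_le (by positivity),
      ← intervalIntegral.integral_of_le (by norm_num), intervalIntegral.integral_comp_div _ hy0.ne',
      zero_div, show y / 2 / y = 1 / 2 by field_simp]
    change _ = ∫ c in (0 : ℝ)..(1 / 2), (y : ℂ) * G y c
    rw [intervalIntegral.integral_const_mul]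
    exact real_smul
  · rw [indicator_of_notMem (by simpa using hy)]
    have e1 : (fun w => cuspBase.indicator (fun p : ℝ × ℝ => G p.1 (p.2 / p.1)) (y, w)) = 0 := by
      funext w
      exact indicator_of_notMem (fun h => hy h.1) _
    rw [e1]
    exact integral_zero _ _

/-- The kernel left after integration over the real parts. -/
def cuspKer (η v f : V n) (l t : ℝ) (x : V n) (k : ℤ) (y c : ℝ) : ℂ :=
  (y ^ (((n : ℝ) + 1) / 2) * Real.exp (-(2 * Real.pi * y * q (x + c • η))) : ℝ) *
    pTerm η v f l t y c x k

/-- The part of `q(x)` orthogonal to `η`. -/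
def perpNorm (η x : V n) : ℝ := q x - bil x η ^ 2 / (4 * q η)

/-- The coordinate of `x` along `η`. -/
def alongCoord (η x : V n) : ℝ := bil x η / (2 * q η)

theorem q_add_smul {η : V n} (hη : q η ≠ 0) (x : V n) (c : ℝ) :
    q (x + c • η) = perpNorm η x + q η * (c + alongCoord η x) ^ 2 := by
  rw [q_add, bil_smul_right, q_smul, perpNorm, alongCoord]; field_simp; ring

theorem measurable_pTerm (η v f : V n) (l t : ℝ) (x : V n) (k : ℤ) :
    Measurable fun z : ℝ × ℝ => pTerm η v f l t z.1 z.2 x k := by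
  have hline0 : Measurable fun z : ℝ × ℝ => x + z.2 • η := by fun_prop
  have h3 := measurable_q.comp hline0
  have h4 := (measurable_bil_left f).comp hline0
  simp only [Function.comp_def] at h3 h4
  unfold pTerm
  fun_prop

theorem measurable_cuspKer (η v f : V n) (l t : ℝ) (x : V n) (k : ℤ) :
    Measurable fun z : ℝ × ℝ => cuspKer η v f l t x k z.1 z.2 := by
  have hline0 : Measurable fun z : ℝ × ℝ => x + z.2 • η := by fun_prop
  have h3 := measurable_q.comp hline0
  have h4 := measurable_pTerm η v f l t x k
  simp only [Function.comp_def] at h3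
  unfold cuspKer
  fun_prop

theorem integrable_linear_mul_gaussian {a : ℝ} (ha : 0 < a) (A B c₀ : ℝ) :
    Integrable fun c : ℝ => (A + B * |c|) * Real.exp (-a * (c + c₀) ^ 2) := by
  have h1 := (integrable_exp_neg_mul_sq ha).comp_add_right c₀
  have h2 := (integrable_mul_exp_neg_mul_sq ha).norm.comp_add_right c₀
  refine Integrable.mono' ((h1.const_mul (|A| + |B| * |c₀|)).add (h2.const_mul |B|))
    (by fun_prop) (Eventually.of_forall fun c => ?_)
  simp only [Pi.add_apply, norm_mul, Real.norm_eq_abs, Real.abs_exp]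
  have h3 : |A + B * (|c|)| ≤ |A| + |B| * |c₀| + |B| * |c + c₀| := by
    have e1 : |c| ≤ |c + c₀| + |c₀| := by
      have := abs_sub (c + c₀) c₀
      simpa using this
    calc |A + B * (|c|)| ≤ |A| + |B| * |c| := (abs_add_le _ _).trans (by rw [abs_mul, abs_abs])
      _ ≤ _ := by nlinarith [mul_le_mul_of_nonneg_left e1 (abs_nonneg B)]
  calc _ ≤ (|A| + |B| * |c₀| + |B| * |c + c₀|) * Real.exp (-a * (c + c₀) ^ 2) :=
        mul_le_mul_of_nonneg_right h3 (Real.exp_pos _).le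
    _ = _ := by ring

theorem norm_cuspKer_le {η v f : V n} (hη : 0 < q η) {l t : ℝ} (ht : 0 < t) (x : V n) (k : ℤ)
    {y : ℝ} (hy : 1 < y) (c : ℝ) :
    ‖cuspKer η v f l t x k y c‖ ≤
      (2 * √2 * t * (y ^ (((n : ℝ) + 1) / 2) * Real.exp (-(4 * Real.pi * perpNorm η x) * y))) *
      (((k * t) ^ 2 * |bil η f| + |k * (l + bil η v)| * |bil x f| +
        |k * (l + bil η v)| * |bil η f| * |c|) *
        Real.exp (-(4 * Real.pi * q η) * (c + alongCoord η x) ^ 2)) := by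
  have hy0 : 0 < y := by linarith
  have hsy : 1 ≤ √y := Real.one_le_sqrt.mpr hy.le
  rw [cuspKer, pTerm, norm_mul, norm_mul, norm_mul, norm_e_real, mul_one, norm_real, norm_real,
    Real.norm_of_nonneg (by positivity), Real.norm_of_nonneg (by positivity)]
  have h1 : ‖((((k * t) ^ 2 / y ^ 2 * bil η f : ℝ) : ℂ) -
      I * (k * (l + bil η v) * bil (x + c • η) f / y : ℝ))‖ ≤ (k * t) ^ 2 * |bil η f| +
      |k * (l + bil η v)| * |bil x f| + |k * (l + bil η v)| * |bil η f| * |c| := by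
    refine (norm_sub_le _ _).trans ?_
    rw [norm_mul, norm_I, one_mul, norm_real, norm_real, Real.norm_eq_abs, Real.norm_eq_abs,
      abs_mul, abs_div, abs_div, abs_mul, abs_of_nonneg (sq_nonneg (k * t)),
      abs_of_nonneg (sq_nonneg y), abs_of_pos hy0, bil_add_left, bil_smul_left, add_assoc]
    refine add_le_add (mul_le_mul_of_nonneg_right (div_le_self (sq_nonneg _) (by nlinarith))
      (abs_nonneg _)) ((div_le_self (by positivity) hy.le).trans ?_)
    calc |↑k * (l + bil η v)| * |bil x f + c * bil η f|
        ≤ |↑k * (l + bil η v)| * (|bil x f| + |c| * |bil η f|) :=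
          mul_le_mul_of_nonneg_left ((abs_add_le _ _).trans (by rw [abs_mul])) (abs_nonneg _)
      _ = _ := by ring
  have h2 : 2 * √2 * t / √y * Real.exp (-(2 * Real.pi * y * q (x + c • η))) *
      Real.exp (-(Real.pi * (k * t) ^ 2 / y)) ≤
      2 * √2 * t * Real.exp (-(2 * Real.pi * y * q (x + c • η))) := by
    have e1 : 2 * √2 * t / √y ≤ 2 * √2 * t := div_le_self (by positivity) hsy
    have e2 : Real.exp (-(Real.pi * (k * t) ^ 2 / y)) ≤ 1 := Real.exp_le_one_iff.mpr
      (neg_nonpos.mpr (by positivity))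
    calc _ ≤ 2 * √2 * t * Real.exp (-(2 * Real.pi * y * q (x + c • η))) * 1 := by gcongr
      _ = _ := mul_one _
  -- One factor comes from the cusp form and its weight, the other from the theta kernel. In the
  -- Gaussian in c the height y is lowered to 1, which separates the variables.
  have h3 : Real.exp (-(2 * Real.pi * y * q (x + c • η))) *
      Real.exp (-(2 * Real.pi * y * q (x + c • η))) ≤
      Real.exp (-(4 * Real.pi * perpNorm η x) * y) *
        Real.exp (-(4 * Real.pi * q η) * (c + alongCoord η x) ^ 2) := by
    rw [← Real.exp_add, ← Real.exp_add, q_add_smul hη.ne']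
    refine Real.exp_le_exp.mpr ?_
    have : 0 ≤ Real.pi * q η * (c + alongCoord η x) ^ 2 * (y - 1) := by
      have : 0 ≤ y - 1 := by linarith
      positivity
    nlinarith
  set E := Real.exp (-(2 * Real.pi * y * q (x + c • η))) with hE
  set S := (k * t) ^ 2 * |bil η f| + |k * (l + bil η v)| * |bil x f| +
    |k * (l + bil η v)| * |bil η f| * |c| with hS
  have hS0 : 0 ≤ S := by positivity
  have hyp : 0 < y ^ (((n : ℝ) + 1) / 2) := by positivity
  calc _ ≤ y ^ (((n : ℝ) + 1) / 2) * E * (2 * √2 * t * E * S) :=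
        mul_le_mul_of_nonneg_left (mul_le_mul h2 h1 (norm_nonneg _) (by positivity)) (by positivity)
    _ = 2 * √2 * t * y ^ (((n : ℝ) + 1) / 2) * S * (E * E) := by ring
    _ ≤ 2 * √2 * t * y ^ (((n : ℝ) + 1) / 2) * S * (Real.exp (-(4 * Real.pi * perpNorm η x) * y) *
        Real.exp (-(4 * Real.pi * q η) * (c + alongCoord η x) ^ 2)) :=
        mul_le_mul_of_nonneg_left h3 (by positivity)
    _ = _ := by ring

/-- Decay in y comes from `perpNorm` being positive, decay in c from q(η) > 0. -/
theorem integrableOn_cuspKer {η v f : V n} (hη : 0 < q η) {l t : ℝ} (ht : 0 < t) {x : V n}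
    (hx : 0 < perpNorm η x) (k : ℤ) :
    IntegrableOn (fun z : ℝ × ℝ => cuspKer η v f l t x k z.1 z.2) (Ioi 1 ×ˢ univ) := by
  have h1 : IntegrableOn (fun y : ℝ => 2 * √2 * t * (y ^ (((n : ℝ) + 1) / 2) *
      Real.exp (-(4 * Real.pi * perpNorm η x) * y))) (Ioi 1) :=
    (integrableOn_rpow_mul_exp_neg _ (by positivity)).const_mul _
  have h2 : IntegrableOn (fun c : ℝ => ((k * t) ^ 2 * |bil η f| + |k * (l + bil η v)| * |bil x f| +
        |k * (l + bil η v)| * |bil η f| * |c|) *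
        Real.exp (-(4 * Real.pi * q η) * (c + alongCoord η x) ^ 2)) univ :=
    (integrable_linear_mul_gaussian (by positivity) _ _ _).integrableOn
  have h3 := Integrable.mul_prod h1 h2
  rw [Measure.prod_restrict] at h3
  refine Integrable.mono' h3 (measurable_cuspKer η v f l t x k).aestronglyMeasurable ?_
  refine (ae_restrict_iff' (measurableSet_Ioi.prod MeasurableSet.univ)).mpr
    (Eventually.of_forall fun z hz => norm_cuspKer_le hη ht x k hz.1 z.2)

end RealParts

/-! ### Fourier coefficients in the cusp part of the inner product -/

section CuspIntegral
variable {n : ℕ} {Λ : Submodule ℤ (EuclideanSpace ℝ (Fin n))}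

/-- The cusp condition at r = q(x), s = (x, η) says precisely that the part of x orthogonal to η has
positive norm. This dichotomy secures convergence wherever a coefficient is present. -/
theorem diagCoeff_eq_zero_or {η : dualLattice (posLattice Λ)}
    {φ : ℂ → ℂ → Disc (lorLattice Λ) → ℂ}
    {a : Disc (lorLattice Λ) → ℝ → ℝ → ℂ} {sig : ℤ} {k : ℝ} (hη : 0 < q (η : V n))
    (hφ : IsJacobiCuspForm (lorLattice Λ) sig k (toLorDual η) φ a)
    (x : dualLattice (posLattice Λ)) : diagCoeff η a x = 0 ∨ 0 < perpNorm (η : V n) x := by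
  by_cases h : diagCoeff η a x = 0
  · exact Or.inl h
  · right
    have h1 := hφ.cusp (toLorDual x) 0 0
    simp only [Int.cast_zero, zero_add] at h1
    have h2 : bil (x : V n) η ^ 2 < 4 * q (η : V n) * q (x : V n) := h1 h
    rw [perpNorm, sub_pos, div_lt_iff₀ (by positivity)]
    linarith

/-- The terms with `j = 0` as integrals over the imaginary parts. -/
theorem integral_cuspDomain_perTerm {η : dualLattice (posLattice Λ)}
    {φ : ℂ → ℂ → Disc (lorLattice Λ) → ℂ}
    {a : Disc (lorLattice Λ) → ℝ → ℝ → ℂ} {sig : ℤ} {k : ℝ} (hη : 0 < q (η : V n))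
    (hφ : IsJacobiCuspForm (lorLattice Λ) sig k (toLorDual η) φ a)
    {v f : V n} {l : ℕ} {t : ℝ} (ht : 0 < t) (x : dualLattice (posLattice Λ)) (d : ℤ)
    (hint : IntegrableOn (perTerm η φ v f l t (x, 0, d)) jacobiDomain) :
    ∫ τ in cuspDomain, perTerm η φ v f l t (x, 0, d) τ =
      ∫ z in Ioi (1 : ℝ) ×ˢ Icc (0 : ℝ) (1 / 2),
        diagCoeff η a x * cuspKer (η : V n) v f l t x d z.1 z.2 := by
  set G : ℝ → ℝ → ℂ := fun y c => diagCoeff η a x *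
    ((Real.exp (-(2 * Real.pi * (y * (q (x : V n) + c * bil (x : V n) η)))) *
      perWeight n (q (η : V n)) y c : ℝ) * pTerm (η : V n) v f l t y c x d) with hG
  have hGker : ∀ y c : ℝ, 1 < y → y * G y c = diagCoeff η a x * cuspKer (η : V n) v f l t x d y c := by
    intro y c hy
    have hy0 : 0 < y := by linarith
    have e1 : y * (Real.exp (-(2 * Real.pi * (y * (q (x : V n) + c * bil (x : V n) η)))) *
        perWeight n (q (η : V n)) y c) =
        y ^ (((n : ℝ) + 1) / 2) * Real.exp (-(2 * Real.pi * y * q ((x : V n) + c • (η : V n)))) := by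
      rw [perWeight, show ((n : ℝ) + 1) / 2 = 1 + ((n : ℝ) - 1) / 2 by ring,
        Real.rpow_add hy0, Real.rpow_one, q_add, bil_smul_right, q_smul,
        show -(2 * Real.pi * y * (q (x : V n) + c * bil (x : V n) η + c ^ 2 * q (η : V n))) =
          -(2 * Real.pi * (y * (q (x : V n) + c * bil (x : V n) η))) +
          -(2 * Real.pi * q (η : V n) * c ^ 2 * y) by ring, Real.exp_add]
      ring
    rw [hG, cuspKer, ← e1]
    push_cast
    ring
  have hpt : ∀ p : (ℝ × ℝ) × (ℝ × ℝ), 1 < p.1.1 → perTerm η φ v f l t (x, 0, d) (shearMap p) =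
      (perWeight n (q (η : V n)) p.1.1 (p.1.2 / p.1.1) : ℝ) *
        pTerm (η : V n) v f l t p.1.1 (p.1.2 / p.1.1) x d *
      (φ (p.2.1 + p.1.1 * I) (p.2.2 + ((p.1.2 / p.1.1 : ℝ) : ℂ) * (p.2.1 + p.1.1 * I))
        (cls (toLorDual x)) * e ((-(q (x : V n) * p.2.1 +
          bil (x : V n) η * (p.2.2 + p.1.2 / p.1.1 * p.2.1)) : ℝ) : ℂ)) := by
    intro p hp
    rw [perTerm, perBase, perKer, if_pos rfl, shearMap_snd (by linarith)]
    have e1 : (shearMap p).1 = p.2.1 + p.1.1 * I := by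
      apply Complex.ext <;> simp [shearMap]
    have e2 : (shearMap p).1.im = p.1.1 := rfl
    rw [e2, e1]
    simp only [add_im, mul_im, ofReal_im, ofReal_re, I_re, I_im, add_re, mul_re, Int.cast_zero]
    have hp0 : p.1.1 ≠ 0 := by linarith
    have e3 : 0 + (p.1.2 / p.1.1 * (0 + (p.1.1 * 1 + 0 * 0)) + 0 * (p.2.1 + (p.1.1 * 0 - 0 * 1))) =
        p.1.2 := by field_simp; ring
    rw [e3]
    ring_nf
  have hsq : (unitSquare : Set (ℝ × ℝ)) =ᵐ[volume] Icc (-(1 / 2)) (1 / 2) ×ˢ Icc 0 1 :=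
    Measure.set_prod_ae_eq Ioc_ae_eq_Icc Ioc_ae_eq_Icc
  have hint2 : IntegrableOn (fun p => perTerm η φ v f l t (x, 0, d) (shearMap p))
      (cuspBase ×ˢ (Icc (-(1 / 2) : ℝ) (1 / 2) ×ˢ Icc (0 : ℝ) 1)) := by
    rw [← shearMap_preimage_cuspDomain]
    exact (measurePreserving_shearMap.integrableOn_comp_preimage measurableEmbedding_shearMap).mpr
      (hint.mono_set inter_subset_left)
  -- The coefficient formula on the line τ₂ = x + cτ₁ with c = w/y; the closed rectangle differs
  -- from `unitSquare` by a null set.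
  have hinner : ∀ p ∈ cuspBase, ∫ z : ℝ × ℝ in Icc (-(1 / 2) : ℝ) (1 / 2) ×ˢ Icc (0 : ℝ) 1,
      perTerm η φ v f l t (x, 0, d) (shearMap (p, z)) = G p.1 (p.2 / p.1) := by
    intro p hp
    have h := hφ.fourier.integral_eq (toLorDual x) (y := p.1) (by linarith [hp.1]) (p.2 / p.1)
    rw [setIntegral_congr_set hsq] at h
    simp only [← ofReal_neg] at h
    calc _ = ∫ z : ℝ × ℝ in Icc (-(1 / 2) : ℝ) (1 / 2) ×ˢ Icc (0 : ℝ) 1,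
        (perWeight n (q (η : V n)) p.1 (p.2 / p.1) : ℝ) *
        pTerm (η : V n) v f l t p.1 (p.2 / p.1) x d *
      (φ (z.1 + p.1 * I) (z.2 + ((p.2 / p.1 : ℝ) : ℂ) * (z.1 + p.1 * I))
        (cls (toLorDual x)) * e ((-(q (x : V n) * z.1 +
          bil (x : V n) η * (z.2 + p.2 / p.1 * z.1)) : ℝ) : ℂ)) :=
          integral_congr_ae (Eventually.of_forall fun z => hpt (p, z) hp.1)
      _ = _ := by
          rw [integral_const_mul]
          refine (congrArg _ h).trans ?_
          rw [hG]
          change _ * (diagCoeff η a x * (Real.exp (-(2 * Real.pi * (p.1 * (q (x : V n) +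
            p.2 / p.1 * bil (x : V n) η)))) : ℝ)) = _
          push_cast
          ring
  have hbase : IntegrableOn (fun p : ℝ × ℝ => G p.1 (p.2 / p.1)) cuspBase := by
    have h1 : Integrable (fun p => perTerm η φ v f l t (x, 0, d) (shearMap p))
        ((volume.restrict cuspBase).prod (volume.restrict (Icc (-(1 / 2)) (1 / 2) ×ˢ Icc 0 1))) := by
      rw [Measure.prod_restrict]; exact hint2
    have h2 := h1.integral_prod_left
    refine h2.congr ((ae_restrict_iff' measurableSet_cuspBase).mpr
      (Eventually.of_forall fun p hp => hinner p hp))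
  have hker : IntegrableOn (fun z : ℝ × ℝ => diagCoeff η a x *
      cuspKer (η : V n) v f l t x d z.1 z.2) (Ioi 1 ×ˢ Icc 0 (1 / 2)) := by
    rcases diagCoeff_eq_zero_or hη hφ x with h | h
    · simp [h]
    · exact ((integrableOn_cuspKer hη ht h d).mono_set
        (prod_mono Subset.rfl (subset_univ _))).const_mul _
  have hmeas : MeasurableSet (Ioi (1 : ℝ) ×ˢ Icc (0 : ℝ) (1 / 2)) :=
    measurableSet_Ioi.prod measurableSet_Icc
  have hbase2 : IntegrableOn (fun p : ℝ × ℝ => p.1 * G p.1 p.2) (Ioi 1 ×ˢ Icc 0 (1 / 2)) :=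
    hker.congr_fun (fun z hz => (hGker z.1 z.2 hz.1).symm) hmeas
  calc ∫ τ in cuspDomain, perTerm η φ v f l t (x, 0, d) τ
      = ∫ p in shearMap ⁻¹' cuspDomain, perTerm η φ v f l t (x, 0, d) (shearMap p) :=
        (measurePreserving_shearMap.setIntegral_preimage_emb measurableEmbedding_shearMap _ _).symm
    _ = ∫ p in cuspBase, ∫ z : ℝ × ℝ in Icc (-(1 / 2) : ℝ) (1 / 2) ×ˢ Icc (0 : ℝ) 1,
          perTerm η φ v f l t (x, 0, d) (shearMap (p, z)) := by
        rw [shearMap_preimage_cuspDomain, Measure.volume_eq_prod, setIntegral_prod _ hint2]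
    _ = ∫ p in cuspBase, G p.1 (p.2 / p.1) := setIntegral_congr_fun measurableSet_cuspBase hinner
    _ = ∫ z in Ioi (1 : ℝ) ×ˢ Icc (0 : ℝ) (1 / 2), z.1 * G z.1 z.2 :=
        setIntegral_cuspBase hbase hbase2
    _ = _ := setIntegral_congr_fun hmeas fun z hz => hGker z.1 z.2 hz.1

end CuspIntegral
end
end JacobiLift

namespace JacobiLift

noncomputable section

open Complex MeasureTheory Filter Topology Asymptotics Set

/-! ### The Gaussian integral along the index -/

section GaussIntegral

theorem fourier_neg_eq_integral_e (h : ℝ → ℂ) (s : ℝ) :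
    FourierTransform.fourier h (-s) = ∫ u : ℝ, h u * e ((s * u : ℝ) : ℂ) := by
  rw [Real.fourier_eq']
  refine integral_congr_ae (Eventually.of_forall fun u => ?_)
  simp only [smul_eq_mul, e, RCLike.inner_apply, conj_trivial]
  rw [mul_comm]
  congr 2
  push_cast
  ring

theorem integral_gauss_mul_e {a : ℝ} (ha : 0 < a) (s : ℝ) :
    ∫ u : ℝ, gauss a u * e ((s * u : ℝ) : ℂ) =
      (1 / √a * Real.exp (-(Real.pi * s ^ 2 / a)) : ℝ) := by
  rw [← fourier_neg_eq_integral_e, fourier_gauss ha, gauss_eq_ofReal]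
  push_cast
  congr 2
  field_simp

theorem integral_gauss₁_mul_e {a : ℝ} (ha : 0 < a) (s : ℝ) :
    ∫ u : ℝ, gauss₁ a u * e ((s * u : ℝ) : ℂ) =
      I * (s / a * (1 / √a * Real.exp (-(Real.pi * s ^ 2 / a))) : ℝ) := by
  rw [← fourier_neg_eq_integral_e, fourier_gauss₁ ha, gauss_eq_ofReal,
    show -Real.pi * a⁻¹ * (-s) ^ 2 = -(Real.pi * s ^ 2 / a) by field_simp]
  push_cast
  ring

theorem integrable_mul_e {h : ℝ → ℂ} (hh : Integrable h) (s : ℝ) :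
    Integrable fun u : ℝ => h u * e ((s * u : ℝ) : ℂ) := by
  refine hh.mono (hh.aestronglyMeasurable.mul ?_) (Eventually.of_forall fun u => ?_)
  · exact (continuous_e.comp (by fun_prop : Continuous fun u : ℝ => ((s * u : ℝ) : ℂ))).aestronglyMeasurable
  · rw [norm_mul, norm_e_real, mul_one]

end GaussIntegral

section AlongIndex
variable {n : ℕ}

/-- The component of `x` orthogonal to `η`. -/
def perpPart (η x : V n) : V n := x - alongCoord η x • η

/-- The phase of the terms attached to `x`. -/
def phase (η v : V n) (l : ℝ) (x : V n) : ℝ := bil (perpPart η x) v - l * alongCoord η x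

/-- The integral of `cuspKer` along the index, as a function of the height. -/
theorem integral_cuspKer_snd {η v f : V n} (hη : 0 < q η) {l t T : ℝ}
    (hT : T ^ 2 = t ^ 2 + (l + bil η v) ^ 2 / (4 * q η)) (x : V n) (k : ℕ) {y : ℝ} (hy : 1 < y) :
    ∫ c, cuspKer η v f l t x k y c = (√2 * t / √(q η) : ℝ) *
      ((bil η f * e (k * phase η v l x : ℝ)) * ((k * T) ^ 2 * (y ^ (((n : ℝ) - 1) / 2 - 2) *
        Real.exp (-(4 * Real.pi * perpNorm η x) * y - Real.pi * (k * T) ^ 2 / y)) : ℝ) +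
      (-(I * ((l + bil η v) * bil (perpPart η x) f : ℝ)) * e (k * phase η v l x : ℝ)) *
        (k * (y ^ (((n : ℝ) - 1) / 2 - 1) *
        Real.exp (-(4 * Real.pi * perpNorm η x) * y - Real.pi * (k * T) ^ 2 / y)) : ℝ)) := by
  have hy0 : 0 < y := by linarith
  set L := l + bil η v with hL
  set m := q η with hm
  set a := 4 * m * y with ha
  have ha0 : 0 < a := by positivity
  set c₀ := alongCoord η x with hc₀
  set b := bil (perpPart η x) f with hb
  set Y := bil η f with hY
  set θ := phase η v l x with hθ
  set K : ℝ := 2 * √2 * t / √y * y ^ (((n : ℝ) + 1) / 2) *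
    Real.exp (-(4 * Real.pi * perpNorm η x) * y) * Real.exp (-(Real.pi * (k * t) ^ 2 / y)) with hK
  have hpt : ∀ c : ℝ, cuspKer η v f l t x k y c =
      ((K : ℂ) * e (k * θ : ℝ) * (((k * t) ^ 2 / y ^ 2 * Y : ℝ) - I * (k * L * b / y : ℝ))) *
        (gauss a (c + c₀) * e ((k * L * (c + c₀) : ℝ) : ℂ)) -
      ((K : ℂ) * e (k * θ : ℝ) * (I * (k * L * Y / y : ℝ))) *
        (gauss₁ a (c + c₀) * e ((k * L * (c + c₀) : ℝ) : ℂ)) := by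
    intro c
    have e1 : bil (x + c • η) f = b + (c + c₀) * Y := by
      rw [hb, perpPart, bil_add_left, bil_sub_left, bil_smul_left, bil_smul_left]; ring
    have e2 : e ((k * (bil x v + L * c) : ℝ) : ℂ) = e (k * θ : ℝ) * e ((k * L * (c + c₀) : ℝ) : ℂ) := by
      rw [← e_add, hθ, phase, perpPart, bil_sub_left, bil_smul_left]
      congr 1
      push_cast [hL]
      ring
    have e3 : Real.exp (-(2 * Real.pi * y * q (x + c • η))) * Real.exp (-(2 * Real.pi * y * q (x + c • η))) =
        Real.exp (-(4 * Real.pi * perpNorm η x) * y) * Real.exp (-Real.pi * a * (c + c₀) ^ 2) := by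
      rw [← Real.exp_add, ← Real.exp_add, q_add_smul hη.ne']; congr 1; rw [ha]; ring
    have e4 : y ^ (((n : ℝ) + 1) / 2) * Real.exp (-(2 * Real.pi * y * q (x + c • η))) *
        (2 * √2 * t / √y * Real.exp (-(2 * Real.pi * y * q (x + c • η))) *
          Real.exp (-(Real.pi * (k * t) ^ 2 / y))) = K * Real.exp (-Real.pi * a * (c + c₀) ^ 2) := by
      linear_combination (y ^ (((n : ℝ) + 1) / 2) * (2 * √2 * t / √y) *
        Real.exp (-(Real.pi * (k * t) ^ 2 / y))) * e3
    rw [cuspKer, pTerm, gauss₁, gauss_eq_ofReal]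
    simp only [Int.cast_natCast]
    rw [← hL, ← hY, e1, e2]
    calc _ = ((y ^ (((n : ℝ) + 1) / 2) * Real.exp (-(2 * Real.pi * y * q (x + c • η))) *
        (2 * √2 * t / √y * Real.exp (-(2 * Real.pi * y * q (x + c • η))) *
          Real.exp (-(Real.pi * (k * t) ^ 2 / y))) : ℝ) : ℂ) * (((k * t) ^ 2 / y ^ 2 * Y : ℝ) -
          I * (k * L * (b + (c + c₀) * Y) / y : ℝ)) * (e (k * θ : ℝ) *
          e ((k * L * (c + c₀) : ℝ) : ℂ)) := by push_cast; ring
      _ = _ := by rw [e4]; push_cast; ring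
  simp_rw [hpt]
  have i1 : Integrable fun c : ℝ => gauss a (c + c₀) * e ((k * L * (c + c₀) : ℝ) : ℂ) :=
    (integrable_mul_e (integrable_gauss ha0) (k * L)).comp_add_right c₀
  have i2 : Integrable fun c : ℝ => gauss₁ a (c + c₀) * e ((k * L * (c + c₀) : ℝ) : ℂ) :=
    (integrable_mul_e (integrable_gauss₁ ha0) (k * L)).comp_add_right c₀
  have j1 : ∫ c : ℝ, gauss a (c + c₀) * e ((k * L * (c + c₀) : ℝ) : ℂ) =
      (1 / √a * Real.exp (-(Real.pi * (k * L) ^ 2 / a)) : ℝ) := by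
    rw [← integral_gauss_mul_e ha0 (k * L)]
    exact integral_add_right_eq_self (fun u : ℝ => gauss a u * e ((k * L * u : ℝ) : ℂ)) c₀
  have j2 : ∫ c : ℝ, gauss₁ a (c + c₀) * e ((k * L * (c + c₀) : ℝ) : ℂ) =
      I * (k * L / a * (1 / √a * Real.exp (-(Real.pi * (k * L) ^ 2 / a))) : ℝ) := by
    rw [← integral_gauss₁_mul_e ha0 (k * L)]
    exact integral_add_right_eq_self (fun u : ℝ => gauss₁ a u * e ((k * L * u : ℝ) : ℂ)) c₀
  rw [integral_sub (i1.const_mul _) (i2.const_mul _), integral_const_mul, integral_const_mul, j1, j2]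
  have hsa : √a = 2 * (√m * √y) := by
    rw [ha, show 4 * m * y = 2 ^ 2 * (m * y) by ring, Real.sqrt_mul (by positivity),
      Real.sqrt_sq (by norm_num), Real.sqrt_mul hη.le]
  -- With a = 4q(η)y the Gaussian integral contributes L²/4q(η) next to t², and the sum is T².
  have hexp : Real.exp (-(Real.pi * (k * t) ^ 2 / y)) * Real.exp (-(Real.pi * (k * L) ^ 2 / a)) *
      Real.exp (-(4 * Real.pi * perpNorm η x) * y) =
      Real.exp (-(4 * Real.pi * perpNorm η x) * y - Real.pi * (k * T) ^ 2 / y) := by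
    rw [← Real.exp_add, ← Real.exp_add]
    congr 1
    rw [mul_pow (k : ℝ) T, hT, ha]
    field_simp
    ring
  have hysq : √y * √y = y := Real.mul_self_sqrt hy0.le
  have hyp : y ^ (((n : ℝ) + 1) / 2) = y ^ (((n : ℝ) - 1) / 2 - 2) * y ^ 3 := by
    rw [← Real.rpow_natCast, ← Real.rpow_add hy0]; congr 1; push_cast; ring
  have hyp1 : y ^ (((n : ℝ) - 1) / 2 - 1) = y ^ (((n : ℝ) - 1) / 2 - 2) * y := by
    nth_rewrite 3 [← Real.rpow_one y]
    rw [← Real.rpow_add hy0]; congr 1; ring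
  set P := y ^ (((n : ℝ) - 1) / 2 - 2)
  have hKc : K * (1 / √a * Real.exp (-(Real.pi * (k * L) ^ 2 / a))) =
      √2 * t / √m * (P * y ^ 2 * Real.exp (-(4 * Real.pi * perpNorm η x) * y - Real.pi * (k * T) ^ 2 / y)) := by
    have hm0 : 0 < √m := Real.sqrt_pos.mpr hη
    have hy1 : 0 < √y := Real.sqrt_pos.mpr hy0
    rw [← hexp, hK, hyp, hsa]
    field_simp
    rw [Real.sq_sqrt hy0.le]
    ring
  rw [hyp1]
  set W := Real.exp (-(4 * Real.pi * perpNorm η x) * y - Real.pi * (k * T) ^ 2 / y)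
  have hKc' : (K : ℂ) * ((1 / √a * Real.exp (-(Real.pi * (k * L) ^ 2 / a)) : ℝ) : ℂ) =
      ((√2 * t / √m : ℝ) : ℂ) * ((P * y ^ 2 * W : ℝ) : ℂ) := by
    rw [← ofReal_mul, hKc, ofReal_mul]
  have hTc : (T : ℂ) ^ 2 = t ^ 2 + L ^ 2 / (4 * m) := by exact_mod_cast hT
  have hmc : (m : ℂ) ≠ 0 := by exact_mod_cast hη.ne'
  have hyc : (y : ℂ) ≠ 0 := by exact_mod_cast hy0.ne'
  -- The first moment of the Gaussian brings a second factor I; by I² = -1 its contribution changes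
  -- (kt)² into (kT)² in the coefficient of (η, f).
  calc _ = ((K : ℂ) * ((1 / √a * Real.exp (-(Real.pi * (k * L) ^ 2 / a)) : ℝ) : ℂ)) * e (k * θ : ℝ) *
        ((((k * t) ^ 2 / y ^ 2 * Y : ℝ) - I * (k * L * b / y : ℝ)) -
          I * I * (k * L * Y / y : ℝ) * (k * L / a : ℝ)) := by push_cast; ring
    _ = _ := by
      rw [hKc', I_mul_I, ha]
      push_cast
      rw [mul_pow (k : ℂ) (T : ℂ), hTc]
      field_simp
      ring

/-- The integral of `cuspKer` over the whole strip. -/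
theorem integral_cuspKer {η v f : V n} (hη : 0 < q η) {l t T : ℝ} (ht : 0 < t)
    (hT : T ^ 2 = t ^ 2 + (l + bil η v) ^ 2 / (4 * q η)) {x : V n} (hx : 0 < perpNorm η x) (k : ℕ) :
    ∫ z in Ioi (1 : ℝ) ×ˢ univ, cuspKer η v f l t x k z.1 z.2 = (√2 * t / √(q η) : ℝ) *
      besselTerm (((n : ℝ) - 1) / 2) (-(I * ((l + bil η v) * bil (perpPart η x) f : ℝ)) *
        e (k * phase η v l x : ℝ)) (bil η f * e (k * phase η v l x : ℝ)) (perpNorm η x) k T := by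
  have hi := integrableOn_cuspKer (v := v) (f := f) (l := l) hη ht hx k
  have hb : ∀ p : ℝ, IntegrableOn (fun y : ℝ => y ^ p *
      Real.exp (-(4 * Real.pi * perpNorm η x) * y - Real.pi * (k * T) ^ 2 / y)) (Ioi 1) := fun p =>
    integrableOn_bessel p (by positivity) (by positivity)
  rw [Measure.volume_eq_prod, setIntegral_prod _ hi]
  simp only [Measure.restrict_univ]
  rw [setIntegral_congr_fun measurableSet_Ioi fun y hy => integral_cuspKer_snd hη hT x k hy,
    integral_const_mul, integral_add, integral_const_mul, integral_const_mul, integral_complex_ofReal,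
    integral_complex_ofReal, integral_const_mul, integral_const_mul]
  · rfl
  · exact (((hb _).const_mul _).ofReal).const_mul _
  · exact (((hb _).const_mul _).ofReal).const_mul _

end AlongIndex
end
end JacobiLift

namespace JacobiLift

noncomputable section

open Complex MeasureTheory Filter Topology Asymptotics Set

/-! ### Unfolding along the index -/

section Unfold
variable {n : ℕ}

/-- Under a simultaneous sign change of x, k and c the odd quantities occur only in products of two.
-/
theorem cuspKer_neg (η v f : V n) (l t : ℝ) (x : V n) (k : ℤ) (y c : ℝ) :
    cuspKer η v f l t (-x) (-k) y c = cuspKer η v f l t x k y (-c) := by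
  have e1 : -x + c • η = -(x + (-c) • η) := by rw [neg_smul]; abel
  unfold cuspKer pTerm
  rw [e1, q_neg, bil_neg_left, bil_neg_left]
  push_cast
  ring_nf

/-- Moving x by rη moves c by r. The phases differ by e(klr), which is 1 because l is an integer. -/
theorem cuspKer_add_zsmul (η v f : V n) (l : ℕ) (t : ℝ) (x : V n) (k r : ℤ) (y c : ℝ) :
    cuspKer η v f l t (x + r • η) k y c = cuspKer η v f l t x k y (c + r) := by
  have e1 : x + r • η + c • η = x + (c + r) • η := by
    rw [← Int.cast_smul_eq_zsmul ℝ, add_smul]; abel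
  have e2 : e ((k * (bil x v + (l + bil η v) * (c + r)) : ℝ) : ℂ) =
      e ((k * (bil (x + r • η) v + (l + bil η v) * c) : ℝ) : ℂ) := by
    rw [show (k * (bil x v + (l + bil η v) * (c + r)) : ℝ) =
      k * (bil (x + r • η) v + (l + bil η v) * c) + (k * (l : ℤ) * r : ℤ) by
        rw [bil_add_left, bil_zsmul_left]; push_cast; ring, ofReal_add, e_add, e_real_int ⟨k * (l : ℤ) * r, rfl⟩, mul_one]
  unfold cuspKer pTerm
  rw [e1, e2]

theorem alongCoord_add_zsmul {η : V n} (hη : q η ≠ 0) (x : V n) (r : ℤ) :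
    alongCoord η (x + r • η) = alongCoord η x + r := by
  rw [alongCoord, alongCoord, bil_add_left, bil_zsmul_left, bil_self]; field_simp

theorem cuspKer_zero (η v f : V n) (l t : ℝ) (x : V n) (y c : ℝ) :
    cuspKer η v f l t x 0 y c = 0 := by
  rw [cuspKer, pTerm_zero, mul_zero]

theorem setIntegral_prod_neg (G : ℝ → ℝ → ℂ) (s t : Set ℝ) :
    ∫ z in s ×ˢ t, G z.1 (-z.2) = ∫ z in s ×ˢ ((Neg.neg : ℝ → ℝ) ⁻¹' t), G z.1 z.2 := by
  have h := (MeasurePreserving.id (volume : Measure ℝ)).prod (Measure.measurePreserving_neg (volume : Measure ℝ))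
  have he : MeasurableEmbedding (Prod.map id Neg.neg : ℝ × ℝ → ℝ × ℝ) :=
    MeasurableEmbedding.id.prodMap (MeasurableEquiv.neg ℝ).measurableEmbedding
  have hset : (Prod.map id Neg.neg : ℝ × ℝ → ℝ × ℝ) ⁻¹' (s ×ˢ ((Neg.neg : ℝ → ℝ) ⁻¹' t)) =
      s ×ˢ t := by
    ext z; simp
  rw [← hset]
  exact h.setIntegral_preimage_emb he (fun z => G z.1 z.2) _

theorem setIntegral_prod_add (G : ℝ → ℝ → ℂ) (s t : Set ℝ) (r : ℝ) :
    ∫ z in s ×ˢ ((· + r) ⁻¹' t), G z.1 (z.2 + r) = ∫ z in s ×ˢ t, G z.1 z.2 := by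
  have h := (MeasurePreserving.id (volume : Measure ℝ)).prod (measurePreserving_add_right volume r)
  have he : MeasurableEmbedding (Prod.map id (· + r) : ℝ × ℝ → ℝ × ℝ) :=
    MeasurableEmbedding.id.prodMap (MeasurableEquiv.addRight r).measurableEmbedding
  exact h.setIntegral_preimage_emb he (fun z => G z.1 z.2) (s ×ˢ t)

end Unfold

section UnfoldSum
variable {n : ℕ} {Λ : Submodule ℤ (EuclideanSpace ℝ (Fin n))}

/-- Representatives of `L⁺'` modulo `η`. -/
def fundReps (η : dualLattice (posLattice Λ)) : Set (dualLattice (posLattice Λ)) :=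
  {x | alongCoord (η : V n) x ∈ Ico (0 : ℝ) 1}

/-- The multiple of η to be removed is the integral part of the coordinate along η. -/
theorem fundReps_bijective {η : dualLattice (posLattice Λ)} (hη : q (η : V n) ≠ 0) :
    Function.Bijective fun p : fundReps η × ℤ => (p.1 : dualLattice (posLattice Λ)) + p.2 • η := by
  have key : ∀ (x : dualLattice (posLattice Λ)) (r : ℤ), alongCoord (η : V n)
      ((x + r • η : dualLattice (posLattice Λ)) : V n) = alongCoord (η : V n) x + r := fun x r => by
    rw [AddSubgroup.coe_add, AddSubgroup.coe_zsmul, alongCoord_add_zsmul hη]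
  constructor
  · rintro ⟨⟨x, hx⟩, r⟩ ⟨⟨x', hx'⟩, r'⟩ h
    simp only at h
    have h1 := key x r
    rw [h, key] at h1
    have h2 : r = r' := by
      have := congrArg Int.floor h1
      rw [Int.floor_add_intCast, Int.floor_add_intCast, Int.floor_eq_zero_iff.mpr hx,
        Int.floor_eq_zero_iff.mpr hx'] at this
      linarith
    subst h2
    simpa using h
  · intro x
    set r := ⌊alongCoord (η : V n) x⌋ with hr
    refine ⟨(⟨x + (-r) • η, ?_⟩, r), ?_⟩
    · rw [fundReps, mem_ofPred_eq, key]
      push_cast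
      exact ⟨by linarith [Int.floor_le (alongCoord (η : V n) x)],
        by linarith [Int.lt_floor_add_one (alongCoord (η : V n) x)]⟩
    · simp

theorem diagCoeff_add_zsmul [DiscreteTopology Λ] [IsZLattice ℝ Λ] {η : dualLattice (posLattice Λ)}
    {φ : ℂ → ℂ → Disc (lorLattice Λ) → ℂ} {a : Disc (lorLattice Λ) → ℝ → ℝ → ℂ} {sig : ℤ} {k : ℝ}
    (hφ : IsJacobiCuspForm (lorLattice Λ) sig k (toLorDual η) φ a)
    (x : dualLattice (posLattice Λ)) (r : ℤ) : diagCoeff η a (x + r • η) = diagCoeff η a x := by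
  induction r using Int.induction_on with
  | zero => simp
  | succ i ih => rw [add_smul, one_smul, ← add_assoc, diagCoeff_add hφ, ih]
  | pred i ih =>
    rw [← ih, ← diagCoeff_add hφ, sub_smul, one_smul, add_assoc, sub_add_cancel]

/-- A term of the unfolded sum. -/
def cuspTerm (η : dualLattice (posLattice Λ)) (a : Disc (lorLattice Λ) → ℝ → ℝ → ℂ) (v f : V n)
    (l : ℕ) (t : ℝ) (x : dualLattice (posLattice Λ)) (k : ℤ) (z : ℝ × ℝ) : ℂ :=
  diagCoeff η a x * cuspKer (η : V n) v f l t x k z.1 z.2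

theorem integrableOn_cuspTerm {η : dualLattice (posLattice Λ)}
    {φ : ℂ → ℂ → Disc (lorLattice Λ) → ℂ}
    {a : Disc (lorLattice Λ) → ℝ → ℝ → ℂ} {sig : ℤ} {k : ℝ} (hη : 0 < q (η : V n))
    (hφ : IsJacobiCuspForm (lorLattice Λ) sig k (toLorDual η) φ a)
    (v f : V n) (l : ℕ) {t : ℝ} (ht : 0 < t) (x : dualLattice (posLattice Λ)) (d : ℤ) :
    IntegrableOn (cuspTerm η a v f l t x d) (Ioi 1 ×ˢ univ) := by
  unfold cuspTerm
  rcases diagCoeff_eq_zero_or hη hφ x with h | h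
  · simp [h]
  · exact (integrableOn_cuspKer hη ht h d).const_mul _

/-- Negative frequencies at x equal positive ones at -x with c reflected, by evenness of the
coefficients. They fill in the strip -1/2 ≤ c ≤ 0, and k = 0 contributes nothing. -/
theorem hasSum_symm [DiscreteTopology Λ] [IsZLattice ℝ Λ]
    (hΛ : ∀ x ∈ Λ, ∃ m : ℤ, inner ℝ x x = 2 * (m : ℝ)) {η : dualLattice (posLattice Λ)}
    {φ : ℂ → ℂ → Disc (lorLattice Λ) → ℂ} {a : Disc (lorLattice Λ) → ℝ → ℝ → ℂ}
    (hη : 0 < q (η : V n))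
    (hφ : IsJacobiCuspForm (lorLattice Λ) n (1 + ((n : ℝ) + 2) / 2) (toLorDual η) φ a)
    {v f : V n} {l : ℕ} {t : ℝ} (ht : 0 < t) {s : ℂ}
    (h : HasSum (fun x : dualLattice (posLattice Λ) × ℤ => ∫ z in Ioi (1 : ℝ) ×ˢ Icc (0 : ℝ) (1 / 2),
      cuspTerm η a v f l t x.1 x.2 z) s) :
    HasSum (fun x : dualLattice (posLattice Λ) × ℕ =>
      ∫ z in Ioi (1 : ℝ) ×ˢ Ioc (-(1 / 2) : ℝ) (1 / 2), cuspTerm η a v f l t x.1 (x.2 + 1) z) s := by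
  set J : dualLattice (posLattice Λ) × ℤ → ℂ := fun x => ∫ z in Ioi (1 : ℝ) ×ˢ Icc (0 : ℝ) (1 / 2),
    cuspTerm η a v f l t x.1 x.2 z with hJ
  let g₁ : dualLattice (posLattice Λ) × ℕ → dualLattice (posLattice Λ) × ℤ := fun x => (x.1, x.2 + 1)
  let g₂ : dualLattice (posLattice Λ) × ℕ → dualLattice (posLattice Λ) × ℤ := fun x => (-x.1, -(x.2 + 1))
  have hg₁ : Function.Injective g₁ := by
    rintro ⟨x, k⟩ ⟨x', k'⟩ h; simpa [g₁] using h
  have hg₂ : Function.Injective g₂ := by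
    rintro ⟨x, k⟩ ⟨x', k'⟩ h; simpa [g₂] using h
  have hg : Function.Injective (Sum.elim g₁ g₂) := by
    refine hg₁.sumElim hg₂ fun x y hxy => ?_
    have : (x.2 : ℤ) + 1 = -(y.2 + 1) := congrArg Prod.snd hxy
    omega
  have hzero : ∀ x ∉ Set.range (Sum.elim g₁ g₂), J x = 0 := by
    rintro ⟨x, k⟩ hx
    have hk : k = 0 := by
      by_contra hk
      rcases lt_or_gt_of_ne hk with hk | hk
      · refine hx ⟨Sum.inr (-x, (-k - 1).toNat), ?_⟩
        simp only [Sum.elim_inr, g₂, neg_neg, Prod.mk.injEq, true_and]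
        omega
      · refine hx ⟨Sum.inl (x, (k - 1).toNat), ?_⟩
        simp only [Sum.elim_inl, g₁, Prod.mk.injEq, true_and]
        omega
    subst hk
    simp [hJ, cuspTerm, cuspKer_zero]
  have h3 := (hg.hasSum_iff hzero).mpr h
  have h1 : Summable (J ∘ g₁) := h.summable.comp_injective hg₁
  have h2 : Summable (J ∘ g₂) := h.summable.comp_injective hg₂
  have hs : HasSum (fun x => (J ∘ g₁) x + (J ∘ g₂) x) s := by
    rw [h3.unique (HasSum.sum (f := J ∘ Sum.elim g₁ g₂) h1.hasSum h2.hasSum)]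
    exact h1.hasSum.add h2.hasSum
  refine hs.congr_fun fun x => ?_
  have e2 : (J ∘ g₂) x = ∫ z in Ioi (1 : ℝ) ×ˢ Icc (-(1 / 2) : ℝ) 0,
      cuspTerm η a v f l t x.1 (x.2 + 1) z := by
    have e3 := setIntegral_prod_neg (fun y c => cuspTerm η a v f l t x.1 (x.2 + 1) (y, c))
      (Ioi 1) (Icc 0 (1 / 2))
    rw [show (Neg.neg : ℝ → ℝ) ⁻¹' Icc (0 : ℝ) (1 / 2) = Icc (-(1 / 2)) 0 by simp] at e3
    refine Eq.trans ?_ e3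
    simp only [Function.comp_apply, hJ, g₂, cuspTerm, AddSubgroup.coe_neg, cuspKer_neg]
    rw [diagCoeff_neg hΛ hφ]
  have hi := integrableOn_cuspTerm hη hφ v f l ht x.1 (x.2 + 1)
  have e4 : (Ioi (1 : ℝ) ×ˢ Icc (-(1 / 2) : ℝ) 0 : Set (ℝ × ℝ)) =ᵐ[volume]
      Ioi (1 : ℝ) ×ˢ Ioc (-(1 / 2) : ℝ) 0 :=
    Measure.set_prod_ae_eq (ae_eq_refl _) Ioc_ae_eq_Icc.symm
  have e5 : (Ioi (1 : ℝ) ×ˢ Icc (0 : ℝ) (1 / 2) : Set (ℝ × ℝ)) =ᵐ[volume]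
      Ioi (1 : ℝ) ×ˢ Ioc (0 : ℝ) (1 / 2) :=
    Measure.set_prod_ae_eq (ae_eq_refl _) Ioc_ae_eq_Icc.symm
  rw [e2, setIntegral_congr_set e4]
  simp only [Function.comp_apply, hJ, g₁]
  rw [setIntegral_congr_set e5, ← Ioc_union_Ioc_eq_Ioc (a := (-(1 / 2) : ℝ)) (b := 0) (by norm_num)
    (by norm_num), prod_union, setIntegral_union _ (measurableSet_Ioi.prod measurableSet_Ioc)
    (hi.mono_set (prod_mono Subset.rfl (subset_univ _)))
    (hi.mono_set (prod_mono Subset.rfl (subset_univ _))), add_comm]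
  refine Set.disjoint_left.mpr fun z hz hz' => ?_
  exact absurd hz.2.2 (not_le.mpr hz'.2.1)

/-- Summing over x + rη with r in ℤ amounts to translating the strip of width one by r, because the
coefficients are η-periodic; the translates tile the whole line. -/
theorem hasSum_unfold [DiscreteTopology Λ] [IsZLattice ℝ Λ]
    {η : dualLattice (posLattice Λ)}
    {φ : ℂ → ℂ → Disc (lorLattice Λ) → ℂ} {a : Disc (lorLattice Λ) → ℝ → ℝ → ℂ}
    {sig : ℤ} {k : ℝ} (hη : 0 < q (η : V n))
    (hφ : IsJacobiCuspForm (lorLattice Λ) sig k (toLorDual η) φ a)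
    {v f : V n} {l : ℕ} {t : ℝ} (ht : 0 < t) {s : ℂ}
    (h : HasSum (fun x : dualLattice (posLattice Λ) × ℕ =>
      ∫ z in Ioi (1 : ℝ) ×ˢ Ioc (-(1 / 2) : ℝ) (1 / 2), cuspTerm η a v f l t x.1 (x.2 + 1) z) s) :
    HasSum (fun x : fundReps η × ℕ =>
      ∫ z in Ioi (1 : ℝ) ×ˢ univ, cuspTerm η a v f l t x.1 (x.2 + 1) z) s := by
  let E : (fundReps η × ℕ) × ℤ ≃ dualLattice (posLattice Λ) × ℕ :=
    (Equiv.prodAssoc _ _ _).trans (((Equiv.refl _).prodCongr (Equiv.prodComm _ _)).trans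
      ((Equiv.prodAssoc _ _ _).symm.trans
        ((Equiv.ofBijective _ (fundReps_bijective hη.ne')).prodCongr (Equiv.refl _))))
  have h1 := E.hasSum_iff.mpr h
  refine h1.prod_fiberwise fun x => ?_
  have hi := integrableOn_cuspTerm hη hφ v f l ht x.1 (x.2 + 1)
  have hU : (⋃ r : ℤ, Ioi (1 : ℝ) ×ˢ Ioc (-(1 / 2) + (r : ℝ)) (-(1 / 2) + r + 1)) =
      Ioi (1 : ℝ) ×ˢ univ := by
    rw [← prod_iUnion, iUnion_Ioc_add_intCast]
  rw [← hU] at hi ⊢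
  refine (hasSum_integral_iUnion (fun r => measurableSet_Ioi.prod measurableSet_Ioc)
    (fun r r' hr => Disjoint.set_prod_right (pairwise_disjoint_Ioc_add_intCast (-(1 / 2) : ℝ) hr) _ _)
    hi).congr_fun fun r => ?_
  have e3 := setIntegral_prod_add (fun y c => cuspTerm η a v f l t x.1 (x.2 + 1) (y, c))
      (Ioi 1) (Ioc (-(1 / 2) + (r : ℝ)) (-(1 / 2) + r + 1)) r
  rw [show (· + (r : ℝ)) ⁻¹' Ioc (-(1 / 2) + (r : ℝ)) (-(1 / 2) + r + 1) = Ioc (-(1 / 2)) (1 / 2) by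
    rw [preimage_add_const_Ioc]; congr 1 <;> ring] at e3
  refine Eq.trans ?_ e3
  change ∫ z in Ioi (1 : ℝ) ×ˢ Ioc (-(1 / 2) : ℝ) (1 / 2),
    cuspTerm η a v f l t ((x.1 : dualLattice (posLattice Λ)) + r • η) (x.2 + 1) z = _
  simp only [cuspTerm, AddSubgroup.coe_add, AddSubgroup.coe_zsmul, cuspKer_add_zsmul]
  rw [diagCoeff_add_zsmul hφ]

end UnfoldSum
end
end JacobiLift

namespace JacobiLift

noncomputable section

open Complex MeasureTheory Filter Topology Asymptotics Set

/-! ### The decay of the unfolded sum -/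

section Decay
variable {n : ℕ} {Λ : Submodule ℤ (EuclideanSpace ℝ (Fin n))}

/-- The powers of y combine as 1/2 + (1 + (n + 2)/2) - 3 = (n - 1)/2, and the exponential factors as
2 - 4 = -2 times πq(η)c²y; this is `perWeight`. -/
theorem petersson_jacobiTheta [DiscreteTopology Λ]
    [IsZLattice ℝ Λ] (hΛ : ∀ x ∈ Λ, ∃ m : ℤ, inner ℝ x x = 2 * (m : ℝ))
    {i₀ i₁ i₂ : Fin n} (h01 : i₁ ≠ i₀) (h02 : i₂ ≠ i₀) (h12 : i₁ ≠ i₂)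
    (η : dualLattice (posLattice Λ)) {f v : V n} (hf : IsPos f) (hf1 : bil f f = 1) (hv : IsPos v)
    (l : ℕ) {t : ℝ} (ht1 : 1 ≤ t) (ht : 16 * q v ≤ t ^ 2)
    {g : V n ≃ₗ[ℝ] V n} (hg : IsIsometry g) (hg1 : g (eU 1) = eP i₀) (hg3 : g (eU 3) = eU 3)
    (hcoord : ∀ x, IsPos x → ∀ j d : ℝ,
        g (x + j • uTilde' n + d • uTilde n) (Fin.castAdd 4 i₁) =
          (j * t + (d + bil x v - q v * j) / t) / √2 ∧
        g (x + j • uTilde' n + d • uTilde n) (Fin.castAdd 4 i₂) = bil (x - j • v) f ∧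
        g (x + j • uTilde' n + d • uTilde n) (Fin.natAdd n 2) =
          -((j * t - (d + bil x v - q v * j) / t) / √2) ∧
        g (x + j • uTilde' n + d • uTilde n) (Fin.natAdd n 3) = 0)
    (φ : ℂ → ℂ → Disc (lorLattice Λ) → ℂ) :
    petersson (1 + ((n : ℝ) + 2) / 2) (q (η : V n)) φ
      (jacobiTheta (lorLattice Λ) 1 (gM g)
        (fixSecond (gM g ((η : V n) + l • uTilde n)) (reducedPoly g (polyAlpha i₀ i₁ i₁ i₂) 0 1))
        ((η : V n) + l • uTilde n)) =
    ∫ τ in jacobiDomain, ∑' p : dualLattice (posLattice Λ) × ℤ × ℤ, perBase η φ l p τ *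
        (thKer (η : V n) v f l t τ.1.im (τ.2.im / τ.1.im) p.1 p.2.1 p.2.2 : ℝ) := by
  rw [petersson]
  refine setIntegral_congr_fun measurableSet_jacobiDomain fun τ hτ => ?_
  have hy := half_le_im hτ
  have hy0 : 0 < τ.1.im := by linarith
  have hc := ratio_mem hτ
  have hτ2 : τ.2.im = τ.2.im / τ.1.im * τ.1.im := by field_simp
  rw [jacobiTheta_pairing hΛ h01 h02 h12 η hf hf1 hv l ht1 ht hg hg1 hg3 hcoord (φ τ.1 τ.2) hy hτ2
    (by rw [abs_le]; constructor <;> linarith [hc.1, hc.2]), ← tsum_mul_right]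
  refine tsum_congr fun p => ?_
  set c := τ.2.im / τ.1.im with hcdef
  set y := τ.1.im with hydef
  have hw : y ^ (1 / 2 : ℝ) * Real.exp (2 * Real.pi * q (η : V n) * c ^ 2 * y) *
      (y ^ (1 + ((n : ℝ) + 2) / 2) * Real.exp (-(4 * Real.pi * q (η : V n) * τ.2.im ^ 2 / y)) / y ^ 3) =
      perWeight n (q (η : V n)) y c := by
    have e1 : Real.exp (2 * Real.pi * q (η : V n) * c ^ 2 * y) *
        Real.exp (-(4 * Real.pi * q (η : V n) * τ.2.im ^ 2 / y)) =
        Real.exp (-(2 * Real.pi * q (η : V n) * c ^ 2 * y)) := by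
      rw [← Real.exp_add]; congr 1; rw [hτ2]; field_simp; ring
    have e2 : y ^ (1 / 2 : ℝ) * (y ^ (1 + ((n : ℝ) + 2) / 2) / y ^ 3) = y ^ (((n : ℝ) - 1) / 2) := by
      rw [← Real.rpow_natCast y 3, ← Real.rpow_sub hy0, ← Real.rpow_add hy0]; congr 1; push_cast; ring
    rw [perWeight, ← e1, ← e2]
    ring
  rw [perBase, ← hw]
  push_cast
  ring

theorem mul_besselTerm (b : ℂ) (s : ℝ) (A₁ A₂ : ℂ) (ρ : ℝ) (κ : ℕ) (T : ℝ) :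
    b * besselTerm s A₁ A₂ ρ κ T = besselTerm s (b * A₁) (b * A₂) ρ κ T := by
  unfold besselTerm; ring

/-- The coefficients of the Bessel functions of second kind in the unfolded sum. -/
def coeff₁ (η : dualLattice (posLattice Λ)) (a : Disc (lorLattice Λ) → ℝ → ℝ → ℂ) (v f : V n)
    (l : ℕ) (x : dualLattice (posLattice Λ)) (k : ℕ) : ℂ :=
  diagCoeff η a x * (-(I * ((l + bil (η : V n) v) * bil (perpPart (η : V n) x) f : ℝ)) *
    e (((k + 1 : ℕ) : ℝ) * phase (η : V n) v l x : ℝ))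

/-- The coefficients of the leading Bessel functions in the unfolded sum. -/
def coeff₂ (η : dualLattice (posLattice Λ)) (a : Disc (lorLattice Λ) → ℝ → ℝ → ℂ) (v f : V n)
    (l : ℕ) (x : dualLattice (posLattice Λ)) (k : ℕ) : ℂ :=
  diagCoeff η a x * (bil (η : V n) f * e (((k + 1 : ℕ) : ℝ) * phase (η : V n) v l x : ℝ))

theorem integral_cuspTerm {η : dualLattice (posLattice Λ)}
    {φ : ℂ → ℂ → Disc (lorLattice Λ) → ℂ}
    {a : Disc (lorLattice Λ) → ℝ → ℝ → ℂ} {sig : ℤ} {k : ℝ} (hη : 0 < q (η : V n))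
    (hφ : IsJacobiCuspForm (lorLattice Λ) sig k (toLorDual η) φ a)
    {v f : V n} {l : ℕ} {t T : ℝ} (ht : 0 < t)
    (hT : T ^ 2 = t ^ 2 + (l + bil (η : V n) v) ^ 2 / (4 * q (η : V n)))
    (x : dualLattice (posLattice Λ)) (d : ℕ) :
    ∫ z in Ioi (1 : ℝ) ×ˢ univ, cuspTerm η a v f l t x (d + 1) z =
      (√2 * t / √(q (η : V n)) : ℝ) * besselTerm (((n : ℝ) - 1) / 2) (coeff₁ η a v f l x d)
        (coeff₂ η a v f l x d) (perpNorm (η : V n) x) (d + 1) T := by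
  unfold cuspTerm coeff₁ coeff₂
  rcases diagCoeff_eq_zero_or hη hφ x with h | h
  · simp [h, besselTerm]
  · rw [integral_const_mul, ← mul_besselTerm, ← Nat.cast_succ, integral_cuspKer hη ht hT h (d + 1)]
    ring

/-- For large T the dilation is chosen as t = √(T² - M), so that the unfolded series is evaluated at
T. The error exp(-t²/16) changes only by the constant exp(M/16). -/
theorem exists_unfolded_bound [DiscreteTopology Λ] [IsZLattice ℝ Λ]
    (hΛ : ∀ x ∈ Λ, ∃ m : ℤ, inner ℝ x x = 2 * (m : ℝ)) {η : dualLattice (posLattice Λ)}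
    {φ : ℂ → ℂ → Disc (lorLattice Λ) → ℂ} {a : Disc (lorLattice Λ) → ℝ → ℝ → ℂ}
    (hη : 0 < q (η : V n))
    (hφ : IsJacobiCuspForm (lorLattice Λ) n (1 + ((n : ℝ) + 2) / 2) (toLorDual η) φ a)
    {i₀ i₁ i₂ : Fin n} (h01 : i₀ ≠ i₁) (h02 : i₀ ≠ i₂) (h12 : i₁ ≠ i₂)
    {f v : V n} (hf : IsPos f) (hf1 : bil f f = 1) (hf0 : bil f (eP i₀) = 0) (hv : IsPos v)
    (hv0 : bil (η : V n) (eP i₀) ≠ 0 → bil v (eP i₀) = 0) (l : ℕ)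
    (hvanish : ∀ g : V n ≃ₗ[ℝ] V n, IsIsometry g → LinearMap.det (g : V n →ₗ[ℝ] V n) = 1 →
        g (eU 1) = eP i₀ → g (eU 3) = eU 3 →
        (bil (η : V n) (eP i₀) ≠ 0 → g (eP i₀) = eU 1) →
        petersson (1 + ((n : ℝ) + 2) / 2) (q (η : V n)) φ
          (jacobiTheta (lorLattice Λ) 1 (gM g)
            (fixSecond (gM g ((η : V n) + l • uTilde n))
              (reducedPoly g (polyAlpha i₀ i₁ i₁ i₂) 0 1))
            ((η : V n) + l • uTilde n)) = 0) :
    ∃ C : ℝ, ∀ᶠ T : ℝ in atTop, ‖∑' x : fundReps η × ℕ, besselTerm (((n : ℝ) - 1) / 2)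
      (coeff₁ η a v f l x.1 x.2) (coeff₂ η a v f l x.1 x.2) (perpNorm (η : V n) x.1) (x.2 + 1) T‖ ≤
      C * Real.exp (-(1 / 16) * T ^ 2) := by
  obtain ⟨C, hC⟩ := exists_cusp_sum_bound hΛ hη hφ hv hf hf1 l
  set M := (l + bil (η : V n) v) ^ 2 / (4 * q (η : V n)) with hM
  have hM0 : 0 ≤ M := by positivity
  refine ⟨C * Real.exp (1 / 16 * M) * √(q (η : V n)), ?_⟩
  have hev : ∀ᶠ T : ℝ in atTop, 1 + 16 * q v + M ≤ T ^ 2 :=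
    (tendsto_pow_atTop two_ne_zero).eventually_ge_atTop _
  filter_upwards [hev] with T hT
  have hqv := hv.q_nonneg
  set t := √(T ^ 2 - M) with ht
  have htsq : t ^ 2 = T ^ 2 - M := Real.sq_sqrt (by linarith)
  have ht1 : 1 ≤ t := Real.one_le_sqrt.mpr (by linarith)
  have ht0 : 0 < t := by linarith
  have htv : 16 * q v ≤ t ^ 2 := by rw [htsq]; linarith
  obtain ⟨g, hg, hdet, hg1, hg3, hg0, hcoord⟩ := exists_isometry h01 h02 h12 hf hf1 hf0 hv ht0.ne'
  have hz := hvanish g hg hdet hg1 hg3 fun h => hg0 (hv0 h)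
  rw [petersson_jacobiTheta hΛ h01.symm h02.symm h12 η hf hf1 hv l ht1 htv hg hg1 hg3 hcoord] at hz
  obtain ⟨hint, hsum, hle⟩ := hC t ht1 htv hz
  have h1 := hsum.hasSum.congr_fun fun x =>
    (integral_cuspDomain_perTerm hη hφ ht0 x.1 x.2 (hint (x.1, 0, x.2))).symm
  have h2 := hasSum_unfold hη hφ ht0 (hasSum_symm hΛ hη hφ ht0 h1)
  have hTM : T ^ 2 = t ^ 2 + M := by rw [htsq]; ring
  have h3 := h2.tsum_eq
  simp_rw [integral_cuspTerm hη hφ ht0 hTM, tsum_mul_left] at h3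
  rw [← h3, norm_mul, norm_real, Real.norm_of_nonneg (by positivity)] at hle
  set W := ‖∑' x : fundReps η × ℕ, besselTerm (((n : ℝ) - 1) / 2)
      (coeff₁ η a v f l x.1 x.2) (coeff₂ η a v f l x.1 x.2) (perpNorm (η : V n) x.1) (x.2 + 1) T‖
  have hW : 0 ≤ W := norm_nonneg _
  have hsm : 0 < √(q (η : V n)) := Real.sqrt_pos.mpr hη
  have hs2 : 1 ≤ √2 := Real.one_le_sqrt.mpr one_le_two
  have hE : Real.exp (-(1 / 16) * t ^ 2) = Real.exp (1 / 16 * M) * Real.exp (-(1 / 16) * T ^ 2) := by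
    rw [← Real.exp_add, htsq]; congr 1; ring
  have h4 : W / √(q (η : V n)) ≤ √2 * t / √(q (η : V n)) * W := by
    rw [div_mul_eq_mul_div]
    refine div_le_div_of_nonneg_right ?_ hsm.le
    nlinarith [mul_le_mul hs2 ht1 zero_le_one (by positivity)]
  rw [hE] at hle
  have h5 := (div_le_iff₀ hsm).mp (h4.trans hle)
  linarith

end Decay
end
end JacobiLift

namespace JacobiLift

noncomputable section

open Complex MeasureTheory Filter Topology Asymptotics Set

/-! ### The leading relations -/

section Relations
variable {n : ℕ} {Λ : Submodule ℤ (EuclideanSpace ℝ (Fin n))}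

theorem perpNorm_eq {η : V n} (hη : q η ≠ 0) (x : V n) : perpNorm η x = q (perpPart η x) := by
  have h := q_add_smul hη x (-alongCoord η x)
  rw [neg_add_cancel, zero_pow two_ne_zero, mul_zero, add_zero] at h
  rw [← h, perpPart, neg_smul, sub_eq_add_neg]

theorem perpNorm_nonneg {η : dualLattice (posLattice Λ)} (hη : 0 < q (η : V n))
    (x : dualLattice (posLattice Λ)) : 0 ≤ perpNorm (η : V n) x := by
  rw [perpNorm_eq hη.ne']
  exact ((isPos_dual x).sub ((isPos_dual η).smul _)).q_nonneg

theorem q_le_perpNorm_add {η : dualLattice (posLattice Λ)} (hη : 0 < q (η : V n))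
    (x : fundReps η) : q (x : V n) ≤ perpNorm (η : V n) x + q (η : V n) := by
  have h := q_add_smul hη.ne' (x : V n) 0
  rw [zero_smul, add_zero, zero_add] at h
  obtain ⟨h0, h1⟩ := x.2
  rw [h]
  have : alongCoord (η : V n) x ^ 2 ≤ 1 := pow_le_one₀ h0 h1.le
  nlinarith

/-- Representatives modulo η have bounded coordinate along η, so the orthogonal norm is at least
q(x) - q(η). -/
theorem summable_exp_neg_perpNorm [DiscreteTopology Λ] [IsZLattice ℝ Λ]
    {η : dualLattice (posLattice Λ)} (hη : 0 < q (η : V n)) {ε : ℝ} (hε : 0 < ε) :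
    Summable fun x : fundReps η => Real.exp (-ε * perpNorm (η : V n) x) := by
  refine Summable.of_nonneg_of_le (fun _ => (Real.exp_pos _).le) (fun x => ?_)
    (((summable_exp_neg_q Λ hε).comp_injective
      (Subtype.val_injective (p := (· ∈ fundReps η)))).mul_left (Real.exp (ε * q (η : V n))))
  rw [Function.comp_apply, ← Real.exp_add]
  refine Real.exp_le_exp.mpr ?_
  nlinarith [q_le_perpNorm_add hη x]

/-- Subexponential growth: the coefficient is computed at height ε/2π on the line with slope minus
the coordinate of x along η. There the growth of φ in c cancels the η-part of the exponent, and only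
the orthogonal norm remains. -/
theorem norm_diagCoeff_le [DiscreteTopology Λ] [IsZLattice ℝ Λ]
    (hΛ : ∀ x ∈ Λ, ∃ m : ℤ, inner ℝ x x = 2 * (m : ℝ)) {η : dualLattice (posLattice Λ)}
    {φ : ℂ → ℂ → Disc (lorLattice Λ) → ℂ} {a : Disc (lorLattice Λ) → ℝ → ℝ → ℂ}
    {sig : ℤ} {k : ℝ} (hη : 0 < q (η : V n))
    (hφ : IsJacobiCuspForm (lorLattice Λ) sig k (toLorDual η) φ a) {ε : ℝ} (hε : 0 < ε) :
    ∃ B ≥ 0, ∀ x : fundReps η, ‖diagCoeff η a x‖ ≤ B * Real.exp (ε * perpNorm (η : V n) x) := by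
  obtain ⟨δ, hδ, h⟩ := hφ.exists_norm_le hΛ hη
  have hpi := Real.pi_pos
  set y := ε / (2 * Real.pi) with hy
  have hy0 : 0 < y := by positivity
  obtain ⟨B, hB, hle⟩ := h y hy0
  refine ⟨B, hB, fun x => ?_⟩
  set c := alongCoord (η : V n) x with hc
  obtain ⟨hc0, hc1⟩ := x.2
  rw [← hc] at hc0 hc1
  have h1 := hφ.fourier.integral_eq (toLorDual (x : dualLattice (posLattice Λ))) hy0 (-c)
  change _ = diagCoeff η a x * (Real.exp (-(2 * Real.pi * (y * (q (x : V n) +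
    -c * bil (x : V n) η)))) : ℝ) at h1
  have hvol : volume.real unitSquare = 1 := by
    rw [unitSquare, Measure.volume_eq_prod, measureReal_prod_prod]; norm_num
  have h2 : ‖diagCoeff η a x * (Real.exp (-(2 * Real.pi * (y * (q (x : V n) +
      -c * bil (x : V n) η)))) : ℝ)‖ ≤
      B * Real.exp (-δ * y) * Real.exp (2 * Real.pi * q (η : V n) * c ^ 2 * y) := by
    rw [← h1]
    refine (norm_setIntegral_le_of_norm_le_const (C := B * Real.exp (-δ * y) *
      Real.exp (2 * Real.pi * q (η : V n) * c ^ 2 * y)) ?_ fun p _ => ?_).trans ?_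
    · rw [unitSquare, Measure.volume_eq_prod, Measure.prod_prod]; simp
    · rw [← ofReal_neg, norm_mul, norm_e_real, mul_one]
      have him : ((p.1 : ℂ) + y * I).im = y := by simp
      have h3 := hle (cls (toLorDual (x : dualLattice (posLattice Λ)))) (p.1 + y * I) him.ge (-c)
        (by rw [abs_neg, abs_of_nonneg hc0]; exact hc1.le) p.2
      rw [him, neg_sq] at h3
      exact h3
    · rw [hvol, mul_one]
  have hbil : bil (x : V n) η = 2 * q (η : V n) * c := by rw [hc, alongCoord]; field_simp
  have hq := q_add_smul hη.ne' (x : V n) 0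
  rw [zero_smul, add_zero, zero_add, ← hc] at hq
  rw [norm_mul, norm_real, Real.norm_of_nonneg (Real.exp_pos _).le] at h2
  have h4 : Real.exp (2 * Real.pi * q (η : V n) * c ^ 2 * y) =
      Real.exp (ε * perpNorm (η : V n) x) * Real.exp (-(2 * Real.pi * (y * (q (x : V n) +
      -c * bil (x : V n) η)))) := by
    rw [← Real.exp_add, hbil, hq, hy]; congr 1; field_simp; ring
  rw [h4, ← mul_assoc (B * Real.exp (-δ * y))] at h2
  refine (le_of_mul_le_mul_right h2 (Real.exp_pos _)).trans ?_
  refine mul_le_mul_of_nonneg_right ?_ (Real.exp_pos _).le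
  exact mul_le_of_le_one_right hB (Real.exp_le_one_iff.mpr (by nlinarith))

theorem norm_coeff_le [DiscreteTopology Λ] [IsZLattice ℝ Λ]
    (hΛ : ∀ x ∈ Λ, ∃ m : ℤ, inner ℝ x x = 2 * (m : ℝ)) {η : dualLattice (posLattice Λ)}
    {φ : ℂ → ℂ → Disc (lorLattice Λ) → ℂ} {a : Disc (lorLattice Λ) → ℝ → ℝ → ℂ}
    {sig : ℤ} {k : ℝ} (hη : 0 < q (η : V n))
    (hφ : IsJacobiCuspForm (lorLattice Λ) sig k (toLorDual η) φ a) {f : V n} (hf : IsPos f)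
    (hf1 : bil f f = 1) (v : V n) (l : ℕ) {ε : ℝ} (hε : 0 < ε) :
    ∃ B, ∀ (x : fundReps η) (d : ℕ),
      ‖coeff₁ η a v f l x d‖ ≤ B * Real.exp (ε * perpNorm (η : V n) x) ∧
      ‖coeff₂ η a v f l x d‖ ≤ B * Real.exp (ε * perpNorm (η : V n) x) := by
  obtain ⟨B, hB, hle⟩ := norm_diagCoeff_le hΛ hη hφ (half_pos hε)
  set L := |l + bil (η : V n) v|
  refine ⟨B * (L * (1 + 4 / ε) + |bil (η : V n) f|), fun x d => ?_⟩
  set ρ := perpNorm (η : V n) x with hρ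
  have hρ0 : 0 ≤ ρ := perpNorm_nonneg hη x.1
  have hE : 1 ≤ Real.exp (ε / 2 * ρ) := Real.one_le_exp (by positivity)
  have hE2 : Real.exp (ε / 2 * ρ) * Real.exp (ε / 2 * ρ) = Real.exp (ε * ρ) := by
    rw [← Real.exp_add]; congr 1; ring
  have hpf : |bil (perpPart (η : V n) x) f| ≤ (1 + 4 / ε) * Real.exp (ε / 2 * ρ) := by
    have h1 := ((isPos_dual x.1).sub ((isPos_dual η).smul (alongCoord (η : V n) x))).bil_sq_le hf
    change bil (perpPart (η : V n) x) f ^ 2 ≤ 4 * q (perpPart (η : V n) x) * q f at h1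
    rw [← perpNorm_eq hη.ne', q, hf1, ← hρ] at h1
    have h2 : |bil (perpPart (η : V n) x) f| ≤ 1 + 2 * ρ :=
      abs_le_of_sq_le_sq (by nlinarith) (by linarith)
    have h3 := Real.add_one_le_exp (ε / 2 * ρ)
    have h4 : 2 * ρ ≤ 4 / ε * Real.exp (ε / 2 * ρ) := by
      rw [div_mul_eq_mul_div, le_div_iff₀ hε]; nlinarith
    nlinarith
  have hd := hle x
  rw [← hρ] at hd
  have hp : 0 ≤ 1 + 4 / ε := by positivity
  constructor
  · rw [coeff₁, norm_mul, norm_mul, norm_e_real, mul_one, norm_neg, norm_mul, norm_I, one_mul,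
      norm_real, Real.norm_eq_abs, abs_mul]
    calc _ ≤ B * Real.exp (ε / 2 * ρ) * (L * ((1 + 4 / ε) * Real.exp (ε / 2 * ρ))) := by gcongr
      _ = B * (L * (1 + 4 / ε)) * Real.exp (ε * ρ) := by rw [← hE2]; ring
      _ ≤ _ := by gcongr; linarith [abs_nonneg (bil (η : V n) f)]
  · rw [coeff₂, norm_mul, norm_mul, norm_e_real, mul_one, norm_real, Real.norm_eq_abs]
    calc _ ≤ B * Real.exp (ε / 2 * ρ) * (|bil (η : V n) f| * Real.exp (ε / 2 * ρ)) := by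
          refine mul_le_mul hd (le_mul_of_one_le_right (abs_nonneg _) hE) (abs_nonneg _)
            (by positivity)
      _ = B * |bil (η : V n) f| * Real.exp (ε * ρ) := by rw [← hE2]; ring
      _ ≤ _ := by
        refine mul_le_mul_of_nonneg_right (mul_le_mul_of_nonneg_left ?_ hB) (Real.exp_pos _).le
        have : 0 ≤ L * (1 + 4 / ε) := by positivity
        linarith

/-- The representatives with nonzero coefficient and a given orthogonal norm. -/
def leadSet (η : dualLattice (posLattice Λ)) (a : Disc (lorLattice Λ) → ℝ → ℝ → ℂ) (ρ₁ : ℝ) :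
    Set (fundReps η) :=
  {x | perpNorm (η : V n) x = ρ₁ ∧ diagCoeff η a x ≠ 0}

/-- A convergent series attains a given positive value only finitely often. -/
theorem finite_leadSet [DiscreteTopology Λ] [IsZLattice ℝ Λ] {η : dualLattice (posLattice Λ)}
    (hη : 0 < q (η : V n)) (a : Disc (lorLattice Λ) → ℝ → ℝ → ℂ) (ρ₁ : ℝ) :
    (leadSet η a ρ₁).Finite := by
  have h := (summable_exp_neg_perpNorm hη one_pos).tendsto_cofinite_zero.eventually
    (gt_mem_nhds (Real.exp_pos (-1 * ρ₁)))
  refine (Filter.eventually_cofinite.mp h).subset fun x hx => ?_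
  rw [mem_ofPred_eq, hx.1, not_lt]

/-- Orthogonal norms are integral multiples of a fixed δ > 0, since discriminants have a common
denominator. So the positive values attained have a minimum, and any other is larger by at least δ.
-/
theorem exists_minimal_perpNorm [DiscreteTopology Λ] [IsZLattice ℝ Λ]
    (hΛ : ∀ x ∈ Λ, ∃ m : ℤ, inner ℝ x x = 2 * (m : ℝ)) {η : dualLattice (posLattice Λ)}
    {φ : ℂ → ℂ → Disc (lorLattice Λ) → ℂ} {a : Disc (lorLattice Λ) → ℝ → ℝ → ℂ}
    {sig : ℤ} {k : ℝ} (hη : 0 < q (η : V n))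
    (hφ : IsJacobiCuspForm (lorLattice Λ) sig k (toLorDual η) φ a)
    (hex : ∃ x : fundReps η, diagCoeff η a x ≠ 0) :
    ∃ ρ₁ > 0, ∃ δ > 0, (leadSet η a ρ₁).Nonempty ∧ ∀ x : fundReps η, diagCoeff η a x ≠ 0 →
      x ∉ leadSet η a ρ₁ → ρ₁ + δ ≤ perpNorm (η : V n) x := by
  obtain ⟨E, hE, hgap⟩ := exists_discriminant_gap hΛ (toLorDual η)
  set δ := 1 / (4 * q (η : V n) * E) with hδ
  have hδ0 : 0 < δ := by positivity
  have hval : ∀ x : fundReps η, ∃ j : ℤ, perpNorm (η : V n) x = j * δ := by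
    intro x
    obtain ⟨j, hj⟩ := hgap (toLorDual x.1) 0 0
    refine ⟨j, ?_⟩
    simp only [Int.cast_zero, zero_add] at hj
    change 4 * q (η : V n) * q (x : V n) - bil (x : V n) η ^ 2 = j / E at hj
    rw [perpNorm, hδ]
    field_simp at hj ⊢
    linarith
  choose j hj using hval
  have hpos : ∀ x : fundReps η, diagCoeff η a x ≠ 0 → 0 < perpNorm (η : V n) x := fun x hx =>
    (diagCoeff_eq_zero_or hη hφ x.1).resolve_left hx
  have hjpos : ∀ x : fundReps η, diagCoeff η a x ≠ 0 → 0 < j x := fun x hx => by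
    have := hpos x hx
    rw [hj] at this
    exact_mod_cast pos_of_mul_pos_left this hδ0.le
  obtain ⟨x, hx, hmin⟩ := exists_minimalFor_of_wellFoundedLT (fun x : fundReps η =>
    diagCoeff η a x ≠ 0) (fun x => (j x).toNat) hex
  refine ⟨perpNorm (η : V n) x, hpos x hx, δ, hδ0, ⟨x, rfl, hx⟩, fun y hy hyl => ?_⟩
  have hne : perpNorm (η : V n) y ≠ perpNorm (η : V n) x := fun h => hyl ⟨h, hy⟩
  rw [hj, hj] at hne ⊢
  have hne2 : j y ≠ j x := fun h => hne (by rw [h])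
  have h1 : j x + 1 ≤ j y := by
    by_contra h
    have h2 := hjpos x hx
    have h3 := hjpos y hy
    have h4 := hmin hy (by simp only; omega)
    simp only at h4
    omega
  have h2 : ((j x + 1 : ℤ) : ℝ) ≤ j y := by exact_mod_cast h1
  push_cast at h2
  nlinarith

/-- The unfolded series is smaller than its own leading terms, so these cancel, separately for the
two types of Bessel integrals. Frequency one is the index 0 in `coeff₁` and `coeff₂`. -/
theorem leading_relations [DiscreteTopology Λ] [IsZLattice ℝ Λ]
    (hΛ : ∀ x ∈ Λ, ∃ m : ℤ, inner ℝ x x = 2 * (m : ℝ)) {η : dualLattice (posLattice Λ)}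
    {φ : ℂ → ℂ → Disc (lorLattice Λ) → ℂ} {a : Disc (lorLattice Λ) → ℝ → ℝ → ℂ}
    (hη : 0 < q (η : V n))
    (hφ : IsJacobiCuspForm (lorLattice Λ) n (1 + ((n : ℝ) + 2) / 2) (toLorDual η) φ a)
    {ρ₁ δ : ℝ} (hρ₁ : 0 < ρ₁) (hδ : 0 < δ)
    (hgap : ∀ x : fundReps η, diagCoeff η a x ≠ 0 → x ∉ leadSet η a ρ₁ →
      ρ₁ + δ ≤ perpNorm (η : V n) x)
    {S : Finset (fundReps η)} (hS : ∀ x, x ∈ S ↔ x ∈ leadSet η a ρ₁)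
    {i₀ i₁ i₂ : Fin n} (h01 : i₀ ≠ i₁) (h02 : i₀ ≠ i₂) (h12 : i₁ ≠ i₂)
    {f v : V n} (hf : IsPos f) (hf1 : bil f f = 1) (hf0 : bil f (eP i₀) = 0) (hv : IsPos v)
    (hv0 : bil (η : V n) (eP i₀) ≠ 0 → bil v (eP i₀) = 0) (l : ℕ)
    (hvanish : ∀ g : V n ≃ₗ[ℝ] V n, IsIsometry g → LinearMap.det (g : V n →ₗ[ℝ] V n) = 1 →
        g (eU 1) = eP i₀ → g (eU 3) = eU 3 →
        (bil (η : V n) (eP i₀) ≠ 0 → g (eP i₀) = eU 1) →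
        petersson (1 + ((n : ℝ) + 2) / 2) (q (η : V n)) φ
          (jacobiTheta (lorLattice Λ) 1 (gM g)
            (fixSecond (gM g ((η : V n) + l • uTilde n))
              (reducedPoly g (polyAlpha i₀ i₁ i₁ i₂) 0 1))
            ((η : V n) + l • uTilde n)) = 0) :
    ∑ x ∈ S, diagCoeff η a x * (((l + bil (η : V n) v) * bil (perpPart (η : V n) x) f : ℝ) *
      e (phase (η : V n) v l x : ℝ)) = 0 ∧
    ∑ x ∈ S, diagCoeff η a x * (bil (η : V n) f * e (phase (η : V n) v l x : ℝ)) = 0 := by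
  obtain ⟨C, hC⟩ := exists_unfolded_bound hΛ hη hφ h01 h02 h12 hf hf1 hf0 hv hv0 l hvanish
  obtain ⟨h1, h2⟩ := leading_bessel_coeffs_eq_zero (fun x : fundReps η => perpNorm (η : V n) x)
    hρ₁ hδ S (fun x hx => ((hS x).mp hx).1) (fun x => coeff₁ η a v f l x)
    (fun x => coeff₂ η a v f l x) (fun x hx => by
      by_cases h : diagCoeff η a x = 0
      · exact Or.inr fun d => by simp [coeff₁, coeff₂, h]
      · exact Or.inl (hgap x h fun h' => hx ((hS x).mpr h')))
    (fun ε hε => summable_exp_neg_perpNorm hη hε)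
    (fun ε hε => norm_coeff_le hΛ hη hφ hf hf1 v l hε) (((n : ℝ) - 1) / 2)
    (ε := 1 / 16) (by norm_num) hC
  simp only [coeff₁, coeff₂, zero_add, Nat.cast_one, one_mul] at h1 h2
  refine ⟨?_, h2⟩
  have hI : (-I : ℂ) ≠ 0 := neg_ne_zero.mpr I_ne_zero
  refine (mul_eq_zero.mp ?_).resolve_left hI
  rw [Finset.mul_sum, ← h1]
  exact Finset.sum_congr rfl fun x _ => by ring

end Relations
end
end JacobiLift

namespace JacobiLift

noncomputable section

open Complex MeasureTheory Filter Topology Asymptotics Set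

/-! ### Linear independence of characters -/

section Characters

/-- Dedekind's independence of characters, for a finite family of distinct characters. -/
theorem eq_zero_of_sum_monoidHom {G ι : Type*} [Monoid G] {S : Finset ι} {χ : ι → G →* ℂ}
    (hχ : InjOn χ S) {c : ι → ℂ} (h : ∀ g, ∑ x ∈ S, c x * χ x g = 0) : ∀ x ∈ S, c x = 0 := by
  intro x hx
  have li : LinearIndependent ℂ fun y : S => (χ y : G → ℂ) :=
    (linearIndependent_monoidHom G ℂ).comp (fun y : S => χ y)
      fun y y' hy => Subtype.ext (hχ y.2 y'.2 hy)
  refine linearIndependent_iff'.mp li Finset.univ (fun y => c y) ?_ ⟨x, hx⟩ (Finset.mem_univ _)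
  funext g
  rw [Finset.univ_eq_attach, Finset.sum_apply]
  simpa [Finset.sum_attach S fun y => c y * χ y g] using h g

/-- As all z x have the same N-th power ω, the N relations propagate to every exponent l ≥ 1.
Independence of the characters l ↦ z^l then applies, with b x * z x as coefficients because the
exponents start at 1. -/
theorem eq_zero_of_sum_pow {ι : Type*} {S : Finset ι} {z b : ι → ℂ} (hz : InjOn z S)
    (hz0 : ∀ x ∈ S, z x ≠ 0) {N : ℕ} (hN : 0 < N) {ω : ℂ} (hω : ∀ x ∈ S, z x ^ N = ω)
    (h : ∀ l, 1 ≤ l → l ≤ N → ∑ x ∈ S, b x * z x ^ l = 0) : ∀ x ∈ S, b x = 0 := by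
  have hall : ∀ l, ∑ x ∈ S, b x * z x ^ (l + 1) = 0 := by
    intro l
    induction l using Nat.strong_induction_on with
    | _ l ih =>
      rcases le_or_gt (l + 1) N with hl | hl
      · exact h _ (by omega) hl
      · have h1 := ih (l - N) (by omega)
        rw [← mul_zero ω, ← h1, Finset.mul_sum]
        refine Finset.sum_congr rfl fun x hx => ?_
        rw [← hω x hx, show l + 1 = N + (l - N + 1) by omega, pow_add]
        ring
  have h2 := eq_zero_of_sum_monoidHom (S := S) (χ := fun x => powersHom ℂ (z x))
    (c := fun x => b x * z x) (fun x hx y hy hxy => hz hx hy ((powersHom ℂ).injective hxy))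
    (fun g => by
      rw [← hall g.toAdd]
      refine Finset.sum_congr rfl fun x _ => ?_
      rw [powersHom_apply, pow_succ]
      ring)
  exact fun x hx => (mul_eq_zero.mp (h2 x hx)).resolve_right (hz0 x hx)

variable {n : ℕ}

/-- The character `v ↦ e((p, v))` of a subspace. -/
def bilChar (W : Submodule ℝ (V n)) (p : V n) : Multiplicative W →* ℂ where
  toFun v := e (bil p (v.toAdd : V n) : ℝ)
  map_one' := by
    change e (bil p 0 : ℝ) = 1
    rw [bil_zero_right, ofReal_zero, e_zero]
  map_mul' v v' := by
    change e (bil p ((v.toAdd : V n) + v'.toAdd) : ℝ) = _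
    rw [bil_add_right, ofReal_add, e_add]

theorem bilChar_apply (W : Submodule ℝ (V n)) (p : V n) (v : W) :
    bilChar W p (Multiplicative.ofAdd v) = e (bil p v : ℝ) := rfl

/-- If the pairing were nonzero, v could be rescaled within W to make it 1/2, and e(1/2) = -1 would
separate the characters. -/
theorem bil_eq_of_bilChar_eq {W : Submodule ℝ (V n)} {p p' : V n}
    (h : bilChar W p = bilChar W p') {v : V n} (hv : v ∈ W) : bil (p - p') v = 0 := by
  by_contra hne
  set w := bil (p - p') v with hw
  have hs := W.smul_mem (1 / (2 * w)) hv
  have h1 := DFunLike.congr_fun h (Multiplicative.ofAdd ⟨_, hs⟩)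
  rw [bilChar_apply, bilChar_apply] at h1
  have h2 : bil p ((1 / (2 * w)) • v) = bil p' ((1 / (2 * w)) • v) + 1 / 2 := by
    have : bil (p - p') ((1 / (2 * w)) • v) = 1 / 2 := by
      rw [bil_smul_right, ← hw]; field_simp
    rw [bil_sub_left] at this
    linarith
  rw [h2, ofReal_add, e_add] at h1
  have h3 : e ((1 / 2 : ℝ) : ℂ) = -1 := by
    rw [e, ← Complex.exp_pi_mul_I]; congr 1; push_cast; ring
  rw [h3] at h1
  have h4 : e (bil p' ((1 / (2 * w)) • v) : ℝ) = 0 := by linear_combination (-1 / 2 : ℂ) * h1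
  have h5 := norm_e_real (bil p' ((1 / (2 * w)) • v))
  rw [h4] at h5
  simp at h5

/-- Several x may share the same P x, so independence of characters only annihilates the sum over
each fibre of P. -/
theorem sum_filter_eq_zero_of_characters {ι : Type*} {S : Finset ι} {P : ι → V n}
    {W : Submodule ℝ (V n)}
    (hsep : ∀ x ∈ S, ∀ y ∈ S, (∀ v ∈ W, bil (P x - P y) v = 0) → P x = P y) {d : ι → ℂ}
    (h : ∀ v ∈ W, ∑ x ∈ S, d x * e (bil (P x) v : ℝ) = 0) {x₀ : ι} (hx₀ : x₀ ∈ S) :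
    ∑ x ∈ S with P x = P x₀, d x = 0 := by
  classical
  have h1 := eq_zero_of_sum_monoidHom (S := S.image P) (χ := bilChar W)
    (c := fun p => ∑ x ∈ S with P x = p, d x) ?_ ?_ (P x₀) (Finset.mem_image_of_mem P hx₀)
  · convert h1
  · intro p hp p' hp' hpp
    obtain ⟨x, hx, rfl⟩ := Finset.mem_image.mp hp
    obtain ⟨y, hy, rfl⟩ := Finset.mem_image.mp hp'
    exact hsep x hx y hy fun v hv => bil_eq_of_bilChar_eq hpp hv
  · intro g
    rw [← h _ g.toAdd.2, ← Finset.sum_fiberwise_of_maps_to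
      (g := P) (t := S.image P) fun x hx => Finset.mem_image_of_mem P hx]
    refine Finset.sum_congr rfl fun p _ => ?_
    rw [Finset.sum_mul]
    refine Finset.sum_congr rfl fun x hx => ?_
    rw [← (Finset.mem_filter.mp hx).2]
    rfl

end Characters

/-! ### Divisors of the index in L⁺' -/

section Divisibility
variable {n : ℕ} {Λ : Submodule ℤ (EuclideanSpace ℝ (Fin n))}

theorem exists_le_q_dual [DiscreteTopology Λ] [IsZLattice ℝ Λ]
    (hΛ : ∀ x ∈ Λ, ∃ m : ℤ, inner ℝ x x = 2 * (m : ℝ)) :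
    ∃ κ > 0, ∀ x : dualLattice (posLattice Λ), (x : V n) ≠ 0 → κ ≤ q (x : V n) := by
  obtain ⟨E, hE, h⟩ := exists_nsmul_mem_lorLattice hΛ
  have hE0 : (0 : ℝ) < E := by exact_mod_cast hE
  refine ⟨1 / (E : ℝ) ^ 2, by positivity, fun x hx => ?_⟩
  obtain ⟨j, hj⟩ := exists_int_q_lorLattice hΛ (h _ (toLorDual x).2)
  rw [q_nsmul] at hj
  change (E : ℝ) ^ 2 * q (x : V n) = j at hj
  have hq : 0 < q (x : V n) := lt_of_le_of_ne (isPos_dual x).q_nonneg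
    fun h0 => hx ((isPos_dual x).eq_zero_of_q h0.symm)
  have h1 : (0 : ℝ) < j := by rw [← hj]; positivity
  have h2 : (1 : ℝ) ≤ j := by
    have h3 : (0 : ℤ) < j := by exact_mod_cast h1
    exact_mod_cast h3
  rw [div_le_iff₀ (by positivity)]
  linarith

/-- The multiples of `η` in the dual lattice are the multiples of `η / N`. -/
theorem exists_int_eq_mul [DiscreteTopology Λ] [IsZLattice ℝ Λ]
    (hΛ : ∀ x ∈ Λ, ∃ m : ℤ, inner ℝ x x = 2 * (m : ℝ)) {η : dualLattice (posLattice Λ)}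
    (hη : 0 < q (η : V n)) {N : ℕ}
    (hN : IsGreatest {m : ℕ | 0 < m ∧ ∃ ξ : dualLattice (posLattice Λ), m • ξ = η} N) {c : ℝ}
    (hc : c • (η : V n) ∈ dualLattice (posLattice Λ)) : ∃ k : ℤ, N * c = k := by
  obtain ⟨⟨hN0, ξ, hξ⟩, hmax⟩ := hN
  obtain ⟨κ, hκ, hle⟩ := exists_le_q_dual hΛ
  have hη0 : (η : V n) ≠ 0 := fun h => by rw [h] at hη; simp [q, bil] at hη
  -- The real multipliers r with rη in L⁺' form a discrete subgroup of ℝ, since q is bounded below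
  -- on nonzero elements of L⁺'; hence it is cyclic.
  let G : AddSubgroup ℝ := (dualLattice (posLattice Λ)).comap
    (LinearMap.toSpanSingleton ℝ (V n) (η : V n)).toAddMonoidHom
  have hmem : ∀ r : ℝ, r ∈ G ↔ r • (η : V n) ∈ dualLattice (posLattice Λ) := fun r => Iff.rfl
  have hdisj : Disjoint (G : Set ℝ) (Ioo 0 (√(κ / q (η : V n)))) := by
    refine Set.disjoint_left.mpr fun r hr hr2 => ?_
    have h1 := hle ⟨_, (hmem r).mp hr⟩ (smul_ne_zero hr2.1.ne' hη0)
    rw [q_smul] at h1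
    have h2 : r ^ 2 < κ / q (η : V n) := (Real.lt_sqrt hr2.1.le).mp hr2.2
    rw [lt_div_iff₀ hη] at h2
    linarith
  obtain ⟨γ, hγ⟩ := AddSubgroup.cyclic_of_isolated_zero (Real.sqrt_pos.mpr (by positivity)) hdisj
  have hgen : ∀ r : ℝ, r • (η : V n) ∈ dualLattice (posLattice Λ) → ∃ k : ℤ, k * γ = r := by
    intro r hr
    rw [← hmem, hγ, AddSubgroup.mem_closure_singleton] at hr
    simpa using hr
  have hNr : (0 : ℝ) < N := by exact_mod_cast hN0
  have hξ' : (N : ℝ) • (ξ : V n) = η := by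
    rw [← hξ, AddSubgroup.coe_nsmul, Nat.cast_smul_eq_nsmul]
  obtain ⟨k, hk⟩ := hgen (1 / N) (by
    rw [← hξ', smul_smul, one_div_mul_cancel hNr.ne', one_smul]; exact ξ.2)
  have hγG : γ • (η : V n) ∈ dualLattice (posLattice Λ) := by
    rw [← hmem, hγ]; exact AddSubgroup.subset_closure rfl
  have hk0 : k ≠ 0 := by
    rintro rfl
    rw [Int.cast_zero, zero_mul] at hk
    exact absurd hk.symm (by positivity)
  have hkN : (k : ℝ) * N * γ = 1 := by
    rw [mul_assoc, mul_comm (N : ℝ), ← mul_assoc, hk]; field_simp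
  -- If 1/N = kγ for a generator γ, then |k|N divides η in L⁺', and maximality of N forces |k| = 1.
  have hle2 : k.natAbs * N ≤ N := by
    refine hmax ⟨Nat.mul_pos (Int.natAbs_pos.mpr hk0) hN0, k.sign • ⟨_, hγG⟩, ?_⟩
    have h1 : (k.natAbs : ℝ) * (k.sign : ℝ) = k := by
      have := Int.sign_mul_natAbs k
      generalize k.natAbs = A at this
      generalize k.sign = ε at this
      rw [← this]
      push_cast
      ring
    apply Subtype.ext
    rw [AddSubgroup.coe_nsmul, AddSubgroup.coe_zsmul, ← Nat.cast_smul_eq_nsmul ℝ,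
      ← Int.cast_smul_eq_zsmul ℝ, smul_smul, smul_smul, Nat.cast_mul,
      show (k.natAbs : ℝ) * N * k.sign * γ = 1 by rw [← hkN, ← h1]; ring, one_smul]
  have hk1 : k.natAbs = 1 := by
    have := Int.natAbs_pos.mpr hk0
    nlinarith
  obtain ⟨j, hj⟩ := hgen c hc
  rcases Int.natAbs_eq k with hk2 | hk2 <;> rw [hk1] at hk2 <;> subst hk2
  · refine ⟨j, ?_⟩
    rw [← hj]
    push_cast at hkN
    linear_combination (j : ℝ) * hkN
  · refine ⟨-j, ?_⟩
    rw [← hj]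
    push_cast at hkN ⊢
    linear_combination -(j : ℝ) * hkN

end Divisibility
end
end JacobiLift

namespace JacobiLift

noncomputable section

open Complex MeasureTheory Filter Topology Asymptotics Set

/-! ### Vanishing of the coefficients -/

section Vanishing
variable {n : ℕ} {Λ : Submodule ℤ (EuclideanSpace ℝ (Fin n))}

theorem isPos_eP (i : Fin n) : IsPos (eP i : V n) := fun j hj => by
  rw [eP, Pi.single_apply, if_neg]
  rintro rfl
  simp only [Fin.val_castAdd] at hj
  omega

theorem bil_eP_eP (i : Fin n) : bil (eP i : V n) (eP i) = 1 := by
  rw [bil_eP_right, eP, Pi.single_eq_same]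

theorem bil_perpPart {η : V n} (hη : q η ≠ 0) (x : V n) : bil (perpPart η x) η = 0 := by
  rw [perpPart, bil_sub_left, bil_smul_left, bil_self, alongCoord]; field_simp; ring

theorem isPos_perpPart (η x : dualLattice (posLattice Λ)) : IsPos (perpPart (η : V n) x) :=
  (isPos_dual x).sub ((isPos_dual η).smul _)

theorem perpPart_add_smul (η x : V n) : perpPart η x + alongCoord η x • η = x := by
  rw [perpPart, sub_add_cancel]

theorem IsPos.bil_normalize {w : V n} (hw : 0 < q w) :
    bil ((1 / √(2 * q w)) • w) ((1 / √(2 * q w)) • w) = 1 := by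
  have h : √(2 * q w) ^ 2 = 2 * q w := Real.sq_sqrt (by positivity)
  have h0 : √(2 * q w) ≠ 0 := (Real.sqrt_pos.mpr (by positivity)).ne'
  rw [bil_smul_left, bil_smul_right, bil_self]
  generalize √(2 * q w) = s at h h0
  rw [← h]
  field_simp

/-- The translations which are allowed in the isometries under consideration. -/
def translations (η : V n) (i : Fin n) : Submodule ℝ (V n) where
  carrier := {v | IsPos v ∧ (bil η (eP i) ≠ 0 → bil v (eP i) = 0)}
  zero_mem' := ⟨fun _ _ => rfl, fun _ => bil_zero_left _⟩
  add_mem' := fun ⟨h1, h2⟩ ⟨h3, h4⟩ => ⟨h1.add h3, fun h => by rw [bil_add_left, h2 h, h4 h, add_zero]⟩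
  smul_mem' := fun c _ ⟨h1, h2⟩ => ⟨h1.smul c, fun h => by rw [bil_smul_left, h2 h, mul_zero]⟩

/-- If (η, e_i) = 0, every translation is allowed and d can be tested against itself. Otherwise d is
a multiple of e_i, and orthogonality to η excludes all but zero. -/
theorem eq_zero_of_bil_translations {η : V n} {i : Fin n} {d : V n} (hd : IsPos d)
    (hdη : bil d η = 0) (h : ∀ v ∈ translations η i, bil d v = 0) : d = 0 := by
  by_cases hη : bil η (eP i) = 0
  · have h1 := h d ⟨hd, fun h' => absurd hη h'⟩
    exact hd.eq_zero_of_q (by rw [q, h1, zero_div])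
  · set v := d - bil d (eP i) • (eP i : V n) with hv
    have hvp : IsPos v := hd.sub ((isPos_eP i).smul _)
    have hve : bil v (eP i) = 0 := by
      rw [hv, bil_sub_left, bil_smul_left, bil_eP_eP, mul_one, sub_self]
    have h1 := h v ⟨hvp, fun _ => hve⟩
    have hd2 : d = v + bil d (eP i) • (eP i : V n) := by rw [hv, sub_add_cancel]
    have h2 : bil v v = 0 := by
      have : bil d v = bil v v := by
        nth_rewrite 1 [hd2]
        rw [bil_add_left, bil_smul_left, bil_comm (eP i), hve, mul_zero, add_zero]
      rw [← this, h1]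
    have h3 : v = 0 := hvp.eq_zero_of_q (by rw [q, h2, zero_div])
    rw [h3, zero_add] at hd2
    rw [hd2, bil_smul_left, bil_comm (eP i)] at hdη
    rw [hd2, (mul_eq_zero.mp hdη).resolve_right hη, zero_smul]

/-- The relations among the coefficients with a given component orthogonal to the index. -/
theorem sum_perpPart_eq_zero [DiscreteTopology Λ] [IsZLattice ℝ Λ]
    (hΛ : ∀ x ∈ Λ, ∃ m : ℤ, inner ℝ x x = 2 * (m : ℝ)) {η : dualLattice (posLattice Λ)}
    {φ : ℂ → ℂ → Disc (lorLattice Λ) → ℂ} {a : Disc (lorLattice Λ) → ℝ → ℝ → ℂ}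
    (hη : 0 < q (η : V n))
    (hφ : IsJacobiCuspForm (lorLattice Λ) n (1 + ((n : ℝ) + 2) / 2) (toLorDual η) φ a)
    {ρ₁ δ : ℝ} (hρ₁ : 0 < ρ₁) (hδ : 0 < δ)
    (hgap : ∀ x : fundReps η, diagCoeff η a x ≠ 0 → x ∉ leadSet η a ρ₁ →
      ρ₁ + δ ≤ perpNorm (η : V n) x)
    {S : Finset (fundReps η)} (hS : ∀ x, x ∈ S ↔ x ∈ leadSet η a ρ₁)
    {i₀ i₁ i₂ : Fin n} (h01 : i₀ ≠ i₁) (h02 : i₀ ≠ i₂) (h12 : i₁ ≠ i₂) {l : ℕ} (hl : 1 ≤ l)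
    (hvanish : ∀ g : V n ≃ₗ[ℝ] V n, IsIsometry g → LinearMap.det (g : V n →ₗ[ℝ] V n) = 1 →
        g (eU 1) = eP i₀ → g (eU 3) = eU 3 →
        (bil (η : V n) (eP i₀) ≠ 0 → g (eP i₀) = eU 1) →
        petersson (1 + ((n : ℝ) + 2) / 2) (q (η : V n)) φ
          (jacobiTheta (lorLattice Λ) 1 (gM g)
            (fixSecond (gM g ((η : V n) + l • uTilde n))
              (reducedPoly g (polyAlpha i₀ i₁ i₁ i₂) 0 1))
            ((η : V n) + l • uTilde n)) = 0) {x₀ : fundReps η} (hx₀ : x₀ ∈ S) :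
    ∑ x ∈ S.filter fun x : fundReps η => perpPart (η : V n) x = perpPart (η : V n) x₀,
      diagCoeff η a x * e (-(alongCoord (η : V n) x) : ℝ) ^ l = 0 := by
  set P : fundReps η → V n := fun x => perpPart (η : V n) x with hP
  have hPpos : ∀ x, IsPos (P x) := fun x => isPos_perpPart η x.1
  have hPη : ∀ x, bil (P x) η = 0 := fun x => bil_perpPart hη.ne' _
  have hsep : ∀ x ∈ S, ∀ y ∈ S, (∀ v ∈ translations (η : V n) i₀, bil (P x - P y) v = 0) →
      P x = P y := fun x _ y _ h => sub_eq_zero.mp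
    (eq_zero_of_bil_translations ((hPpos x).sub (hPpos y))
      (by rw [bil_sub_left, hPη, hPη, sub_zero]) h)
  have hphase : ∀ (v : V n) (x : fundReps η), e (phase (η : V n) v l x : ℝ) =
      e (bil (P x) v : ℝ) * e (-(alongCoord (η : V n) x) : ℝ) ^ l := by
    intro v x
    have h1 : e (-(alongCoord (η : V n) x) : ℝ) ^ l = e ((l : ℝ) * -(alongCoord (η : V n) x) : ℝ) := by
      rw [e, e, ← Complex.exp_nat_mul]; congr 1; push_cast; ring
    rw [h1, ← e_add, phase]
    congr 1
    push_cast
    ring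
  -- A weight which is constant and nonzero on the fibre of x₀ may be divided out after the
  -- characters in v are separated.
  have key : ∀ (w : fundReps η → ℂ), (∀ x, P x = P x₀ → w x = w x₀) → w x₀ ≠ 0 →
      (∀ v ∈ translations (η : V n) i₀, ∑ x ∈ S, diagCoeff η a x *
        (w x * e (phase (η : V n) v l x : ℝ)) = 0) →
      ∑ x ∈ S with P x = P x₀, diagCoeff η a x * e (-(alongCoord (η : V n) x) : ℝ) ^ l = 0 := by
    intro w hw hw0 h
    have h1 := sum_filter_eq_zero_of_characters (d := fun x => diagCoeff η a x *
      (w x * e (-(alongCoord (η : V n) x) : ℝ) ^ l)) hsep (fun v hv => by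
        rw [← h v hv]
        refine Finset.sum_congr rfl fun x _ => ?_
        rw [hphase]
        ring) hx₀
    refine (mul_eq_zero.mp ?_).resolve_left hw0
    rw [Finset.mul_sum, ← h1]
    refine Finset.sum_congr rfl fun x hx => ?_
    rw [← hw x (Finset.mem_filter.mp hx).2]
    ring
  set w := (η : V n) - bil (η : V n) (eP i₀) • (eP i₀ : V n) with hw
  have hwp : IsPos w := (isPos_dual η).sub ((isPos_eP i₀).smul _)
  have hwe : bil w (eP i₀) = 0 := by
    rw [hw, bil_sub_left, bil_smul_left, bil_eP_eP, mul_one, sub_self]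
  have hηw : (η : V n) = w + bil (η : V n) (eP i₀) • (eP i₀ : V n) := by rw [hw, sub_add_cancel]
  -- If η is a multiple of e_{i₀}, every admissible f is orthogonal to η and the second relation is
  -- empty. The first one is used then, with f in the direction of the orthogonal part of x₀.
  rcases eq_or_lt_of_le hwp.q_nonneg with hqw | hqw
  · have hw0 := hwp.eq_zero_of_q hqw.symm
    rw [hw0, zero_add] at hηw
    have hr : bil (η : V n) (eP i₀) ≠ 0 := fun h => by
      rw [h, zero_smul] at hηw
      rw [hηw] at hη
      simp [q, bil] at hη
    have hpe : bil (P x₀) (eP i₀) = 0 := by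
      have h1 := hPη x₀
      rw [hηw, bil_smul_right] at h1
      exact (mul_eq_zero.mp h1).resolve_left hr
    have hqp : q (P x₀) = ρ₁ := by
      rw [← ((hS x₀).mp hx₀).1, perpNorm_eq hη.ne']
    have hqp0 : 0 < q (P x₀) := by rw [hqp]; exact hρ₁
    set f := (1 / √(2 * q (P x₀))) • P x₀ with hf
    have hs : 0 < √(2 * q (P x₀)) := Real.sqrt_pos.mpr (by positivity)
    refine key (fun x => (l * bil (P x) f : ℝ)) (fun x hx => by simp only [hx]) ?_ fun v hv => ?_
    · rw [ofReal_ne_zero, hf, bil_smul_right, bil_self]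
      have hl0 : (0 : ℝ) < l := by exact_mod_cast hl
      positivity
    -- As η is a multiple of e_{i₀}, an allowed v is orthogonal to it. The factor l + (η, v) is then
    -- just l, nonzero because l ≥ 1.
    · have hηv : bil (η : V n) v = 0 := by
        rw [hηw, bil_smul_left, bil_comm (eP i₀), hv.2 hr, mul_zero]
      have h1 := (leading_relations hΛ hη hφ hρ₁ hδ hgap hS h01 h02 h12 ((hPpos x₀).smul _)
        (IsPos.bil_normalize hqp0) (by rw [bil_smul_left, hpe, mul_zero]) hv.1 hv.2 l hvanish).1
      rw [hηv, add_zero] at h1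
      exact h1
  -- Here f is the normalized component of η orthogonal to e_{i₀}; then (η, f) ≠ 0 and the second
  -- relation suffices.
  · have hs : 0 < √(2 * q w) := Real.sqrt_pos.mpr (by positivity)
    refine key (fun _ => (bil (η : V n) ((1 / √(2 * q w)) • w) : ℝ)) (fun x _ => rfl) ?_ fun v hv => ?_
    · have h1 : bil (η : V n) w = 2 * q w := by
        nth_rewrite 1 [hηw]
        rw [bil_add_left, bil_smul_left, bil_comm (eP i₀), hwe, mul_zero, add_zero, bil_self]
      rw [ofReal_ne_zero, bil_smul_right, h1]
      positivity
    · exact (leading_relations hΛ hη hφ hρ₁ hδ hgap hS h01 h02 h12 (hwp.smul _)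
        (IsPos.bil_normalize hqw) (by rw [bil_smul_left, hwe, mul_zero]) hv.1 hv.2 l hvanish).2

/-- A largest divisor exists only for η ≠ 0, because N + 1 divides 0 as well. -/
theorem q_pos_of_isGreatest {η : dualLattice (posLattice Λ)} {N : ℕ}
    (hN : IsGreatest {m : ℕ | 0 < m ∧ ∃ ξ : dualLattice (posLattice Λ), m • ξ = η} N) :
    0 < q (η : V n) := by
  refine lt_of_le_of_ne (isPos_dual η).q_nonneg fun h => ?_
  have h0 : η = 0 := Subtype.ext ((isPos_dual η).eq_zero_of_q h.symm)
  have := hN.2 ⟨N.succ_pos, 0, by rw [h0, smul_zero]⟩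
  omega

/-- A nonzero coefficient can be moved to `fundReps`, and one of least orthogonal norm exists. The
representatives sharing its orthogonal part satisfy a Vandermonde system, so that coefficient
vanishes after all. -/
theorem diagCoeff_eq_zero [DiscreteTopology Λ] [IsZLattice ℝ Λ]
    (hΛ : ∀ x ∈ Λ, ∃ m : ℤ, inner ℝ x x = 2 * (m : ℝ)) {η : dualLattice (posLattice Λ)}
    {φ : ℂ → ℂ → Disc (lorLattice Λ) → ℂ} {a : Disc (lorLattice Λ) → ℝ → ℝ → ℂ} {N : ℕ}
    (hN : IsGreatest {m : ℕ | 0 < m ∧ ∃ ξ : dualLattice (posLattice Λ), m • ξ = η} N)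
    (hφ : IsJacobiCuspForm (lorLattice Λ) n (1 + ((n : ℝ) + 2) / 2) (toLorDual η) φ a)
    {i₀ i₁ i₂ : Fin n} (h01 : i₀ ≠ i₁) (h02 : i₀ ≠ i₂) (h12 : i₁ ≠ i₂)
    (hvanish : ∀ l : ℕ, 1 ≤ l → l ≤ N →
      ∀ g : V n ≃ₗ[ℝ] V n, IsIsometry g → LinearMap.det (g : V n →ₗ[ℝ] V n) = 1 →
        g (eU 1) = eP i₀ → g (eU 3) = eU 3 →
        (bil (η : V n) (eP i₀) ≠ 0 → g (eP i₀) = eU 1) →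
        petersson (1 + ((n : ℝ) + 2) / 2) (q (η : V n)) φ
          (jacobiTheta (lorLattice Λ) 1 (gM g)
            (fixSecond (gM g ((η : V n) + l • uTilde n))
              (reducedPoly g (polyAlpha i₀ i₁ i₁ i₂) 0 1))
            ((η : V n) + l • uTilde n)) = 0) (x : dualLattice (posLattice Λ)) :
    diagCoeff η a x = 0 := by
  have hη := q_pos_of_isGreatest hN
  by_contra hx
  obtain ⟨⟨y, r⟩, hyr⟩ := (fundReps_bijective hη.ne').2 x
  rw [← hyr, diagCoeff_add_zsmul hφ] at hx
  obtain ⟨ρ₁, hρ₁, δ, hδ, ⟨x₀, hx₀⟩, hgap⟩ := exists_minimal_perpNorm hΛ hη hφ ⟨y, hx⟩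
  set S := (finite_leadSet hη a ρ₁).toFinset with hSdef
  have hS : ∀ x, x ∈ S ↔ x ∈ leadSet η a ρ₁ := fun x => (finite_leadSet hη a ρ₁).mem_toFinset
  have hx₀S := (hS x₀).mpr hx₀
  set S' := S.filter fun x : fundReps η => perpPart (η : V n) x = perpPart (η : V n) x₀ with hS'
  set c : fundReps η → ℝ := fun x => alongCoord (η : V n) x with hc
  have hmem : ∀ x ∈ S', ((x : dualLattice (posLattice Λ)) : V n) =
      x₀ + (c x - c x₀) • (η : V n) := by
    intro x hx
    have h1 := (Finset.mem_filter.mp hx).2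
    rw [← perpPart_add_smul (η : V n) x, ← perpPart_add_smul (η : V n) x₀, h1, add_assoc, ← add_smul]
    congr 2
    simp only [hc]
    ring
  refine hx₀.2 (eq_zero_of_sum_pow (S := S') (z := fun x => e (-(c x) : ℝ))
    (b := fun x => diagCoeff η a x) ?_ ?_ hN.1.1 (ω := e (-(c x₀) : ℝ) ^ N) ?_ ?_ x₀
    (Finset.mem_filter.mpr ⟨hx₀S, rfl⟩))
  -- Equal values of e(-c) with c in [0, 1) force equal c, and x is determined by c within the
  -- fibre.
  · intro x hx y hy hxy
    have h1 : e ((c y - c x : ℝ) : ℂ) = 1 := by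
      rw [show c y - c x = -(c x) - -(c y) by ring, ofReal_sub, sub_eq_add_neg, e_add, e_neg]
      simp only at hxy
      rw [hxy, mul_inv_cancel₀]
      exact Complex.exp_ne_zero _
    obtain ⟨k, hk⟩ := e_eq_one_iff.mp h1
    obtain ⟨hx0, hx1⟩ := x.2
    obtain ⟨hy0, hy1⟩ := y.2
    have hk0 : k = 0 := by
      have h2 : (k : ℝ) < 1 := by rw [← hk]; linarith
      have h3 : (-1 : ℝ) < k := by rw [← hk]; linarith
      have h4 : k < 1 := by exact_mod_cast h2
      have h5 : -1 < k := by exact_mod_cast h3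
      omega
    rw [hk0, Int.cast_zero] at hk
    have hcc : c x = c y := by linarith
    apply Subtype.ext
    apply Subtype.ext
    rw [hmem x hx, hmem y hy, hcc]
  · exact fun x _ => Complex.exp_ne_zero _
  -- Elements of one fibre differ by a multiple of η in L⁺', hence by a multiple of η/N, so e(-c)^N
  -- is constant on the fibre.
  · intro x hx
    have hd : (c x - c x₀) • (η : V n) ∈ dualLattice (posLattice Λ) := by
      have h1 := AddSubgroup.sub_mem _ x.1.2 x₀.1.2
      rwa [hmem x hx, add_sub_cancel_left] at h1
    obtain ⟨k, hk⟩ := exists_int_eq_mul hΛ hη hN hd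
    have hpow : ∀ r : ℝ, e ((r : ℝ) : ℂ) ^ N = e ((N * r : ℝ) : ℂ) := fun r => by
      rw [e, e, ← Complex.exp_nat_mul]; congr 1; push_cast; ring
    rw [hpow, hpow, show N * -(c x) = N * -(c x₀) + (-k : ℤ) by push_cast; linarith, ofReal_add,
      e_add, e_real_int ⟨-k, rfl⟩, mul_one]
  · intro l hl hlN
    exact sum_perpPart_eq_zero hΛ hη hφ hρ₁ hδ hgap hS h01 h02 h12 hl (hvanish l hl hlN) hx₀S

end Vanishing
end
end JacobiLift

/-! ### Conclusion -/

open JacobiLift in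
theorem mainTheorem7 (n : ℕ) (hn : 3 ≤ n)
    (Λ : Submodule ℤ (EuclideanSpace ℝ (Fin n))) [DiscreteTopology Λ] [IsZLattice ℝ Λ]
    (hΛ : ∀ x ∈ Λ, ∃ m : ℤ, inner ℝ x x = 2 * (m : ℝ))
    (η : dualLattice (posLattice Λ)) (N : ℕ)
    (hN : IsGreatest {m : ℕ | 0 < m ∧ ∃ ξ : dualLattice (posLattice Λ), m • ξ = η} N)
    (φ : ℂ → ℂ → Disc (lorLattice Λ) → ℂ) (a : Disc (lorLattice Λ) → ℝ → ℝ → ℂ)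
    (hφ : IsJacobiCuspForm (lorLattice Λ) n (1 + ((n : ℝ) + 2) / 2) (toLorDual η) φ a)
    (hvanish : ∀ l : ℕ, 1 ≤ l → l ≤ N →
      ∀ α₁ α₂ β₁ β₂ : Fin n, α₁ ≠ α₂ → β₁ ≠ β₂ → α₁ < β₁ → α₂ < β₂ →
      ∀ g : V n ≃ₗ[ℝ] V n, IsIsometry g → LinearMap.det (g : V n →ₗ[ℝ] V n) = 1 →
        g (eU 1) = eP α₁ → g (eU 3) = eU 3 →
        (bil (η : V n) (eP α₁) ≠ 0 → g (eP α₁) = eU 1) →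
        petersson (1 + ((n : ℝ) + 2) / 2) (q (η : V n)) φ
          (jacobiTheta (lorLattice Λ) 1 (gM g)
            (fixSecond (gM g ((η : V n) + l • uTilde n))
              (reducedPoly g (polyAlpha α₁ α₂ β₁ β₂) 0 1))
            ((η : V n) + l • uTilde n)) = 0) :
    ∀ lam : dualLattice (posLattice Λ),
      a (cls (toLorDual lam)) (q (lam : V n)) (bil (lam : V n) η) = 0 := by
  intro lam
  have hlt : ∀ i j : ℕ, ∀ (hi : i < n) (hj : j < n), i < j → (⟨i, hi⟩ : Fin n) < ⟨j, hj⟩ :=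
    fun _ _ _ _ h => h
  have h01 := hlt 0 1 (by omega) (by omega) one_pos
  have h12 := hlt 1 2 (by omega) (by omega) one_lt_two
  -- The single admissible tuple (α₁, α₂, β₁, β₂) = (0, 1, 1, 2) suffices; it uses three coordinates
  -- of L⁺ ⊗ ℝ, which exist because n ≥ 3.
  exact diagCoeff_eq_zero hΛ hN hφ h01.ne (h01.trans h12).ne h12.ne
    (fun l hl hlN => hvanish l hl hlN _ _ _ _ h01.ne h12.ne h01 h12) lam
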